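/- Let $\mathbb K$ be a field of characteristic zero. For a set $A$: * A rooted forest labelled by $A$ is a finite non-planar rooted forest with a label in $A$ on each vertex. It is regarded as a poset of vertices in which $y\le x$ if $y$ lies on the path from $x$ to a root, so roots are minimal. $B^+_a(u)$ is the tree obtained by grafting all trees of the forest $u$ to a new root labelled $a$. For a tree $t$, $t\circ u$ is obtained by grafting the roots of $u$ to the root of $t$, and $t^{\circ r}=t\circ(t\circ(\cdots\circ t))$ ($r$ factors). * $\mathbb K[\mathbf T(A)]$ is the free commutative algebra on the $A$-labelled rooted trees, with the forests as a basis and coproduct $\Delta(u)=\sum v\otimes w$, the sum being over all decompositions of the vertex set of $u$ into the vertex sets of $v$ and $w$ such that every vertex $\le$ a vertex of $w$ is in $w$. * $\pi$ is the linear map from $\mathbb K[\mathbf T(A)]$ to the noncommutative polynomials $\mathbb K\langle A\rangle$ which sends a forest to the sum, over all total orders extending its partial order, of the word of vertex labels listed in decreasing order. Put $I_\pi=\ker\pi$. * $H_{CK}(A)$ is the $A$-labelled Connes–Kreimer Hopf algebra: polynomials in $A$-labelled rooted trees with $\Delta(t)=t\otimes 1+1\otimes t+\sum_c P_c(t)\otimes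 R_c(t)$, $c$ running over the nonempty admissible cuts, $P_c(t)$ being the forest cut off and $R_c(t)$ the remaining tree containing the root. * $H_{NAP}(A)$ is the $A$-labelled incidence Hopf algebra of the set operad NAP. For a finite vertex set $I$ with labels in $A$, let $\Pi_{NAP}(I)$ be the poset of forests of rooted trees with vertex set $I$, where $X\le Y$ if $Y$ arises from the components of $X$ by NAP composition, that is, by adding edges between roots of components of $X$. If $Y$ covers $X$ by grafting the root $v$ of one component of $X$ to the root of another, this covering relation carries the label of $v$. $H_{NAP}(A)$ has as a basis elements $F_{[i]}$ indexed by the classes of intervals $i$ of all these posets up to isomorphism of posets preserving the labels of covering relations, with $F_{[i]}F_{[j]}=F_{[i\times j]}$ and $\Delta F_{[[X,Y]]}=\sum_{X\le Z\le Y}F_{[[X,Z]]}\otimes F_{[[Z,Y]]}$. (1) Let $A$ be a totally ordered, locally finite set (a disjoint union of finite sets $A_n$, $n\ge1$, of letters of degree $n$), with a Hoffman pairing $\langle\cdot,\cdot\rangle$ on $A\cup\{0\}$: it is commutative and associative, $\langle a,0\rangle=0$, and $\langle a,b\rangle$ is $0$ or has degree $|a|+|b|$ for $a,b\in A$. Let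 $\star^-$ be the quasi-shuffle product on $\mathbb K\langle A\rangle$, defined by $1\star^-w=w\star^-1=w$ and $$(aw_1)\star^-(bw_2)=a(w_1\star^- bw_2)+b(aw_1\star^- w_2)+\langle a,b\rangle(w_1\star^-w_2).$$ Then $(\mathbb K\langle A\rangle,\star^-)$ with the deconcatenation coproduct, $\mathbb K[\mathbf T(A)]$, $H_{CK}(A)$ and $H_{NAP}(A)$ are commutative Hopf algebras, $I_\pi$ is a Hopf ideal of $\mathbb K[\mathbf T(A)]$, and there are Hopf ideals $J_1\subseteq H_{CK}(A)$ and $J_2\subseteq H_{NAP}(A)$ such that, as Hopf algebras, $$(\mathbb K\langle A\rangle,\star^-)\;\cong\;\mathbb K[\mathbf T(A)]/I_\pi\;\cong\;H_{CK}(A)/J_1\;\cong\;H_{NAP}(A)/J_2 .$$ (2) Let $H_{\mathbb U}$ be the Connes–Marcolli universal Hopf algebra of renormalization (over $\mathbb K$), i.e. the graded dual of the universal enveloping algebra of the free Lie algebra on generators $e_{-n}$ of degree $n$, $n=1,2,\dots$. Let $A=\{f_n:n\ge1\}$, ordered by $f_m>f_n\Leftrightarrow n>m$. Then $H_{\mathbb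 U}$ is a commutative Hopf algebra; there are a Hopf algebra isomorphism $\Phi:\mathbb K[\mathbf T(A)]/I_\pi\to H_{\mathbb U}$ and Hopf ideals $J_1,J_2$ with $H_{\mathbb U}\cong H_{CK}(A)/J_1\cong H_{NAP}(A)/J_2$ as Hopf algebras. Moreover, a Hall set of $A$-labelled rooted trees is a totally ordered set $\mathbf H$ of such trees which contains all one-vertex trees; all of whose elements have the form $B^+_a(t_1^{\circ r_1}\cdots t_m^{\circ r_m})$ with $m\ge0$, $t_i\in\mathbf H$, $t_1>\dots>t_m$, $r_i\ge1$; in which every element of this form is smaller than each $t_j$; and such that, for $m\ge1$, a tree of this form is in $\mathbf H$ if and only if $t_m>B^+_a(t_1^{\circ r_1}\cdots t_{m-1}^{\circ r_{m-1}})\in\mathbf H$. The foliage of a one-vertex tree is its label, and the foliage of $t=B^+_a(t_1^{\circ r_1}\cdots t_m^{\circ r_m})\in\mathbf H$, $m\ge1$, is the concatenation of the foliages of $B^+_a(t_1^{\circ r_1}\cdots t_m^{\circ(r_m-1)})$ and of $t_m$. There is a Hall set of $A$-labelled rooted trees which the foliage maps isomorphically, as an ordered set, onto the alphabetically ordered set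 of Lyndon words over $A$; and for every such Hall set $\mathbf H$, the algebra $H_{\mathbb U}$ is freely generated, as a commutative algebra, by the elements $\Phi(t+I_\pi)$, $t\in\mathbf H$ (so the monomials in these elements form a basis of $H_{\mathbb U}$). -/

import Mathlib

open scoped TensorProduct

/-- The structure maps of a would-be Hopf algebra on a vector space `V`: a unit element, a
bilinear product, a coproduct and a counit.  No law is imposed here. -/
structure PreHopf (K V : Type*) [Field K] [AddCommGroup V] [Module K V] where
  one : V
  mul : V →ₗ[K] V →ₗ[K] V
  comul : V →ₗ[K] V ⊗[K] V
  counit : V →ₗ[K] K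

namespace PreHopf

variable {K V : Type*} [Field K] [AddCommGroup V] [Module K V]

/-- The given structure maps make `V` a commutative Hopf algebra.  (The antipode of a bialgebra
is unique when it exists.) -/
class IsHopf (D : PreHopf K V) : Prop where
  mul_assoc : ∀ x y z, D.mul (D.mul x y) z = D.mul x (D.mul y z)
  mul_comm : ∀ x y, D.mul x y = D.mul y x
  one_mul : ∀ x, D.mul D.one x = x
  coassoc : (TensorProduct.assoc K V V V).toLinearMap ∘ₗ D.comul.rTensor V ∘ₗ D.comul =
    D.comul.lTensor V ∘ₗ D.comul
  rTensor_counit : D.counit.rTensor V ∘ₗ D.comul = TensorProduct.mk K K V 1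
  lTensor_counit : D.counit.lTensor V ∘ₗ D.comul = (TensorProduct.mk K V K).flip 1
  counit_one : D.counit D.one = 1
  counit_mul : ∀ x y, D.counit (D.mul x y) = D.counit x * D.counit y
  comul_one : D.comul D.one = D.one ⊗ₜ[K] D.one
  comul_mul : ∀ x y, D.comul (D.mul x y) =
    TensorProduct.map₂ D.mul D.mul (D.comul x) (D.comul y)
  exists_antipode : ∃ S : V →ₗ[K] V,
    (∀ x, TensorProduct.lift D.mul (S.rTensor V (D.comul x)) = D.counit x • D.one) ∧
    (∀ x, TensorProduct.lift D.mul (S.lTensor V (D.comul x)) = D.counit x • D.one)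

/-- The vector space `V`, regarded as carrying the structure maps `D`. -/
def Carrier (_ : PreHopf K V) : Type _ := V

variable (D : PreHopf K V)

instance : AddCommGroup D.Carrier := inferInstanceAs (AddCommGroup V)
instance : Module K D.Carrier := inferInstanceAs (Module K V)

variable [h : D.IsHopf]

instance : CommRing D.Carrier where
  __ := (inferInstance : AddCommGroup D.Carrier)
  mul x y := D.mul x y
  one := D.one
  mul_assoc := h.mul_assoc
  mul_comm := h.mul_comm
  one_mul := h.one_mul
  mul_one x := (h.mul_comm _ _).trans (h.one_mul x)
  left_distrib x y z := (D.mul x).map_add y z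
  right_distrib x y z := D.mul.map_add₂ x y z
  zero_mul x := D.mul.map_zero₂ x
  mul_zero x := (D.mul x).map_zero

instance : Algebra K D.Carrier :=
  Algebra.ofModule (fun r x y => D.mul.map_smul₂ r x y) (fun r x y => (D.mul x).map_smul r y)

instance : Coalgebra K D.Carrier where
  comul := D.comul
  counit := D.counit
  coassoc := h.coassoc
  rTensor_counit_comp_comul := h.rTensor_counit
  lTensor_counit_comp_comul := h.lTensor_counit

theorem tensor_mul_eq (x y : D.Carrier ⊗[K] D.Carrier) :
    x * y = TensorProduct.map₂ (M := V) (N := V) D.mul D.mul x y := by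
  have e : LinearMap.mul K (D.Carrier ⊗[K] D.Carrier) =
      TensorProduct.map₂ (M := V) (N := V) D.mul D.mul := by
    apply TensorProduct.ext'
    intro a b
    apply TensorProduct.ext'
    intro c d
    refine (Algebra.TensorProduct.tmul_mul_tmul (R := K) a c b d).trans ?_
    exact (congrArg (fun f => f (c ⊗ₜ[K] d))
      (TensorProduct.map₂_apply_tmul (M := V) (N := V) D.mul D.mul a b)).symm
  exact congrArg (fun f => f x y) e

noncomputable instance : HopfAlgebra K D.Carrier where
  __ := Bialgebra.mk' K D.Carrier h.counit_one (fun {x y} => h.counit_mul x y) h.comul_one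
    (fun {x y} => (h.comul_mul x y).trans (D.tensor_mul_eq _ _).symm)
  antipode := h.exists_antipode.choose
  mul_antipode_rTensor_comul := by
    ext x
    exact (h.exists_antipode.choose_spec.1 x).trans
      (Algebra.algebraMap_eq_smul_one (A := D.Carrier) (D.counit x)).symm
  mul_antipode_lTensor_comul := by
    ext x
    exact (h.exists_antipode.choose_spec.2 x).trans
      (Algebra.algebraMap_eq_smul_one (A := D.Carrier) (D.counit x)).symm

end PreHopf


/-- A rooted forest with vertex set `V`: every vertex has a parent unless it is a root, and
going from a vertex to its parent never runs in circles. -/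
@[ext]
structure RForest (V : Type) where
  parent : V → Option V
  wf : WellFounded (fun u v => parent v = some u)

namespace RForest

variable {V W : Type}

/-- `X.le u v`: the vertex `u` lies on the path from `v` to a root, i.e. `u ≤ v` in the poset
represented by the forest (roots are minimal). -/
def le (X : RForest V) : V → V → Prop :=
  Relation.ReflTransGen (fun u v => X.parent v = some u)

/-- A forest is a tree if it has exactly one root. -/
def IsTree (X : RForest V) : Prop := ∃! r, X.parent r = none

/-- Renaming of vertices. -/
def transport (X : RForest V) (e : V ≃ W) : RForest W where
  parent w := (X.parent (e.symm w)).map e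
  wf := by
    refine Subrelation.wf (r := InvImage (fun u v => X.parent v = some u) e.symm) ?_
      (InvImage.wf _ X.wf)
    intro u v h
    obtain ⟨p, hp, rfl⟩ := Option.map_eq_some_iff.1 h
    simpa [InvImage] using hp

/-- The forest induced on a set of vertices: the edges with both ends in the set are kept. -/
noncomputable def restrict (X : RForest V) (S : Set V) : RForest S where
  parent v := open Classical in
    (X.parent v).bind fun p => if h : p ∈ S then some ⟨p, h⟩ else none
  wf := by
    refine Subrelation.wf (r := InvImage (fun u v => X.parent v = some u) Subtype.val) ?_
      (InvImage.wf _ X.wf)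
    intro u v h
    obtain ⟨p, hp, h⟩ := Option.bind_eq_some_iff.1 h
    split_ifs at h with hS
    simp only [Option.some.injEq] at h
    subst h
    exact hp

/-- Disjoint union of forests. -/
def sum (X : RForest V) (Y : RForest W) : RForest (V ⊕ W) where
  parent := Sum.elim (fun v => (X.parent v).map Sum.inl) (fun w => (Y.parent w).map Sum.inr)
  wf := by
    refine ⟨fun z => ?_⟩
    rcases z with v | w
    · induction v using X.wf.induction with
      | _ v ih =>
        refine ⟨_, fun y hy => ?_⟩
        obtain ⟨p, hp, rfl⟩ := Option.map_eq_some_iff.1 hy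
        exact ih p hp
    · induction w using Y.wf.induction with
      | _ w ih =>
        refine ⟨_, fun y hy => ?_⟩
        obtain ⟨p, hp, rfl⟩ := Option.map_eq_some_iff.1 hy
        exact ih p hp

/-- Attach all roots of the forest to one new root `none`. -/
def addRoot (X : RForest V) : RForest (Option V) where
  parent v := v.elim none fun v => some (X.parent v)
  wf := by
    have h0 : Acc (fun u v : Option V => (v.elim none fun v => some (X.parent v)) = some u)
        none := ⟨_, fun y hy => by simp at hy⟩
    refine ⟨fun z => ?_⟩
    rcases z with _ | v
    · exact h0
    · induction v using X.wf.induction with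
      | _ v ih =>
        refine ⟨_, fun y hy => ?_⟩
        rcases y with _ | p
        · exact h0
        · exact ih p (by simpa using hy)

/-- Attach all roots of `Y` to the vertex `r` of `X`. -/
def graft (X : RForest V) (r : V) (Y : RForest W) : RForest (V ⊕ W) where
  parent := Sum.elim (fun v => (X.parent v).map Sum.inl)
    (fun w => some ((Y.parent w).elim (Sum.inl r) Sum.inr))
  wf := by
    have hX : ∀ v, Acc (fun u v : V ⊕ W => Sum.elim (fun v => (X.parent v).map Sum.inl)
        (fun w => some ((Y.parent w).elim (Sum.inl r) Sum.inr)) v = some u) (Sum.inl v) := by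
      intro v
      induction v using X.wf.induction with
      | _ v ih =>
        refine ⟨_, fun y hy => ?_⟩
        obtain ⟨p, hp, rfl⟩ := Option.map_eq_some_iff.1 hy
        exact ih p hp
    refine ⟨fun z => ?_⟩
    rcases z with v | w
    · exact hX v
    · induction w using Y.wf.induction with
      | _ w ih =>
        refine ⟨_, fun y hy => ?_⟩
        cases hp : Y.parent w with
        | none =>
          simp only [Sum.elim_inr, hp, Option.elim_none, Option.some.injEq] at hy
          exact hy ▸ hX r
        | some p =>
          simp only [Sum.elim_inr, hp, Option.elim_some, Option.some.injEq] at hy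
          exact hy ▸ ih p hp

noncomputable instance [Finite V] : Fintype (RForest V) :=
  @Fintype.ofFinite _ (Finite.of_injective RForest.parent fun _ _ h => RForest.ext h)

end RForest

/-- A rooted forest with vertex set `V` whose vertices are labelled by `A`. -/
structure LForest (A : Type*) (V : Type) extends RForest V where
  lab : V → A

namespace LForest

variable {A : Type*} {V W : Type}

def transport (X : LForest A V) (e : V ≃ W) : LForest A W where
  toRForest := X.toRForest.transport e
  lab := X.lab ∘ e.symm

noncomputable def restrict (X : LForest A V) (S : Set V) : LForest A S where
  toRForest := X.toRForest.restrict S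
  lab v := X.lab v

def sum (X : LForest A V) (Y : LForest A W) : LForest A (V ⊕ W) where
  toRForest := X.toRForest.sum Y.toRForest
  lab := Sum.elim X.lab Y.lab

def addRoot (a : A) (X : LForest A V) : LForest A (Option V) where
  toRForest := X.toRForest.addRoot
  lab v := v.elim a X.lab

def graft (X : LForest A V) (r : V) (Y : LForest A W) : LForest A (V ⊕ W) where
  toRForest := X.toRForest.graft r Y.toRForest
  lab := Sum.elim X.lab Y.lab

/-- `e` is an isomorphism of labelled rooted forests. -/
def IsIso (X : LForest A V) (Y : LForest A W) (e : V ≃ W) : Prop :=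
  ∀ v, Y.parent (e v) = (X.parent v).map e ∧ Y.lab (e v) = X.lab v

theorem IsIso.refl (X : LForest A V) : X.IsIso X (Equiv.refl V) := fun v => by simp

theorem IsIso.symm {X : LForest A V} {Y : LForest A W} {e : V ≃ W} (h : X.IsIso Y e) :
    Y.IsIso X e.symm := by
  intro w
  obtain ⟨h1, h2⟩ := h (e.symm w)
  simp only [Equiv.apply_symm_apply] at h1 h2
  refine ⟨?_, h2.symm⟩
  rw [h1]
  simp

theorem IsIso.trans {U : Type} {X : LForest A V} {Y : LForest A W} {Z : LForest A U}
    {e : V ≃ W} {f : W ≃ U} (h : X.IsIso Y e) (h' : Y.IsIso Z f) : X.IsIso Z (e.trans f) := by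
  intro v
  obtain ⟨h1, h2⟩ := h v
  obtain ⟨h3, h4⟩ := h' (e v)
  refine ⟨?_, h4.trans h2⟩
  simp only [Equiv.trans_apply]
  rw [h3, h1, Option.map_map]
  rfl

theorem isIso_transport (X : LForest A V) (e : V ≃ W) : X.IsIso (X.transport e) e := fun v => by
  simp [transport, RForest.transport]

theorem IsIso.isTree {X : LForest A V} {Y : LForest A W} {e : V ≃ W} (h : X.IsIso Y e)
    (hX : X.IsTree) : Y.IsTree := by
  obtain ⟨r, hr, hu⟩ := hX
  refine ⟨e r, by simp [(h r).1, hr], fun s hs => ?_⟩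
  have := (h.symm s).1
  rw [hs] at this
  rw [← hu _ this]
  simp

/-- Labelled rooted forests on the vertex sets `Fin n`, up to isomorphism. -/
instance setoid (A : Type*) : Setoid (Σ n, LForest A (Fin n)) where
  r X Y := ∃ e : Fin X.1 ≃ Fin Y.1, X.2.IsIso Y.2 e
  iseqv := ⟨fun X => ⟨_, IsIso.refl X.2⟩, fun ⟨_, h⟩ => ⟨_, h.symm⟩,
    fun ⟨_, h⟩ ⟨_, h'⟩ => ⟨_, h.trans h'⟩⟩

end LForest

/-- `F(A)`: isomorphism classes of finite (non-planar) rooted forests labelled by `A`,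
including the empty forest. -/
def Forest (A : Type*) : Type _ := Quotient (LForest.setoid A)

/-- The isomorphism class of a finite labelled forest. -/
noncomputable def LForest.cls {A : Type*} {V : Type} [Finite V] (X : LForest A V) : Forest A :=
  ⟦⟨Nat.card V, X.transport (Finite.equivFin V)⟩⟧

namespace Forest

variable {A : Type*}

/-- The number of vertices. -/
noncomputable def size (u : Forest A) : ℕ := (Quotient.out u).1

/-- A labelled forest (a labelled poset) representing the class `u`. -/
noncomputable def rep (u : Forest A) : LForest A (Fin u.size) := (Quotient.out u).2

theorem exists_isIso_rep_cls {V : Type} [Finite V] (X : LForest A V) :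
    ∃ e : V ≃ Fin X.cls.size, X.IsIso X.cls.rep e := by
  obtain ⟨e, he⟩ := Quotient.mk_out (s := LForest.setoid A)
    ⟨Nat.card V, X.transport (Finite.equivFin V)⟩
  exact ⟨_, (X.isIso_transport (Finite.equivFin V)).trans he.symm⟩

/-- The empty forest. -/
noncomputable instance : One (Forest A) :=
  ⟨LForest.cls (V := Fin 0) ⟨⟨finZeroElim, ⟨fun v => v.elim0⟩⟩, finZeroElim⟩⟩

/-- The commutative product of forests is the disjoint union. -/
noncomputable instance : Mul (Forest A) := ⟨fun u v => (u.rep.sum v.rep).cls⟩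

/-- `B⁺_a(u)`: graft all the trees of `u` to a new root labelled by `a`. -/
noncomputable def B (a : A) (u : Forest A) : Forest A := (u.rep.addRoot a).cls

def IsTree (u : Forest A) : Prop := u.rep.IsTree

open Classical in
/-- `t ∘ u`: graft the roots of all trees of the forest `u` to the root of the tree `t`.
(Only used for trees `t`; the value for the empty forest `t` is immaterial.) -/
noncomputable def comp (t u : Forest A) : Forest A :=
  if h : ∃ r, t.rep.parent r = none then (t.rep.graft h.choose u.rep).cls else u

/-- `t^{∘ r} = t ∘ (t ∘ (⋯ ∘ t))` with `r` factors; the empty forest for `r = 0`. -/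
noncomputable def cpow (t : Forest A) : ℕ → Forest A
  | 0 => 1
  | r + 1 => comp t (cpow t r)

end Forest

/-- `T(A)`: (non-planar) rooted trees labelled by `A`. -/
def LTree (A : Type*) : Type _ := {t : Forest A // t.IsTree}

/-- The isomorphism class of a finite labelled tree. -/
noncomputable def LForest.tcls {A : Type*} {V : Type} [Finite V] (X : LForest A V)
    (h : X.IsTree) : LTree A :=
  ⟨X.cls, (Forest.exists_isIso_rep_cls X).choose_spec.isTree h⟩

section Trees

variable (K A : Type*) [Field K]

open Classical in
/-- The Hopf algebra `K[T(A)]`: the free commutative algebra on the labelled rooted trees, with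
the forests as a basis.  The coproduct of a forest `u` is the sum of all `v ⊗ w`, where the vertex
set of a poset representing `u` is the disjoint union of those of `v` and `w`, and every vertex
below (i.e. nearer to the root than) a vertex of `w` belongs to `w`. -/
noncomputable def treeHopf : PreHopf K (Forest A →₀ K) where
  one := Finsupp.single 1 1
  mul := Finsupp.linearCombination K fun u => Finsupp.linearCombination K fun v =>
    Finsupp.single (u * v) 1
  comul := Finsupp.linearCombination K fun u =>
    ∑ W : Finset (Fin u.size) with ∀ x y, u.rep.le y x → x ∈ W → y ∈ W,
      Finsupp.single (u.rep.restrict {x | x ∉ W}).cls 1 ⊗ₜ[K]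
        Finsupp.single (u.rep.restrict {x | x ∈ W}).cls 1
  counit := Finsupp.linearCombination K fun u => if u = 1 then 1 else 0

namespace RForest

variable {V : Type} (X : RForest V)

/-- An admissible cut of a rooted tree: a set of edges, each path from the root to a vertex
containing at most one of them.  An edge is represented by its end further from the root. -/
def IsAdmissible (c : Finset V) : Prop :=
  (∀ x ∈ c, X.parent x ≠ none) ∧ ∀ z, ∀ x ∈ c, ∀ y ∈ c, X.le x z → X.le y z → x = y

theorem isTree_above (x : V) : (X.restrict {v | X.le x v}).IsTree := by
  have hp : ∀ v p, X.parent v = some p → X.le x v → v ≠ x → X.le x p := by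
    intro v p hv h hne
    rcases Relation.ReflTransGen.cases_tail h with h | ⟨q, hq, hqv⟩
    · exact absurd h hne
    · rw [hv] at hqv
      exact (Option.some.inj hqv) ▸ hq
  refine ⟨⟨x, Relation.ReflTransGen.refl⟩, ?_, ?_⟩
  · simp only [restrict]
    refine Option.bind_eq_none_iff.2 fun p hp => ?_
    rw [dif_neg]
    intro (hxp : X.le x p)
    have : Relation.TransGen (fun u v => X.parent v = some u) x x :=
      Relation.TransGen.tail' hxp hp
    exact (WellFounded.transGen X.wf).irrefl.irrefl x this
  · rintro ⟨v, hv⟩ h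
    by_contra hne
    have hne : v ≠ x := fun h => hne (Subtype.ext h)
    have hvp : ∃ p, X.parent v = some p := by
      rcases Relation.ReflTransGen.cases_tail hv with h | ⟨q, hq, hqv⟩
      · exact absurd h hne
      · exact ⟨q, hqv⟩
    obtain ⟨p, hvp'⟩ := hvp
    have hxp : X.le x p := hp v p hvp' hv hne
    simp [restrict, hvp', hxp] at h

theorem isTree_remaining (hX : X.IsTree) (c : Finset V) (hc : ∀ x ∈ c, X.parent x ≠ none) :
    (X.restrict {z | ∀ x ∈ c, ¬ X.le x z}).IsTree := by
  obtain ⟨r, hr, hu⟩ := hX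
  have hr' : ∀ x, X.le x r → x = r := by
    intro x h
    rcases Relation.ReflTransGen.cases_tail h with h | ⟨q, hq, hqv⟩
    · exact h.symm
    · rw [hr] at hqv; cases hqv
  refine ⟨⟨r, fun x hx h => hc x hx (hr' x h ▸ hr)⟩, by simp [restrict, hr], ?_⟩
  rintro ⟨v, hv⟩ h
  refine Subtype.ext (hu v ?_)
  by_contra hne
  obtain ⟨p, hvp⟩ := Option.ne_none_iff_exists'.1 hne
  · exfalso
    have hp : ∀ x ∈ c, ¬ X.le x p := fun x hx h => hv x hx (h.tail hvp)
    simp only [restrict, hvp, Option.bind_some] at h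
    rw [dif_pos (show p ∈ {z | ∀ x ∈ c, ¬ X.le x z} from hp)] at h
    cases h

end RForest

variable {A} in
/-- A labelled rooted tree representing the class `t`. -/
noncomputable def LTree.rep (t : LTree A) : LForest A (Fin t.1.size) := t.1.rep

variable {A} in
/-- `P_c(t)`: the forest of the trees cut off by the cut `c`, as a monomial. -/
noncomputable def prunedPart (t : LTree A) (c : Finset (Fin t.1.size)) :
    MvPolynomial (LTree A) K :=
  ∏ x ∈ c, MvPolynomial.X ((t.rep.restrict {v | t.rep.le x v}).tcls (t.rep.isTree_above x))

variable {A} in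
/-- `R_c(t)`: the tree which remains connected to the root after the cut `c`. -/
noncomputable def remainingPart (t : LTree A) (c : Finset (Fin t.1.size))
    (hc : t.rep.IsAdmissible c) : MvPolynomial (LTree A) K :=
  MvPolynomial.X ((t.rep.restrict {z | ∀ x ∈ c, ¬ t.rep.le x z}).tcls
    (t.rep.isTree_remaining t.2 c hc.1))

open Classical in
/-- The labelled Connes–Kreimer Hopf algebra `H_CK(A)`: polynomials in labelled rooted trees, with
`Δ t = t ⊗ 1 + 1 ⊗ t + ∑_c P_c(t) ⊗ R_c(t)`, the sum running over the non-trivial (i.e. nonempty)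
admissible cuts. -/
noncomputable def ckHopf : PreHopf K (MvPolynomial (LTree A) K) where
  one := 1
  mul := LinearMap.mul K _
  comul := (MvPolynomial.aeval fun t : LTree A =>
    (MvPolynomial.X t ⊗ₜ[K] 1 + 1 ⊗ₜ[K] MvPolynomial.X t +
      ∑ c : Finset (Fin t.1.size), if hc : c.Nonempty ∧ t.rep.IsAdmissible c then
        prunedPart K t c ⊗ₜ[K] remainingPart K t c hc.2 else 0 :
      MvPolynomial (LTree A) K ⊗[K] MvPolynomial (LTree A) K)).toLinearMap
  counit := (MvPolynomial.aeval fun _ : LTree A => (0 : K)).toLinearMap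

end Trees

/-! ### Quasi-shuffles -/

/-- A Hoffman pairing on `A ∪ {0}`, where `0` is `none` and `deg` is the degree of letters. -/
structure HoffmanPairing (A : Type*) (deg : A → ℕ) where
  pair : Option A → Option A → Option A
  pair_none : ∀ a, pair a none = none
  pair_comm : ∀ a b, pair a b = pair b a
  pair_assoc : ∀ a b c, pair (pair a b) c = pair a (pair b c)
  deg_pair : ∀ a b c, pair (some a) (some b) = some c → deg c = deg a + deg b

section QuasiShuffle

variable (K : Type*) {A : Type*} [Field K]

/-- The quasi-shuffle product of two words. -/
noncomputable def quasiShuffle (p : Option A → Option A → Option A) :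
    List A → List A → (List A →₀ K)
  | [], w => Finsupp.single w 1
  | a :: u, [] => Finsupp.single (a :: u) 1
  | a :: u, b :: v =>
    (quasiShuffle p u (b :: v)).mapDomain (List.cons a) +
    (quasiShuffle p (a :: u) v).mapDomain (List.cons b) +
    (p (some a) (some b)).elim 0 fun c => (quasiShuffle p u v).mapDomain (List.cons c)
termination_by u v => u.length + v.length

open Classical in
/-- The quasi-shuffle Hopf algebra: noncommutative polynomials in the letters `A` (with the words
as a basis), the quasi-shuffle product and the deconcatenation coproduct. -/
noncomputable def quasiShuffleHopf {deg : A → ℕ} (p : HoffmanPairing A deg) :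
    PreHopf K (List A →₀ K) where
  one := Finsupp.single [] 1
  mul := Finsupp.linearCombination K fun u => Finsupp.linearCombination K fun v =>
    quasiShuffle K p.pair u v
  comul := Finsupp.linearCombination K fun w => ∑ i ∈ Finset.range (w.length + 1),
    Finsupp.single (w.take i) 1 ⊗ₜ[K] Finsupp.single (w.drop i) 1
  counit := Finsupp.linearCombination K fun w => if w = [] then 1 else 0

variable (A)

open Classical in
/-- The linear map `π` from `K[T(A)]` to noncommutative polynomials: a forest is sent to the sum,
over all total orders extending the order of a labelled poset representing it, of the word of
labels of its vertices, listed in decreasing order.  (A total order is given by the listing `σ` of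
the vertices; a vertex comes after all vertices above it, so roots come after their trees.) -/
noncomputable def forestToWords : (Forest A →₀ K) →ₗ[K] (List A →₀ K) :=
  Finsupp.linearCombination K fun u =>
    ∑ σ : Fin u.size ≃ Fin u.size with ∀ i j, u.rep.le (σ j) (σ i) → i ≤ j,
      Finsupp.single (List.ofFn fun i => u.rep.lab (σ i)) 1

end QuasiShuffle

/-! ### The incidence Hopf algebra of the operad NAP -/

namespace RForest

variable {V W : Type}

/-- The order of the operadic partition poset of NAP on the vertex set `V`, whose elements are the
forests of rooted trees with vertex set `V`: `X ≤ Y` if `Y` is obtained from the components of `X`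
by NAP composition, i.e. there is a forest `T` on the set of components of `X` (which are
represented by their roots) such that `Y` consists of the edges of `X` and, for each edge of `T`
between two components, an edge between their roots. -/
def NAPLe (X Y : RForest V) : Prop :=
  ∃ T : RForest {v // X.parent v = none}, ∀ v, Y.parent v =
    if h : X.parent v = none then (T.parent ⟨v, h⟩).map Subtype.val else X.parent v

theorem napLe_iff {X Y : RForest V} : NAPLe X Y ↔
    (∀ v p, X.parent v = some p → Y.parent v = some p) ∧
    ∀ v p, X.parent v = none → Y.parent v = some p → X.parent p = none := by
  constructor
  · rintro ⟨T, hT⟩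
    refine ⟨fun v p h => by rw [hT, dif_neg (by simp [h]), h], fun v p h h' => ?_⟩
    rw [hT, dif_pos h] at h'
    obtain ⟨q, -, rfl⟩ := Option.map_eq_some_iff.1 h'
    exact q.2
  · rintro ⟨h1, h2⟩
    classical
    refine ⟨Y.restrict {v | X.parent v = none}, fun v => ?_⟩
    by_cases h : X.parent v = none
    · rw [dif_pos h]
      cases hY : Y.parent v with
      | none => simp [restrict, hY]
      | some p => simp [restrict, hY, h2 v p h hY]
    · rw [dif_neg h]
      obtain ⟨p, hp⟩ := Option.ne_none_iff_exists'.1 h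
      rw [h1 v p hp, hp]

theorem NAPLe.refl (X : RForest V) : NAPLe X X :=
  napLe_iff.2 ⟨fun _ _ h => h, fun _ _ h h' => by simp [h] at h'⟩

theorem NAPLe.transport {X Y : RForest V} (h : NAPLe X Y) (e : V ≃ W) :
    NAPLe (X.transport e) (Y.transport e) := by
  rw [napLe_iff] at h ⊢
  refine ⟨fun v p h' => ?_, fun v p h' h'' => ?_⟩
  · obtain ⟨q, hq, rfl⟩ := Option.map_eq_some_iff.1 h'
    exact Option.map_eq_some_iff.2 ⟨q, h.1 _ _ hq, rfl⟩
  · obtain ⟨q, hq, rfl⟩ := Option.map_eq_some_iff.1 h''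
    have := h.2 _ _ (Option.map_eq_none_iff.1 h') hq
    simp [RForest.transport, this]

theorem NAPLe.sum {X Y : RForest V} {X' Y' : RForest W} (h : NAPLe X Y) (h' : NAPLe X' Y') :
    NAPLe (X.sum X') (Y.sum Y') := by
  rw [napLe_iff] at h h' ⊢
  constructor
  · rintro (v | v) p hv
    · obtain ⟨q, hq, rfl⟩ := Option.map_eq_some_iff.1 hv
      exact Option.map_eq_some_iff.2 ⟨q, h.1 _ _ hq, rfl⟩
    · obtain ⟨q, hq, rfl⟩ := Option.map_eq_some_iff.1 hv
      exact Option.map_eq_some_iff.2 ⟨q, h'.1 _ _ hq, rfl⟩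
  · rintro (v | v) p hv hp
    · obtain ⟨q, hq, rfl⟩ := Option.map_eq_some_iff.1 hp
      have := h.2 _ _ (Option.map_eq_none_iff.1 hv) hq
      simp [RForest.sum, this]
    · obtain ⟨q, hq, rfl⟩ := Option.map_eq_some_iff.1 hp
      have := h'.2 _ _ (Option.map_eq_none_iff.1 hv) hq
      simp [RForest.sum, this]

/-- `Y` covers `X` in the operadic partition poset by grafting the root `v`, with label `a`, of one
component of `X` to the root `r` of another component. -/
def NAPCover {A : Type*} (lab : V → A) (a : A) (X Y : RForest V) : Prop :=
  ∃ v r, v ≠ r ∧ X.parent v = none ∧ X.parent r = none ∧ lab v = a ∧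
    Y.parent v = some r ∧ ∀ w, w ≠ v → Y.parent w = X.parent w

theorem transport_symm_transport (X : RForest V) (e : V ≃ W) :
    (X.transport e).transport e.symm = X := by
  ext1
  funext v
  simp [RForest.transport, Option.map_map]

theorem transport_injective (e : V ≃ W) :
    Function.Injective fun X : RForest V => X.transport e := fun X Y h => by
  have := congrArg (fun Z => RForest.transport Z e.symm) h
  simpa only [transport_symm_transport] using this

theorem transport_surjective (e : V ≃ W) (Y : RForest W) : ∃ X : RForest V, X.transport e = Y :=
  ⟨Y.transport e.symm, Y.transport_symm_transport e.symm⟩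

theorem napLe_transport_iff {X Y : RForest V} {e : V ≃ W} :
    NAPLe (X.transport e) (Y.transport e) ↔ NAPLe X Y :=
  ⟨fun h => by simpa only [transport_symm_transport] using h.transport e.symm,
    fun h => h.transport e⟩

theorem NAPCover.transport {A : Type*} {lab : V → A} {a : A} {X Y : RForest V}
    (h : NAPCover lab a X Y) (e : V ≃ W) :
    NAPCover (lab ∘ e.symm) a (X.transport e) (Y.transport e) := by
  obtain ⟨v, r, hvr, hv, hr, ha, hY, hw⟩ := h
  refine ⟨e v, e r, e.injective.ne hvr, ?_, ?_, ?_, ?_, fun w hw' => ?_⟩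
  · simp [RForest.transport, hv]
  · simp [RForest.transport, hr]
  · simp [ha]
  · simp [RForest.transport, hY]
  · have : e.symm w ≠ v := fun h => hw' (by simp [← h])
    simp [RForest.transport, hw _ this]

theorem napCover_transport_iff {A : Type*} {lab : V → A} {a : A} {X Y : RForest V} {e : V ≃ W} :
    NAPCover (lab ∘ e.symm) a (X.transport e) (Y.transport e) ↔ NAPCover lab a X Y := by
  refine ⟨fun h => ?_, fun h => h.transport e⟩
  have h' := h.transport e.symm
  simp only [transport_symm_transport] at h'
  convert h' using 1
  funext v
  simp

theorem sum_injective {X X' : RForest V} {Y Y' : RForest W} (h : X.sum Y = X'.sum Y') :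
    X = X' ∧ Y = Y' := by
  constructor
  · ext1
    funext v
    have := congrFun (congrArg RForest.parent h) (Sum.inl v)
    exact Option.map_injective Sum.inl_injective this
  · ext1
    funext v
    have := congrFun (congrArg RForest.parent h) (Sum.inr v)
    exact Option.map_injective Sum.inr_injective this

theorem napLe_sum_iff {X Y : RForest V} {X' Y' : RForest W} :
    NAPLe (X.sum X') (Y.sum Y') ↔ NAPLe X Y ∧ NAPLe X' Y' := by
  refine ⟨fun h => ?_, fun h => h.1.sum h.2⟩
  simp only [napLe_iff] at h ⊢
  refine ⟨⟨fun v p hv => ?_, fun v p hv hp => ?_⟩, ⟨fun v p hv => ?_, fun v p hv hp => ?_⟩⟩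
  · simpa [RForest.sum] using h.1 (Sum.inl v) (Sum.inl p) (by simp [RForest.sum, hv])
  · simpa [RForest.sum] using h.2 (Sum.inl v) (Sum.inl p) (by simp [RForest.sum, hv])
      (by simp [RForest.sum, hp])
  · simpa [RForest.sum] using h.1 (Sum.inr v) (Sum.inr p) (by simp [RForest.sum, hv])
  · simpa [RForest.sum] using h.2 (Sum.inr v) (Sum.inr p) (by simp [RForest.sum, hv])
      (by simp [RForest.sum, hp])

theorem exists_eq_sum {Z : RForest (V ⊕ W)} {Y : RForest V} {Y' : RForest W}
    (h : NAPLe Z (Y.sum Y')) : ∃ X X', Z = RForest.sum X X' := by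
  rw [napLe_iff] at h
  refine ⟨⟨fun v => (Z.parent (Sum.inl v)).bind Sum.getLeft?, ?_⟩,
    ⟨fun v => (Z.parent (Sum.inr v)).bind Sum.getRight?, ?_⟩, ?_⟩
  · refine Subrelation.wf (r := InvImage (fun u v => Z.parent v = some u) Sum.inl) ?_
      (InvImage.wf _ Z.wf)
    intro u v hu
    obtain ⟨p, hp, hpu⟩ := Option.bind_eq_some_iff.1 hu
    rw [Sum.getLeft?_eq_some_iff.1 hpu] at hp
    exact hp
  · refine Subrelation.wf (r := InvImage (fun u v => Z.parent v = some u) Sum.inr) ?_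
      (InvImage.wf _ Z.wf)
    intro u v hu
    obtain ⟨p, hp, hpu⟩ := Option.bind_eq_some_iff.1 hu
    rw [Sum.getRight?_eq_some_iff.1 hpu] at hp
    exact hp
  · ext1
    funext v
    rcases v with v | v
    · cases hp : Z.parent (Sum.inl v) with
      | none => simp [RForest.sum, hp]
      | some p =>
        obtain ⟨q, -, rfl⟩ := Option.map_eq_some_iff.1 (h.1 _ _ hp)
        simp [RForest.sum, hp]
    · cases hp : Z.parent (Sum.inr v) with
      | none => simp [RForest.sum, hp]
      | some p =>
        obtain ⟨q, -, rfl⟩ := Option.map_eq_some_iff.1 (h.1 _ _ hp)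
        simp [RForest.sum, hp]

theorem napCover_sum_iff {A : Type*} {l : V → A} {l' : W → A} {a : A} {X Y : RForest V}
    {X' Y' : RForest W} : NAPCover (Sum.elim l l') a (X.sum X') (Y.sum Y') ↔
      (NAPCover l a X Y ∧ X' = Y') ∨ (X = Y ∧ NAPCover l' a X' Y') := by
  constructor
  · rintro ⟨v | v, r, hvr, hv, hr, ha, hY, hw⟩
    · refine Or.inl ⟨?_, ?_⟩
      · obtain ⟨p, hp, rfl⟩ := Option.map_eq_some_iff.1 hY
        refine ⟨v, p, fun h => hvr (h ▸ rfl), Option.map_eq_none_iff.1 hv,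
          Option.map_eq_none_iff.1 hr, ha, hp, fun w hwv => ?_⟩
        exact Option.map_injective Sum.inl_injective (hw (Sum.inl w) (by simpa using hwv))
      · ext1
        funext w
        exact (Option.map_injective Sum.inr_injective (hw (Sum.inr w) (by simp))).symm
    · refine Or.inr ⟨?_, ?_⟩
      · ext1
        funext w
        exact (Option.map_injective Sum.inl_injective (hw (Sum.inl w) (by simp))).symm
      · obtain ⟨p, hp, rfl⟩ := Option.map_eq_some_iff.1 hY
        refine ⟨v, p, fun h => hvr (h ▸ rfl), Option.map_eq_none_iff.1 hv,
          Option.map_eq_none_iff.1 hr, ha, hp, fun w hwv => ?_⟩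
        exact Option.map_injective Sum.inr_injective (hw (Sum.inr w) (by simpa using hwv))
  · rintro (⟨⟨v, r, hvr, hv, hr, ha, hY, hw⟩, rfl⟩ | ⟨rfl, ⟨v, r, hvr, hv, hr, ha, hY, hw⟩⟩)
    · refine ⟨Sum.inl v, Sum.inl r, by simpa using hvr, by simp [RForest.sum, hv],
        by simp [RForest.sum, hr], ha, by simp [RForest.sum, hY], ?_⟩
      rintro (w | w) hwv
      · simp [RForest.sum, hw w (by simpa using hwv)]
      · rfl
    · refine ⟨Sum.inr v, Sum.inr r, by simpa using hvr, by simp [RForest.sum, hv],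
        by simp [RForest.sum, hr], ha, by simp [RForest.sum, hY], ?_⟩
      rintro (w | w) hwv
      · rfl
      · simp [RForest.sum, hw w (by simpa using hwv)]

end RForest

/-- An interval `[bot, top]` of the operadic partition poset of NAP on the vertex set `Fin n`, the
vertices being labelled by `A`. -/
structure NAPInterval (A : Type*) where
  n : ℕ
  lab : Fin n → A
  bot : RForest (Fin n)
  top : RForest (Fin n)
  le : RForest.NAPLe bot top

namespace NAPInterval

variable {A : Type*}

/-- The underlying set of the interval. -/
def Elem (i : NAPInterval A) : Type := {Z : RForest (Fin i.n) // i.bot.NAPLe Z ∧ Z.NAPLe i.top}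

noncomputable instance (i : NAPInterval A) : Fintype i.Elem := by
  classical exact inferInstanceAs (Fintype {Z // _})

/-- `φ` is an isomorphism of labelled intervals: it preserves the order, and the labels of covering
relations (the label of a covering relation being the label of the root that is grafted). -/
def IsIso (i j : NAPInterval A) (φ : i.Elem ≃ j.Elem) : Prop :=
  (∀ Z Z' : i.Elem, Z.1.NAPLe Z'.1 ↔ (φ Z).1.NAPLe (φ Z').1) ∧
  ∀ (a : A) (Z Z' : i.Elem), Z.1.NAPCover i.lab a Z'.1 ↔ (φ Z).1.NAPCover j.lab a (φ Z').1

instance setoid (A : Type*) : Setoid (NAPInterval A) where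
  r i j := ∃ φ : i.Elem ≃ j.Elem, i.IsIso j φ
  iseqv := ⟨fun i => ⟨Equiv.refl _, by simp [IsIso]⟩,
    fun ⟨φ, h⟩ => ⟨φ.symm, fun Z Z' => by simp [h.1], fun a Z Z' => by simp [h.2]⟩,
    fun ⟨φ, h⟩ ⟨ψ, h'⟩ => ⟨φ.trans ψ, fun Z Z' => by simp [h.1, h'.1],
      fun a Z Z' => by simp [h.2, h'.2]⟩⟩

/-- The interval of the disjoint union of two vertex sets; it is the direct product of the two
intervals, see `exists_sum_equiv`. -/
def sum (i j : NAPInterval A) : NAPInterval A where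
  n := i.n + j.n
  lab := Sum.elim i.lab j.lab ∘ finSumFinEquiv.symm
  bot := (i.bot.sum j.bot).transport finSumFinEquiv
  top := (i.top.sum j.top).transport finSumFinEquiv
  le := (i.le.sum j.le).transport _

theorem exists_sum_equiv (i j : NAPInterval A) : ∃ ψ : i.Elem × j.Elem ≃ (i.sum j).Elem,
    (∀ p q, (ψ p).1.NAPLe (ψ q).1 ↔ p.1.1.NAPLe q.1.1 ∧ p.2.1.NAPLe q.2.1) ∧
    ∀ a p q, (ψ p).1.NAPCover (i.sum j).lab a (ψ q).1 ↔
      (p.1.1.NAPCover i.lab a q.1.1 ∧ p.2 = q.2) ∨ (p.1 = q.1 ∧ p.2.1.NAPCover j.lab a q.2.1) := by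
  let f : i.Elem × j.Elem → (i.sum j).Elem := fun p =>
    ⟨(p.1.1.sum p.2.1).transport finSumFinEquiv,
      (p.1.2.1.sum p.2.2.1).transport _, (p.1.2.2.sum p.2.2.2).transport _⟩
  have hf : Function.Bijective f := by
    constructor
    · rintro ⟨⟨X, hX⟩, ⟨Y, hY⟩⟩ ⟨⟨X', hX'⟩, ⟨Y', hY'⟩⟩ h
      obtain ⟨rfl, rfl⟩ := RForest.sum_injective
        (RForest.transport_injective _ (congrArg Subtype.val h))
      rfl
    · rintro ⟨Z, h1, h2⟩
      obtain ⟨Z, rfl⟩ := RForest.transport_surjective finSumFinEquiv Z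
      have h1' := RForest.napLe_transport_iff.1 h1
      have h2' := RForest.napLe_transport_iff.1 h2
      obtain ⟨X, Y, rfl⟩ := RForest.exists_eq_sum h2'
      rw [RForest.napLe_sum_iff] at h1' h2'
      exact ⟨(⟨X, h1'.1, h2'.1⟩, ⟨Y, h1'.2, h2'.2⟩), rfl⟩
  refine ⟨Equiv.ofBijective f hf, fun p q => ?_, fun a p q => ?_⟩
  · exact RForest.napLe_transport_iff.trans RForest.napLe_sum_iff
  · refine RForest.napCover_transport_iff.trans (RForest.napCover_sum_iff.trans ?_)
    exact or_congr (and_congr Iff.rfl ⟨fun h => Subtype.ext h, congrArg Subtype.val⟩)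
      (and_congr ⟨fun h => Subtype.ext h, congrArg Subtype.val⟩ Iff.rfl)

/-- The interval on the empty vertex set, a single point. -/
def point : NAPInterval A where
  n := 0
  lab := finZeroElim
  bot := ⟨finZeroElim, ⟨fun v => v.elim0⟩⟩
  top := ⟨finZeroElim, ⟨fun v => v.elim0⟩⟩
  le := .refl _

/-- The lower interval `[bot, Z]`. -/
def lower (i : NAPInterval A) (Z : i.Elem) : NAPInterval A := { i with top := Z.1, le := Z.2.1 }

/-- The upper interval `[Z, top]`. -/
def upper (i : NAPInterval A) (Z : i.Elem) : NAPInterval A := { i with bot := Z.1, le := Z.2.2 }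

/-- Isomorphism classes of labelled intervals. -/
def Cls (A : Type*) : Type _ := Quotient (setoid A)

/-- The isomorphism class of a labelled interval. -/
def cls (i : NAPInterval A) : Cls A := ⟦i⟧

end NAPInterval

open Classical in
/-- The labelled incidence Hopf algebra `H_NAP(A)` of the operad NAP: it has a basis `F_[i]` indexed
by the isomorphism classes of labelled intervals, with `F_[i] F_[j] = F_[i × j]` and
`Δ F_[i] = ∑_{Z ∈ i} F_[0, Z] ⊗ F_[Z, 1]`. -/
noncomputable def napHopf (K A : Type*) [Field K] : PreHopf K (NAPInterval.Cls A →₀ K) where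
  one := Finsupp.single NAPInterval.point.cls 1
  mul := Finsupp.linearCombination K fun i => Finsupp.linearCombination K fun j =>
    Finsupp.single (i.out.sum j.out).cls 1
  comul := Finsupp.linearCombination K fun i => ∑ Z : i.out.Elem,
    Finsupp.single (i.out.lower Z).cls 1 ⊗ₜ[K] Finsupp.single (i.out.upper Z).cls 1
  counit := Finsupp.linearCombination K fun i => if i = NAPInterval.point.cls then 1 else 0

/-! ### The universal Hopf algebra of renormalization -/

section Universal

attribute [local instance 100] LieRing.ofAssociativeRing

variable (K : Type*) [Field K]

/-- The Lie algebra `L_𝕌`: the free Lie algebra on generators `e₋ₙ`, `n = 1, 2, …`. -/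
abbrev LieU : Type _ := FreeLieAlgebra K ℕ+

/-- The universal enveloping algebra of `L_𝕌`. -/
abbrev EnvU : Type _ := UniversalEnvelopingAlgebra K (LieU K)

/-- The coproduct of the enveloping algebra, for which the elements of the Lie algebra are
primitive. -/
noncomputable def envComul : EnvU K →ₐ[K] EnvU K ⊗[K] EnvU K :=
  UniversalEnvelopingAlgebra.lift K
    { toFun x := UniversalEnvelopingAlgebra.ι K x ⊗ₜ[K] 1 + 1 ⊗ₜ[K] UniversalEnvelopingAlgebra.ι K x
      map_add' x y := by simp only [map_add, TensorProduct.add_tmul, TensorProduct.tmul_add]; abel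
      map_smul' r x := by
        simp only [map_smul, TensorProduct.smul_tmul', TensorProduct.tmul_smul, smul_add,
          RingHom.id_apply]
      map_lie' {x y} := by
        simp only [LieHom.map_lie, LieRing.of_associative_ring_bracket, mul_add, add_mul,
          Algebra.TensorProduct.tmul_mul_tmul, one_mul, mul_one, TensorProduct.sub_tmul,
          TensorProduct.tmul_sub]
        abel }

/-- The counit of the enveloping algebra, which vanishes on the Lie algebra. -/
noncomputable def envCounit : EnvU K →ₐ[K] K := UniversalEnvelopingAlgebra.lift K 0

/-- The component of degree `m` of the enveloping algebra, `e₋ₙ` having degree `n`. -/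
noncomputable def envGrade (m : ℕ) : Submodule K (EnvU K) :=
  Submodule.span K {x | ∃ l : List ℕ+, (l.map fun n : ℕ+ => (n : ℕ)).sum = m ∧
    x = (l.map fun n => UniversalEnvelopingAlgebra.ι K (FreeLieAlgebra.of K n)).prod}

/-- The underlying space of `H_𝕌`: the graded dual of the enveloping algebra of `L_𝕌`, i.e. the
linear forms which vanish on all components of large degree. -/
noncomputable def HU : Submodule K (Module.Dual K (EnvU K)) where
  carrier := {f | ∃ N, ∀ m, N ≤ m → ∀ x ∈ envGrade K m, f x = 0}
  add_mem' := by
    rintro f g ⟨M, hf⟩ ⟨N, hg⟩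
    refine ⟨max M N, fun m hm x hx => ?_⟩
    simp [hf m (le_trans (le_max_left _ _) hm) x hx, hg m (le_trans (le_max_right _ _) hm) x hx]
  zero_mem' := ⟨0, fun _ _ _ _ => rfl⟩
  smul_mem' := by
    rintro r f ⟨M, hf⟩
    exact ⟨M, fun m hm x hx => by simp [hf m hm x hx]⟩

/-- The pairing of `H_𝕌 ⊗ H_𝕌` with the tensor square of the enveloping algebra. -/
noncomputable def pairU : HU K ⊗[K] HU K →ₗ[K] Module.Dual K (EnvU K ⊗[K] EnvU K) :=
  TensorProduct.dualDistrib K (EnvU K) (EnvU K) ∘ₗ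
    TensorProduct.map (HU K).subtype (HU K).subtype

/-- The structure maps of `D` are the transposes of those of the enveloping algebra of `L_𝕌`; so
`D` is the universal Hopf algebra of renormalization `H_𝕌`.  (These conditions determine `D`.) -/
structure IsUniversalHopf (D : PreHopf K (HU K)) : Prop where
  one_apply : ∀ x, (D.one : Module.Dual K (EnvU K)) x = envCounit K x
  mul_apply : ∀ f g x, (D.mul f g : Module.Dual K (EnvU K)) x =
    pairU K (f ⊗ₜ[K] g) (envComul K x)
  comul_apply : ∀ f x y, pairU K (D.comul f) (x ⊗ₜ[K] y) = f.1 (x * y)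
  counit_apply : ∀ f, D.counit f = f.1 1

end Universal

/-! ### Hall sets of trees and Lyndon words -/

section Hall

variable {A : Type*}

/-- The forest `t₁^{∘ r₁} ⋯ t_m^{∘ r_m}`. -/
noncomputable def hallForest {H : Set (Forest A)} (l : List (H × ℕ)) : Forest A :=
  (l.map fun p => p.1.1.cpow p.2).prod

/-- `t₁ > ⋯ > t_m` and `r₁, …, r_m ≥ 1`. -/
def IsDecreasing {H : Set (Forest A)} (lt : H → H → Prop) (l : List (H × ℕ)) : Prop :=
  l.Pairwise (fun p q => lt q.1 p.1) ∧ ∀ p ∈ l, 1 ≤ p.2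

/-- A Hall set of labelled rooted trees, with its strict total order `lt`. -/
structure IsHallSet (H : Set (Forest A)) (lt : H → H → Prop) : Prop where
  isTree : ∀ t ∈ H, t.IsTree
  total : IsStrictTotalOrder H lt
  letter : ∀ a, Forest.B a 1 ∈ H
  /-- Every Hall tree is of the form `B⁺_a(t₁^{∘ r₁} ⋯ t_m^{∘ r_m})` (with `m = 0` allowed). -/
  form : ∀ t ∈ H, ∃ a, ∃ l : List (H × ℕ), IsDecreasing lt l ∧ t = Forest.B a (hallForest l)
  mem_iff : ∀ (a : A) (l : List (H × ℕ)) (s : H) (r : ℕ), IsDecreasing lt (l ++ [(s, r)]) →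
    (Forest.B a (hallForest (l ++ [(s, r)])) ∈ H ↔
      ∃ h : Forest.B a (hallForest l) ∈ H, lt ⟨_, h⟩ s)
  lt_of_mem : ∀ (a : A) (l : List (H × ℕ)), IsDecreasing lt l →
    ∀ h : Forest.B a (hallForest l) ∈ H, ∀ p ∈ l, lt ⟨_, h⟩ p.1

/-- `Foliage lt t w`: the Hall tree `t` has the foliage `w`.  The foliage of a one-vertex tree is its
label, and the foliage of a larger Hall tree with standard decomposition `(t¹, t²)` is the product of
those of `t¹` and `t²`, where `t¹ = B⁺_a(t₁^{∘ r₁} ⋯ t_m^{∘ (r_m - 1)})` and `t² = t_m` for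
`t = B⁺_a(t₁^{∘ r₁} ⋯ t_m^{∘ r_m})`. -/
inductive Foliage {H : Set (Forest A)} (lt : H → H → Prop) : Forest A → List A → Prop
  | letter (a : A) : Foliage lt (Forest.B a 1) [a]
  | node (a : A) (l : List (H × ℕ)) (s : H) (r : ℕ) (u v : List A)
      (hl : IsDecreasing lt (l ++ [(s, r + 1)]))
      (ht : Forest.B a (hallForest (l ++ [(s, r + 1)])) ∈ H)
      (hu : Foliage lt (Forest.B a (hallForest (l ++ [(s, r)]))) u) (hv : Foliage lt s.1 v) :
      Foliage lt (Forest.B a (hallForest (l ++ [(s, r + 1)]))) (u ++ v)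

/-- Lyndon words; words are compared alphabetically (a proper prefix being smaller). -/
def IsLyndon [LinearOrder A] (w : List A) : Prop :=
  w ≠ [] ∧ ∀ u v, u ≠ [] → v ≠ [] → w = u ++ v → w < v

/-- The Hall set of trees `H` corresponds to the set of Lyndon words, ordered alphabetically: the
foliage is an isomorphism of ordered sets from `H` onto the set of Lyndon words. -/
def IsLyndonHallSet [LinearOrder A] (H : Set (Forest A)) (lt : H → H → Prop) : Prop :=
  IsHallSet H lt ∧ ∃ f : H → List A, (∀ t, Foliage lt t.1 (f t)) ∧
    Set.range f = {w | IsLyndon w} ∧ ∀ s t, lt s t ↔ f s < f t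

end Hall

/-! Everything rests on one surjective Hopf morphism, `π` from the forests to the words with the
ordinary shuffle product (the quasi-shuffle product for the zero pairing). A surjective morphism of
Hopf algebras has a Hopf ideal as kernel and identifies its target with the quotient, so every
quotient statement is reduced to producing such surjections out of `K[T(A)]`, `H_CK(A)` and
`H_NAP(A)`.

That `π` is a Hopf morphism follows from cofreeness of words under deconcatenation. The coefficient
of a word is multiplicative for convolution, so a linear map whose coefficients are convolution
products of forms attached to letters preserves coproducts (`comul_eq_of_coeff`), and a coalgebra
morphism is determined by its one-letter coefficients (`coalgHom_ext`). For `π` the first condition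
says that a linear extension starts by removing a maximal vertex, that is, by passing to a lower set
whose complement is one vertex (`forestToWords_apply_cons`). Multiplicativity then only has to be
compared on one-letter words (`map_mul_of_letters`). Surjectivity holds because `B⁺_a` becomes the
appending of the letter `a`. A general pairing is reached by Hoffman's exponential, which contracts
consecutive blocks of letters with weights `1/k!`; it is a Hopf morphism by the same one-letter
criterion, and it is bijective because it is the identity up to shorter words. Composing with it
does not change the kernel of `π`.

`H_CK(A)` and `H_NAP(A)` are both isomorphic to `K[T(A)]`. Forests form the free commutative monoid
on trees (`ofTrees_bijective`), and the nonempty admissible cuts of a tree correspond to the lower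
sets other than the empty one and the whole tree (`sum_admissible`). An interval of the NAP poset is
the lattice of lower sets of the forest of the vertices grafted between its ends, and this lattice
with its labelled covering relations determines the forest (`exists_isIso_of_lower`). The bialgebra
axioms are proved for words by the recursion of the product and for forests by the cocycle property
of `B⁺_a`; antipodes come from a connected filtration.

The enveloping algebra of a free Lie algebra is the free algebra, with the words as a basis and
primitive generators. Only finitely many words have degree below a given bound, so the graded dual
is again spanned by words, and the transposed structure maps are the shuffle product and
deconcatenation.

For free generation, words are read backwards and compared alphabetically. The largest word
occurring in the image of a Hall tree is its foliage, a Lyndon word (`lead_of_foliage`). The largest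
word in a product is the concatenation of the Lyndon words of its factors in nonincreasing order,
because any shuffle of two such concatenations is at most the sorted one (`IsShuffle.le_flatten`).
Every word has exactly one nonincreasing factorization into Lyndon words, so monomials in the Hall
trees correspond to words by a triangular matrix whose diagonal entries are nonzero natural numbers,
and characteristic zero makes it invertible. A Hall set of the required kind is built by sending `a
w` to the tree with root `a` whose branches come from the Lyndon factors of `w`. -/

/-! ### Kernels and quotients of Hopf algebra morphisms. -/

section HopfQuotient

open WithConv Coalgebra

variable {K A B : Type*} [Field K] [CommRing A] [CommRing B] [HopfAlgebra K A] [HopfAlgebra K B]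

/-- Both composites are inverse to `f` in the convolution algebra of linear maps from `A` to `B`,
one from the left and the other from the right, so they coincide. -/
theorem BialgHom.map_antipode' (f : A →ₐc[K] B) (x : A) :
    f (HopfAlgebra.antipode K x) = HopfAlgebra.antipode K (f x) := by
  have h : (toConv ((f : A →ₗ[K] B) ∘ₗ HopfAlgebra.antipode K) : WithConv (A →ₗ[K] B)) =
      toConv (HopfAlgebra.antipode K ∘ₗ (f : A →ₗ[K] B)) := by
    refine left_inv_eq_right_inv (a := toConv (f : A →ₗ[K] B)) ?_ ?_
    · ext x
      rw [(ℛ K x).convMul_apply]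
      simp only [LinearMap.convOne_apply, LinearMap.comp_apply]
      have := congrArg f (HopfAlgebra.sum_antipode_mul_eq_algebraMap_counit (ℛ K x))
      rw [map_sum] at this
      simp only [map_mul] at this
      exact this.trans (AlgHomClass.commutes f _)
    · have := LinearMap.convMul_comp_coalgHom_distrib (R := K)
        (toConv LinearMap.id) (toConv (HopfAlgebra.antipode K (A := B))) (f : A →ₗc[K] B)
      rw [LinearMap.id_mul_antipode] at this
      apply WithConv.ofConv_injective
      refine Eq.trans this.symm ?_
      exact LinearMap.convOne_comp_coalgHom (f : A →ₗc[K] B)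
  exact LinearMap.congr_fun (congrArg ofConv h) x

/-- Over a field `f` has a linear section, so the quotient map factors through `f`. The condition on
the coproduct of an element of the kernel then follows from the vanishing of the coproduct of its
image. -/
theorem BialgHom.ker_isHopfIdeal (f : A →ₐc[K] B) (hf : Function.Surjective f) :
    (RingHom.ker f).IsHopfIdeal K := by
  have hc : ∀ x, counit (R := K) (f x) = counit (R := K) x := fun x =>
    CoalgHomClass.counit_comp_apply f x
  have hΔ : ∀ x, TensorProduct.map (f : A →ₗ[K] B) (f : A →ₗ[K] B) (comul x) = comul (f x) :=
    fun x => CoalgHomClass.map_comp_comul_apply f x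
  obtain ⟨g, hg⟩ := (f : A →ₗ[K] B).exists_rightInverse_of_surjective
    (LinearMap.range_eq_top.2 hf)
  have hI : ∀ y, y ∈ (RingHom.ker f).restrictScalars K ↔ f y = 0 := fun y => Iff.rfl
  have hmk : ((RingHom.ker f).restrictScalars K).mkQ =
      (((RingHom.ker f).restrictScalars K).mkQ ∘ₗ g) ∘ₗ (f : A →ₗ[K] B) := by
    ext x
    refine (Submodule.Quotient.eq _).2 ((hI _).2 ?_)
    have : f (g (f x)) = f x := LinearMap.congr_fun hg (f x)
    rw [map_sub, sub_eq_zero]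
    exact this.symm
  refine { counit_eq_zero := ?_, map_mkQ_comul_eq_zero := ?_, antipode_mem := ?_ }
  · intro x hx
    rw [← hc, (hI x).1 hx, map_zero]
  · intro x hx
    rw [hmk, TensorProduct.map_comp, LinearMap.comp_apply, hΔ, (hI x).1 hx, map_zero, map_zero]
  · intro x hx
    have hx : f x = 0 := hx
    show f _ = 0
    rw [BialgHom.map_antipode', hx, map_zero]

/-- A surjective morphism of Hopf algebras identifies its target with the quotient of its source
by its kernel. -/
theorem BialgHom.exists_quotientKerEquiv (f : A →ₐc[K] B) (hf : Function.Surjective f)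
    [(RingHom.ker f).IsHopfIdeal K] :
    ∃ e : (A ⧸ RingHom.ker f) ≃ₐc[K] B, ∀ x, e (Ideal.Quotient.mk _ x) = f x := by
  let e₀ : (A ⧸ RingHom.ker (f : A →ₐ[K] B)) ≃ₐ[K] B :=
    Ideal.quotientKerAlgEquivOfSurjective (f := (f : A →ₐ[K] B)) hf
  refine ⟨BialgEquiv.ofAlgEquiv e₀ ?_ ?_, fun x => rfl⟩
  · refine Ideal.Quotient.algHom_ext K ?_
    ext x
    exact CoalgHomClass.counit_comp_apply f x
  · refine Ideal.Quotient.algHom_ext K ?_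
    ext x
    have := CoalgHomClass.map_comp_comul_apply f x
    refine Eq.trans ?_ this
    simp only [AlgHom.comp_apply]
    have h2 : ∀ z : A ⊗[K] A, Algebra.TensorProduct.map (e₀ : _ →ₐ[K] B) (e₀ : _ →ₐ[K] B)
        (TensorProduct.map (Ideal.Quotient.mkₐ K (RingHom.ker (f : A →ₐ[K] B))).toLinearMap
          (Ideal.Quotient.mkₐ K (RingHom.ker (f : A →ₐ[K] B))).toLinearMap z) =
        TensorProduct.map (f : A →ₗ[K] B) (f : A →ₗ[K] B) z := by
      intro z
      induction z using TensorProduct.induction_on with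
      | zero => simp
      | tmul a b => rfl
      | add a b ha hb => simp only [map_add, ha, hb]
    exact h2 _

end HopfQuotient

/-! ### Structure-preserving maps and transport of the Hopf axioms. -/

namespace PreHopf

variable {K U V W : Type*} [Field K] [AddCommGroup U] [Module K U] [AddCommGroup V] [Module K V]
  [AddCommGroup W] [Module K W]

/-- A linear map which preserves the structure maps. -/
structure IsHom (D : PreHopf K V) (E : PreHopf K W) (f : V →ₗ[K] W) : Prop where
  map_one : f D.one = E.one
  map_mul : ∀ x y, f (D.mul x y) = E.mul (f x) (f y)
  map_comul : ∀ x, E.comul (f x) = TensorProduct.map f f (D.comul x)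
  map_counit : ∀ x, E.counit (f x) = D.counit x

variable {D : PreHopf K V} {E : PreHopf K W} {C : PreHopf K U}

theorem IsHom.comp {f : V →ₗ[K] W} {g : U →ₗ[K] V} (hf : IsHom D E f) (hg : IsHom C D g) :
    IsHom C E (f ∘ₗ g) where
  map_one := by simp [hg.map_one, hf.map_one]
  map_mul x y := by simp [hg.map_mul, hf.map_mul]
  map_comul x := by
    rw [LinearMap.comp_apply, hf.map_comul, hg.map_comul, TensorProduct.map_comp]
    rfl
  map_counit x := by simp [hg.map_counit, hf.map_counit]

theorem IsHom.symm {e : V ≃ₗ[K] W} (he : IsHom D E e.toLinearMap) :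
    IsHom E D e.symm.toLinearMap where
  map_one := by
    have := he.map_one
    simp only [LinearEquiv.coe_coe] at this ⊢
    rw [← this, e.symm_apply_apply]
  map_mul x y := by
    have := he.map_mul (e.symm x) (e.symm y)
    simp only [LinearEquiv.coe_coe, e.apply_symm_apply] at this ⊢
    rw [← this, e.symm_apply_apply]
  map_comul x := by
    have := he.map_comul (e.symm x)
    simp only [LinearEquiv.coe_coe, e.apply_symm_apply] at this ⊢
    rw [this, ← LinearMap.comp_apply, ← TensorProduct.map_comp]
    simp
  map_counit x := by
    have := he.map_counit (e.symm x)
    simp only [LinearEquiv.coe_coe, e.apply_symm_apply] at this ⊢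
    exact this.symm

theorem map₂_mul_map {f : V →ₗ[K] W} (hf : ∀ x y, f (D.mul x y) = E.mul (f x) (f y))
    (x y : V ⊗[K] V) :
    TensorProduct.map f f (TensorProduct.map₂ D.mul D.mul x y) =
      TensorProduct.map₂ E.mul E.mul (TensorProduct.map f f x) (TensorProduct.map f f y) := by
  induction x using TensorProduct.induction_on with
  | zero => simp
  | add a b ha hb => simp only [map_add, LinearMap.add_apply, ha, hb]
  | tmul a b =>
    induction y using TensorProduct.induction_on with
    | zero => simp
    | add c d hc hd => simp only [map_add, hc, hd]
    | tmul c d => simp [hf]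

theorem lift_mul_map {f : V →ₗ[K] W} (hf : ∀ x y, f (D.mul x y) = E.mul (f x) (f y))
    (x : V ⊗[K] V) :
    f (TensorProduct.lift D.mul x) = TensorProduct.lift E.mul (TensorProduct.map f f x) := by
  induction x using TensorProduct.induction_on with
  | zero => simp
  | add a b ha hb => simp only [map_add, ha, hb]
  | tmul a b => simp [hf]

/-- Each axiom can be tested after applying a tensor power of `e`, which is injective; the antipode
is conjugated by `e`. In this way the axioms need a direct proof only for words and for forests. -/
theorem isHopf_of_equiv (e : V ≃ₗ[K] W) (he : IsHom D E e.toLinearMap) [h : E.IsHopf] :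
    D.IsHopf := by
  have hm : ∀ x y, e (D.mul x y) = E.mul (e x) (e y) := he.map_mul
  have h1 : e D.one = E.one := he.map_one
  have hε : ∀ x, E.counit (e x) = D.counit x := he.map_counit
  have hΔ : ∀ x, E.comul (e x) = TensorProduct.congr e e (D.comul x) := he.map_comul
  have hinj : Function.Injective (TensorProduct.congr e e) := (TensorProduct.congr e e).injective
  refine ⟨?_, ?_, ?_, ?_, ?_, ?_, ?_, ?_, ?_, ?_, ?_⟩
  · intro x y z
    apply e.injective
    simp only [hm, h.mul_assoc]
  · intro x y
    apply e.injective
    simp only [hm]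
    exact h.mul_comm _ _
  · intro x
    apply e.injective
    simp only [hm, h1, h.one_mul]
  · ext x
    apply (TensorProduct.congr e (TensorProduct.congr e e)).injective
    have h0 := LinearMap.congr_fun h.coassoc (e x)
    simp only [LinearMap.comp_apply, hΔ] at h0 ⊢
    generalize D.comul x = y at h0 ⊢
    have ha : ∀ y : V ⊗[K] V, TensorProduct.congr e (TensorProduct.congr e e)
        (TensorProduct.assoc K V V V (D.comul.rTensor V y)) =
        TensorProduct.assoc K W W W (E.comul.rTensor W (TensorProduct.congr e e y)) := by
      intro y
      induction y using TensorProduct.induction_on with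
      | zero => simp
      | add a b ha hb => simp only [map_add, ha, hb]
      | tmul a b =>
        simp only [LinearMap.rTensor_tmul, TensorProduct.congr_tmul, hΔ]
        generalize D.comul a = z
        induction z using TensorProduct.induction_on with
        | zero => simp
        | add a b ha hb => simp only [map_add, TensorProduct.add_tmul, ha, hb]
        | tmul c d => simp
    have hb : ∀ y : V ⊗[K] V, TensorProduct.congr e (TensorProduct.congr e e)
        (D.comul.lTensor V y) = E.comul.lTensor W (TensorProduct.congr e e y) := by
      intro y
      induction y using TensorProduct.induction_on with
      | zero => simp
      | add a b ha hb => simp only [map_add, ha, hb]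
      | tmul a b => simp [hΔ]
    rw [hb, ← h0]
    exact ha y
  · ext x
    apply (TensorProduct.congr (LinearEquiv.refl K K) e).injective
    have h0 := LinearMap.congr_fun h.rTensor_counit (e x)
    simp only [LinearMap.comp_apply, hΔ, TensorProduct.mk_apply] at h0 ⊢
    simp only [TensorProduct.congr_tmul, LinearEquiv.refl_apply, ← h0]
    generalize D.comul x = y
    induction y using TensorProduct.induction_on with
    | zero => simp
    | add a b ha hb => simp only [map_add, ha, hb]
    | tmul a b => simp [hε]
  · ext x
    apply (TensorProduct.congr e (LinearEquiv.refl K K)).injective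
    have h0 := LinearMap.congr_fun h.lTensor_counit (e x)
    simp only [LinearMap.comp_apply, hΔ, TensorProduct.mk_apply, LinearMap.flip_apply] at h0 ⊢
    simp only [TensorProduct.congr_tmul, LinearEquiv.refl_apply, ← h0]
    generalize D.comul x = y
    induction y using TensorProduct.induction_on with
    | zero => simp
    | add a b ha hb => simp only [map_add, ha, hb]
    | tmul a b => simp [hε]
  · rw [← hε, h1, h.counit_one]
  · intro x y
    rw [← hε, hm, h.counit_mul, hε, hε]
  · apply hinj
    rw [← hΔ, h1, h.comul_one, TensorProduct.congr_tmul, h1]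
  · intro x y
    apply hinj
    rw [← hΔ, hm, h.comul_mul, hΔ, hΔ]
    exact (map₂_mul_map (f := e.toLinearMap) hm _ _).symm
  · obtain ⟨S, hl, hr⟩ := h.exists_antipode
    refine ⟨e.symm.toLinearMap ∘ₗ S ∘ₗ e.toLinearMap, fun x => ?_, fun x => ?_⟩
    · apply e.injective
      rw [map_smul, h1, ← hε, ← hl, hΔ]
      refine (lift_mul_map (f := e.toLinearMap) hm _).trans ?_
      congr 1
      generalize D.comul x = y
      induction y using TensorProduct.induction_on with
      | zero => simp
      | add a b ha hb => simp only [map_add, ha, hb]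
      | tmul a b => simp
    · apply e.injective
      rw [map_smul, h1, ← hε, ← hr, hΔ]
      refine (lift_mul_map (f := e.toLinearMap) hm _).trans ?_
      congr 1
      generalize D.comul x = y
      induction y using TensorProduct.induction_on with
      | zero => simp
      | add a b ha hb => simp only [map_add, ha, hb]
      | tmul a b => simp

/-- The morphism of bialgebras given by a structure-preserving linear map. -/
noncomputable def IsHom.toBialgHom [D.IsHopf] [E.IsHopf] {f : V →ₗ[K] W} (hf : IsHom D E f) :
    D.Carrier →ₐc[K] E.Carrier :=
  BialgHom.ofAlgHom
    (AlgHom.ofLinearMap (A := D.Carrier) (B := E.Carrier) f hf.map_one hf.map_mul)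
    (by ext x; exact hf.map_counit x)
    (by ext x; exact (hf.map_comul x).symm)

/-- A surjective structure-preserving linear map identifies its target with the quotient of its
source by a Hopf ideal. -/
theorem IsHom.exists_quotient [D.IsHopf] [E.IsHopf] {f : V →ₗ[K] W} (hf : IsHom D E f)
    (hs : Function.Surjective f) :
    ∃ (I : Ideal D.Carrier) (_ : I.IsHopfIdeal K), (∀ x : V, (x : D.Carrier) ∈ I ↔ f x = 0) ∧
      ∃ e : (D.Carrier ⧸ I) ≃ₐc[K] E.Carrier,
        ∀ x : V, e (Ideal.Quotient.mk I (x : D.Carrier)) = (f x : W) := by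
  have hs' : Function.Surjective hf.toBialgHom := hs
  have hI := BialgHom.ker_isHopfIdeal hf.toBialgHom hs'
  exact ⟨_, hI, fun x => Iff.rfl, BialgHom.exists_quotientKerEquiv hf.toBialgHom hs'⟩

end PreHopf

/-! ### Antipodes from connected filtrations. -/

section Takeuchi

open WithConv Coalgebra

variable {K H : Type*} [Field K] [CommRing H] [Algebra K H] [Coalgebra K H]

/-- The identity minus the unit of the convolution algebra. -/
noncomputable def convAugmentation (K H : Type*) [Field K] [CommRing H] [Algebra K H]
    [Coalgebra K H] : WithConv (H →ₗ[K] H) := toConv LinearMap.id - 1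

/-- A bialgebra with a suitable connected filtration has an antipode. -/
theorem exists_convInverse_of_filtration (F : ℕ → Submodule K H) (hmono : Monotone F)
    (hF : ∀ x, ∃ n, x ∈ F n)
    (hone : counit (R := K) (1 : H) = 1)
    (h0 : ∀ x ∈ F 0, x = algebraMap K H (counit x))
    (hstep : ∀ n, ∀ x ∈ F (n + 1), ∃ z : H ⊗[K] F n,
      comul x = (1 : H) ⊗ₜ[K] x + TensorProduct.map LinearMap.id (F n).subtype z) :
    ∃ S : WithConv (H →ₗ[K] H), S * toConv LinearMap.id = 1 ∧ toConv LinearMap.id * S = 1 := by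
  set J := convAugmentation K H with hJ
  have hJx : ∀ x, J.ofConv x = x - algebraMap K H (counit x) := fun x => rfl
  -- `J` kills the unit, so the leading term `1 ⊗ x` of the coproduct disappears and the remaining
  -- second factors lie one filtration step lower. Hence `J ^ (n + 1)` vanishes on `F n`.
  have hnil : ∀ n, ∀ x ∈ F n, (J ^ (n + 1)).ofConv x = 0 := by
    intro n
    induction n with
    | zero =>
      intro x hx
      rw [zero_add, pow_one, hJx, ← h0 x hx, sub_self]
    | succ n ih =>
      intro x hx
      obtain ⟨z, hz⟩ := hstep n x hx
      rw [pow_succ', LinearMap.convMul_def, ofConv_toConv, LinearMap.comp_apply,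
        LinearMap.comp_apply, hz, map_add, map_add, TensorProduct.map_tmul, hJx, hone, map_one,
        sub_self, TensorProduct.zero_tmul, map_zero, zero_add]
      have : ∀ z : H ⊗[K] F n, TensorProduct.map J.ofConv (J ^ (n + 1)).ofConv
          (TensorProduct.map LinearMap.id (F n).subtype z) = 0 := by
        intro z
        induction z using TensorProduct.induction_on with
        | zero => simp
        | add a b ha hb => simp only [map_add, ha, hb, add_zero]
        | tmul a b => simp [ih b.1 b.2]
      rw [this, map_zero]
  have hnil' : ∀ n k x, x ∈ F n → n < k → ((-J) ^ k).ofConv x = 0 := by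
    intro n k x hx hk
    have h1 := hnil (k - 1) x (hmono (by omega) hx)
    rw [show k - 1 + 1 = k by omega] at h1
    rw [neg_pow]
    rcases neg_one_pow_eq_or (WithConv (H →ₗ[K] H)) k with h | h <;> rw [h]
    · rw [one_mul, h1]
    · rw [neg_one_mul]
      exact (congrArg Neg.neg h1).trans neg_zero
  have hfin : ∀ x, (Function.support fun k => ((-J) ^ k).ofConv x).Finite := by
    intro x
    obtain ⟨n, hn⟩ := hF x
    refine (Set.finite_Iic n).subset fun k hk => ?_
    by_contra hkn
    exact hk (hnil' n k x hn (not_le.1 hkn))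
  -- The identity is `1 - (-J)` in the convolution algebra, so its inverse is the geometric series
  -- in `-J`, a finite sum on each element.
  let S : H →ₗ[K] H :=
    { toFun := fun x => ∑ᶠ k, ((-J) ^ k).ofConv x
      map_add' := fun x y => by
        simp only [map_add]
        exact finsum_add_distrib (hfin x) (hfin y)
      map_smul' := fun r x => by
        simp only [map_smul, RingHom.id_apply]
        exact (smul_finsum r _).symm }
  let G : ℕ → WithConv (H →ₗ[K] H) := fun N => ∑ k ∈ Finset.range N, (-J) ^ k
  have hG : ∀ N x, (G N).ofConv x = ∑ k ∈ Finset.range N, ((-J) ^ k).ofConv x := by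
    intro N x
    have : (G N).ofConv = ∑ k ∈ Finset.range N, ((-J) ^ k).ofConv :=
      map_sum (WithConv.linearEquiv K (H →ₗ[K] H)) _ _
    rw [this, LinearMap.sum_apply]
  have hSG : ∀ n N x, x ∈ F n → n < N → S x = (G N).ofConv x := by
    intro n N x hx hN
    rw [hG]
    refine finsum_eq_sum_of_support_subset _ fun k hk => ?_
    simp only [Finset.coe_range, Set.mem_Iio]
    by_contra hkN
    exact hk (hnil' n k x hx (by omega))
  have hid : toConv (LinearMap.id : H →ₗ[K] H) = 1 - -J := by rw [hJ, convAugmentation]; abel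
  -- A tensor involves finitely many elements, so on it the series may be replaced by a partial sum
  -- `G N`, to which the finite geometric sum formula applies.
  have key : ∀ y : H ⊗[K] H, ∃ n, ∀ N, n < N →
      TensorProduct.map S LinearMap.id y = TensorProduct.map (G N).ofConv LinearMap.id y ∧
      TensorProduct.map LinearMap.id S y = TensorProduct.map LinearMap.id (G N).ofConv y := by
    intro y
    induction y using TensorProduct.induction_on with
    | zero => exact ⟨0, fun N _ => by simp⟩
    | add a b ha hb =>
      obtain ⟨n, hn⟩ := ha
      obtain ⟨m, hm⟩ := hb
      refine ⟨max n m, fun N hN => ?_⟩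
      have h1 := hn N (lt_of_le_of_lt (le_max_left _ _) hN)
      have h2 := hm N (lt_of_le_of_lt (le_max_right _ _) hN)
      simp only [map_add, h1.1, h1.2, h2.1, h2.2, and_self]
    | tmul a b =>
      obtain ⟨n, hn⟩ := hF a
      obtain ⟨m, hm⟩ := hF b
      refine ⟨max n m, fun N hN => ?_⟩
      simp only [TensorProduct.map_tmul, LinearMap.id_apply,
        hSG n N a hn (lt_of_le_of_lt (le_max_left _ _) hN),
        hSG m N b hm (lt_of_le_of_lt (le_max_right _ _) hN), and_self]
  refine ⟨toConv S, ?_, ?_⟩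
  · ext x
    obtain ⟨n, hn⟩ := hF x
    obtain ⟨m, hm⟩ := key (comul x)
    set N := max n m + 1
    have h1 : (G N * toConv LinearMap.id) = 1 - (-J) ^ N := by
      rw [hid]; exact geom_sum_mul_neg _ _
    have h2 : (toConv S * toConv LinearMap.id : WithConv (H →ₗ[K] H)).ofConv x =
        (G N * toConv LinearMap.id : WithConv (H →ₗ[K] H)).ofConv x := by
      exact congrArg (LinearMap.mul' K H) (hm N (by omega)).1
    refine h2.trans ?_
    rw [h1]
    refine Eq.trans (b := (1 : WithConv (H →ₗ[K] H)).ofConv x - ((-J) ^ N).ofConv x) rfl ?_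
    rw [hnil' n N x hn (by omega), sub_zero]
  · ext x
    obtain ⟨n, hn⟩ := hF x
    obtain ⟨m, hm⟩ := key (comul x)
    set N := max n m + 1
    have h1 : (toConv LinearMap.id * G N) = 1 - (-J) ^ N := by
      rw [hid]; exact mul_neg_geom_sum _ _
    have h2 : (toConv LinearMap.id * toConv S : WithConv (H →ₗ[K] H)).ofConv x =
        (toConv LinearMap.id * G N : WithConv (H →ₗ[K] H)).ofConv x := by
      exact congrArg (LinearMap.mul' K H) (hm N (by omega)).2
    refine h2.trans ?_
    rw [h1]
    refine Eq.trans (b := (1 : WithConv (H →ₗ[K] H)).ofConv x - ((-J) ^ N).ofConv x) rfl ?_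
    rw [hnil' n N x hn (by omega), sub_zero]

end Takeuchi

namespace PreHopf

variable {K V : Type*} [Field K] [AddCommGroup V] [Module K V]

/-- A commutative bialgebra with a suitable connected filtration is a Hopf algebra. -/
theorem isHopf_of_filtration (D : PreHopf K V)
    (mul_assoc : ∀ x y z, D.mul (D.mul x y) z = D.mul x (D.mul y z))
    (mul_comm : ∀ x y, D.mul x y = D.mul y x)
    (one_mul : ∀ x, D.mul D.one x = x)
    (coassoc : (TensorProduct.assoc K V V V).toLinearMap ∘ₗ D.comul.rTensor V ∘ₗ D.comul =
      D.comul.lTensor V ∘ₗ D.comul)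
    (rTensor_counit : D.counit.rTensor V ∘ₗ D.comul = TensorProduct.mk K K V 1)
    (lTensor_counit : D.counit.lTensor V ∘ₗ D.comul = (TensorProduct.mk K V K).flip 1)
    (counit_one : D.counit D.one = 1)
    (counit_mul : ∀ x y, D.counit (D.mul x y) = D.counit x * D.counit y)
    (comul_one : D.comul D.one = D.one ⊗ₜ[K] D.one)
    (comul_mul : ∀ x y, D.comul (D.mul x y) =
      TensorProduct.map₂ D.mul D.mul (D.comul x) (D.comul y))
    (F : ℕ → Submodule K V) (hmono : Monotone F) (hF : ∀ x, ∃ n, x ∈ F n)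
    (h0 : ∀ x ∈ F 0, x = D.counit x • D.one)
    (hstep : ∀ n, ∀ x ∈ F (n + 1), ∃ z : V ⊗[K] F n,
      D.comul x = D.one ⊗ₜ[K] x + TensorProduct.map LinearMap.id (F n).subtype z) :
    D.IsHopf := by
  refine ⟨mul_assoc, mul_comm, one_mul, coassoc, rTensor_counit, lTensor_counit, counit_one,
    counit_mul, comul_one, comul_mul, ?_⟩
  let _ : CommRing V :=
    { (inferInstance : AddCommGroup V) with
      mul := fun x y => D.mul x y
      one := D.one
      mul_assoc := mul_assoc
      mul_comm := mul_comm
      one_mul := one_mul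
      mul_one := fun x => (mul_comm _ _).trans (one_mul x)
      left_distrib := fun x y z => (D.mul x).map_add y z
      right_distrib := fun x y z => D.mul.map_add₂ x y z
      zero_mul := fun x => D.mul.map_zero₂ x
      mul_zero := fun x => (D.mul x).map_zero }
  let _ : Algebra K V :=
    Algebra.ofModule (fun r x y => D.mul.map_smul₂ r x y) (fun r x y => (D.mul x).map_smul r y)
  let _ : Coalgebra K V :=
    { comul := D.comul
      counit := D.counit
      coassoc := coassoc
      rTensor_counit_comp_comul := rTensor_counit
      lTensor_counit_comp_comul := lTensor_counit }
  have ha : ∀ r : K, algebraMap K V r = r • D.one := fun r => Algebra.algebraMap_eq_smul_one r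
  have hl : ∀ z : V ⊗[K] V, LinearMap.mul' K V z = TensorProduct.lift D.mul z := by
    intro z
    induction z using TensorProduct.induction_on with
    | zero => simp
    | add a b ha hb => simp only [map_add, ha, hb]
    | tmul a b => rfl
  obtain ⟨S, h1, h2⟩ := exists_convInverse_of_filtration (K := K) (H := V) F hmono hF counit_one
    (fun x hx => (h0 x hx).trans (ha _).symm) hstep
  refine ⟨S.ofConv, fun x => ?_, fun x => ?_⟩
  · rw [← ha, ← hl]
    exact LinearMap.congr_fun (congrArg WithConv.ofConv h1) x
  · rw [← ha, ← hl]
    exact LinearMap.congr_fun (congrArg WithConv.ofConv h2) x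

end PreHopf

/-! ### Commutativity and associativity of the quasi-shuffle product. -/

namespace QuasiShuffle

variable (K : Type*) {A : Type*} [Field K]

/-- Prepending a letter to all words. -/
noncomputable def consL (a : A) : (List A →₀ K) →ₗ[K] (List A →₀ K) :=
  Finsupp.lmapDomain K K (List.cons a)

/-- Prepending a letter or zero to all words. -/
noncomputable def consO (o : Option A) : (List A →₀ K) →ₗ[K] (List A →₀ K) :=
  o.elim 0 (consL K)

@[simp] theorem consL_single (a : A) (w : List A) (r : K) :
    consL K a (Finsupp.single w r) = Finsupp.single (a :: w) r := by
  simp [consL]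

@[simp] theorem consO_some (a : A) : consO K (some a) = consL K a := rfl
@[simp] theorem consO_none : consO K (none : Option A) = 0 := rfl

variable {K}

theorem ext_words {V : Type*} [AddCommGroup V] [Module K V] {f g : (List A →₀ K) →ₗ[K] V}
    (h : ∀ w, f (Finsupp.single w 1) = g (Finsupp.single w 1)) : f = g :=
  Finsupp.lhom_ext' fun w => LinearMap.ext_ring (h w)

@[elab_as_elim]
theorem induction_words {P : (List A →₀ K) → Prop} (x : List A →₀ K) (zero : P 0)
    (add : ∀ f g, P f → P g → P (f + g)) (smul : ∀ (r : K) f, P f → P (r • f))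
    (single : ∀ w, P (Finsupp.single w 1)) : P x := by
  induction x using Finsupp.induction_linear with
  | zero => exact zero
  | add f g hf hg => exact add f g hf hg
  | single w r =>
    rw [← mul_one r, ← smul_eq_mul, ← Finsupp.smul_single]
    exact smul r _ (single w)

variable {deg : A → ℕ} (p : HoffmanPairing A deg)

theorem mul_single (u v : List A) :
    (quasiShuffleHopf K p).mul (Finsupp.single u 1) (Finsupp.single v 1) =
      quasiShuffle K p.pair u v := by
  simp [quasiShuffleHopf]

theorem nil_mul (x : List A →₀ K) :
    (quasiShuffleHopf K p).mul (Finsupp.single [] 1) x = x := by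
  induction x using Finsupp.induction_linear with
  | zero => simp
  | add f g hf hg => simp only [map_add, hf, hg]
  | single w r =>
    rw [← mul_one r, ← smul_eq_mul, ← Finsupp.smul_single, map_smul, mul_single, quasiShuffle]

theorem mul_nil (x : List A →₀ K) :
    (quasiShuffleHopf K p).mul x (Finsupp.single [] 1) = x := by
  induction x using Finsupp.induction_linear with
  | zero => simp
  | add f g hf hg => simp only [map_add, LinearMap.add_apply, hf, hg]
  | single w r =>
    rw [← mul_one r, ← smul_eq_mul, ← Finsupp.smul_single, map_smul, LinearMap.smul_apply,
      mul_single]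
    cases w <;> simp [quasiShuffle]

theorem mul_consL_consL (a b : A) (x y : List A →₀ K) :
    (quasiShuffleHopf K p).mul (consL K a x) (consL K b y) =
      consL K a ((quasiShuffleHopf K p).mul x (consL K b y)) +
      consL K b ((quasiShuffleHopf K p).mul (consL K a x) y) +
      consO K (p.pair (some a) (some b)) ((quasiShuffleHopf K p).mul x y) := by
  induction x using Finsupp.induction_linear with
  | zero => simp
  | add f g hf hg => simp only [map_add, LinearMap.add_apply, hf, hg]; abel
  | single u r =>
    induction y using Finsupp.induction_linear with
    | zero => simp
    | add f g hf hg => simp only [map_add, hf, hg]; abel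
    | single v s =>
      rw [← mul_one r, ← smul_eq_mul, ← Finsupp.smul_single,
        ← mul_one s, ← smul_eq_mul, ← Finsupp.smul_single]
      simp only [map_smul, LinearMap.smul_apply, consL_single, mul_single, ← smul_add]
      rw [quasiShuffle]
      congr 3
      cases p.pair (some a) (some b) <;> rfl

/-- Extends the recursion to a first letter that may be zero, so that iterated pairings need no
distinction of whether they vanish. -/
theorem mul_consO_consL (o : Option A) (b : A) (x y : List A →₀ K) :
    (quasiShuffleHopf K p).mul (consO K o x) (consL K b y) =
      consO K o ((quasiShuffleHopf K p).mul x (consL K b y)) +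
      consL K b ((quasiShuffleHopf K p).mul (consO K o x) y) +
      consO K (p.pair o (some b)) ((quasiShuffleHopf K p).mul x y) := by
  cases o with
  | none => simp [p.pair_comm none, p.pair_none]
  | some a => exact mul_consL_consL p a b x y

theorem mul_consL_consO (a : A) (o : Option A) (x y : List A →₀ K) :
    (quasiShuffleHopf K p).mul (consL K a x) (consO K o y) =
      consL K a ((quasiShuffleHopf K p).mul x (consO K o y)) +
      consO K o ((quasiShuffleHopf K p).mul (consL K a x) y) +
      consO K (p.pair (some a) o) ((quasiShuffleHopf K p).mul x y) := by
  cases o with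
  | none => simp [p.pair_none]
  | some b => exact mul_consL_consL p a b x y

theorem quasiShuffle_comm (u v : List A) :
    quasiShuffle K p.pair u v = quasiShuffle K p.pair v u := by
  fun_induction quasiShuffle K p.pair u v with
  | case1 w => cases w <;> simp [quasiShuffle]
  | case2 a u => simp [quasiShuffle]
  | case3 a u b v h1 h2 h3 =>
    rw [quasiShuffle, h1, h2, h3, p.pair_comm (some b)]
    abel

theorem mul_comm (x y : List A →₀ K) :
    (quasiShuffleHopf K p).mul x y = (quasiShuffleHopf K p).mul y x := by
  have : (quasiShuffleHopf K p).mul = (quasiShuffleHopf K p).mul.flip := by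
    refine ext_words fun u => ext_words fun v => ?_
    rw [LinearMap.flip_apply, mul_single, mul_single, quasiShuffle_comm]
  exact LinearMap.congr_fun (LinearMap.congr_fun this x) y

/-- Induction on the total length. The first letter of a term of the triple product arises from a
nonempty subset of the three first letters by pairing; the seven induction hypotheses match the
seven subsets, and associativity of the pairing handles the case of all three letters. -/
theorem mul_assoc_words (n : ℕ) : ∀ u v w : List A, u.length + v.length + w.length ≤ n →
    (quasiShuffleHopf K p).mul ((quasiShuffleHopf K p).mul (Finsupp.single u 1)
      (Finsupp.single v 1)) (Finsupp.single w 1) =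
    (quasiShuffleHopf K p).mul (Finsupp.single u 1) ((quasiShuffleHopf K p).mul
      (Finsupp.single v 1) (Finsupp.single w 1)) := by
  induction n with
  | zero =>
    intro u v w h
    have hu : u = [] := List.length_eq_zero_iff.1 (by omega)
    rw [hu, nil_mul, nil_mul]
  | succ n ih =>
    intro u v w h
    rcases u with _ | ⟨a, u⟩
    · rw [nil_mul, nil_mul]
    rcases v with _ | ⟨b, v⟩
    · rw [nil_mul, mul_nil]
    rcases w with _ | ⟨c, w⟩
    · rw [mul_nil, mul_nil]
    simp only [List.length_cons] at h
    have i1 := ih u (b :: v) (c :: w) (by simp only [List.length_cons]; omega)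
    have i2 := ih (a :: u) v (c :: w) (by simp only [List.length_cons]; omega)
    have i3 := ih (a :: u) (b :: v) w (by simp only [List.length_cons]; omega)
    have i4 := ih u v (c :: w) (by simp only [List.length_cons]; omega)
    have i5 := ih u (b :: v) w (by simp only [List.length_cons]; omega)
    have i6 := ih (a :: u) v w (by simp only [List.length_cons]; omega)
    have i7 := ih u v w (by omega)
    simp only [← consL_single] at i1 i2 i3 i4 i5 i6 ⊢
    generalize Finsupp.single u (1 : K) = x at *
    generalize Finsupp.single v (1 : K) = y at *
    generalize Finsupp.single w (1 : K) = z at *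
    -- The terms beginning with `c`, and in `e2` those beginning with `a`, contain products that the
    -- expansion of the goal also expands. These two instances of the induction hypothesis are
    -- therefore expanded alongside it.
    have e1 : consL K c ((quasiShuffleHopf K p).mul
        ((quasiShuffleHopf K p).mul (consL K a x) (consL K b y)) z) =
        consL K c ((quasiShuffleHopf K p).mul (consL K a x)
          ((quasiShuffleHopf K p).mul (consL K b y) z)) := by rw [i3]
    have e2 : consL K a ((quasiShuffleHopf K p).mul
        ((quasiShuffleHopf K p).mul x (consL K b y)) (consL K c z)) =
        consL K a ((quasiShuffleHopf K p).mul x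
          ((quasiShuffleHopf K p).mul (consL K b y) (consL K c z))) := by rw [i1]
    rw [mul_consL_consL p a b] at e1 ⊢
    rw [mul_consL_consL p b c] at e2 ⊢
    simp only [map_add, LinearMap.add_apply, mul_consL_consL, mul_consO_consL, mul_consL_consO,
      i2, i4, i5, i6, i7, p.pair_assoc] at e1 e2 ⊢
    linear_combination (norm := module) e1 + e2

theorem mul_assoc (x y z : List A →₀ K) :
    (quasiShuffleHopf K p).mul ((quasiShuffleHopf K p).mul x y) z =
      (quasiShuffleHopf K p).mul x ((quasiShuffleHopf K p).mul y z) := by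
  induction x using induction_words with
  | zero => simp
  | add f g hf hg => simp only [map_add, LinearMap.add_apply, hf, hg]
  | smul r f hf => simp only [map_smul, LinearMap.smul_apply, hf]
  | single u =>
  induction y using induction_words with
  | zero => simp
  | add f g hf hg => simp only [map_add, LinearMap.add_apply, hf, hg]
  | smul r f hf => simp only [map_smul, LinearMap.smul_apply, hf]
  | single v =>
  induction z using induction_words with
  | zero => simp
  | add f g hf hg => simp only [map_add, hf, hg]
  | smul r f hf => simp only [map_smul, hf]
  | single w => exact mul_assoc_words p _ u v w le_rfl

end QuasiShuffle

/-! ### Hopf algebras with a size function on a basis. -/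

namespace PreHopf

variable {K ι : Type*} [Field K]

/-- A commutative bialgebra with a basis and a suitable size function on the basis is a Hopf
algebra. -/
theorem isHopf_of_size (D : PreHopf K (ι →₀ K))
    (mul_assoc : ∀ x y z, D.mul (D.mul x y) z = D.mul x (D.mul y z))
    (mul_comm : ∀ x y, D.mul x y = D.mul y x)
    (one_mul : ∀ x, D.mul D.one x = x)
    (coassoc : (TensorProduct.assoc K _ _ _).toLinearMap ∘ₗ D.comul.rTensor _ ∘ₗ D.comul =
      D.comul.lTensor _ ∘ₗ D.comul)
    (rTensor_counit : D.counit.rTensor _ ∘ₗ D.comul = TensorProduct.mk K K _ 1)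
    (lTensor_counit : D.counit.lTensor _ ∘ₗ D.comul = (TensorProduct.mk K _ K).flip 1)
    (counit_one : D.counit D.one = 1)
    (counit_mul : ∀ x y, D.counit (D.mul x y) = D.counit x * D.counit y)
    (comul_one : D.comul D.one = D.one ⊗ₜ[K] D.one)
    (comul_mul : ∀ x y, D.comul (D.mul x y) =
      TensorProduct.map₂ D.mul D.mul (D.comul x) (D.comul y))
    (size : ι → ℕ) (h0 : ∀ i, size i = 0 → Finsupp.single i 1 = D.one)
    (hstep : ∀ i, ∃ z ∈ Submodule.span K {t | ∃ j k, size k < size i ∧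
        t = Finsupp.single j (1 : K) ⊗ₜ[K] Finsupp.single k (1 : K)},
      D.comul (Finsupp.single i 1) = D.one ⊗ₜ[K] Finsupp.single i 1 + z) :
    D.IsHopf := by
  let F : ℕ → Submodule K (ι →₀ K) := fun n =>
    Submodule.span K {x | ∃ i, size i ≤ n ∧ x = Finsupp.single i 1}
  have hmono : Monotone F := fun m n hmn => Submodule.span_mono
    (by rintro x ⟨i, hi, rfl⟩; exact ⟨i, hi.trans hmn, rfl⟩)
  refine isHopf_of_filtration D mul_assoc mul_comm one_mul coassoc rTensor_counit lTensor_counit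
    counit_one counit_mul comul_one comul_mul F hmono ?_ ?_ ?_
  · intro x
    induction x using Finsupp.induction_linear with
    | zero => exact ⟨0, zero_mem _⟩
    | add f g hf hg =>
      obtain ⟨m, hm⟩ := hf
      obtain ⟨n, hn⟩ := hg
      exact ⟨max m n, add_mem (hmono (le_max_left _ _) hm) (hmono (le_max_right _ _) hn)⟩
    | single i r =>
      refine ⟨size i, ?_⟩
      rw [← mul_one r, ← smul_eq_mul, ← Finsupp.smul_single]
      exact Submodule.smul_mem _ _ (Submodule.subset_span ⟨i, le_rfl, rfl⟩)
  · intro x hx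
    induction hx using Submodule.span_induction with
    | mem x hx =>
      obtain ⟨i, hi, rfl⟩ := hx
      rw [h0 i (by omega), counit_one, one_smul]
    | zero => simp
    | add x y _ _ hx hy => rw [map_add, add_smul, ← hx, ← hy]
    | smul r x _ hx => rw [map_smul, smul_assoc, ← hx]
  · intro n x hx
    induction hx using Submodule.span_induction with
    | mem x hx =>
      obtain ⟨i, hi, rfl⟩ := hx
      obtain ⟨z, hz, hz'⟩ := hstep i
      suffices h : z ∈ LinearMap.range (TensorProduct.map LinearMap.id (F n).subtype) by
        obtain ⟨y, rfl⟩ := h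
        exact ⟨y, hz'⟩
      refine Submodule.span_le.2 ?_ hz
      rintro t ⟨j, k, hk, rfl⟩
      exact ⟨Finsupp.single j 1 ⊗ₜ ⟨Finsupp.single k 1,
        Submodule.subset_span ⟨k, by omega, rfl⟩⟩, rfl⟩
    | zero => exact ⟨0, by simp⟩
    | add x y _ _ hx hy =>
      obtain ⟨z, hz⟩ := hx
      obtain ⟨z', hz'⟩ := hy
      refine ⟨z + z', ?_⟩
      rw [map_add, hz, hz', TensorProduct.tmul_add, map_add]
      exact add_add_add_comm _ _ _ _
    | smul r x _ hx =>
      obtain ⟨z, hz⟩ := hx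
      exact ⟨r • z, by rw [map_smul, hz, TensorProduct.tmul_smul, map_smul, smul_add]⟩

end PreHopf

/-! ### The deconcatenation coalgebra. -/

namespace QuasiShuffle

variable {K : Type*} {A : Type*} [Field K] {deg : A → ℕ} (p : HoffmanPairing A deg)

theorem one_def : (quasiShuffleHopf K p).one = Finsupp.single [] 1 := rfl

theorem comul_single (w : List A) : (quasiShuffleHopf K p).comul (Finsupp.single w 1) =
    ∑ i ∈ Finset.range (w.length + 1),
      Finsupp.single (w.take i) 1 ⊗ₜ[K] Finsupp.single (w.drop i) 1 := by
  simp [quasiShuffleHopf]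

theorem comul_nil : (quasiShuffleHopf K p).comul (Finsupp.single [] 1) =
    Finsupp.single [] 1 ⊗ₜ[K] Finsupp.single [] 1 := by
  simp [comul_single]

/-- The only place to cut `a w` that does not come from a cut of `w` is in front of `a`. This
identity replaces the sum over positions in the later inductions. -/
theorem comul_consL (a : A) (x : List A →₀ K) :
    (quasiShuffleHopf K p).comul (consL K a x) = Finsupp.single [] 1 ⊗ₜ[K] consL K a x +
      (consL K a).rTensor _ ((quasiShuffleHopf K p).comul x) := by
  induction x using induction_words with
  | zero => simp
  | add f g hf hg => simp only [map_add, hf, hg, TensorProduct.tmul_add]; abel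
  | smul r f hf => simp only [map_smul, hf, TensorProduct.tmul_smul, smul_add]
  | single w =>
    rw [consL_single, comul_single, comul_single, List.length_cons, Finset.sum_range_succ', map_sum,
      add_comm]
    simp

theorem counit_nil : (quasiShuffleHopf K p).counit (Finsupp.single [] 1) = 1 := by
  simp [quasiShuffleHopf]

theorem counit_consL (a : A) (x : List A →₀ K) :
    (quasiShuffleHopf K p).counit (consL K a x) = 0 := by
  induction x using induction_words with
  | zero => simp
  | add f g hf hg => simp only [map_add, hf, hg, add_zero]
  | smul r f hf => simp only [map_smul, hf, smul_zero]
  | single w => simp [quasiShuffleHopf]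

theorem counit_consO (o : Option A) (x : List A →₀ K) :
    (quasiShuffleHopf K p).counit (consO K o x) = 0 := by
  cases o with
  | none => simp
  | some a => exact counit_consL p a x

theorem comul_consO (o : Option A) (x : List A →₀ K) :
    (quasiShuffleHopf K p).comul (consO K o x) = Finsupp.single [] 1 ⊗ₜ[K] consO K o x +
      (consO K o).rTensor _ ((quasiShuffleHopf K p).comul x) := by
  cases o with
  | none => simp
  | some a => exact comul_consL p a x

/-- Words are generated by the empty word and the prepending of letters. -/
@[elab_as_elim]
theorem induction_consL {P : (List A →₀ K) → Prop} (x : List A →₀ K) (zero : P 0)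
    (add : ∀ f g, P f → P g → P (f + g)) (smul : ∀ (r : K) f, P f → P (r • f))
    (nil : P (Finsupp.single [] 1)) (consL : ∀ a f, P f → P (consL K a f)) : P x := by
  induction x using induction_words with
  | zero => exact zero
  | add f g hf hg => exact add f g hf hg
  | smul r f hf => exact smul r f hf
  | single w =>
    induction w with
    | nil => exact nil
    | cons a w ih => rw [← consL_single]; exact consL a _ ih

theorem coassoc : (TensorProduct.assoc K _ _ _).toLinearMap ∘ₗ
      (quasiShuffleHopf K p).comul.rTensor _ ∘ₗ (quasiShuffleHopf K p).comul =
    (quasiShuffleHopf K p).comul.lTensor _ ∘ₗ (quasiShuffleHopf K p).comul := by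
  refine LinearMap.ext fun x => ?_
  simp only [LinearMap.comp_apply, LinearEquiv.coe_coe]
  induction x using induction_consL with
  | zero => simp
  | add f g hf hg => simp only [map_add, hf, hg]
  | smul r f hf => simp only [map_smul, hf]
  | nil => simp [comul_nil]
  | consL a f hf =>
    have h : ∀ y : (List A →₀ K) ⊗[K] (List A →₀ K),
        TensorProduct.assoc K _ _ _ ((quasiShuffleHopf K p).comul.rTensor _
          ((consL K a).rTensor _ y)) = Finsupp.single [] 1 ⊗ₜ[K] (consL K a).rTensor _ y +
        (consL K a).rTensor _ (TensorProduct.assoc K _ _ _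
          ((quasiShuffleHopf K p).comul.rTensor _ y)) := by
      intro y
      induction y using TensorProduct.induction_on with
      | zero => simp
      | add y z hy hz => simp only [map_add, hy, hz, TensorProduct.tmul_add]; abel
      | tmul y z =>
        simp only [LinearMap.rTensor_tmul, comul_consL, TensorProduct.add_tmul, map_add,
          TensorProduct.assoc_tmul]
        congr 1
        generalize (quasiShuffleHopf K p).comul y = t
        induction t using TensorProduct.induction_on with
        | zero => simp
        | add s t hs ht => simp only [map_add, hs, ht, TensorProduct.add_tmul]
        | tmul s t => simp
    have h' : ∀ y : (List A →₀ K) ⊗[K] (List A →₀ K),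
        (quasiShuffleHopf K p).comul.lTensor _ ((consL K a).rTensor _ y) =
        (consL K a).rTensor _ ((quasiShuffleHopf K p).comul.lTensor _ y) := by
      intro y
      induction y using TensorProduct.induction_on with
      | zero => simp
      | add y z hy hz => simp only [map_add, hy, hz]
      | tmul y z => simp
    rw [comul_consL, map_add, map_add, map_add, h, hf, h', LinearMap.lTensor_tmul, comul_consL]
    simp [comul_nil, TensorProduct.tmul_add, add_assoc]

theorem rTensor_counit : (quasiShuffleHopf K p).counit.rTensor _ ∘ₗ (quasiShuffleHopf K p).comul =
    TensorProduct.mk K K _ 1 := by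
  refine LinearMap.ext fun x => ?_
  simp only [LinearMap.comp_apply, TensorProduct.mk_apply]
  induction x using induction_consL with
  | zero => simp
  | add f g hf hg => simp only [map_add, hf, hg, TensorProduct.tmul_add]
  | smul r f hf => simp only [map_smul, hf, TensorProduct.tmul_smul]
  | nil => simp [comul_nil, counit_nil]
  | consL a f hf =>
    have h : (quasiShuffleHopf K p).counit ∘ₗ consL K a = 0 := by
      exact LinearMap.ext fun x => counit_consL p a x
    rw [comul_consL, map_add, ← LinearMap.rTensor_comp_apply, h]
    simp [counit_nil]

theorem lTensor_counit : (quasiShuffleHopf K p).counit.lTensor _ ∘ₗ (quasiShuffleHopf K p).comul =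
    (TensorProduct.mk K _ K).flip 1 := by
  refine LinearMap.ext fun x => ?_
  simp only [LinearMap.comp_apply, TensorProduct.mk_apply, LinearMap.flip_apply]
  induction x using induction_consL with
  | zero => simp
  | add f g hf hg => simp only [map_add, hf, hg, TensorProduct.add_tmul]
  | smul r f hf => simp only [map_smul, hf, TensorProduct.smul_tmul']
  | nil => simp [comul_nil, counit_nil]
  | consL a f hf =>
    have h : (quasiShuffleHopf K p).counit.lTensor _
        ((consL K a).rTensor _ ((quasiShuffleHopf K p).comul f)) =
        (consL K a).rTensor _ ((quasiShuffleHopf K p).counit.lTensor _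
          ((quasiShuffleHopf K p).comul f)) :=
      LinearMap.congr_fun ((LinearMap.lTensor_comp_rTensor ..).trans
        (LinearMap.rTensor_comp_lTensor ..).symm) _
    rw [comul_consL, map_add, h, hf]
    simp [counit_consL]

theorem counit_mul (x y : List A →₀ K) : (quasiShuffleHopf K p).counit
    ((quasiShuffleHopf K p).mul x y) =
      (quasiShuffleHopf K p).counit x * (quasiShuffleHopf K p).counit y := by
  induction x using induction_consL with
  | zero => simp
  | add f g hf hg => simp only [map_add, LinearMap.add_apply, hf, hg, add_mul]
  | smul r f hf => simp only [map_smul, LinearMap.smul_apply, hf, smul_eq_mul, _root_.mul_assoc]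
  | nil => rw [nil_mul, counit_nil, one_mul]
  | consL a f hf =>
    clear hf
    induction y using induction_consL with
    | zero => simp
    | add f g hf hg => simp only [map_add, hf, hg, mul_add]
    | smul r f hf => simp only [map_smul, hf, smul_eq_mul, mul_left_comm]
    | nil => rw [mul_nil, counit_nil, mul_one]
    | consL b g hg => simp [mul_consL_consL, counit_consL, counit_consO]

end QuasiShuffle

/-! ### Compatibility of the quasi-shuffle product with deconcatenation. -/

namespace QuasiShuffle

variable {K : Type*} {A : Type*} [Field K] {deg : A → ℕ} (p : HoffmanPairing A deg)

/-- The product of the tensor square of the quasi-shuffle algebra. -/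
noncomputable abbrev mul₂ : (List A →₀ K) ⊗[K] (List A →₀ K) →ₗ[K]
    (List A →₀ K) ⊗[K] (List A →₀ K) →ₗ[K] (List A →₀ K) ⊗[K] (List A →₀ K) :=
  TensorProduct.map₂ (quasiShuffleHopf K p).mul (quasiShuffleHopf K p).mul

theorem mul₂_one_tmul (x y : List A →₀ K) :
    mul₂ p (Finsupp.single [] 1 ⊗ₜ[K] x) (Finsupp.single [] 1 ⊗ₜ[K] y) =
      Finsupp.single [] 1 ⊗ₜ[K] (quasiShuffleHopf K p).mul x y := by
  simp [nil_mul]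

theorem map₂_one_left (x : List A →₀ K) (Y : (List A →₀ K) ⊗[K] (List A →₀ K)) (c : A) :
    mul₂ p (Finsupp.single [] 1 ⊗ₜ[K] x) ((consL K c).rTensor _ Y) =
      (consL K c).rTensor _ (mul₂ p (Finsupp.single [] 1 ⊗ₜ[K] x) Y) := by
  induction Y using TensorProduct.induction_on with
  | zero => simp
  | add y z hy hz => simp only [map_add, hy, hz]
  | tmul y z => simp [nil_mul]

theorem map₂_one_right (X : (List A →₀ K) ⊗[K] (List A →₀ K)) (y : List A →₀ K) (c : A) :
    mul₂ p ((consL K c).rTensor _ X) (Finsupp.single [] 1 ⊗ₜ[K] y) =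
      (consL K c).rTensor _ (mul₂ p X (Finsupp.single [] 1 ⊗ₜ[K] y)) := by
  induction X using TensorProduct.induction_on with
  | zero => simp
  | add y z hy hz => simp only [map_add, LinearMap.add_apply, hy, hz]
  | tmul y z => simp [mul_nil]

/-- The product of the tensor square obeys the quasi-shuffle recursion in its first factor, so
compatibility with the coproduct follows by the same induction that defines the product. -/
theorem map₂_consL (X Y : (List A →₀ K) ⊗[K] (List A →₀ K)) (a b : A) :
    mul₂ p ((consL K a).rTensor _ X) ((consL K b).rTensor _ Y) =
      (consL K a).rTensor _ (mul₂ p X ((consL K b).rTensor _ Y)) +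
      (consL K b).rTensor _ (mul₂ p ((consL K a).rTensor _ X) Y) +
      (consO K (p.pair (some a) (some b))).rTensor _ (mul₂ p X Y) := by
  induction X using TensorProduct.induction_on with
  | zero => simp
  | add y z hy hz => simp only [map_add, LinearMap.add_apply, hy, hz]; abel
  | tmul x x' =>
    induction Y using TensorProduct.induction_on with
    | zero => simp
    | add y z hy hz => simp only [map_add, hy, hz]; abel
    | tmul y z => simp [mul_consL_consL, TensorProduct.add_tmul]

theorem map₂_one (X : (List A →₀ K) ⊗[K] (List A →₀ K)) :
    mul₂ p (Finsupp.single [] 1 ⊗ₜ[K] Finsupp.single [] 1) X = X := by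
  induction X using TensorProduct.induction_on with
  | zero => simp
  | add y z hy hz => simp only [map_add, hy, hz]
  | tmul x x' => simp [nil_mul]

theorem map₂_one' (X : (List A →₀ K) ⊗[K] (List A →₀ K)) :
    mul₂ p X (Finsupp.single [] 1 ⊗ₜ[K] Finsupp.single [] 1) = X := by
  induction X using TensorProduct.induction_on with
  | zero => simp
  | add y z hy hz => simp only [map_add, LinearMap.add_apply, hy, hz]
  | tmul x x' => simp [mul_nil]

theorem comul_mul_words (n : ℕ) : ∀ u v : List A, u.length + v.length ≤ n →
    (quasiShuffleHopf K p).comul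
      ((quasiShuffleHopf K p).mul (Finsupp.single u 1) (Finsupp.single v 1)) =
    mul₂ p ((quasiShuffleHopf K p).comul (Finsupp.single u 1))
      ((quasiShuffleHopf K p).comul (Finsupp.single v 1)) := by
  induction n with
  | zero =>
    intro u v h
    have hu : u = [] := List.length_eq_zero_iff.1 (by omega)
    rw [hu, nil_mul, comul_nil, map₂_one]
  | succ n ih =>
    intro u v h
    rcases u with _ | ⟨a, u⟩
    · rw [nil_mul, comul_nil, map₂_one]
    rcases v with _ | ⟨b, v⟩
    · rw [mul_nil, comul_nil, map₂_one']
    simp only [List.length_cons] at h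
    have i1 := ih u (b :: v) (by simp only [List.length_cons]; omega)
    have i2 := ih (a :: u) v (by simp only [List.length_cons]; omega)
    have i3 := ih u v (by omega)
    simp only [← consL_single] at i1 i2 ⊢
    generalize Finsupp.single u (1 : K) = x at *
    generalize Finsupp.single v (1 : K) = y at *
    simp only [mul_consL_consL, map_add, comul_consL, comul_consO, i1, i2, i3,
      LinearMap.add_apply, map₂_consL, map₂_one_left, map₂_one_right, TensorProduct.tmul_add,
      mul₂_one_tmul]
    abel

theorem comul_mul (x y : List A →₀ K) :
    (quasiShuffleHopf K p).comul ((quasiShuffleHopf K p).mul x y) =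
      mul₂ p ((quasiShuffleHopf K p).comul x) ((quasiShuffleHopf K p).comul y) := by
  induction x using induction_words with
  | zero => simp
  | add f g hf hg => simp only [map_add, LinearMap.add_apply, hf, hg]
  | smul r f hf => simp only [map_smul, LinearMap.smul_apply, hf]
  | single u =>
  induction y using induction_words with
  | zero => simp
  | add f g hf hg => simp only [map_add, hf, hg]
  | smul r f hf => simp only [map_smul, hf]
  | single v => exact comul_mul_words p _ u v le_rfl

instance isHopf : (quasiShuffleHopf K p).IsHopf := by
  refine PreHopf.isHopf_of_size _ (mul_assoc p) (mul_comm p) (nil_mul p) (coassoc p)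
    (rTensor_counit p) (lTensor_counit p) (counit_nil p) (counit_mul p) (comul_nil p)
    (comul_mul p) List.length ?_ ?_
  · intro w hw
    rw [List.length_eq_zero_iff.1 hw, one_def]
  · intro w
    -- The cut at position `0` is the term `1 ⊗ w`; all other cuts leave a shorter second factor.
    rw [comul_single, Finset.sum_range_succ']
    refine ⟨_, ?_, add_comm _ _⟩
    refine Submodule.sum_mem _ fun i hi => Submodule.subset_span
      ⟨w.take (i + 1), w.drop (i + 1), ?_, rfl⟩
    have := Finset.mem_range.1 hi
    simp only [List.length_drop]
    omega

end QuasiShuffle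

/-! ### Words as a cofree coalgebra. -/

namespace QuasiShuffle

variable {K : Type*} {A : Type*} [Field K] {deg : A → ℕ} (p : HoffmanPairing A deg)

theorem ext_coeff₂ {y z : (List A →₀ K) ⊗[K] (List A →₀ K)}
    (h : ∀ u v, LinearMap.mul' K K (TensorProduct.map (Finsupp.lapply u) (Finsupp.lapply v) y) =
      LinearMap.mul' K K (TensorProduct.map (Finsupp.lapply u) (Finsupp.lapply v) z)) : y = z := by
  have key : ∀ (y : (List A →₀ K) ⊗[K] (List A →₀ K)) (u v : List A),
      finsuppTensorFinsupp' K (List A) (List A) y (u, v) =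
        LinearMap.mul' K K (TensorProduct.map (Finsupp.lapply u) (Finsupp.lapply v) y) := by
    intro y u v
    induction y using TensorProduct.induction_on with
    | zero => simp
    | add a b ha hb => simp only [map_add, Finsupp.add_apply, ha, hb]
    | tmul a b => simp
  apply (finsuppTensorFinsupp' K (List A) (List A)).injective
  ext ⟨u, v⟩
  rw [key, key, h]

theorem lapply_nil_consL (a : A) : Finsupp.lapply [] ∘ₗ consL K a = 0 :=
  ext_words fun w => by simp

open Classical in
theorem lapply_cons_consL (a b : A) (w : List A) : Finsupp.lapply (a :: w) ∘ₗ consL K b =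
    if a = b then Finsupp.lapply w else (0 : (List A →₀ K) →ₗ[K] K) :=
  ext_words fun v => by
    by_cases h : a = b
    · subst h; simp [Finsupp.single_apply]
    · simp [h]

theorem counit_apply (x : List A →₀ K) : (quasiShuffleHopf K p).counit x = x [] := by
  have : (quasiShuffleHopf K p).counit = Finsupp.lapply [] := ext_words fun w => by
    classical simp [quasiShuffleHopf, Finsupp.single_apply]
  rw [this]
  rfl

/-- Deconcatenation is dual to concatenation. Compatibility of a map with coproducts thus becomes
multiplicativity of its coefficients under convolution. -/
theorem coeff_comul (u v : List A) (x : List A →₀ K) :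
    LinearMap.mul' K K (TensorProduct.map (Finsupp.lapply u) (Finsupp.lapply v)
      ((quasiShuffleHopf K p).comul x)) = x (u ++ v) := by
  classical
  induction u generalizing x with
  | nil =>
    induction x using induction_consL with
    | zero => simp
    | add f g hf hg => simp only [map_add, hf, hg, Finsupp.add_apply]
    | smul r f hf => simp only [map_smul, hf, Finsupp.smul_apply]
    | nil => simp [comul_nil]
    | consL a f hf =>
      rw [comul_consL, map_add, map_add, LinearMap.map_rTensor, lapply_nil_consL]
      simp
  | cons a u ih =>
    induction x using induction_consL with
    | zero => simp
    | add f g hf hg => simp only [map_add, hf, hg, Finsupp.add_apply]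
    | smul r f hf => simp only [map_smul, hf, Finsupp.smul_apply]
    | nil => simp [comul_nil]
    | consL b f hf =>
      have h := LinearMap.congr_fun (lapply_cons_consL (K := K) a b (u ++ v)) f
      rw [comul_consL, map_add, map_add, LinearMap.map_rTensor, lapply_cons_consL]
      simp only [LinearMap.comp_apply, Finsupp.lapply_apply] at h
      rw [List.cons_append, h]
      split_ifs
      · rw [ih]; simp
      · simp

section Coalgebra

open Coalgebra WithConv

variable {C : Type*} [AddCommGroup C] [Module K C] [Coalgebra K C]

/-- The coefficient of a word. -/
noncomputable def coeff (w : List A) : (quasiShuffleHopf K p).Carrier →ₗ[K] K :=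
  Finsupp.lapply (M := K) (R := K) w

theorem coeff_comul' (u v : List A) (x : (quasiShuffleHopf K p).Carrier) :
    LinearMap.mul' K K (TensorProduct.map (coeff p u) (coeff p v) (comul x)) =
      coeff p (u ++ v) x :=
  coeff_comul p u v x

theorem ext_coeff₂' {y z : (quasiShuffleHopf K p).Carrier ⊗[K] (quasiShuffleHopf K p).Carrier}
    (h : ∀ u v, LinearMap.mul' K K (TensorProduct.map (coeff p u) (coeff p v) y) =
      LinearMap.mul' K K (TensorProduct.map (coeff p u) (coeff p v) z)) : y = z :=
  ext_coeff₂ (K := K) h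

/-- A linear map to the quasi-shuffle Hopf algebra is a morphism of coalgebras if its coefficients
are the convolution products of linear forms attached to letters. -/
theorem comul_eq_of_coeff (f : C →ₗ[K] (quasiShuffleHopf K p).Carrier)
    (h0 : coeff p [] ∘ₗ f = counit)
    (h1 : ∀ a, ∃ q : C →ₗ[K] K, ∀ w, coeff p (a :: w) ∘ₗ f =
      LinearMap.mul' K K ∘ₗ TensorProduct.map q (coeff p w ∘ₗ f) ∘ₗ comul) :
    TensorProduct.map f f ∘ₗ comul = comul ∘ₗ f := by
  choose q hq using h1
  let c : List A → WithConv (C →ₗ[K] K) := fun w => toConv (coeff p w ∘ₗ f)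
  have hc0 : c [] = 1 := by
    apply WithConv.ofConv_injective
    exact h0
  have hc1 : ∀ a w, c (a :: w) = toConv (q a) * c w := fun a w =>
    WithConv.ofConv_injective (hq a w)
  -- The hypothesis gives multiplicativity for one letter in front; by induction the coefficient
  -- forms are multiplicative for concatenation, which is compatibility with the coproduct tested on
  -- pairs of words.
  have hc : ∀ u v, c (u ++ v) = c u * c v := by
    intro u v
    induction u with
    | nil => rw [hc0, one_mul, List.nil_append]
    | cons a u ih => rw [List.cons_append, hc1, hc1, ih, _root_.mul_assoc]
  refine LinearMap.ext fun x => ?_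
  refine ext_coeff₂' p fun u v => ?_
  have h2 := LinearMap.congr_fun (congrArg WithConv.ofConv (hc u v)) x
  refine Eq.trans ?_ (h2.symm.trans (coeff_comul' p u v (f x)).symm)
  rw [LinearMap.comp_apply, ← LinearMap.comp_apply (TensorProduct.map _ _),
    ← TensorProduct.map_comp]
  rfl

theorem coeff_cons_coalgHom (f : C →ₗc[K] (quasiShuffleHopf K p).Carrier) (a : A) (w : List A)
    (x : C) : coeff p (a :: w) (f x) = LinearMap.mul' K K (TensorProduct.map
      (coeff p [a] ∘ₗ f.toLinearMap) (coeff p w ∘ₗ f.toLinearMap) (comul x)) := by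
  refine (coeff_comul' p [a] w (f x)).symm.trans ?_
  rw [← CoalgHomClass.map_comp_comul_apply f x, ← LinearMap.comp_apply (TensorProduct.map _ _),
    ← TensorProduct.map_comp]
  rfl

/-- A morphism of coalgebras to the quasi-shuffle Hopf algebra is determined by the coefficients of
the words of length one. -/
theorem coalgHom_ext {f g : C →ₗc[K] (quasiShuffleHopf K p).Carrier}
    (h : ∀ a x, coeff p [a] (f x) = coeff p [a] (g x)) : f = g := by
  have key : ∀ w x, coeff p w (f x) = coeff p w (g x) := by
    intro w
    induction w with
    | nil =>
      intro x
      have h1 : ∀ f : C →ₗc[K] (quasiShuffleHopf K p).Carrier,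
          coeff p [] (f x) = counit (R := K) x := fun f =>
        (counit_apply p (f x)).symm.trans (CoalgHomClass.counit_comp_apply f x)
      rw [h1, h1]
    | cons a w ih =>
      intro x
      rw [coeff_cons_coalgHom, coeff_cons_coalgHom]
      have e1 : coeff p [a] ∘ₗ f.toLinearMap = coeff p [a] ∘ₗ g.toLinearMap :=
        LinearMap.ext (h a)
      have e2 : coeff p w ∘ₗ f.toLinearMap = coeff p w ∘ₗ g.toLinearMap := LinearMap.ext ih
      rw [e1, e2]
  ext x
  exact Finsupp.ext (M := K) fun w => key w x

/-- A morphism of coalgebras from a bialgebra to the quasi-shuffle Hopf algebra is multiplicative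
if the coefficients of the words of length one are compatible with the product. -/
theorem map_mul_of_letters {H : Type*} [CommRing H] [Bialgebra K H]
    (f : H →ₗc[K] (quasiShuffleHopf K p).Carrier)
    (h : ∀ a x y, coeff p [a] (f (x * y)) = coeff p [a] (f x * f y)) (x y : H) :
    f (x * y) = f x * f y := by
  -- The multiplication of a commutative bialgebra is a morphism of coalgebras, so both composites
  -- are coalgebra morphisms on the tensor square and only their one-letter coefficients have to
  -- agree.
  have e : f.comp (Bialgebra.mulCoalgHom K H) =
      (Bialgebra.mulCoalgHom K (quasiShuffleHopf K p).Carrier).comp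
        (Coalgebra.TensorProduct.map f f) := by
    refine coalgHom_ext p fun a z => ?_
    induction z using TensorProduct.induction_on with
    | zero => simp only [map_zero]
    | add u v hu hv => simp only [map_add, hu, hv]
    | tmul u v => exact h a u v
  exact congrArg (fun g => g (x ⊗ₜ[K] y)) e

end Coalgebra

end QuasiShuffle

/-! ### Order and restriction in rooted forests. -/

namespace RForest

variable {V W : Type}

theorem restrict_parent_eq_some {X : RForest V} {S : Set V} {v w : S} :
    (X.restrict S).parent v = some w ↔ X.parent v = some w.1 := by
  simp only [restrict]
  constructor
  · intro h
    obtain ⟨p, hp, h⟩ := Option.bind_eq_some_iff.1 h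
    split_ifs at h with hS
    simp only [Option.some.injEq] at h
    subst h
    exact hp
  · intro h
    refine Option.bind_eq_some_iff.2 ⟨w.1, h, ?_⟩
    rw [dif_pos w.2]

theorem restrict_parent_eq_none {X : RForest V} {S : Set V} {v : S} :
    (X.restrict S).parent v = none ↔ ∀ p, X.parent v = some p → p ∉ S := by
  constructor
  · intro h p hp hpS
    have : (X.restrict S).parent v = some ⟨p, hpS⟩ := restrict_parent_eq_some.2 hp
    rw [h] at this
    cases this
  · intro h
    by_contra hne
    obtain ⟨p, hp⟩ := Option.ne_none_iff_exists'.1 hne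
    exact h p (restrict_parent_eq_some.1 hp) p.2

theorem exists_root_le (X : RForest V) (v : V) : ∃ r, X.parent r = none ∧ X.le r v := by
  induction v using X.wf.induction with
  | _ v ih =>
    cases hv : X.parent v with
    | none => exact ⟨v, hv, .refl⟩
    | some p =>
      obtain ⟨r, hr, hrp⟩ := ih p hv
      exact ⟨r, hr, hrp.tail hv⟩

theorem le_parent {X : RForest V} {x v p : V} (h : X.le x v) (hne : v ≠ x)
    (hp : X.parent v = some p) : X.le x p := by
  rcases Relation.ReflTransGen.cases_tail h with h | ⟨q, hq, hqv⟩
  · exact absurd h hne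
  · rw [hp] at hqv
    exact (Option.some.inj hqv) ▸ hq

theorem eq_of_le_root {X : RForest V} {x r : V} (h : X.le x r) (hr : X.parent r = none) :
    x = r := by
  rcases Relation.ReflTransGen.cases_tail h with h | ⟨q, hq, hqv⟩
  · exact h.symm
  · rw [hr] at hqv; cases hqv

theorem le_antisymm {X : RForest V} {x y : V} (h : X.le x y) (h' : X.le y x) : x = y := by
  by_contra hne
  have h1 := (Relation.reflTransGen_iff_eq_or_transGen.1 h).resolve_left (Ne.symm hne)
  exact (WellFounded.transGen X.wf).irrefl.irrefl x (h1.trans_left h')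

/-- Two vertices below a third one are comparable. -/
theorem le_total_of_le {X : RForest V} {x y z : V} (hx : X.le x z) (hy : X.le y z) :
    X.le x y ∨ X.le y x := by
  induction hy with
  | refl => exact Or.inl hx
  | tail hy hp ih =>
    rename_i b c
    by_cases hc : c = x
    · subst hc
      exact Or.inr (hy.tail hp)
    · exact ih (le_parent hx hc hp)

end RForest

/-! ### Isomorphisms of labelled forests. -/

namespace LForest

variable {A : Type*} {U V W : Type}

theorem isIso_iff {X : LForest A V} {Y : LForest A W} {e : V ≃ W} : X.IsIso Y e ↔
    (∀ v w, Y.parent (e v) = some (e w) ↔ X.parent v = some w) ∧ ∀ v, Y.lab (e v) = X.lab v := by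
  constructor
  · intro h
    refine ⟨fun v w => ?_, fun v => (h v).2⟩
    rw [(h v).1, Option.map_eq_some_iff]
    constructor
    · rintro ⟨a, ha, h⟩
      rw [ha, e.injective h]
    · intro h
      exact ⟨w, h, rfl⟩
  · rintro ⟨h, hl⟩ v
    refine ⟨?_, hl v⟩
    ext w
    obtain ⟨w, rfl⟩ := e.surjective w
    rw [h, Option.map_eq_some_iff]
    constructor
    · intro h
      exact ⟨w, h, rfl⟩
    · rintro ⟨a, ha, h⟩
      rw [ha, e.injective h]

theorem cls_eq_cls_iff [Finite V] [Finite W] {X : LForest A V} {Y : LForest A W} :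
    X.cls = Y.cls ↔ ∃ e : V ≃ W, X.IsIso Y e := by
  constructor
  · intro h
    obtain ⟨e, he⟩ := Quotient.exact h
    exact ⟨_, (X.isIso_transport (Finite.equivFin V)).trans
      (he.trans (Y.isIso_transport (Finite.equivFin W)).symm)⟩
  · rintro ⟨e, he⟩
    exact Quotient.sound ⟨_, (X.isIso_transport (Finite.equivFin V)).symm.trans
      (he.trans (Y.isIso_transport (Finite.equivFin W)))⟩

theorem IsIso.cls_eq [Finite V] [Finite W] {X : LForest A V} {Y : LForest A W} {e : V ≃ W}
    (h : X.IsIso Y e) : X.cls = Y.cls :=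
  cls_eq_cls_iff.2 ⟨e, h⟩

theorem cls_rep (u : Forest A) : u.rep.cls = u := by
  have h := Quotient.out_eq u
  refine Eq.trans (Quotient.sound ?_) h
  exact ⟨_, (isIso_transport u.rep (Finite.equivFin _)).symm⟩

theorem size_cls [Finite V] (X : LForest A V) : X.cls.size = Nat.card V := by
  obtain ⟨e, -⟩ := Forest.exists_isIso_rep_cls X
  rw [Nat.card_congr e, Nat.card_fin]

theorem cls_eq_one [IsEmpty V] (X : LForest A V) : X.cls = 1 :=
  IsIso.cls_eq (e := Equiv.equivOfIsEmpty V (Fin 0)) fun v => isEmptyElim v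

theorem IsIso.sum {U' : Type} {X : LForest A U} {Y : LForest A V} {X' : LForest A W}
    {Y' : LForest A U'} {e : U ≃ W} {f : V ≃ U'} (h : X.IsIso X' e) (h' : Y.IsIso Y' f) :
    (X.sum Y).IsIso (X'.sum Y') (e.sumCongr f) := by
  rintro (v | v)
  · refine ⟨?_, (h v).2⟩
    simp only [LForest.sum, RForest.sum, Equiv.sumCongr_apply, Sum.map_inl, Sum.elim_inl, (h v).1,
      Option.map_map]
    rfl
  · refine ⟨?_, (h' v).2⟩
    simp only [LForest.sum, RForest.sum, Equiv.sumCongr_apply, Sum.map_inr, Sum.elim_inr, (h' v).1,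
      Option.map_map]
    rfl

theorem IsIso.addRoot {X : LForest A V} {Y : LForest A W} {e : V ≃ W} (h : X.IsIso Y e) (a : A) :
    (X.addRoot a).IsIso (Y.addRoot a) e.optionCongr := by
  rintro (_ | v)
  · exact ⟨rfl, rfl⟩
  · refine ⟨?_, (h v).2⟩
    simp [LForest.addRoot, RForest.addRoot, (h v).1]

theorem IsIso.graft {U' : Type} {X : LForest A U} {Y : LForest A V} {X' : LForest A W}
    {Y' : LForest A U'} {e : U ≃ W} {f : V ≃ U'} (h : X.IsIso X' e) (h' : Y.IsIso Y' f) (r : U) :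
    (X.graft r Y).IsIso (X'.graft (e r) Y') (e.sumCongr f) := by
  rintro (v | v)
  · refine ⟨?_, (h v).2⟩
    simp only [LForest.graft, RForest.graft, Equiv.sumCongr_apply, Sum.map_inl, Sum.elim_inl,
      (h v).1, Option.map_map]
    rfl
  · refine ⟨?_, (h' v).2⟩
    simp only [LForest.graft, RForest.graft, Equiv.sumCongr_apply, Sum.map_inr, Sum.elim_inr,
      (h' v).1]
    cases Y.parent v <;> rfl

theorem IsIso.le_iff {X : LForest A V} {Y : LForest A W} {e : V ≃ W} (h : X.IsIso Y e) (v w : V) :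
    Y.le (e v) (e w) ↔ X.le v w := by
  have key : ∀ {U U' : Type} {X : LForest A U} {Y : LForest A U'} {e : U ≃ U'},
      X.IsIso Y e → ∀ v w, X.le v w → Y.le (e v) (e w) := by
    intro U U' X Y e h v w hvw
    induction hvw with
    | refl => exact .refl
    | tail _ hp ih =>
      refine ih.tail ?_
      rw [(h _).1, hp]
      rfl
  refine ⟨fun hvw => ?_, key h v w⟩
  simpa using key h.symm _ _ hvw

theorem IsIso.restrict {X : LForest A V} {Y : LForest A W} {e : V ≃ W} (h : X.IsIso Y e)
    {S : Set V} {T : Set W} (hST : ∀ v, v ∈ S ↔ e v ∈ T) :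
    (X.restrict S).IsIso (Y.restrict T) (e.subtypeEquiv hST) := by
  refine isIso_iff.2 ⟨fun v w => ?_, fun v => (h v).2⟩
  exact RForest.restrict_parent_eq_some.trans
    (((isIso_iff.1 h).1 _ _).trans RForest.restrict_parent_eq_some.symm)

theorem cls_restrict_congr [Finite V] (X : LForest A V) {S T : Set V} (h : S = T) :
    (X.restrict S).cls = (X.restrict T).cls := by
  subst h; rfl

theorem cls_restrict_univ [Finite V] (X : LForest A V) {S : Set V} (hS : ∀ v, v ∈ S) :
    (X.restrict S).cls = X.cls := by
  refine IsIso.cls_eq (e := Equiv.subtypeUnivEquiv hS) (isIso_iff.2 ⟨fun v w => ?_, fun v => rfl⟩)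
  exact RForest.restrict_parent_eq_some.symm

theorem cls_restrict_restrict [Finite V] (X : LForest A V) (S : Set V) (T : Set S) :
    ((X.restrict S).restrict T).cls = (X.restrict (Subtype.val '' T)).cls := by
  refine IsIso.cls_eq (e := Equiv.Set.image Subtype.val T Subtype.val_injective)
    (isIso_iff.2 ⟨fun v w => ?_, fun v => rfl⟩)
  refine RForest.restrict_parent_eq_some.trans ?_
  exact (RForest.restrict_parent_eq_some.trans RForest.restrict_parent_eq_some).symm

/-- The empty forest on a type without elements. -/
def empty (A : Type*) (V : Type) [IsEmpty V] : LForest A V :=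
  ⟨⟨isEmptyElim, ⟨fun v => isEmptyElim v⟩⟩, isEmptyElim⟩

end LForest

/-! ### The commutative monoid of forests. -/

namespace Forest

open LForest

variable {A : Type*} {V W : Type} [Finite V] [Finite W]

theorem cls_mul_cls (X : LForest A V) (Y : LForest A W) : X.cls * Y.cls = (X.sum Y).cls := by
  obtain ⟨e, he⟩ := exists_isIso_rep_cls X
  obtain ⟨f, hf⟩ := exists_isIso_rep_cls Y
  exact (he.sum hf).symm.cls_eq

theorem B_cls (a : A) (X : LForest A V) : B a X.cls = (X.addRoot a).cls := by
  obtain ⟨e, he⟩ := exists_isIso_rep_cls X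
  exact (he.addRoot a).symm.cls_eq

theorem exists_cls (u : Forest A) : ∃ n, ∃ X : LForest A (Fin n), X.cls = u :=
  ⟨_, _, cls_rep u⟩

noncomputable instance : CommMonoid (Forest A) where
  mul_assoc u v w := by
    obtain ⟨l, X, rfl⟩ := exists_cls u
    obtain ⟨m, Y, rfl⟩ := exists_cls v
    obtain ⟨n, Z, rfl⟩ := exists_cls w
    simp only [cls_mul_cls]
    refine IsIso.cls_eq (e := Equiv.sumAssoc _ _ _) ?_
    rintro ((v | v) | v) <;> refine ⟨?_, rfl⟩ <;>
      simp [LForest.sum, RForest.sum, Option.map_map, Function.comp_def]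
  one_mul u := by
    obtain ⟨m, Y, rfl⟩ := exists_cls u
    rw [← cls_eq_one (LForest.empty A Empty), cls_mul_cls]
    refine IsIso.cls_eq (e := Equiv.emptySum _ _) ?_
    rintro (v | v)
    · exact v.elim
    · refine ⟨?_, rfl⟩
      simp [LForest.sum, RForest.sum, Option.map_map, Function.comp_def]
  mul_one u := by
    obtain ⟨m, Y, rfl⟩ := exists_cls u
    rw [← cls_eq_one (LForest.empty A Empty), cls_mul_cls]
    refine IsIso.cls_eq (e := Equiv.sumEmpty _ _) ?_
    rintro (v | v)
    · refine ⟨?_, rfl⟩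
      simp [LForest.sum, RForest.sum, Option.map_map, Function.comp_def]
    · exact v.elim
  mul_comm u v := by
    obtain ⟨l, X, rfl⟩ := exists_cls u
    obtain ⟨m, Y, rfl⟩ := exists_cls v
    simp only [cls_mul_cls]
    refine IsIso.cls_eq (e := Equiv.sumComm _ _) ?_
    rintro (v | v) <;> refine ⟨?_, rfl⟩ <;>
      simp [LForest.sum, RForest.sum, Option.map_map, Function.comp_def]

@[simp] theorem size_one : (1 : Forest A).size = 0 := by
  rw [← cls_eq_one (LForest.empty A Empty), size_cls]
  simp

@[simp] theorem size_mul (u v : Forest A) : (u * v).size = u.size + v.size := by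
  obtain ⟨l, X, rfl⟩ := exists_cls u
  obtain ⟨m, Y, rfl⟩ := exists_cls v
  simp only [cls_mul_cls, size_cls, Nat.card_sum]

@[simp] theorem size_B (a : A) (u : Forest A) : (B a u).size = u.size + 1 := by
  obtain ⟨l, X, rfl⟩ := exists_cls u
  simp only [B_cls, size_cls, Finite.card_option]

theorem eq_one_of_size {u : Forest A} (h : u.size = 0) : u = 1 := by
  have : IsEmpty (Fin u.size) := by rw [h]; infer_instance
  rw [← cls_rep u, cls_eq_one]

/-- The disjoint union of two parts without edges between them. -/
theorem cls_restrict_union (X : LForest A V) (S T : Set V) (hST : Disjoint S T)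
    (h1 : ∀ v ∈ S, ∀ w ∈ T, X.parent v ≠ some w) (h2 : ∀ v ∈ T, ∀ w ∈ S, X.parent v ≠ some w) :
    (X.restrict (S ∪ T)).cls = (X.restrict S).cls * (X.restrict T).cls := by
  classical
  rw [cls_mul_cls]
  refine (IsIso.cls_eq (e := (Equiv.Set.union hST).symm) (isIso_iff.2 ⟨?_, ?_⟩)).symm
  · rintro (v | v) (w | w)
    · simp [LForest.sum, RForest.sum]
      exact RForest.restrict_parent_eq_some.trans
        (RForest.restrict_parent_eq_some (X := X.toRForest) (v := v) (w := w)).symm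
    · simp [LForest.sum, RForest.sum]
      exact fun h => h1 v v.2 w w.2 (RForest.restrict_parent_eq_some.1 h)
    · simp [LForest.sum, RForest.sum]
      exact fun h => h2 v v.2 w w.2 (RForest.restrict_parent_eq_some.1 h)
    · simp [LForest.sum, RForest.sum]
      exact RForest.restrict_parent_eq_some.trans
        (RForest.restrict_parent_eq_some (X := X.toRForest) (v := v) (w := w)).symm
  · rintro (v | v)
    · simp [LForest.sum, LForest.restrict]
    · simp [LForest.sum, LForest.restrict]

theorem isTree_cls {X : LForest A V} : X.cls.IsTree ↔ X.IsTree := by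
  obtain ⟨e, he⟩ := exists_isIso_rep_cls X
  exact ⟨he.symm.isTree, he.isTree⟩

theorem isTree_addRoot {V : Type} (a : A) (X : LForest A V) : (X.addRoot a).IsTree := by
  refine ⟨none, rfl, ?_⟩
  rintro (_ | v) h
  · rfl
  · cases h

theorem isTree_B (a : A) (u : Forest A) : (B a u).IsTree := by
  obtain ⟨l, X, rfl⟩ := exists_cls u
  rw [B_cls, isTree_cls]
  exact isTree_addRoot a X

/-- A tree is obtained from the forest of its non-root vertices by adding a root. -/
theorem cls_eq_B {X : LForest A V} {r : V} (hr : X.parent r = none)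
    (hX : ∀ v, X.parent v = none → v = r) :
    X.cls = B (X.lab r) (X.restrict {v | v ≠ r}).cls := by
  classical
  rw [B_cls]
  refine (IsIso.cls_eq (e := Equiv.optionSubtypeNe r) (isIso_iff.2 ⟨?_, ?_⟩)).symm
  · rintro (_ | v) (_ | w)
    · simp [LForest.addRoot, RForest.addRoot, hr]
    · simp [LForest.addRoot, RForest.addRoot, hr]
    · have : X.parent v = some r ↔ (X.restrict {v | v ≠ r}).parent v = none := by
        refine Iff.trans ?_ RForest.restrict_parent_eq_none.symm
        constructor
        · intro h p hp
          rw [h] at hp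
          cases hp
          simp
        · intro h
          obtain ⟨p, hp⟩ := Option.ne_none_iff_exists'.1 fun h => v.2 (hX v h)
          rw [hp, Option.some.injEq]
          by_contra hpr
          exact h p hp hpr
      simpa [LForest.addRoot, RForest.addRoot] using this
    · have : X.parent v = some w.1 ↔ (X.restrict {v | v ≠ r}).parent v = some w :=
        RForest.restrict_parent_eq_some.symm
      simpa [LForest.addRoot, RForest.addRoot] using this
  · rintro (_ | v)
    · simp [LForest.addRoot]
    · simp [LForest.addRoot, LForest.restrict]

theorem IsTree.exists_eq_B {u : Forest A} (h : u.IsTree) : ∃ a v, u = B a v := by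
  obtain ⟨r, hr, hu⟩ := h
  refine ⟨u.rep.lab r, _, (cls_rep u).symm.trans (cls_eq_B hr hu)⟩

/-- Splitting off the tree above a root. -/
theorem cls_eq_mul_of_root (X : LForest A V) {r : V} (hr : X.parent r = none) :
    X.cls = (X.restrict {v | X.le r v}).cls * (X.restrict {v | ¬ X.le r v}).cls := by
  rw [← cls_restrict_union, cls_restrict_univ]
  · intro v
    exact em _
  · exact Set.disjoint_left.2 fun v h h' => h' h
  · intro v hv w hw h
    refine hw (RForest.le_parent hv (fun h' => ?_) h)
    rw [h', hr] at h
    cases h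
  · intro v hv w hw h
    exact hv (hw.tail h)

theorem exists_eq_B_mul {u : Forest A} (hu : u ≠ 1) : ∃ a v w, u = B a v * w := by
  have : Nonempty (Fin u.size) := by
    rw [← Fin.pos_iff_nonempty]
    exact Nat.pos_of_ne_zero fun h => hu (eq_one_of_size h)
  obtain ⟨r, hr, -⟩ := u.rep.exists_root_le this.some
  have h := cls_eq_mul_of_root u.rep hr
  rw [cls_rep] at h
  obtain ⟨a, v, hv⟩ := IsTree.exists_eq_B (isTree_cls.2 (u.rep.isTree_above r) :
    (u.rep.restrict {v | u.rep.le r v}).cls.IsTree)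
  exact ⟨a, v, _, by rw [← hv]; exact h⟩

/-- Forests are generated by the empty forest, products and the addition of roots. -/
theorem induction {P : Forest A → Prop} (one : P 1) (mul : ∀ u v, P u → P v → P (u * v))
    (B : ∀ a u, P u → P (B a u)) (u : Forest A) : P u := by
  induction hn : u.size using Nat.strong_induction_on generalizing u with
  | _ n ih =>
    by_cases hu : u = 1
    · rw [hu]; exact one
    · obtain ⟨a, v, w, rfl⟩ := exists_eq_B_mul hu
      simp only [size_mul, size_B] at hn
      exact mul _ _ (B a v (ih _ (by omega) _ rfl)) (ih _ (by omega) _ rfl)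

/-- The root is unique, so the choice made in `comp` is forced, and what is grafted to the root
joins the forest of branches. -/
theorem comp_B (a : A) (u v : Forest A) : comp (B a u) v = B a (u * v) := by
  obtain ⟨l, X, rfl⟩ := exists_cls u
  obtain ⟨m, Y, rfl⟩ := exists_cls v
  rw [cls_mul_cls, B_cls, B_cls]
  obtain ⟨e, he⟩ := exists_isIso_rep_cls (X.addRoot a)
  obtain ⟨f, hf⟩ := exists_isIso_rep_cls Y
  have h : ∃ r, (X.addRoot a).cls.rep.parent r = none := ⟨e none, by rw [(he none).1]; rfl⟩
  rw [comp, dif_pos h]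
  have hr : h.choose = e none := by
    refine ((isTree_cls.2 (isTree_addRoot a X)).unique h.choose_spec ?_)
    rw [(he none).1]; rfl
  rw [hr, ← (he.graft hf none).cls_eq]
  let σ : Option (Fin l) ⊕ Fin m ≃ Option (Fin l ⊕ Fin m) :=
    { toFun := Sum.elim (Option.map Sum.inl) (some ∘ Sum.inr)
      invFun := fun o => o.elim (Sum.inl none) (Sum.map some id)
      left_inv := by rintro ((_ | v) | v) <;> rfl
      right_inv := by rintro (_ | v | v) <;> rfl }
  refine IsIso.cls_eq (e := σ) ?_
  rintro ((_ | v) | v)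
  · exact ⟨rfl, rfl⟩
  · refine ⟨?_, rfl⟩
    cases h : X.parent v <;> simp [σ, LForest.graft, RForest.graft, LForest.addRoot,
      RForest.addRoot, LForest.sum, RForest.sum, h]
  · refine ⟨?_, rfl⟩
    cases h : Y.parent v <;> simp [σ, LForest.graft, RForest.graft, LForest.addRoot,
      RForest.addRoot, LForest.sum, RForest.sum, h]

end Forest

/-! ### Restrictions of disjoint unions and of rooted trees. -/

namespace LForest

variable {A : Type*} {V W : Type} [Finite V] [Finite W]

theorem cls_restrict_sum (X : LForest A V) (Y : LForest A W) (S : Set (V ⊕ W)) :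
    ((X.sum Y).restrict S).cls =
      (X.restrict (Sum.inl ⁻¹' S)).cls * (Y.restrict (Sum.inr ⁻¹' S)).cls := by
  rw [Forest.cls_mul_cls]
  refine IsIso.cls_eq (e := Equiv.subtypeSum) (IsIso.symm (e := Equiv.subtypeSum.symm) ?_)
  refine isIso_iff.2 ⟨?_, ?_⟩
  · rintro (v | v) (w | w) <;> refine RForest.restrict_parent_eq_some.trans ?_
    · have : X.parent v = some w.1 ↔ (X.restrict (Sum.inl ⁻¹' S)).parent v = some w :=
        RForest.restrict_parent_eq_some.symm
      simpa [LForest.sum, RForest.sum, Equiv.subtypeSum] using this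
    · simp [LForest.sum, RForest.sum, Equiv.subtypeSum]
    · simp [LForest.sum, RForest.sum, Equiv.subtypeSum]
    · have : Y.parent v = some w.1 ↔ (Y.restrict (Sum.inr ⁻¹' S)).parent v = some w :=
        RForest.restrict_parent_eq_some.symm
      simpa [LForest.sum, RForest.sum, Equiv.subtypeSum] using this
  · rintro (v | v) <;> rfl

/-- By `hl` the set contains the parents of its vertices, so a root of the restricted forest is
already a root of `X` and hence is attached to the new root. Without this, a vertex that has lost
its parent would be a second root on the left. -/
theorem cls_restrict_addRoot_of_mem (a : A) (X : LForest A V) {S : Set (Option V)}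
    (hS : none ∈ S) (hl : ∀ v p, X.parent v = some p → some v ∈ S → some p ∈ S) :
    ((X.addRoot a).restrict S).cls =
      Forest.B a (X.restrict (some ⁻¹' S)).cls := by
  rw [Forest.B_cls]
  let σ : Option ↥(some ⁻¹' S) ≃ S :=
    { toFun := fun o => o.elim ⟨none, hS⟩ fun v => ⟨some v.1, v.2⟩
      invFun := fun s => match s with
        | ⟨none, _⟩ => none
        | ⟨some v, h⟩ => some ⟨v, h⟩
      left_inv := by rintro (_ | v) <;> rfl
      right_inv := by rintro ⟨_ | v, h⟩ <;> rfl }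
  refine (IsIso.cls_eq (e := σ) (isIso_iff.2 ⟨?_, ?_⟩)).symm
  · rintro (_ | v) (_ | w) <;> refine RForest.restrict_parent_eq_some.trans ?_
    · simp [σ, LForest.addRoot, RForest.addRoot]
    · simp [σ, LForest.addRoot, RForest.addRoot]
    · have : X.parent v = none ↔ (X.restrict (some ⁻¹' S)).parent v = none := by
        refine Iff.trans ?_ RForest.restrict_parent_eq_none.symm
        refine ⟨fun h p hp => by simp [h] at hp, fun h => ?_⟩
        by_contra hne
        obtain ⟨p, hp⟩ := Option.ne_none_iff_exists'.1 hne
        exact h p hp (hl _ _ hp v.2)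
      simpa [σ, LForest.addRoot, RForest.addRoot] using this
    · have : X.parent v = some w.1 ↔ (X.restrict (some ⁻¹' S)).parent v = some w :=
        RForest.restrict_parent_eq_some.symm
      simpa [σ, LForest.addRoot, RForest.addRoot] using this
  · rintro (_ | v) <;> rfl

theorem cls_restrict_addRoot_of_notMem (a : A) (X : LForest A V) {S : Set (Option V)}
    (hS : none ∉ S) : ((X.addRoot a).restrict S).cls = (X.restrict (some ⁻¹' S)).cls := by
  let σ : ↥(some ⁻¹' S) ≃ S :=
    { toFun := fun v => ⟨some v.1, v.2⟩
      invFun := fun s => match s with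
        | ⟨none, h⟩ => (hS h).elim
        | ⟨some v, h⟩ => ⟨v, h⟩
      left_inv := fun _ => rfl
      right_inv := by
        rintro ⟨_ | v, h⟩
        · exact (hS h).elim
        · rfl }
  refine (IsIso.cls_eq (e := σ) (isIso_iff.2 ⟨fun v w => ?_, fun v => rfl⟩)).symm
  refine RForest.restrict_parent_eq_some.trans ?_
  have : X.parent v = some w.1 ↔ (X.restrict (some ⁻¹' S)).parent v = some w :=
    RForest.restrict_parent_eq_some.symm
  simpa [σ, LForest.addRoot, RForest.addRoot] using this

/-- The vertices below a vertex of the set belong to the set. -/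
def IsLower (X : LForest A V) (W : Finset V) : Prop := ∀ x y, X.le y x → x ∈ W → y ∈ W

theorem isLower_iff {V : Type} {X : LForest A V} {W : Finset V} :
    X.IsLower W ↔ ∀ v p, X.parent v = some p → v ∈ W → p ∈ W := by
  constructor
  · intro h v p hp hv
    exact h v p (Relation.ReflTransGen.single hp) hv
  · intro h x y hyx hx
    induction hyx using Relation.ReflTransGen.head_induction_on with
    | refl => exact hx
    | head hp _ ih => exact h _ _ hp ih

end LForest

/-! ### The coproduct of forests. -/

namespace TreeHopf

open LForest QuasiShuffle

variable {K A : Type*} [Field K] {V W : Type} [Fintype V] [Fintype W]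

open Classical in
-- Isomorphisms carry lower sets to lower sets, so the chosen representative in the definition may
-- be replaced by any forest of the class, on any finite vertex type.
theorem comul_cls (X : LForest A V) : (treeHopf K A).comul (Finsupp.single X.cls 1) =
    ∑ W : Finset V with X.IsLower W, Finsupp.single (X.restrict {x | x ∉ W}).cls 1 ⊗ₜ[K]
      Finsupp.single (X.restrict {x | x ∈ W}).cls 1 := by
  obtain ⟨e, he⟩ := Forest.exists_isIso_rep_cls X
  simp only [treeHopf, Finsupp.linearCombination_single, one_smul]
  refine (Finset.sum_equiv e.finsetCongr (fun W => ?_) (fun W _ => ?_)).symm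
  · simp only [Finset.mem_filter, Finset.mem_univ, true_and]
    refine ⟨fun h x y hyx hx => ?_, fun h x y hyx hx => ?_⟩
    · obtain ⟨x, rfl⟩ := e.surjective x
      obtain ⟨y, rfl⟩ := e.surjective y
      simp only [Equiv.finsetCongr_apply, Finset.mem_map_equiv, Equiv.symm_apply_apply] at hx ⊢
      exact h x y ((he.le_iff _ _).1 hyx) hx
    · have := h (e x) (e y) ((he.le_iff _ _).2 hyx)
      simp only [Equiv.finsetCongr_apply, Finset.mem_map_equiv, Equiv.symm_apply_apply] at this
      exact this hx
  · congr 2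
    · exact (he.restrict fun v => by simp).cls_eq
    · exact (he.restrict fun v => by simp).cls_eq

theorem mul_single (u v : Forest A) : (treeHopf K A).mul (Finsupp.single u 1)
    (Finsupp.single v 1) = Finsupp.single (u * v) 1 := by
  simp [treeHopf]

theorem one_def : (treeHopf K A).one = Finsupp.single 1 1 := rfl

theorem counit_single (u : Forest A) [Decidable (u = 1)] :
    (treeHopf K A).counit (Finsupp.single u 1) = if u = 1 then 1 else 0 := by
  simp only [treeHopf, Finsupp.linearCombination_single, one_smul]
  congr

theorem sum_mul_sum {ι κ : Type*} (s : Finset ι) (t : Finset κ)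
    (f f' : ι → Forest A) (g g' : κ → Forest A) :
    TensorProduct.map₂ (treeHopf K A).mul (treeHopf K A).mul
      (∑ i ∈ s, Finsupp.single (f i) 1 ⊗ₜ[K] Finsupp.single (f' i) 1)
      (∑ j ∈ t, Finsupp.single (g j) 1 ⊗ₜ[K] Finsupp.single (g' j) 1) =
    ∑ k ∈ s ×ˢ t, Finsupp.single (f k.1 * g k.2) 1 ⊗ₜ[K]
      Finsupp.single (f' k.1 * g' k.2) 1 := by
  simp only [map_sum, LinearMap.sum_apply, TensorProduct.map₂_apply_tmul, TensorProduct.map_tmul,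
    mul_single]
  rw [Finset.sum_product_right]

theorem comul_single_mul (u v : Forest A) :
    (treeHopf K A).comul (Finsupp.single (u * v) 1) =
      TensorProduct.map₂ (treeHopf K A).mul (treeHopf K A).mul
        ((treeHopf K A).comul (Finsupp.single u 1)) ((treeHopf K A).comul (Finsupp.single v 1)) := by
  classical
  obtain ⟨l, X, rfl⟩ := Forest.exists_cls u
  obtain ⟨m, Y, rfl⟩ := Forest.exists_cls v
  rw [Forest.cls_mul_cls, comul_cls, comul_cls, comul_cls, sum_mul_sum]
  -- A lower set of a disjoint union is a pair of lower sets, one in each part.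
  refine Finset.sum_equiv Finset.sumEquiv.toEquiv (fun W => ?_) (fun W _ => ?_)
  · simp only [Finset.mem_filter, Finset.mem_univ, true_and, Finset.mem_product, isLower_iff,
      OrderIso.coe_toEquiv, Finset.sumEquiv_apply_fst, Finset.sumEquiv_apply_snd,
      Finset.mem_toLeft, Finset.mem_toRight]
    constructor
    · intro h
      refine ⟨fun v p hp hv => h (Sum.inl v) (Sum.inl p) ?_ hv,
        fun v p hp hv => h (Sum.inr v) (Sum.inr p) ?_ hv⟩ <;>
        simp [LForest.sum, RForest.sum, hp]
    · rintro ⟨h, h'⟩ (v | v) p hp hv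
      · obtain ⟨q, hq, rfl⟩ := Option.map_eq_some_iff.1 hp
        exact h _ _ hq hv
      · obtain ⟨q, hq, rfl⟩ := Option.map_eq_some_iff.1 hp
        exact h' _ _ hq hv
  · have h1 : Sum.inl ⁻¹' {x | x ∈ W} = {x | x ∈ (Finset.sumEquiv W).1} := by
      ext; simp
    have h2 : Sum.inr ⁻¹' {x | x ∈ W} = {x | x ∈ (Finset.sumEquiv W).2} := by
      ext; simp
    have h3 : Sum.inl ⁻¹' {x | x ∉ W} = {x | x ∉ (Finset.sumEquiv W).1} := by
      ext; simp
    have h4 : Sum.inr ⁻¹' {x | x ∉ W} = {x | x ∉ (Finset.sumEquiv W).2} := by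
      ext; simp
    rw [cls_restrict_sum, cls_restrict_sum, cls_restrict_congr _ h1, cls_restrict_congr _ h2,
      cls_restrict_congr _ h3, cls_restrict_congr _ h4]
    rfl

/-- The linear extension of `B⁺_a`. -/
noncomputable def BL (K : Type*) [Field K] (a : A) : (Forest A →₀ K) →ₗ[K] (Forest A →₀ K) :=
  Finsupp.lmapDomain K K (Forest.B a)

@[simp] theorem BL_single (a : A) (u : Forest A) (r : K) :
    BL K a (Finsupp.single u r) = Finsupp.single (Forest.B a u) r := by
  simp [BL]

/-- A lower set of a tree is empty or contains the root, and in the latter case the rest is a lower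
set of the branches. So `B⁺_a` is a 1-cocycle, which is what the inductive proofs of the coalgebra
axioms use. -/
theorem comul_single_B (a : A) (u : Forest A) :
    (treeHopf K A).comul (Finsupp.single (Forest.B a u) 1) =
      Finsupp.single (Forest.B a u) 1 ⊗ₜ[K] Finsupp.single 1 1 +
        (BL K a).lTensor _ ((treeHopf K A).comul (Finsupp.single u 1)) := by
  classical
  obtain ⟨l, X, rfl⟩ := Forest.exists_cls u
  rw [Forest.B_cls, comul_cls, comul_cls]
  have hf : (Finset.univ.filter fun W : Finset (Option (Fin l)) => (X.addRoot a).IsLower W) =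
      insert ∅ ((Finset.univ.filter fun W : Finset (Fin l) => X.IsLower W).map
        Finset.insertNone.toEmbedding) := by
    ext W
    simp only [Finset.mem_filter, Finset.mem_univ, true_and, Finset.mem_insert, Finset.mem_map,
      isLower_iff]
    constructor
    · intro h
      rcases W.eq_empty_or_nonempty with hW | ⟨w, hw⟩
      · exact Or.inl hW
      · have hn : none ∈ W := by
          have := (X.addRoot a).exists_root_le w
          obtain ⟨r, hr, hrw⟩ := this
          have hr' : r = none := by
            cases r
            · rfl
            · cases hr
          exact hr' ▸ isLower_iff.2 h _ _ hrw hw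
        refine Or.inr ⟨Finset.eraseNone W, fun v p hp hv => ?_, ?_⟩
        · rw [Finset.mem_eraseNone] at hv ⊢
          exact h (some v) (some p) (by simp [LForest.addRoot, RForest.addRoot, hp]) hv
        · ext o
          cases o
          · simpa using hn
          · simp
    · rintro (rfl | ⟨W, hW, rfl⟩) v p hp hv
      · simp at hv
      · rcases p with _ | p
        · simp
        · rcases v with _ | v
          · simp [LForest.addRoot, RForest.addRoot] at hp
          · simp only [LForest.addRoot, RForest.addRoot, Option.elim_some, Option.some.injEq] at hp
            simp only [RelEmbedding.coe_toEmbedding, Finset.some_mem_insertNone] at hv ⊢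
            exact hW v p hp hv
  rw [hf, Finset.sum_insert, Finset.sum_map, map_sum]
  · congr 1
    · have : IsEmpty {x : Option (Fin l) | x ∈ (∅ : Finset (Option (Fin l)))} :=
        ⟨fun x => by simpa using x.2⟩
      rw [cls_restrict_univ _ (by simp), cls_eq_one (LForest.restrict _ {x | x ∈ ∅})]
    · refine Finset.sum_congr rfl fun W hW => ?_
      have h1 : some ⁻¹' {x | x ∈ Finset.insertNone W} = {x | x ∈ W} := by ext; simp
      have h2 : some ⁻¹' {x | x ∉ Finset.insertNone W} = {x | x ∉ W} := by ext; simp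
      rw [LinearMap.lTensor_tmul, BL_single, ← cls_restrict_congr _ h1, ← cls_restrict_congr _ h2,
        ← cls_restrict_addRoot_of_notMem a, ← cls_restrict_addRoot_of_mem a]
      · rfl
      · simp
      · intro v p hp hv
        have hW := isLower_iff.1 (Finset.mem_filter.1 hW).2
        simp only [Set.mem_ofPred_eq, Finset.some_mem_insertNone] at hv ⊢
        exact hW _ _ hp hv
      · simp
  · intro h
    obtain ⟨W, -, hW⟩ := Finset.mem_map.1 h
    have : none ∈ (∅ : Finset (Option (Fin l))) := by rw [← hW]; simp
    simp at this

end TreeHopf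

/-! ### Propagation of the coalgebra axioms along products and cocycles. -/

namespace PreHopf

variable {K V : Type*} [Field K] [AddCommGroup V] [Module K V] (D : PreHopf K V)

/-- Coassociativity at an element. -/
def CoassocAt (x : V) : Prop :=
  TensorProduct.assoc K V V V (D.comul.rTensor V (D.comul x)) = D.comul.lTensor V (D.comul x)

variable {D}

theorem CoassocAt.mul (hm : ∀ x y, D.comul (D.mul x y) =
    TensorProduct.map₂ D.mul D.mul (D.comul x) (D.comul y)) {x y : V} (hx : D.CoassocAt x)
    (hy : D.CoassocAt y) : D.CoassocAt (D.mul x y) := by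
  have h1 : ∀ X Y : V ⊗[K] V, D.comul.rTensor V (TensorProduct.map₂ D.mul D.mul X Y) =
      TensorProduct.map₂ (TensorProduct.map₂ D.mul D.mul) D.mul (D.comul.rTensor V X)
        (D.comul.rTensor V Y) := by
    intro X Y
    induction X with
    | zero => simp
    | add X X' h h' => simp only [map_add, LinearMap.add_apply, h, h']
    | tmul a b =>
      induction Y with
      | zero => simp
      | add Y Y' h h' => simp only [map_add, h, h']
      | tmul c d => simp [TensorProduct.map₂_apply_tmul, hm]
  have h2 : ∀ X Y : V ⊗[K] V, D.comul.lTensor V (TensorProduct.map₂ D.mul D.mul X Y) =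
      TensorProduct.map₂ D.mul (TensorProduct.map₂ D.mul D.mul) (D.comul.lTensor V X)
        (D.comul.lTensor V Y) := by
    intro X Y
    induction X with
    | zero => simp
    | add X X' h h' => simp only [map_add, LinearMap.add_apply, h, h']
    | tmul a b =>
      induction Y with
      | zero => simp
      | add Y Y' h h' => simp only [map_add, h, h']
      | tmul c d => simp [TensorProduct.map₂_apply_tmul, hm]
  have h3 : ∀ X Y : (V ⊗[K] V) ⊗[K] V, TensorProduct.assoc K V V V
      (TensorProduct.map₂ (TensorProduct.map₂ D.mul D.mul) D.mul X Y) =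
      TensorProduct.map₂ D.mul (TensorProduct.map₂ D.mul D.mul) (TensorProduct.assoc K V V V X)
        (TensorProduct.assoc K V V V Y) := by
    intro X Y
    induction X with
    | zero => simp
    | add X X' h h' => simp only [map_add, LinearMap.add_apply, h, h']
    | tmul X b =>
      induction X with
      | zero => simp
      | add X X' h h' => simp only [TensorProduct.add_tmul, map_add, LinearMap.add_apply, h, h']
      | tmul a a' =>
        induction Y with
        | zero => simp
        | add Y Y' h h' => simp only [map_add, h, h']
        | tmul Y d =>
          induction Y with
          | zero => simp
          | add Y Y' h h' => simp only [TensorProduct.add_tmul, map_add, h, h']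
          | tmul c c' => simp [TensorProduct.map₂_apply_tmul]
  unfold CoassocAt at hx hy ⊢
  rw [hm, h1, h2, h3, hx, hy]

/-- The cocycle identity reduces coassociativity at `L x` to coassociativity at `x`. Together with
products this reaches all forests from the empty one. -/
theorem CoassocAt.cocycle (h1 : D.comul D.one = D.one ⊗ₜ D.one) {L : V →ₗ[K] V}
    (hL : ∀ x, D.comul (L x) = L x ⊗ₜ D.one + L.lTensor V (D.comul x)) {x : V}
    (hx : D.CoassocAt x) : D.CoassocAt (L x) := by
  have e1 : ∀ X : V ⊗[K] V, D.comul.lTensor V (L.lTensor V X) =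
      TensorProduct.assoc K V V V (L.lTensor V X ⊗ₜ D.one) +
        (L.lTensor V).lTensor V (D.comul.lTensor V X) := by
    intro X
    induction X with
    | zero => simp
    | add X X' h h' =>
      simp only [map_add, TensorProduct.add_tmul, h, h']
      abel
    | tmul a b => simp [hL, TensorProduct.tmul_add]
  have e2 : ∀ X : V ⊗[K] V, TensorProduct.assoc K V V V (D.comul.rTensor V (L.lTensor V X)) =
      (L.lTensor V).lTensor V (TensorProduct.assoc K V V V (D.comul.rTensor V X)) := by
    intro X
    induction X with
    | zero => simp
    | add X X' h h' => simp only [map_add, h, h']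
    | tmul a b =>
      simp only [LinearMap.lTensor_tmul, LinearMap.rTensor_tmul]
      induction D.comul a with
      | zero => simp
      | add X X' h h' => simp only [TensorProduct.add_tmul, map_add, h, h']
      | tmul c d => simp
  unfold CoassocAt at hx ⊢
  rw [hL, map_add, map_add, map_add, e1, e2, hx, LinearMap.rTensor_tmul, LinearMap.lTensor_tmul,
    h1, hL, TensorProduct.add_tmul, map_add, TensorProduct.assoc_tmul, add_assoc]

theorem rTensor_counit_mul (hm : ∀ x y, D.comul (D.mul x y) =
    TensorProduct.map₂ D.mul D.mul (D.comul x) (D.comul y))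
    (hc : ∀ x y, D.counit (D.mul x y) = D.counit x * D.counit y) {x y : V}
    (hx : D.counit.rTensor V (D.comul x) = 1 ⊗ₜ x) (hy : D.counit.rTensor V (D.comul y) = 1 ⊗ₜ y) :
    D.counit.rTensor V (D.comul (D.mul x y)) = 1 ⊗ₜ D.mul x y := by
  have h1 : ∀ X Y : V ⊗[K] V, D.counit.rTensor V (TensorProduct.map₂ D.mul D.mul X Y) =
      TensorProduct.map₂ (LinearMap.mul K K) D.mul (D.counit.rTensor V X)
        (D.counit.rTensor V Y) := by
    intro X Y
    induction X with
    | zero => simp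
    | add X X' h h' => simp only [map_add, LinearMap.add_apply, h, h']
    | tmul a b =>
      induction Y with
      | zero => simp
      | add Y Y' h h' => simp only [map_add, h, h']
      | tmul c d => simp [TensorProduct.map₂_apply_tmul, hc]
  rw [hm, h1, hx, hy, TensorProduct.map₂_apply_tmul]
  simp

theorem lTensor_counit_mul (hm : ∀ x y, D.comul (D.mul x y) =
    TensorProduct.map₂ D.mul D.mul (D.comul x) (D.comul y))
    (hc : ∀ x y, D.counit (D.mul x y) = D.counit x * D.counit y) {x y : V}
    (hx : D.counit.lTensor V (D.comul x) = x ⊗ₜ 1) (hy : D.counit.lTensor V (D.comul y) = y ⊗ₜ 1) :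
    D.counit.lTensor V (D.comul (D.mul x y)) = D.mul x y ⊗ₜ 1 := by
  have h1 : ∀ X Y : V ⊗[K] V, D.counit.lTensor V (TensorProduct.map₂ D.mul D.mul X Y) =
      TensorProduct.map₂ D.mul (LinearMap.mul K K) (D.counit.lTensor V X)
        (D.counit.lTensor V Y) := by
    intro X Y
    induction X with
    | zero => simp
    | add X X' h h' => simp only [map_add, LinearMap.add_apply, h, h']
    | tmul a b =>
      induction Y with
      | zero => simp
      | add Y Y' h h' => simp only [map_add, h, h']
      | tmul c d => simp [TensorProduct.map₂_apply_tmul, hc]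
  rw [hm, h1, hx, hy, TensorProduct.map₂_apply_tmul]
  simp

end PreHopf

/-! ### The Hopf algebra of forests. -/

namespace TreeHopf

open LForest QuasiShuffle

variable {K A : Type*} [Field K]

theorem induction_forests {P : (Forest A →₀ K) → Prop} (zero : P 0)
    (add : ∀ x y, P x → P y → P (x + y)) (smul : ∀ (r : K) x, P x → P (r • x))
    (single : ∀ u, P (Finsupp.single u 1)) (x : Forest A →₀ K) : P x := by
  induction x using Finsupp.induction_linear with
  | zero => exact zero
  | add x y hx hy => exact add _ _ hx hy
  | single u r =>
    have := smul r _ (single u)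
    rwa [Finsupp.smul_single, smul_eq_mul, _root_.mul_one] at this

theorem comul_one : (treeHopf K A).comul (treeHopf K A).one =
    (treeHopf K A).one ⊗ₜ (treeHopf K A).one := by
  classical
  have e : ∀ S : Set Empty, ((LForest.empty A Empty).restrict S).cls = 1 :=
    fun S => cls_eq_one _
  rw [one_def, ← cls_eq_one (LForest.empty A Empty), comul_cls]
  simp only [e, cls_eq_one]
  rw [Finset.filter_true_of_mem (p := (LForest.empty A Empty).IsLower) fun W _ x => x.elim]
  simp

theorem comul_mul (x y : Forest A →₀ K) : (treeHopf K A).comul ((treeHopf K A).mul x y) =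
    TensorProduct.map₂ (treeHopf K A).mul (treeHopf K A).mul
      ((treeHopf K A).comul x) ((treeHopf K A).comul y) := by
  induction x using induction_forests with
  | zero => simp
  | add x x' h h' => simp only [map_add, LinearMap.add_apply, h, h']
  | smul r x h => simp only [map_smul, LinearMap.smul_apply, h]
  | single u =>
    induction y using induction_forests with
    | zero => simp
    | add x x' h h' => simp only [map_add, h, h']
    | smul r x h => simp only [map_smul, h]
    | single v => rw [mul_single, comul_single_mul]

theorem comul_BL (a : A) (x : Forest A →₀ K) : (treeHopf K A).comul (BL K a x) =
    BL K a x ⊗ₜ (treeHopf K A).one + (BL K a).lTensor _ ((treeHopf K A).comul x) := by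
  induction x using induction_forests with
  | zero => simp
  | add x x' h h' => simp only [map_add, TensorProduct.add_tmul, h, h']; abel
  | smul r x h => simp only [map_smul, h, smul_add, TensorProduct.smul_tmul']
  | single u => rw [BL_single, comul_single_B, one_def]

theorem counit_mul (x y : Forest A →₀ K) : (treeHopf K A).counit ((treeHopf K A).mul x y) =
    (treeHopf K A).counit x * (treeHopf K A).counit y := by
  classical
  induction x using induction_forests with
  | zero => simp
  | add x x' h h' => simp only [map_add, LinearMap.add_apply, h, h', add_mul]
  | smul r x h => simp only [map_smul, LinearMap.smul_apply, h, smul_mul_assoc]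
  | single u =>
    induction y using induction_forests with
    | zero => simp
    | add x x' h h' => simp only [map_add, h, h', mul_add]
    | smul r x h => simp only [map_smul, h, mul_smul_comm]
    | single v =>
      have : u * v = 1 ↔ u = 1 ∧ v = 1 := by
        refine ⟨fun h => ?_, fun h => by simp [h.1, h.2]⟩
        have := congrArg Forest.size h
        simp only [Forest.size_mul, Forest.size_one, Nat.add_eq_zero_iff] at this
        exact ⟨Forest.eq_one_of_size this.1, Forest.eq_one_of_size this.2⟩
      rw [mul_single, counit_single, counit_single, counit_single]
      by_cases hu : u = 1 <;> by_cases hv : v = 1 <;> simp [this, hu, hv]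

theorem counit_one : (treeHopf K A).counit (treeHopf K A).one = 1 := by
  classical
  rw [one_def, counit_single, if_pos rfl]

theorem counit_BL (a : A) (x : Forest A →₀ K) : (treeHopf K A).counit (BL K a x) = 0 := by
  classical
  induction x using induction_forests with
  | zero => simp
  | add x x' h h' => simp only [map_add, h, h', add_zero]
  | smul r x h => simp only [map_smul, h, smul_zero]
  | single u =>
    rw [BL_single, counit_single, if_neg]
    intro h
    simpa using congrArg Forest.size h

theorem coassocAt (x : Forest A →₀ K) : (treeHopf K A).CoassocAt x := by
  induction x using induction_forests with
  | zero => simp [PreHopf.CoassocAt]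
  | add x x' h h' =>
    unfold PreHopf.CoassocAt at h h' ⊢
    simp only [map_add, h, h']
  | smul r x h =>
    unfold PreHopf.CoassocAt at h ⊢
    simp only [map_smul, h]
  | single u =>
    induction u using Forest.induction with
    | one =>
      rw [← one_def]
      unfold PreHopf.CoassocAt
      simp [comul_one]
    | mul u v hu hv =>
      rw [← mul_single]
      exact hu.mul comul_mul hv
    | B a u hu =>
      rw [← BL_single]
      exact hu.cocycle comul_one (comul_BL a)

theorem rTensor_counit_apply (x : Forest A →₀ K) :
    (treeHopf K A).counit.rTensor _ ((treeHopf K A).comul x) = 1 ⊗ₜ x := by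
  induction x using induction_forests with
  | zero => simp
  | add x x' h h' => simp only [map_add, h, h', TensorProduct.tmul_add]
  | smul r x h => simp only [map_smul, h, TensorProduct.tmul_smul]
  | single u =>
    induction u using Forest.induction with
    | one => rw [← one_def, comul_one, LinearMap.rTensor_tmul, counit_one]
    | mul u v hu hv =>
      rw [← mul_single]
      exact PreHopf.rTensor_counit_mul comul_mul counit_mul hu hv
    | B a u hu =>
      rw [← BL_single, comul_BL, map_add, LinearMap.rTensor_tmul, counit_BL,
        TensorProduct.zero_tmul, zero_add, ← LinearMap.comp_apply, LinearMap.rTensor_comp_lTensor,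
        ← LinearMap.lTensor_comp_rTensor, LinearMap.comp_apply, hu, LinearMap.lTensor_tmul]

theorem lTensor_counit_apply (x : Forest A →₀ K) :
    (treeHopf K A).counit.lTensor _ ((treeHopf K A).comul x) = x ⊗ₜ 1 := by
  induction x using induction_forests with
  | zero => simp
  | add x x' h h' => simp only [map_add, h, h', TensorProduct.add_tmul]
  | smul r x h => simp only [map_smul, h, TensorProduct.smul_tmul']
  | single u =>
    induction u using Forest.induction with
    | one => rw [← one_def, comul_one, LinearMap.lTensor_tmul, counit_one]
    | mul u v hu hv =>
      rw [← mul_single]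
      exact PreHopf.lTensor_counit_mul comul_mul counit_mul hu hv
    | B a u hu =>
      have : (treeHopf K A).counit ∘ₗ BL K a = 0 := LinearMap.ext (counit_BL a)
      rw [← BL_single, comul_BL, map_add, LinearMap.lTensor_tmul, counit_one,
        ← LinearMap.comp_apply, ← LinearMap.lTensor_comp, this, LinearMap.lTensor_zero,
        LinearMap.zero_apply, add_zero]

theorem one_mul (x : Forest A →₀ K) : (treeHopf K A).mul (treeHopf K A).one x = x := by
  induction x using induction_forests with
  | zero => simp
  | add x x' h h' => simp only [map_add, h, h']
  | smul r x h => simp only [map_smul, h]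
  | single u => rw [one_def, mul_single, _root_.one_mul]

theorem mul_comm (x y : Forest A →₀ K) : (treeHopf K A).mul x y = (treeHopf K A).mul y x := by
  induction x using induction_forests with
  | zero => simp
  | add x x' h h' => simp only [map_add, LinearMap.add_apply, h, h']
  | smul r x h => simp only [map_smul, LinearMap.smul_apply, h]
  | single u =>
    induction y using induction_forests with
    | zero => simp
    | add x x' h h' => simp only [map_add, LinearMap.add_apply, h, h']
    | smul r x h => simp only [map_smul, LinearMap.smul_apply, h]
    | single v => rw [mul_single, mul_single, _root_.mul_comm]

theorem mul_assoc (x y z : Forest A →₀ K) : (treeHopf K A).mul ((treeHopf K A).mul x y) z =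
    (treeHopf K A).mul x ((treeHopf K A).mul y z) := by
  induction x using induction_forests with
  | zero => simp
  | add x x' h h' => simp only [map_add, LinearMap.add_apply, h, h']
  | smul r x h => simp only [map_smul, LinearMap.smul_apply, h]
  | single u =>
    induction y using induction_forests with
    | zero => simp
    | add x x' h h' => simp only [map_add, LinearMap.add_apply, h, h']
    | smul r x h => simp only [map_smul, LinearMap.smul_apply, h]
    | single v =>
      induction z using induction_forests with
      | zero => simp
      | add x x' h h' => simp only [map_add, h, h']
      | smul r x h => simp only [map_smul, h]
      | single w => simp only [mul_single, _root_.mul_assoc]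

instance isHopf : (treeHopf K A).IsHopf := by
  classical
  refine PreHopf.isHopf_of_size _ mul_assoc mul_comm one_mul (LinearMap.ext coassocAt)
    (LinearMap.ext rTensor_counit_apply) (LinearMap.ext lTensor_counit_apply) counit_one counit_mul
    comul_one comul_mul Forest.size ?_ ?_
  · intro u hu
    rw [Forest.eq_one_of_size hu, one_def]
  · intro u
    obtain ⟨l, X, rfl⟩ := Forest.exists_cls u
    -- The lower set of all vertices gives `1 ⊗ u`; any other lower set has fewer vertices, as the
    -- size criterion demands of the second factor.
    rw [comul_cls, ← Finset.add_sum_erase _ _ (a := Finset.univ)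
      (Finset.mem_filter.2 ⟨Finset.mem_univ _, fun _ _ _ _ => Finset.mem_univ _⟩)]
    refine ⟨_, ?_, congrArg₂ _ ?_ rfl⟩
    · refine Submodule.sum_mem _ fun W hW => Submodule.subset_span ⟨_, _, ?_, rfl⟩
      rw [size_cls, size_cls]
      have : W ≠ Finset.univ := (Finset.mem_erase.1 hW).1
      have h := Finset.card_lt_card (Finset.ssubset_univ_iff.2 this)
      simpa using h
    · have : IsEmpty {x : Fin l | x ∉ (Finset.univ : Finset (Fin l))} :=
        ⟨fun x => x.2 (Finset.mem_univ _)⟩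
      rw [cls_restrict_univ _ (S := {x | x ∈ Finset.univ}) (by simp),
        cls_eq_one (LForest.restrict _ _), one_def]

end TreeHopf

/-! ### Linear extensions of forests and their words. -/

namespace RForest

theorem restrict_le_iff {V : Type} {X : RForest V} {S : Set V}
    (hS : ∀ x y, X.le y x → x ∈ S → y ∈ S) {v w : S} :
    (X.restrict S).le v w ↔ X.le v w := by
  constructor
  · intro h
    induction h with
    | refl => exact .refl
    | tail _ hp ih => exact ih.tail (restrict_parent_eq_some.1 hp)
  · obtain ⟨w, hw⟩ := w
    intro h
    simp only at h
    induction h with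
    | refl => exact .refl
    | @tail b c _ hp ih =>
      have hb : b ∈ S := hS _ _ (Relation.ReflTransGen.single hp) hw
      exact (ih hb).tail (restrict_parent_eq_some.2 hp)

end RForest

namespace LForest

variable {A : Type*} {V : Type}

/-- `l` lists the elements of `S`, every vertex coming after the vertices above it. -/
def IsListing (X : LForest A V) (S : Finset V) (l : List V) : Prop :=
  l.Pairwise (fun x y => ¬ X.le x y) ∧ ∀ v, v ∈ l ↔ v ∈ S

theorem IsListing.nodup {X : LForest A V} {S : Finset V} {l : List V} (h : X.IsListing S l) :
    l.Nodup := by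
  refine List.Pairwise.imp (fun {x y} hxy hne => ?_) h.1
  subst hne
  exact hxy .refl

theorem finite_isListing [Finite V] (X : LForest A V) (S : Finset V) : {l | X.IsListing S l}.Finite := by
  have := Fintype.ofFinite V
  refine (List.finite_length_le V (Fintype.card V)).subset fun l hl => ?_
  exact List.Nodup.length_le_card (IsListing.nodup hl)

theorem isListing_nil {X : LForest A V} {S : Finset V} : X.IsListing S [] ↔ S = ∅ := by
  simp [IsListing, Finset.eq_empty_iff_forall_notMem]

theorem isListing_cons [DecidableEq V] {X : LForest A V} {S : Finset V} {x : V} {l : List V} :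
    X.IsListing S (x :: l) ↔ (x ∈ S ∧ ∀ y ∈ S, X.le x y → y = x) ∧ X.IsListing (S.erase x) l := by
  simp only [IsListing, List.pairwise_cons, List.mem_cons, Finset.mem_erase]
  constructor
  · rintro ⟨⟨h1, h2⟩, h3⟩
    refine ⟨⟨(h3 x).1 (Or.inl rfl), fun y hy hxy => ?_⟩, h2, fun v => ?_⟩
    · rcases (h3 y).2 hy with h | h
      · exact h
      · exact absurd hxy (h1 y h)
    · constructor
      · intro hv
        exact ⟨fun h => h1 v hv (h ▸ .refl), (h3 v).1 (Or.inr hv)⟩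
      · rintro ⟨hne, hv⟩
        exact ((h3 v).2 hv).resolve_left hne
  · rintro ⟨⟨h1, h2⟩, h3, h4⟩
    refine ⟨⟨fun y hy hxy => ?_, h3⟩, fun v => ?_⟩
    · have := (h4 y).1 hy
      exact this.1 (h2 y this.2 hxy)
    · rw [h4]
      constructor
      · rintro (rfl | h)
        · exact h1
        · exact h.2
      · intro h
        by_cases hv : v = x
        · exact Or.inl hv
        · exact Or.inr ⟨hv, h⟩

variable [Fintype V]

/-- The listings of the elements of `S`. -/
noncomputable def listings (X : LForest A V) (S : Finset V) : Finset (List V) :=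
  (X.finite_isListing S).toFinset

theorem mem_listings {X : LForest A V} {S : Finset V} {l : List V} :
    l ∈ X.listings S ↔ X.IsListing S l := Set.Finite.mem_toFinset _

/-- The words of labels of the listings of `S`. -/
noncomputable def words (K : Type*) [Field K] (X : LForest A V) (S : Finset V) : List A →₀ K :=
  ∑ l ∈ X.listings S, Finsupp.single (l.map X.lab) 1

open QuasiShuffle in
theorem words_apply_cons [DecidableEq V] (K : Type*) [Field K] (X : LForest A V) (S : Finset V)
    (a : A) (w : List A) [DecidablePred fun x => (∀ y ∈ S, X.le x y → y = x) ∧ X.lab x = a] :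
    X.words K S (a :: w) = ∑ x ∈ S with (∀ y ∈ S, X.le x y → y = x) ∧ X.lab x = a,
      X.words K (S.erase x) w := by
  classical
  simp only [words, Finsupp.finsetSum_apply, Finsupp.single_apply, Finset.sum_boole]
  rw [← Nat.cast_sum, ← Finset.card_sigma]
  congr 1
  refine (Finset.card_bij (fun x _ => x.1 :: x.2) ?_ ?_ ?_).symm
  · rintro ⟨x, l⟩ h
    simp only [Finset.mem_sigma, Finset.mem_filter, mem_listings] at h ⊢
    exact ⟨isListing_cons.2 ⟨⟨h.1.1, h.1.2.1⟩, h.2.1⟩, by simp [h.1.2.2, h.2.2]⟩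
  · rintro ⟨x, l⟩ _ ⟨x', l'⟩ _ h
    simp only [List.cons.injEq] at h
    obtain ⟨rfl, rfl⟩ := h
    rfl
  · intro l hl
    simp only [Finset.mem_filter, mem_listings] at hl
    rcases l with _ | ⟨x, l⟩
    · simp at hl
    · obtain ⟨h, h'⟩ := isListing_cons.1 hl.1
      simp only [List.map_cons, List.cons.injEq] at hl
      refine ⟨⟨x, l⟩, ?_, rfl⟩
      simp only [Finset.mem_sigma, Finset.mem_filter, mem_listings]
      exact ⟨⟨h.1, h.2, hl.2.1⟩, h', hl.2.2⟩

theorem words_apply_nil (K : Type*) [Field K] (X : LForest A V) (S : Finset V) [Decidable (S = ∅)] :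
    X.words K S [] = if S = ∅ then 1 else 0 := by
  classical
  simp only [words, Finsupp.finsetSum_apply, Finsupp.single_apply, Finset.sum_boole]
  split_ifs with h
  · have : (X.listings S).filter (fun l => l.map X.lab = []) = {[]} := by
      ext l
      simp only [Finset.mem_filter, mem_listings, List.map_eq_nil_iff, Finset.mem_singleton]
      constructor
      · exact fun h => h.2
      · rintro rfl
        exact ⟨isListing_nil.2 h, rfl⟩
    rw [this]
    simp
  · have : (X.listings S).filter (fun l => l.map X.lab = []) = ∅ := by
      ext l
      simp only [Finset.mem_filter, mem_listings, List.map_eq_nil_iff, Finset.notMem_empty,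
        iff_false]
      rintro ⟨h', rfl⟩
      exact h (isListing_nil.1 h')
    rw [this]
    simp

open Classical in
-- Replaces bijections with an initial segment by lists of vertices, from which a first vertex can
-- be split off; this is the form needed for induction on words.
theorem forestToWords_cls (K : Type*) [Field K] (X : LForest A V) :
    forestToWords K A (Finsupp.single X.cls 1) = X.words K Finset.univ := by
  obtain ⟨e, he⟩ := Forest.exists_isIso_rep_cls X
  simp only [forestToWords, Finsupp.linearCombination_single, one_smul, words]
  refine Finset.sum_bij (fun σ _ => List.ofFn fun i => e.symm (σ i)) ?_ ?_ ?_ ?_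
  · intro σ hσ
    simp only [Finset.mem_filter, Finset.mem_univ, true_and] at hσ
    rw [mem_listings]
    refine ⟨?_, fun v => ?_⟩
    · rw [List.pairwise_ofFn]
      intro i j hij h
      rw [← he.le_iff, Equiv.apply_symm_apply, Equiv.apply_symm_apply] at h
      exact absurd (hσ _ _ h) (not_le.2 hij)
    · simp only [List.mem_ofFn, Finset.mem_univ, iff_true]
      exact ⟨σ.symm (e v), by simp⟩
  · intro σ _ τ _ h
    ext i
    have := congrFun (List.ofFn_injective h) i
    rw [e.symm.injective this]
  · intro l hl
    rw [mem_listings] at hl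
    have hl' : ∀ v, v ∈ l := fun v => (hl.2 v).2 (Finset.mem_univ _)
    have hn : l.length = X.cls.size := by
      rw [← List.toFinset_card_of_nodup hl.nodup, size_cls, Nat.card_eq_fintype_card,
        ← Finset.card_univ]
      congr 1
      ext v
      simp [hl']
    let f := (finCongr hn.symm).trans ((hl.nodup.getEquivOfForallMemList l hl').trans e)
    have hf : ∀ i, e.symm (f i) = l.get (finCongr hn.symm i) := fun i => by simp [f]
    refine ⟨f, ?_, ?_⟩
    · simp only [Finset.mem_filter, Finset.mem_univ, true_and]
      intro i j hij
      by_contra hlt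
      have hp := List.pairwise_iff_get.1 hl.1 (finCongr hn.symm j) (finCongr hn.symm i)
        (by simpa using hlt)
      rw [← hf, ← hf, ← he.le_iff, Equiv.apply_symm_apply, Equiv.apply_symm_apply] at hp
      exact hp hij
    · simp only [hf]
      refine List.ext_get (by simp [hn]) fun i h1 h2 => by simp; rfl
  · intro σ _
    congr 1
    rw [List.map_ofFn]
    congr 1
    funext i
    simp only [Function.comp_apply]
    rw [← (he _).2, Equiv.apply_symm_apply]

/-- A lower set contains the whole path from each of its vertices to a root, so the restricted
forest carries the induced order and has the same listings. For other sets the restricted forest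
could have fewer relations. -/
theorem words_restrict (K : Type*) [Field K] (X : LForest A V) {S : Finset V} (hS : X.IsLower S)
    [Fintype {x | x ∈ S}] : (X.restrict {x | x ∈ S}).words K Finset.univ = X.words K S := by
  have hle : ∀ v w : {x | x ∈ S}, (X.restrict {x | x ∈ S}).le v w ↔ X.le v w :=
    fun v w => RForest.restrict_le_iff (S := {x | x ∈ S}) hS
  refine Finset.sum_bij (fun l _ => l.map Subtype.val) ?_ ?_ ?_ ?_
  · intro l hl
    rw [mem_listings] at hl ⊢
    refine ⟨?_, fun v => ?_⟩
    · rw [List.pairwise_map]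
      exact hl.1.imp fun h h' => h ((hle _ _).2 h')
    · simp only [List.mem_map, hl.2, Finset.mem_univ, true_and]
      exact ⟨fun ⟨x, hx⟩ => hx ▸ x.2, fun h => ⟨⟨v, h⟩, rfl⟩⟩
  · intro l _ l' _ h
    exact List.map_injective_iff.2 Subtype.val_injective h
  · intro l hl
    rw [mem_listings] at hl
    have h1 : ∀ v ∈ l, v ∈ {x | x ∈ S} := fun v hv => (hl.2 v).1 hv
    obtain ⟨l, rfl⟩ : ∃ l' : List {x | x ∈ S}, l'.map Subtype.val = l :=
      ⟨l.attachWith _ h1, by simp⟩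
    refine ⟨l, ?_, rfl⟩
    rw [mem_listings]
    refine ⟨?_, fun v => ?_⟩
    · have := hl.1
      rw [List.pairwise_map] at this
      exact this.imp fun h h' => h ((hle _ _).1 h')
    · simp only [Finset.mem_univ, iff_true]
      have := (hl.2 v).2 v.2
      simpa using this
  · intro l _
    rw [List.map_map]
    rfl

theorem forestToWords_restrict (K : Type*) [Field K] (X : LForest A V) {S : Finset V}
    (hS : X.IsLower S) : forestToWords K A (Finsupp.single (X.restrict {x | x ∈ S}).cls 1) =
      X.words K S := by
  classical
  rw [forestToWords_cls, words_restrict K X hS]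

end LForest

/-! ### One-vertex trees and one-letter words. -/

namespace Forest

open LForest

variable {A : Type*} {V : Type} [Finite V]

theorem cls_eq_B_one_iff {X : LForest A V} {a : A} :
    X.cls = B a 1 ↔ ∃ x, (∀ y, y = x) ∧ X.lab x = a := by
  constructor
  · rw [← cls_eq_one (LForest.empty A Empty), B_cls, cls_eq_cls_iff]
    rintro ⟨e, he⟩
    refine ⟨e.symm none, fun y => ?_, ?_⟩
    · rw [Equiv.eq_symm_apply]
      rcases e y with _ | z
      · rfl
      · exact z.elim
    · rw [(he.symm none).2]
      rfl
  · rintro ⟨x, hx, rfl⟩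
    have hr : X.parent x = none := by
      by_contra h
      obtain ⟨p, hp⟩ := Option.ne_none_iff_exists'.1 h
      exact X.wf.irrefl.irrefl x (by rw [hx p] at hp; exact hp)
    have : IsEmpty {v | v ≠ x} := ⟨fun v => v.2 (hx v)⟩
    rw [cls_eq_B hr (fun v _ => hx v), cls_eq_one]

theorem mul_eq_B_one_iff {u v : Forest A} {a : A} :
    u * v = B a 1 ↔ (u = B a 1 ∧ v = 1) ∨ (u = 1 ∧ v = B a 1) := by
  constructor
  · intro h
    have hs := congrArg size h
    simp only [size_mul, size_B, size_one] at hs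
    by_cases hu : u.size = 0
    · have := eq_one_of_size hu
      subst this
      exact Or.inr ⟨rfl, by rwa [one_mul] at h⟩
    · have := eq_one_of_size (u := v) (by omega)
      subst this
      exact Or.inl ⟨by rwa [mul_one] at h, rfl⟩
  · rintro (⟨rfl, rfl⟩ | ⟨rfl, rfl⟩) <;> simp

theorem B_ne_one (a : A) (u : Forest A) : B a u ≠ 1 := fun h => by
  simpa using congrArg size h

end Forest

/-- The trivial Hoffman pairing. -/
def HoffmanPairing.trivial (A : Type*) (deg : A → ℕ) : HoffmanPairing A deg where
  pair _ _ := none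
  pair_none _ := rfl
  pair_comm _ _ := rfl
  pair_assoc _ _ _ := rfl
  deg_pair _ _ _ h := by cases h

namespace QuasiShuffle

variable {K A : Type*} [Field K] {deg : A → ℕ} (p : HoffmanPairing A deg)

open Classical in
theorem consL_apply_singleton (a b : A) (x : List A →₀ K) :
    consL K b x [a] = if a = b then x [] else 0 := by
  have h := LinearMap.congr_fun (lapply_cons_consL (K := K) a b []) x
  simp only [LinearMap.comp_apply, Finsupp.lapply_apply] at h
  rw [h]
  split_ifs <;> rfl

theorem mul_apply_nil (x y : List A →₀ K) :
    (quasiShuffleHopf K p).mul x y [] = x [] * y [] := by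
  rw [← counit_apply p, counit_mul, counit_apply, counit_apply]

/-- The words of length one in a product, for the trivial pairing. -/
theorem mul_apply_singleton (hp : ∀ a b, p.pair (some a) (some b) = none) (a : A)
    (x y : List A →₀ K) :
    (quasiShuffleHopf K p).mul x y [a] = x [a] * y [] + x [] * y [a] := by
  classical
  induction x using induction_consL with
  | zero => simp
  | add f g hf hg => simp only [map_add, LinearMap.add_apply, Finsupp.add_apply, hf, hg]; ring
  | smul r f hf =>
    simp only [map_smul, LinearMap.smul_apply, Finsupp.smul_apply, hf, smul_eq_mul]; ring
  | nil => rw [nil_mul]; simp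
  | consL b x hx =>
    clear hx
    induction y using induction_consL with
    | zero => simp
    | add f g hf hg => simp only [map_add, Finsupp.add_apply, hf, hg]; ring
    | smul r f hf => simp only [map_smul, Finsupp.smul_apply, hf, smul_eq_mul]; ring
    | nil => rw [mul_nil]; simp
    | consL c y hy =>
      have h0 : ∀ (b : A) (x : List A →₀ K), consL K b x [] = 0 := fun b x =>
        LinearMap.congr_fun (lapply_nil_consL (K := K) b) x
      rw [mul_consL_consL, hp]
      simp only [Finsupp.add_apply, consL_apply_singleton, mul_apply_nil, h0]
      simp

end QuasiShuffle

/-! ### The map `π` as a Hopf morphism onto the shuffle algebra. -/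

namespace TreeHopf

open LForest QuasiShuffle

variable {K A : Type*} [Field K] {V : Type} [Fintype V]

theorem forestToWords_apply_nil (x : Forest A →₀ K) :
    forestToWords K A x [] = (treeHopf K A).counit x := by
  classical
  induction x using induction_forests with
  | zero => simp
  | add x x' h h' => simp only [map_add, Finsupp.add_apply, h, h']
  | smul r x h => simp only [map_smul, Finsupp.smul_apply, h]
  | single u =>
    obtain ⟨n, X, rfl⟩ := Forest.exists_cls u
    rw [forestToWords_cls, words_apply_nil, counit_single]
    congr 1
    rw [Finset.univ_eq_empty_iff, eq_iff_iff]
    constructor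
    · exact fun h => cls_eq_one X
    · intro h
      have := congrArg Forest.size h
      rw [size_cls, Forest.size_one, Nat.card_eq_fintype_card] at this
      exact Fintype.card_eq_zero_iff.1 this

/-- A listing starts with a maximal vertex, and the remaining vertices form a lower set whose
complement is that vertex alone. The coefficient of `B a 1` in the first tensor factor of the
coproduct selects exactly the lower sets with such a complement labelled `a`. -/
theorem forestToWords_apply_cons (a : A) (w : List A) (x : Forest A →₀ K) :
    forestToWords K A x (a :: w) = LinearMap.mul' K K (TensorProduct.map
      (Finsupp.lapply (Forest.B a 1)) (Finsupp.lapply w ∘ₗ forestToWords K A)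
        ((treeHopf K A).comul x)) := by
  classical
  induction x using induction_forests with
  | zero => simp
  | add x x' h h' => simp only [map_add, Finsupp.add_apply, h, h']
  | smul r x h => simp only [map_smul, Finsupp.smul_apply, h]
  | single u =>
    obtain ⟨n, X, rfl⟩ := Forest.exists_cls u
    rw [forestToWords_cls, words_apply_cons, comul_cls, map_sum, map_sum]
    simp only [TensorProduct.map_tmul, LinearMap.mul'_apply, LinearMap.comp_apply,
      Finsupp.lapply_apply, Finsupp.single_apply]
    simp only [ite_mul, _root_.one_mul, zero_mul]
    rw [← Finset.sum_filter]
    have hmem : ∀ W : Finset (Fin n),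
        W ∈ (Finset.univ.filter X.IsLower).filter
          (fun W => (X.restrict {x | x ∉ W}).cls = Forest.B a 1) ↔
        ∃ x, (∀ y, X.le x y → y = x) ∧ X.lab x = a ∧ Finset.univ.erase x = W := by
      intro W
      simp only [Finset.mem_filter, Finset.mem_univ, true_and, Forest.cls_eq_B_one_iff]
      constructor
      · rintro ⟨hW, ⟨x, hx⟩, hu, ha⟩
        have hu' : ∀ y, y ∉ W → y = x := fun y hy => congrArg Subtype.val (hu ⟨y, hy⟩)
        refine ⟨x, fun y hxy => hu' y fun hy => hx (hW _ _ hxy hy), ha, ?_⟩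
        ext y
        simp only [Finset.mem_erase, Finset.mem_univ, and_true]
        exact ⟨fun h => not_not.1 fun hy => h (hu' y hy), fun hy h => hx (h ▸ hy)⟩
      · rintro ⟨x, hx, ha, rfl⟩
        refine ⟨fun y z hzy hy => ?_, ⟨x, by simp⟩, fun y => ?_, ha⟩
        · simp only [Finset.mem_erase, Finset.mem_univ, and_true] at hy ⊢
          rintro rfl
          exact hy (hx y hzy)
        · refine Subtype.ext (not_not.1 fun h => y.2 ?_)
          simpa using h
    refine Finset.sum_bij (fun x _ => Finset.univ.erase x) ?_ ?_ ?_ ?_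
    · intro x hx
      rw [hmem]
      simp only [Finset.mem_filter, Finset.mem_univ, true_and, true_implies] at hx
      exact ⟨x, hx.1, hx.2, rfl⟩
    · intro x _ y _ h
      by_contra hne
      have : x ∈ Finset.univ.erase y := by simp [hne]
      rw [← h] at this
      simp at this
    · intro W hW
      obtain ⟨x, hx, ha, rfl⟩ := (hmem W).1 hW
      exact ⟨x, by simpa using ⟨hx, ha⟩, rfl⟩
    · intro x hx
      rw [forestToWords_restrict]
      have := (hmem (Finset.univ.erase x)).2 ⟨x, by simpa using hx⟩
      exact (Finset.mem_filter.1 (Finset.mem_filter.1 this).1).2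

theorem forestToWords_apply_singleton (a : A) (x : Forest A →₀ K) :
    forestToWords K A x [a] = x (Forest.B a 1) := by
  have h : Finsupp.lapply [] ∘ₗ forestToWords K A = (treeHopf K A).counit :=
    LinearMap.ext forestToWords_apply_nil
  have e : TensorProduct.map (Finsupp.lapply (R := K) (M := K) (Forest.B a 1))
      (treeHopf K A).counit = TensorProduct.map (Finsupp.lapply (Forest.B a 1)) LinearMap.id ∘ₗ
        (treeHopf K A).counit.lTensor _ := by
    rw [LinearMap.lTensor, ← TensorProduct.map_comp]
    rfl
  rw [forestToWords_apply_cons, h, e, LinearMap.comp_apply, lTensor_counit_apply]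
  simp

/-- A disjoint union is a single vertex only if one part is and the other is empty. The coefficient
of a one-vertex tree is thus an infinitesimal character, as is the coefficient of a letter for the
shuffle product. -/
theorem mul_apply_B_one (a : A) (x y : Forest A →₀ K) :
    (treeHopf K A).mul x y (Forest.B a 1) = x (Forest.B a 1) * (treeHopf K A).counit y +
      (treeHopf K A).counit x * y (Forest.B a 1) := by
  classical
  induction x using induction_forests with
  | zero => simp
  | add x x' h h' => simp only [map_add, LinearMap.add_apply, Finsupp.add_apply, h, h']; ring
  | smul r x h =>
    simp only [map_smul, LinearMap.smul_apply, Finsupp.smul_apply, h, smul_eq_mul]; ring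
  | single u =>
    induction y using induction_forests with
    | zero => simp
    | add x x' h h' => simp only [map_add, Finsupp.add_apply, h, h']; ring
    | smul r x h => simp only [map_smul, Finsupp.smul_apply, h, smul_eq_mul]; ring
    | single v =>
      rw [mul_single, counit_single, counit_single, Finsupp.single_apply, Finsupp.single_apply,
        Finsupp.single_apply, Forest.mul_eq_B_one_iff]
      have h1 := Forest.B_ne_one a 1
      by_cases hu : u = 1
      · subst hu
        by_cases hv : v = 1
        · subst hv; simp [h1.symm]
        · simp [hv, h1.symm]
      · by_cases hv : v = 1
        · subst hv; simp [hu, h1.symm]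
        · simp [hu, hv]

variable {deg : A → ℕ} (p : HoffmanPairing A deg)

/-- `π` as a morphism of coalgebras to the shuffle algebra. -/
noncomputable def wordsCoalgHom : (treeHopf K A).Carrier →ₗc[K] (quasiShuffleHopf K p).Carrier where
  toLinearMap := forestToWords K A
  counit_comp := LinearMap.ext fun x => (counit_apply p _).trans (forestToWords_apply_nil x)
  map_comp_comul := by
    refine @comul_eq_of_coeff K A _ deg p (treeHopf K A).Carrier
      (PreHopf.instAddCommGroupCarrier _) (PreHopf.instModuleCarrier _)
      (PreHopf.instCoalgebraCarrier _) (forestToWords K A)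
      (LinearMap.ext forestToWords_apply_nil) fun a => ⟨Finsupp.lapply (M := K) (R := K)
        (Forest.B a 1), fun w => LinearMap.ext fun x => ?_⟩
    exact forestToWords_apply_cons a w x

/-- No shuffling of linear extensions is needed: `π` is a coalgebra morphism, so it suffices to
compare one-letter coefficients, and these are coefficients of one-vertex trees. -/
theorem forestToWords_mul (hp : ∀ a b, p.pair (some a) (some b) = none) (x y : Forest A →₀ K) :
    forestToWords K A ((treeHopf K A).mul x y) =
      (quasiShuffleHopf K p).mul (forestToWords K A x) (forestToWords K A y) := by
  refine map_mul_of_letters p (wordsCoalgHom p) (fun a x y => ?_) x y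
  refine (forestToWords_apply_singleton a _).trans (Eq.trans ?_
    (mul_apply_singleton p hp a (forestToWords K A x) (forestToWords K A y)).symm)
  have h := mul_apply_B_one (K := K) a x y
  rwa [← forestToWords_apply_singleton a x, ← forestToWords_apply_singleton a y,
    ← forestToWords_apply_nil x, ← forestToWords_apply_nil y] at h

theorem forestToWords_one : forestToWords K A (treeHopf K A).one = Finsupp.single [] 1 := by
  classical
  rw [one_def, ← cls_eq_one (LForest.empty A Empty), forestToWords_cls]
  have : (LForest.empty A Empty).listings Finset.univ = {[]} := by
    ext l
    rw [mem_listings, Finset.mem_singleton]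
    constructor
    · intro h
      rcases l with _ | ⟨x, _⟩
      · rfl
      · exact x.elim
    · rintro rfl
      exact isListing_nil.2 rfl
  rw [words, this]
  simp

theorem isHom_forestToWords (hp : ∀ a b, p.pair (some a) (some b) = none) :
    PreHopf.IsHom (treeHopf K A) (quasiShuffleHopf K p) (forestToWords K A) where
  map_one := forestToWords_one
  map_mul := forestToWords_mul p hp
  map_comul x := (LinearMap.congr_fun (wordsCoalgHom (K := K) p).map_comp_comul x).symm
  map_counit x := (counit_apply p _).trans (forestToWords_apply_nil x)

/-- Adding a letter at the end of a word. -/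
noncomputable def snocL (K : Type*) [Field K] (a : A) : (List A →₀ K) →ₗ[K] (List A →₀ K) :=
  Finsupp.lmapDomain K K fun w => w ++ [a]

@[simp] theorem snocL_single (a : A) (w : List A) (r : K) :
    snocL K a (Finsupp.single w r) = Finsupp.single (w ++ [a]) r := by
  simp [snocL]

/-- The new root lies below every vertex, so it is listed last; nothing else about the order
changes. -/
theorem _root_.LForest.isListing_addRoot {X : LForest A V} {a : A} {l : List (Option V)} :
    (X.addRoot a).IsListing Finset.univ l ↔
      ∃ l', X.IsListing Finset.univ l' ∧ l'.map some ++ [none] = l := by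
  have hnone : ∀ v, (X.addRoot a).le none v := by
    intro v
    obtain ⟨r, hr, hrv⟩ := (X.addRoot a).exists_root_le v
    rcases r with _ | r
    · exact hrv
    · cases hr
  have hsome : ∀ {v w}, (X.addRoot a).le (some v) (some w) ↔ X.le v w := by
    intro v w
    constructor
    · intro h
      generalize hw : some w = w' at h
      induction h generalizing w with
      | refl => cases hw; exact .refl
      | @tail b c hb hp ih =>
        subst hw
        rcases b with _ | b
        · exact absurd (RForest.eq_of_le_root hb rfl) (by simp)
        · refine (ih rfl).tail ?_
          simpa [LForest.addRoot, RForest.addRoot] using hp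
    · intro h
      induction h with
      | refl => exact .refl
      | tail _ hp ih => exact ih.tail (by simp [LForest.addRoot, RForest.addRoot, hp])
  constructor
  · rintro ⟨h1, h2⟩
    obtain ⟨s, t, rfl⟩ := List.append_of_mem ((h2 none).2 (Finset.mem_univ _))
    rw [List.pairwise_append, List.pairwise_cons] at h1
    obtain ⟨h3, ⟨h4, h5⟩, h6⟩ := h1
    have ht : t = [] := by
      rw [List.eq_nil_iff_forall_not_mem]
      exact fun v hv => h4 v hv (hnone v)
    subst ht
    have hs : ∀ v ∈ s, v ≠ none := by
      rintro v hv rfl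
      exact h6 none hv none (by simp) .refl
    obtain ⟨l', rfl⟩ : ∃ l' : List V, l'.map some = s := by
      clear h2 h3 h4 h5 h6
      induction s with
      | nil => exact ⟨[], rfl⟩
      | cons v s ih =>
        obtain ⟨l', rfl⟩ := ih fun v hv => hs v (List.mem_cons_of_mem _ hv)
        obtain ⟨x, hx⟩ := Option.ne_none_iff_exists.1 (hs v List.mem_cons_self)
        exact ⟨x :: l', by simp [hx]⟩
    refine ⟨l', ⟨?_, fun v => ?_⟩, rfl⟩
    · rw [List.pairwise_map] at h3
      exact h3.imp fun h h' => h (hsome.2 h')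
    · have := (h2 (some v)).2 (Finset.mem_univ _)
      simpa using this
  · rintro ⟨l', ⟨h1, h2⟩, rfl⟩
    refine ⟨?_, ?_⟩
    · rw [List.pairwise_append, List.pairwise_map]
      refine ⟨h1.imp fun h h' => h (hsome.1 h'), List.pairwise_singleton _ _, ?_⟩
      intro x hx y hy h
      obtain ⟨v, -, rfl⟩ := List.mem_map.1 hx
      rw [List.mem_singleton] at hy
      subst hy
      exact absurd (RForest.eq_of_le_root h rfl) (by simp)
    · rintro (_ | v)
      · simp
      · simp [h2]

theorem forestToWords_BL (a : A) (x : Forest A →₀ K) :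
    forestToWords K A (BL K a x) = snocL K a (forestToWords K A x) := by
  classical
  induction x using induction_forests with
  | zero => simp
  | add x x' h h' => simp only [map_add, h, h']
  | smul r x h => simp only [map_smul, h]
  | single u =>
    obtain ⟨n, X, rfl⟩ := Forest.exists_cls u
    rw [BL_single, Forest.B_cls, forestToWords_cls, forestToWords_cls, words, words, map_sum]
    refine (Finset.sum_bij (fun l _ => l.map some ++ [none]) ?_ ?_ ?_ ?_).symm
    · intro l hl
      rw [mem_listings] at hl ⊢
      exact isListing_addRoot.2 ⟨l, hl, rfl⟩
    · intro l _ l' _ h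
      exact List.map_injective_iff.2 (Option.some_injective _) (List.append_cancel_right h)
    · intro l hl
      rw [mem_listings] at hl
      obtain ⟨l', h, h'⟩ := isListing_addRoot.1 hl
      exact ⟨l', mem_listings.2 h, h'⟩
    · intro l _
      rw [snocL_single, List.map_append, List.map_map]
      rfl

/-- Words are built from the empty word by appending letters, and appending `a` to an image is
achieved by `B⁺_a` on a preimage. -/
theorem forestToWords_surjective : Function.Surjective (forestToWords K A) := by
  intro x
  induction x using induction_words with
  | zero => exact ⟨0, map_zero _⟩
  | add f g hf hg =>
    obtain ⟨x, rfl⟩ := hf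
    obtain ⟨y, rfl⟩ := hg
    exact ⟨x + y, map_add _ _ _⟩
  | smul r f hf =>
    obtain ⟨x, rfl⟩ := hf
    exact ⟨r • x, map_smul _ _ _⟩
  | single w =>
    induction w using List.reverseRecOn with
    | nil => exact ⟨_, forestToWords_one⟩
    | append_singleton w a ih =>
      obtain ⟨x, hx⟩ := ih
      exact ⟨BL K a x, by rw [forestToWords_BL, hx, snocL_single]⟩

end TreeHopf

/-! ### Triangular endomorphisms. -/

/-- A linear endomorphism which is triangular for a transitive well-founded relation on a basis,
with nonzero diagonal entries, is bijective. -/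
theorem Finsupp.bijective_of_triangular {K ι : Type*} [Field K] (f : (ι →₀ K) →ₗ[K] (ι →₀ K))
    (r : ι → ι → Prop) (hr : WellFounded r) (ht : ∀ i j k, r i j → r j k → r i k)
    (h1 : ∀ i, f (single i 1) i ≠ 0)
    (h2 : ∀ i j, f (single i 1) j ≠ 0 → j = i ∨ r j i) : Function.Bijective f := by
  classical
  constructor
  · rw [injective_iff_map_eq_zero]
    intro x hx
    by_contra hne
    -- At an element of the support below no other element of the support only the diagonal entry
    -- contributes, so the value of `f x` there is nonzero.
    obtain ⟨i, hi, hmax⟩ : ∃ i ∈ x.support, ∀ j ∈ x.support, ¬ r i j := by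
      have hirr : ∀ i, ¬ r i i := fun i => hr.irrefl.irrefl i
      have : ∀ s : Finset ι, s.Nonempty → ∃ i ∈ s, ∀ j ∈ s, ¬ r i j := by
        intro s hs
        induction hs using Finset.Nonempty.cons_induction with
        | singleton a => exact ⟨a, by simp, by simpa using hirr a⟩
        | cons a s ha hs ih =>
          obtain ⟨i, hi, h⟩ := ih
          by_cases hia : r i a
          · refine ⟨a, Finset.mem_cons_self _ _, fun j hj haj => ?_⟩
            rcases Finset.mem_cons.1 hj with rfl | hj
            · exact hirr _ haj
            · exact h j hj (ht _ _ _ hia haj)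
          · refine ⟨i, Finset.mem_cons_of_mem hi, fun j hj => ?_⟩
            rcases Finset.mem_cons.1 hj with rfl | hj
            · exact hia
            · exact h j hj
      exact this _ (Finsupp.support_nonempty_iff.2 hne)
    have hx' : f x i = x i * f (single i 1) i := by
      conv_lhs => rw [← Finsupp.sum_single x]
      rw [Finsupp.sum, map_sum, Finsupp.finsetSum_apply, Finset.sum_eq_single i]
      · rw [← mul_one (x i), ← smul_eq_mul (x i) 1, ← Finsupp.smul_single, map_smul,
          Finsupp.smul_apply, smul_eq_mul, smul_eq_mul, mul_one]
      · intro j hj hji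
        rw [← mul_one (x j), ← smul_eq_mul (x j) 1, ← Finsupp.smul_single, map_smul,
          Finsupp.smul_apply, smul_eq_mul]
        by_contra h
        rcases h2 j i (right_ne_zero_of_mul h) with h | h
        · exact hji h.symm
        · exact hmax j hj h
      · intro h
        exact absurd hi h
    rw [hx] at hx'
    exact mul_ne_zero (Finsupp.mem_support_iff.1 hi) (h1 i) hx'.symm
  -- By well-founded induction: `f` of a basis vector differs from its diagonal part by a
  -- combination of smaller basis vectors, which already lie in the range.
  · have key : ∀ i, single i 1 ∈ LinearMap.range f := by
      intro i
      induction i using hr.induction with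
      | _ i ih =>
        have hlow : f (single i 1) - f (single i 1) i • single i 1 ∈ LinearMap.range f := by
          rw [← Finsupp.sum_single (f (single i 1) - f (single i 1) i • single i 1)]
          refine Submodule.sum_mem _ fun j hj => ?_
          rw [← Finsupp.smul_single_one]
          refine Submodule.smul_mem _ _ (ih j ?_)
          have hj := Finsupp.mem_support_iff.1 hj
          have hji : j ≠ i := by
            rintro rfl
            simp at hj
          refine (h2 i j fun h => hj ?_).resolve_left hji
          simp [h, hji.symm]
        have h3 := Submodule.sub_mem _ (LinearMap.mem_range_self f (single i 1)) hlow
        rw [sub_sub_cancel] at h3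
        have h4 := Submodule.smul_mem _ (f (single i 1) i)⁻¹ h3
        rwa [smul_smul, inv_mul_cancel₀ (h1 i), one_smul] at h4
    intro y
    rw [← LinearMap.mem_range, ← Finsupp.sum_single y]
    refine Submodule.sum_mem _ fun j _ => ?_
    rw [← Finsupp.smul_single_one]
    exact Submodule.smul_mem _ _ (key j)

/-! ### Iterated Hoffman pairings. -/

namespace HoffmanPairing

variable {A : Type*} {deg : A → ℕ} (p : HoffmanPairing A deg)

theorem none_pair (o : Option A) : p.pair none o = none := by
  rw [p.pair_comm, p.pair_none]

/-- The iterated pairing of the letters of a word. -/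
def fold : List A → Option A
  -- The empty word gets the value zero, so a one-letter word needs its own clause below: pairing
  -- with zero would annihilate it.
  | [] => none
  | a :: w => if w = [] then some a else p.pair (some a) (fold w)

@[simp] theorem fold_nil : p.fold [] = none := rfl

@[simp] theorem fold_singleton (a : A) : p.fold [a] = some a := by simp [fold]

theorem fold_cons (a : A) {w : List A} (hw : w ≠ []) :
    p.fold (a :: w) = p.pair (some a) (p.fold w) := by
  rw [fold, if_neg hw]

theorem fold_append {u v : List A} (hu : u ≠ []) (hv : v ≠ []) :
    p.fold (u ++ v) = p.pair (p.fold u) (p.fold v) := by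
  induction u with
  | nil => exact absurd rfl hu
  | cons a u ih =>
    by_cases h : u = []
    · subst h
      simp [fold_cons p a hv]
    · rw [List.cons_append, fold_cons p a h, fold_cons p a (by simp [h]), ih h, p.pair_assoc]

/-- A consequence of commutativity and associativity of the pairing. It makes the one-letter
coefficients of the exponential symmetric functions of words, so that they can be evaluated on a
shuffle product by counting. -/
theorem fold_perm {u v : List A} (h : u.Perm v) : p.fold u = p.fold v := by
  induction h with
  | nil => rfl
  | @cons a u v h ih =>
    by_cases hu : u = []
    · subst hu
      rw [h.nil_eq]
    · have hv : v ≠ [] := fun hv => hu (by subst hv; exact h.eq_nil)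
      rw [fold_cons p a hu, fold_cons p a hv, ih]
  | swap a b w =>
    by_cases hw : w = []
    · subst hw
      simp [fold_cons, p.pair_comm]
    · rw [fold_cons p b (w := a :: w) (by simp), fold_cons p a (w := b :: w) (by simp),
        fold_cons p a hw, fold_cons p b hw, ← p.pair_assoc, ← p.pair_assoc, p.pair_comm (some a)]
  | trans _ _ h h' => exact h.trans h'

end HoffmanPairing

/-! ### Hoffman's exponential. -/

namespace QuasiShuffle

variable {K A : Type*} [Field K] {deg : A → ℕ} (p : HoffmanPairing A deg)

theorem consO_apply_nil (o : Option A) (x : List A →₀ K) : consO K o x [] = 0 := by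
  cases o with
  | none => simp
  | some a => exact LinearMap.congr_fun (lapply_nil_consL (K := K) a) x

open Classical in
theorem consL_apply_cons (a b : A) (w : List A) (x : List A →₀ K) :
    consL K a x (b :: w) = if a = b then x w else 0 := by
  have h := LinearMap.congr_fun (lapply_cons_consL (K := K) b a w) x
  simp only [LinearMap.comp_apply, Finsupp.lapply_apply] at h
  rw [h]
  by_cases hab : a = b
  · simp [hab]
  · simp [hab, Ne.symm hab]

open Classical in
theorem consO_apply_cons (o : Option A) (b : A) (w : List A) (x : List A →₀ K) :
    consO K o x (b :: w) = if o = some b then x w else 0 := by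
  cases o with
  | none => simp
  | some a => simp [consL_apply_cons]

/-- The value on a word of Hoffman's exponential. -/
noncomputable def expWord (K : Type*) [Field K] : List A → (List A →₀ K)
  | [] => Finsupp.single [] 1
  -- The first block consists of `i + 1` letters, is contracted to at most one letter, and has
  -- weight `1 / (i + 1)!`; the rest of the word is treated recursively.
  | a :: w => ∑ i ∈ Finset.range (w.length + 1),
      ((i + 1).factorial : K)⁻¹ • consO K (p.fold ((a :: w).take (i + 1))) (expWord K (w.drop i))
termination_by w => w.length
decreasing_by simp only [List.length_drop, List.length_cons]; omega

/-- Hoffman's exponential, from the shuffle algebra to the quasi-shuffle algebra. -/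
noncomputable def expL (K : Type*) [Field K] : (List A →₀ K) →ₗ[K] (List A →₀ K) :=
  Finsupp.linearCombination K (expWord p K)

theorem expL_single (w : List A) : expL p K (Finsupp.single w 1) = expWord p K w := by
  simp [expL]

open Classical in
/-- The coefficients of words of length one in Hoffman's exponential. -/
noncomputable def expLetter (K : Type*) [Field K] (c : A) (w : List A) : K :=
  if p.fold w = some c then ((w.length).factorial : K)⁻¹ else 0

theorem expWord_apply_nil (w : List A) [Decidable (w = [])] :
    expWord p K w [] = if w = [] then 1 else 0 := by
  cases w with
  | nil => simp [expWord]
  | cons a w => simp [expWord, consO_apply_nil, Finsupp.finsetSum_apply]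

/-- The empty first block may be included, since its fold is zero. The sum then has the shape of the
deconcatenation coproduct and exhibits the coefficients of the exponential as convolution products.
-/
theorem expWord_apply_cons (c : A) (v w : List A) : expWord p K w (c :: v) =
    ∑ i ∈ Finset.range (w.length + 1),
      expLetter p K c (w.take i) * expWord p K (w.drop i) v := by
  classical
  cases w with
  | nil => simp [expWord, expLetter]
  | cons a w =>
    rw [Finset.sum_range_succ', expWord]
    simp only [List.take_zero, expLetter, HoffmanPairing.fold_nil, List.drop_succ_cons,
      Finsupp.finsetSum_apply, Finsupp.smul_apply, consO_apply_cons, smul_eq_mul]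
    simp only [reduceCtorEq, if_false, zero_mul, add_zero, List.length_cons]
    refine Finset.sum_congr rfl fun i hi => ?_
    have hi := Finset.mem_range.1 hi
    have hl : ((a :: w).take (i + 1)).length = i + 1 := by simp; omega
    rw [hl]
    split_ifs <;> simp

theorem expWord_apply_singleton (c : A) (w : List A) :
    expWord p K w [c] = expLetter p K c w := by
  classical
  rw [expWord_apply_cons, Finset.sum_range_succ, Finset.sum_eq_zero]
  · simp [expWord_apply_nil]
  · intro i hi
    have hi := Finset.mem_range.1 hi
    rw [expWord_apply_nil, if_neg, mul_zero]
    rw [List.drop_eq_nil_iff]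
    omega

theorem expL_apply_nil (x : List A →₀ K) : expL p K x [] = x [] := by
  classical
  induction x using induction_words with
  | zero => simp
  | add f g hf hg => simp only [map_add, Finsupp.add_apply, hf, hg]
  | smul r f hf => simp only [map_smul, Finsupp.smul_apply, hf]
  | single w => rw [expL_single, expWord_apply_nil, Finsupp.single_apply]

variable (q : HoffmanPairing A deg)

theorem expL_apply_cons (c : A) (v : List A) (x : List A →₀ K) : expL p K x (c :: v) =
    LinearMap.mul' K K (TensorProduct.map (Finsupp.linearCombination K (expLetter p K c))
      (Finsupp.lapply v ∘ₗ expL p K) ((quasiShuffleHopf K q).comul x)) := by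
  induction x using induction_words with
  | zero => simp
  | add f g hf hg => simp only [map_add, Finsupp.add_apply, hf, hg]
  | smul r f hf => simp only [map_smul, Finsupp.smul_apply, hf]
  | single w =>
    rw [comul_single, map_sum, map_sum, expL_single, expWord_apply_cons]
    refine Finset.sum_congr rfl fun i _ => ?_
    simp [expL_single]

/-- Hoffman's exponential as a morphism of coalgebras. -/
noncomputable def expCoalgHom :
    (quasiShuffleHopf K q).Carrier →ₗc[K] (quasiShuffleHopf K p).Carrier where
  toLinearMap := expL p K
  counit_comp := LinearMap.ext fun x =>
    (counit_apply p _).trans ((expL_apply_nil p x).trans (counit_apply q x).symm)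
  map_comp_comul := by
    refine @comul_eq_of_coeff K A _ deg p (quasiShuffleHopf K q).Carrier
      (PreHopf.instAddCommGroupCarrier _) (PreHopf.instModuleCarrier _)
      (PreHopf.instCoalgebraCarrier _) (expL p K)
      (LinearMap.ext fun x => (expL_apply_nil p x).trans (counit_apply q x).symm)
      fun a => ⟨Finsupp.linearCombination K (expLetter p K a), fun w => LinearMap.ext fun x => ?_⟩
    exact expL_apply_cons p q a w x

/-- The value of a symmetric function of words on a shuffle product. -/
theorem linearCombination_shuffle (hq : ∀ a b, q.pair (some a) (some b) = none)
    (F : List A → K) (hF : ∀ u v, List.Perm u v → F u = F v) (u v : List A) :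
    Finsupp.linearCombination K F (quasiShuffle K q.pair u v) =
      ((u.length + v.length).choose u.length : K) * F (u ++ v) := by
  induction hn : u.length + v.length using Nat.strong_induction_on generalizing u v F with
  | _ n ih =>
    rcases u with _ | ⟨a, u⟩
    · simp [quasiShuffle]
    rcases v with _ | ⟨b, v⟩
    · simp only [quasiShuffle, List.length_nil, List.append_nil] at hn ⊢
      subst hn
      simp
    · have hc : ∀ (a : A) (x : List A →₀ K), Finsupp.linearCombination K F
          (x.mapDomain (List.cons a)) = Finsupp.linearCombination K (fun w => F (a :: w)) x := by
        intro a x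
        rw [Finsupp.linearCombination_mapDomain]
        rfl
      simp only [List.length_cons] at hn
      rw [quasiShuffle, hq, map_add, map_add, hc, hc,
        ih _ (by simp; omega) (fun w => F (a :: w)) (fun u v h => hF _ _ (h.cons a)) u (b :: v) rfl,
        ih _ (by simp; omega) (fun w => F (b :: w)) (fun u v h => hF _ _ (h.cons b)) (a :: u) v rfl,
        hF (b :: (a :: u ++ v)) (a :: u ++ b :: v) List.perm_middle.symm]
      subst hn
      -- Pascal's rule, for the two possible origins of the first letter of a shuffle.
      have : (u.length + 1 + (v.length + 1)).choose (u.length + 1) =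
          (u.length + (v.length + 1)).choose u.length +
            (u.length + 1 + v.length).choose (u.length + 1) := by
        rw [show u.length + 1 + (v.length + 1) = (u.length + (v.length + 1)) + 1 by ring,
          Nat.choose_succ_succ, show u.length + 1 + v.length = u.length + (v.length + 1) by ring]
      simp only [List.length_cons, this, Option.elim_none, map_zero, add_zero, List.cons_append]
      push_cast
      ring

end QuasiShuffle

/-! ### Multiplicativity and bijectivity of the exponential. -/

namespace QuasiShuffle

variable {K A : Type*} [Field K] {deg : A → ℕ} (p q : HoffmanPairing A deg)

theorem expWord_nil : expWord p K [] = Finsupp.single [] 1 := by rw [expWord]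

open Classical in
-- When both words are nonempty, a one-letter term of their product can only come from pairing the
-- two first letters with nothing left over.
theorem mul_consO_consO_apply_singleton (o o' : Option A) (x y : List A →₀ K) (c : A) :
    (quasiShuffleHopf K p).mul (consO K o x) (consO K o' y) [c] =
      if p.pair o o' = some c then x [] * y [] else 0 := by
  cases o with
  | none => simp [p.none_pair]
  | some a =>
    cases o' with
    | none => simp [p.pair_none]
    | some b =>
      have h0 : ∀ (a : A) (x : List A →₀ K), consL K a x [] = 0 := fun a x =>
        consO_apply_nil (some a) x
      rw [consO_some, consO_some, mul_consL_consL]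
      simp only [Finsupp.add_apply, consL_apply_cons, consO_apply_cons, mul_apply_nil, h0]
      simp

theorem expL_apply_singleton (c : A) (x : List A →₀ K) :
    expL p K x [c] = Finsupp.linearCombination K (expLetter p K c) x := by
  induction x using induction_words with
  | zero => simp
  | add f g hf hg => simp only [map_add, Finsupp.add_apply, hf, hg]
  | smul r f hf => simp only [map_smul, Finsupp.smul_apply, hf]
  | single w => rw [expL_single, expWord_apply_singleton]; simp

open Classical in
-- A single letter results only when the first blocks exhaust both words; all other summands leave a
-- nonempty remainder.
theorem mul_expWord_apply_singleton (c : A) (a b : A) (u v : List A) :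
    (quasiShuffleHopf K p).mul (expWord p K (a :: u)) (expWord p K (b :: v)) [c] =
      if p.fold (a :: u ++ b :: v) = some c then
        ((u.length + 1).factorial : K)⁻¹ * ((v.length + 1).factorial : K)⁻¹ else 0 := by
  rw [p.fold_append (by simp) (by simp)]
  rw [expWord, expWord]
  simp only [map_sum, LinearMap.sum_apply, Finsupp.finsetSum_apply, map_smul, LinearMap.smul_apply,
    Finsupp.smul_apply, mul_consO_consO_apply_singleton, expWord_apply_nil, List.drop_eq_nil_iff]
  rw [Finset.sum_eq_single v.length, Finset.sum_eq_single u.length]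
  · simp [_root_.mul_comm]
  · intro i hi hne
    have : ¬ u.length ≤ i := by
      have := Finset.mem_range.1 hi
      omega
    simp [this]
  · simp
  · intro i hi hne
    have : ¬ v.length ≤ i := by
      have := Finset.mem_range.1 hi
      omega
    simp [this]
  · simp

/-- It suffices to compare one-letter coefficients. Words of lengths `m` and `n` have `(m +
n).choose m` shuffles, counted with multiplicity, all with the same fold and weight `1 / (m + n)!`,
and the total `1 / (m! n!)` is the product of the two weights. Characteristic zero makes the
factorials invertible. -/
theorem expL_mul [CharZero K] (hq : ∀ a b, q.pair (some a) (some b) = none) (x y : List A →₀ K) :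
    expL p K ((quasiShuffleHopf K q).mul x y) =
      (quasiShuffleHopf K p).mul (expL p K x) (expL p K y) := by
  classical
  refine map_mul_of_letters p (expCoalgHom p q) (fun c x y => ?_) x y
  have key : ∀ x y : List A →₀ K, expL p K ((quasiShuffleHopf K q).mul x y) [c] =
      (quasiShuffleHopf K p).mul (expL p K x) (expL p K y) [c] := by
    intro x y
    induction x using induction_words with
    | zero => simp
    | add f g hf hg => simp only [map_add, LinearMap.add_apply, Finsupp.add_apply, hf, hg]
    | smul r f hf => simp only [map_smul, LinearMap.smul_apply, Finsupp.smul_apply, hf]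
    | single u =>
      induction y using induction_words with
      | zero => simp
      | add f g hf hg => simp only [map_add, Finsupp.add_apply, hf, hg]
      | smul r f hf => simp only [map_smul, Finsupp.smul_apply, hf]
      | single v =>
        rcases u with _ | ⟨a, u⟩
        · rw [nil_mul, expL_single p [], expWord_nil, nil_mul]
        rcases v with _ | ⟨b, v⟩
        · rw [mul_nil, expL_single p [], expWord_nil, mul_nil p]
        rw [mul_single, expL_apply_singleton, linearCombination_shuffle q hq, expL_single,
          expL_single, mul_expWord_apply_singleton, expLetter]
        · split_ifs
          · rw [List.length_append]
            simp only [List.length_cons]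
            have h := Nat.add_choose_mul_factorial_mul_factorial (u.length + 1) (v.length + 1)
            rw [← h, Nat.choose_symm_add]
            have h1 : ((u.length + 1).factorial : K) ≠ 0 := by
              exact_mod_cast Nat.factorial_ne_zero _
            have h2 : ((v.length + 1).factorial : K) ≠ 0 := by
              exact_mod_cast Nat.factorial_ne_zero _
            have h3 : ((u.length + 1 + (v.length + 1)).choose (v.length + 1) : K) ≠ 0 := by
              exact_mod_cast (Nat.choose_pos (Nat.le_add_left _ _)).ne'
            push_cast
            field_simp
          · simp
        · intro u v h
          simp only [expLetter, p.fold_perm h, h.length_eq]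
  exact key x y

theorem isHom_expL [CharZero K] (hq : ∀ a b, q.pair (some a) (some b) = none) :
    PreHopf.IsHom (quasiShuffleHopf K q) (quasiShuffleHopf K p) (expL p K) where
  map_one := by rw [one_def, expL_single, expWord]; rfl
  map_mul := expL_mul p q hq
  map_comul x := (LinearMap.congr_fun (expCoalgHom (K := K) p q).map_comp_comul x).symm
  map_counit x := (counit_apply p _).trans ((expL_apply_nil p x).trans (counit_apply q x).symm)

/-- Hoffman's exponential is triangular with respect to the length of words. -/
theorem expWord_apply (w v : List A) (h : w.length ≤ v.length) [Decidable (v = w)] :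
    expWord p K w v = if v = w then 1 else 0 := by
  classical
  induction v generalizing w with
  | nil =>
    have := List.length_eq_zero_iff.1 (Nat.le_zero.1 h)
    subst this
    simp [expWord]
  | cons c v ih =>
    rw [expWord_apply_cons]
    rcases w with _ | ⟨a, w⟩
    · simp [expLetter]
    simp only [List.length_cons, Nat.add_le_add_iff_right] at h
    rw [Finset.sum_eq_single 1]
    · simp only [List.take_succ_cons, List.take_zero, expLetter, HoffmanPairing.fold_singleton,
        List.drop_succ_cons, List.drop_zero, ih w h]
      by_cases h1 : c = a <;> by_cases h2 : v = w <;> simp [h1, h2, Ne.symm]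
    · intro i hi hne
      have hi := Finset.mem_range.1 hi
      rcases i with _ | i
      · simp [expLetter]
      · rw [List.drop_succ_cons, ih _ (by simp; omega), if_neg, mul_zero]
        rintro rfl
        simp only [List.length_drop, List.length_cons] at h hi hne
        omega
    · simp

/-- Contracting a block of several letters shortens the word, so the exponential is the identity up
to shorter words. -/
theorem expL_bijective : Function.Bijective (expL p K) := by
  classical
  refine Finsupp.bijective_of_triangular _ (fun v w : List A => v.length < w.length)
    (InvImage.wf List.length Nat.lt_wfRel.wf) (fun _ _ _ => lt_trans) ?_ ?_
  · intro w
    rw [expL_single, expWord_apply p w w le_rfl, if_pos rfl]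
    exact one_ne_zero
  · intro w v h
    rw [expL_single] at h
    by_contra! h'
    exact h (by rw [expWord_apply p w v h'.2, if_neg h'.1])

end QuasiShuffle

/-! ### Forests as the free commutative monoid on trees. -/

namespace Forest

open LForest

variable {A : Type*} {V : Type} [Finite V]

/-- The number of components isomorphic to `t`. -/
noncomputable def countComponent (t u : Forest A) : ℕ :=
  Nat.card {r // u.rep.parent r = none ∧ (u.rep.restrict {v | u.rep.le r v}).cls = t}

theorem countComponent_cls (t : Forest A) (X : LForest A V) : countComponent t X.cls =
    Nat.card {r // X.parent r = none ∧ (X.restrict {v | X.le r v}).cls = t} := by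
  obtain ⟨e, he⟩ := exists_isIso_rep_cls X
  refine (Nat.card_congr (e.subtypeEquiv fun r => ?_)).symm
  have h : (X.restrict {v | X.le r v}).cls =
      (X.cls.rep.restrict {v | X.cls.rep.le (e r) v}).cls :=
    (he.restrict fun v => (he.le_iff r v).symm).cls_eq
  rw [h, (he r).1, Option.map_eq_none_iff]

@[simp] theorem countComponent_one (t : Forest A) : countComponent t 1 = 0 := by
  rw [← cls_eq_one (LForest.empty A Empty), countComponent_cls]
  simp

theorem countComponent_of_isTree {t u : Forest A} (h : u.IsTree) [Decidable (u = t)] :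
    countComponent t u = if u = t then 1 else 0 := by
  obtain ⟨r, hr, hu⟩ := h
  have hall : ∀ v, u.rep.le r v := by
    intro v
    obtain ⟨s, hs, hsv⟩ := u.rep.exists_root_le v
    rwa [hu s hs] at hsv
  have hc : ∀ s, u.rep.parent s = none → (u.rep.restrict {v | u.rep.le s v}).cls = u := by
    intro s hs
    have := hu s hs
    subst this
    exact (cls_restrict_univ _ (S := {v | u.rep.le s v}) hall).trans (cls_rep u)
  unfold countComponent
  split_ifs with h
  · rw [Nat.card_eq_one_iff_unique]
    exact ⟨⟨fun a b => Subtype.ext ((hu _ a.2.1).trans (hu _ b.2.1).symm)⟩,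
      ⟨⟨r, hr, (hc r hr).trans h⟩⟩⟩
  · rw [Nat.card_eq_zero]
    exact Or.inl ⟨fun a => h ((hc _ a.2.1).symm.trans a.2.2)⟩

theorem sum_le_inl {V W : Type} {X : RForest V} {Y : RForest W} {v : V} {z : V ⊕ W} :
    (X.sum Y).le (Sum.inl v) z ↔ ∃ w, z = Sum.inl w ∧ X.le v w := by
  constructor
  · intro h
    induction h with
    | refl => exact ⟨v, rfl, .refl⟩
    | @tail b c _ hp ih =>
      obtain ⟨w, rfl, hw⟩ := ih
      rcases c with c | c
      · obtain ⟨q, hq, hqw⟩ := Option.map_eq_some_iff.1 hp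
        rw [Sum.inl_injective hqw] at hq
        exact ⟨c, rfl, hw.tail hq⟩
      · obtain ⟨q, hq, hqw⟩ := Option.map_eq_some_iff.1 hp
        cases hqw
  · rintro ⟨w, rfl, h⟩
    induction h with
    | refl => exact .refl
    | tail _ hp ih => exact ih.tail (by simp [RForest.sum, hp])

theorem sum_le_inr {V W : Type} {X : RForest V} {Y : RForest W} {v : W} {z : V ⊕ W} :
    (X.sum Y).le (Sum.inr v) z ↔ ∃ w, z = Sum.inr w ∧ Y.le v w := by
  constructor
  · intro h
    induction h with
    | refl => exact ⟨v, rfl, .refl⟩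
    | @tail b c _ hp ih =>
      obtain ⟨w, rfl, hw⟩ := ih
      rcases c with c | c
      · obtain ⟨q, hq, hqw⟩ := Option.map_eq_some_iff.1 hp
        cases hqw
      · obtain ⟨q, hq, hqw⟩ := Option.map_eq_some_iff.1 hp
        rw [Sum.inr_injective hqw] at hq
        exact ⟨c, rfl, hw.tail hq⟩
  · rintro ⟨w, rfl, h⟩
    induction h with
    | refl => exact .refl
    | tail _ hp ih => exact ih.tail (by simp [RForest.sum, hp])

theorem countComponent_mul (t u v : Forest A) :
    countComponent t (u * v) = countComponent t u + countComponent t v := by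
  obtain ⟨l, X, rfl⟩ := exists_cls u
  obtain ⟨m, Y, rfl⟩ := exists_cls v
  rw [cls_mul_cls, countComponent_cls, countComponent_cls, countComponent_cls, ← Nat.card_sum]
  refine Nat.card_congr ((Equiv.subtypeSum).trans (Equiv.sumCongr
    (Equiv.subtypeEquivRight fun r => ?_) (Equiv.subtypeEquivRight fun r => ?_)))
  · have h1 : Sum.inl ⁻¹' {z | (X.sum Y).le (Sum.inl r) z} = {v | X.le r v} :=
      Set.ext fun v => sum_le_inl.trans ⟨fun ⟨w, h, h'⟩ => Sum.inl_injective h ▸ h',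
        fun h => ⟨v, rfl, h⟩⟩
    have h2 : Sum.inr ⁻¹' {z | (X.sum Y).le (Sum.inl r) z} = ∅ :=
      Set.eq_empty_of_forall_notMem fun v h => by
        obtain ⟨w, h, -⟩ := sum_le_inl.1 h
        cases h
    rw [cls_restrict_sum, cls_restrict_congr _ h1, cls_restrict_congr _ h2,
      cls_eq_one (Y.restrict ∅), mul_one]
    exact and_congr_left fun _ => Option.map_eq_none_iff
  · have h1 : Sum.inr ⁻¹' {z | (X.sum Y).le (Sum.inr r) z} = {v | Y.le r v} :=
      Set.ext fun v => sum_le_inr.trans ⟨fun ⟨w, h, h'⟩ => Sum.inr_injective h ▸ h',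
        fun h => ⟨v, rfl, h⟩⟩
    have h2 : Sum.inl ⁻¹' {z | (X.sum Y).le (Sum.inr r) z} = ∅ :=
      Set.eq_empty_of_forall_notMem fun v h => by
        obtain ⟨w, h, -⟩ := sum_le_inr.1 h
        cases h
    rw [cls_restrict_sum, cls_restrict_congr _ h1, cls_restrict_congr _ h2,
      cls_eq_one (X.restrict ∅), one_mul]
    exact and_congr_left fun _ => Option.map_eq_none_iff

/-- The forest with given multiplicities of trees. -/
noncomputable def ofTrees (s : LTree A →₀ ℕ) : Forest A := s.prod fun t n => t.1 ^ n

theorem ofTrees_add (s s' : LTree A →₀ ℕ) : ofTrees (s + s') = ofTrees s * ofTrees s' :=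
  Finsupp.prod_add_index' (fun _ => pow_zero _) fun _ _ _ => pow_add _ _ _

theorem ofTrees_single (t : LTree A) (n : ℕ) : ofTrees (Finsupp.single t n) = t.1 ^ n :=
  Finsupp.prod_single_index (pow_zero _)

theorem countComponent_pow (t u : Forest A) (n : ℕ) :
    countComponent t (u ^ n) = n * countComponent t u := by
  induction n with
  | zero => simp
  | succ n ih => rw [pow_succ, countComponent_mul, ih, Nat.succ_mul]

theorem countComponent_ofTrees (t : LTree A) (s : LTree A →₀ ℕ) :
    countComponent t.1 (ofTrees s) = s t := by
  classical
  induction s using Finsupp.induction_linear with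
  | zero => simp [ofTrees]
  | add f g hf hg => rw [ofTrees_add, countComponent_mul, hf, hg, Finsupp.add_apply]
  | single u n =>
    rw [ofTrees_single, countComponent_pow, countComponent_of_isTree u.2, Finsupp.single_apply]
    by_cases h : u = t
    · simp [h]
    · have h' : u.1 ≠ t.1 := fun h' => h (Subtype.ext h')
      simp [h, h']

/-- Counting the components isomorphic to a tree recovers its multiplicity, which gives injectivity;
trees and products generate all forests. -/
theorem ofTrees_bijective : Function.Bijective (ofTrees (A := A)) := by
  constructor
  · intro s s' h
    ext t
    rw [← countComponent_ofTrees, ← countComponent_ofTrees, h]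
  · intro u
    induction u using Forest.induction with
    | one => exact ⟨0, rfl⟩
    | mul u v hu hv =>
      obtain ⟨s, rfl⟩ := hu
      obtain ⟨s', rfl⟩ := hv
      exact ⟨s + s', ofTrees_add _ _⟩
    | B a u _ => exact ⟨_, (ofTrees_single ⟨B a u, isTree_B a u⟩ 1).trans (pow_one _)⟩

/-- By `hc` no vertex lies above two different members of `c`, so the trees above them are disjoint
and without edges between them. For an admissible cut the product is therefore the whole part cut
off. -/
theorem prod_cls_above (X : LForest A V) (c : Finset V)
    (hc : ∀ z, ∀ x ∈ c, ∀ y ∈ c, X.le x z → X.le y z → x = y) :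
    ∏ x ∈ c, (X.restrict {v | X.le x v}).cls = (X.restrict {v | ∃ x ∈ c, X.le x v}).cls := by
  classical
  induction c using Finset.induction with
  | empty =>
    have : IsEmpty {v | ∃ x ∈ (∅ : Finset V), X.le x v} := ⟨fun v => by simpa using v.2⟩
    rw [Finset.prod_empty, cls_eq_one]
  | insert x c hx ih =>
    rw [Finset.prod_insert hx, ih fun z a ha b hb => hc z a (Finset.mem_insert_of_mem ha) b
      (Finset.mem_insert_of_mem hb), ← cls_restrict_union]
    · refine cls_restrict_congr _ (Set.ext fun v => ?_)
      simp
    · refine Set.disjoint_left.2 fun v hv => ?_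
      rintro ⟨y, hy, hyv⟩
      exact hx (hc v x (Finset.mem_insert_self _ _) y (Finset.mem_insert_of_mem hy) hv hyv ▸ hy)
    · rintro v hv w ⟨y, hy, hyw⟩ h
      exact hx (hc v x (Finset.mem_insert_self _ _) y (Finset.mem_insert_of_mem hy) hv
        (hyw.tail h) ▸ hy)
    · rintro v ⟨y, hy, hyv⟩ w hw h
      exact hx (hc v x (Finset.mem_insert_self _ _) y (Finset.mem_insert_of_mem hy)
        (Relation.ReflTransGen.tail hw h) hyv ▸ hy)

end Forest

/-! ### Admissible cuts and lower sets. -/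

namespace LForest

variable {A : Type*} {n : ℕ} (X : LForest A (Fin n))

/-- The vertices which remain connected to the root after the cut `c`. -/
noncomputable def remaining (c : Finset (Fin n)) : Finset (Fin n) :=
  (Set.toFinite {z | ∀ x ∈ c, ¬ X.le x z}).toFinset

variable {X}

theorem mem_remaining {c : Finset (Fin n)} {z : Fin n} :
    z ∈ X.remaining c ↔ ∀ x ∈ c, ¬ X.le x z := by
  simp [remaining]

open Classical in
/-- Summation over the nonempty admissible cuts of a tree. -/
theorem sum_admissible {M : Type*} [AddCommMonoid M] (hX : X.IsTree)
    (g : Finset (Fin n) → M) :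
    ∑ W : Finset (Fin n) with X.IsLower W, g W = g ∅ + g Finset.univ +
      ∑ c : Finset (Fin n), if c.Nonempty ∧ X.IsAdmissible c then g (X.remaining c) else 0 := by
  obtain ⟨r, hr, hu⟩ := hX
  rw [← Finset.sum_filter, ← Finset.add_sum_erase _ _ (a := ∅)
    (Finset.mem_filter.2 ⟨Finset.mem_univ _, fun _ _ _ h => absurd h (Finset.notMem_empty _)⟩),
    ← Finset.add_sum_erase _ _ (a := Finset.univ), add_assoc]
  · congr 2
    have hroot : ∀ W, X.IsLower W → W.Nonempty → r ∈ W := by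
      rintro W hW ⟨w, hw⟩
      obtain ⟨s, hs, hsw⟩ := X.exists_root_le w
      have hsr : s = r := hu s hs
      exact hsr ▸ hW _ _ hsw hw
    symm
    refine Finset.sum_bij (fun c _ => X.remaining c) ?_ ?_ ?_ (fun _ _ => rfl)
    · intro c hc
      obtain ⟨⟨x, hx⟩, hadm, -⟩ := (Finset.mem_filter.1 hc).2
      simp only [Finset.mem_erase, Finset.mem_filter, Finset.mem_univ, true_and]
      refine ⟨fun h => ?_, fun h => ?_, fun y z hzy hy => ?_⟩
      · have := (Finset.ext_iff.1 h x).2 (Finset.mem_univ _)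
        exact mem_remaining.1 this x hx .refl
      · have : r ∉ X.remaining c := by simp [h]
        rw [mem_remaining] at this
        push Not at this
        obtain ⟨y, hy, hyr⟩ := this
        have := RForest.eq_of_le_root hyr hr
        subst this
        exact hadm _ hy hr
      · rw [mem_remaining] at hy ⊢
        exact fun x hx h => hy x hx (h.trans hzy)
    -- A cut is recovered from what it leaves: it consists of the removed vertices whose parent
    -- remains. A removed root does not occur, since members of a cut have parents.
    · have key : ∀ c, X.IsAdmissible c → ∀ x, x ∈ c ↔
          x ∉ X.remaining c ∧ ∀ p, X.parent x = some p → p ∈ X.remaining c := by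
        intro c hc x
        simp only [mem_remaining]
        constructor
        · intro hx
          refine ⟨fun h => h x hx .refl, fun p hp y hy hyp => ?_⟩
          have := hc.2 x x hx y hy .refl (hyp.tail hp)
          subst this
          have := RForest.le_antisymm hyp (Relation.ReflTransGen.single hp)
          subst this
          exact X.wf.irrefl.irrefl x hp
        · rintro ⟨h1, h2⟩
          push Not at h1
          obtain ⟨y, hy, hyx⟩ := h1
          by_cases hxy : x = y
          · exact hxy ▸ hy
          · obtain ⟨p, hp⟩ : ∃ p, X.parent x = some p := by
              rw [← Option.ne_none_iff_exists']
              exact fun h => hxy (RForest.eq_of_le_root hyx h).symm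
            exact absurd (RForest.le_parent hyx hxy hp) (h2 p hp y hy)
      intro c hc d hd h
      ext x
      rw [key c (Finset.mem_filter.1 hc).2.2, key d (Finset.mem_filter.1 hd).2.2, h]
    · intro W hW
      simp only [Finset.mem_erase, Finset.mem_filter, Finset.mem_univ, true_and] at hW
      obtain ⟨hne, hne', hlow⟩ := hW
      have hrW := hroot W hlow (Finset.nonempty_iff_ne_empty.2 hne')
      -- The cut that leaves `W` consists of the vertices just outside `W`. Since `W` is lower, no
      -- two of them are comparable, and two vertices below a common one are comparable; this gives
      -- admissibility.
      let c := Finset.univ.filter fun x => x ∉ W ∧ ∃ p ∈ W, X.parent x = some p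
      have hcm : ∀ {x}, x ∈ c ↔ x ∉ W ∧ ∃ p ∈ W, X.parent x = some p := fun {x} => by
        simp [c]
      have hex : ∀ v, v ∉ W → ∃ x ∈ c, X.le x v := by
        intro v
        induction v using X.wf.induction with
        | _ v ih =>
          intro hv
          cases hp : X.parent v with
          | none => exact absurd ((hu v hp) ▸ hrW) hv
          | some p =>
            by_cases hpW : p ∈ W
            · exact ⟨v, hcm.2 ⟨hv, p, hpW, hp⟩, .refl⟩
            · obtain ⟨x, hx, hxp⟩ := ih p hp hpW
              exact ⟨x, hx, hxp.tail hp⟩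
      have hanti : ∀ x ∈ c, ∀ y ∈ c, X.le x y → x = y := by
        intro x hx y hy hxy
        by_contra hne
        obtain ⟨-, p, hpW, hp⟩ := hcm.1 hy
        exact (hcm.1 hx).1 (hlow _ _ (RForest.le_parent hxy (Ne.symm hne) hp) hpW)
      refine ⟨c, ?_, ?_⟩
      · simp only [Finset.mem_filter, Finset.mem_univ, true_and]
        refine ⟨?_, fun x hx h => ?_, fun z x hx y hy hxz hyz => ?_⟩
        · obtain ⟨v, hv⟩ : ∃ v, v ∉ W := by
            by_contra! h
            exact hne (Finset.eq_univ_iff_forall.2 h)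
          obtain ⟨x, hx, -⟩ := hex v hv
          exact ⟨x, hx⟩
        · obtain ⟨-, p, -, hp⟩ := hcm.1 hx
          rw [h] at hp
          cases hp
        · rcases RForest.le_total_of_le hxz hyz with h | h
          · exact hanti x hx y hy h
          · exact (hanti y hy x hx h).symm
      · ext z
        rw [mem_remaining]
        constructor
        · intro h
          by_contra hz
          obtain ⟨x, hx, hxz⟩ := hex z hz
          exact h x hx hxz
        · intro hz x hx hxz
          exact (hcm.1 hx).1 (hlow _ _ hxz hz)
  · simp only [Finset.mem_erase, Finset.mem_filter, Finset.mem_univ, true_and]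
    refine ⟨fun h => ?_, fun _ _ _ _ => Finset.mem_univ _⟩
    exact absurd (Finset.mem_univ r) (by rw [h]; simp)

end LForest

/-! ### The Connes–Kreimer algebra as the algebra of forests. -/

namespace CKHopf

open LForest

variable {K A : Type*} [Field K]

/-- Forests, as elements of the Hopf algebra of forests. -/
noncomputable def ofForest (K : Type*) [Field K] : Forest A →* (treeHopf K A).Carrier where
  toFun u := (Finsupp.single u 1 : Forest A →₀ K)
  map_one' := rfl
  map_mul' u v := (TreeHopf.mul_single u v).symm

/-- The isomorphism of the Connes–Kreimer algebra with the algebra of forests. -/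
noncomputable def toForests (K A : Type*) [Field K] :
    MvPolynomial (LTree A) K →ₐ[K] (treeHopf K A).Carrier :=
  MvPolynomial.aeval fun t => ofForest K t.1

theorem toForests_X (t : LTree A) : toForests K A (MvPolynomial.X t) = ofForest K t.1 := by
  simp [toForests]

/-- The linear isomorphism of the Connes–Kreimer algebra with the algebra of forests. -/
noncomputable def equiv (K A : Type*) [Field K] :
    MvPolynomial (LTree A) K ≃ₗ[K] (Forest A →₀ K) :=
  (MvPolynomial.basisMonomials (LTree A) K).equiv Finsupp.basisSingleOne
    (Equiv.ofBijective _ Forest.ofTrees_bijective)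

theorem toForests_monomial (s : LTree A →₀ ℕ) :
    toForests K A (MvPolynomial.monomial s 1) = ofForest K (Forest.ofTrees s) := by
  rw [toForests, MvPolynomial.aeval_monomial, map_one, one_mul, Forest.ofTrees, map_finsuppProd]
  simp only [map_pow]

theorem equiv_apply (x : MvPolynomial (LTree A) K) : equiv K A x = toForests K A x := by
  have : (equiv K A).toLinearMap = (toForests K A).toLinearMap := by
    refine (MvPolynomial.basisMonomials (LTree A) K).ext fun s => ?_
    refine (Module.Basis.equiv_apply _ _ _ _).trans ?_
    refine Eq.trans ?_ (toForests_monomial s).symm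
    rw [Finsupp.coe_basisSingleOne]
    rfl
  exact LinearMap.congr_fun this x

end CKHopf

namespace CKHopf

open LForest

variable {K A : Type*} [Field K]

theorem toForests_remainingPart (t : LTree A) (c : Finset (Fin t.1.size))
    (hc : t.rep.IsAdmissible c) : toForests K A (remainingPart K t c hc) =
      ofForest K (t.rep.restrict {x | x ∈ t.rep.remaining c}).cls := by
  rw [remainingPart, toForests_X]
  refine congrArg _ (cls_restrict_congr _ (Set.ext fun z => ?_))
  exact mem_remaining.symm

theorem toForests_prunedPart (t : LTree A) (c : Finset (Fin t.1.size))
    (hc : t.rep.IsAdmissible c) : toForests K A (prunedPart K t c) =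
      ofForest K (t.rep.restrict {x | x ∉ t.rep.remaining c}).cls := by
  rw [prunedPart, map_prod]
  simp only [toForests_X]
  rw [← map_prod]
  refine congrArg _ ((Forest.prod_cls_above t.rep c hc.2).trans
    (cls_restrict_congr _ (Set.ext fun z => ?_)))
  simp [mem_remaining]

open Classical in
theorem comul_ofForest (t : LTree A) : (treeHopf K A).comul (Finsupp.single t.1 1) =
    Finsupp.single t.1 1 ⊗ₜ[K] Finsupp.single 1 1 + Finsupp.single 1 1 ⊗ₜ[K] Finsupp.single t.1 1 +
      ∑ c : Finset (Fin t.1.size), if c.Nonempty ∧ t.rep.IsAdmissible c then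
        Finsupp.single (t.rep.restrict {x | x ∉ t.rep.remaining c}).cls 1 ⊗ₜ[K]
          Finsupp.single (t.rep.restrict {x | x ∈ t.rep.remaining c}).cls 1 else 0 := by
  have h := TreeHopf.comul_cls (K := K) t.rep
  have e1 : IsEmpty {x : Fin t.1.size | x ∈ (∅ : Finset (Fin t.1.size))} :=
    ⟨fun x => absurd x.2 (Finset.notMem_empty _)⟩
  have e2 : IsEmpty {x : Fin t.1.size | x ∉ (Finset.univ : Finset (Fin t.1.size))} :=
    ⟨fun x => x.2 (Finset.mem_univ _)⟩
  rw [sum_admissible (X := t.rep) t.2 (fun W => Finsupp.single (t.rep.restrict {x | x ∉ W}).cls (1 : K) ⊗ₜ[K]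
    Finsupp.single (t.rep.restrict {x | x ∈ W}).cls (1 : K)),
    cls_restrict_univ _ (S := {x | x ∉ (∅ : Finset (Fin t.1.size))}) (by simp),
    cls_restrict_univ _ (S := {x | x ∈ (Finset.univ : Finset (Fin t.1.size))}) (by simp),
    cls_eq_one (t.rep.restrict {x | x ∈ (∅ : Finset (Fin t.1.size))}),
    cls_eq_one (t.rep.restrict {x | x ∉ (Finset.univ : Finset (Fin t.1.size))})] at h
  have ht : t.rep.cls = t.1 := cls_rep t.1
  rw [ht] at h
  exact h

/-- Both sides are algebra morphisms in `x`, so trees suffice. There the empty lower set and the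
whole tree account for `t ⊗ 1` and `1 ⊗ t`, and the other lower sets are the parts left by the
nonempty admissible cuts. -/
theorem comul_toForests (x : MvPolynomial (LTree A) K) :
    (treeHopf K A).comul (toForests K A x) =
      TensorProduct.map (toForests K A).toLinearMap (toForests K A).toLinearMap
        ((ckHopf K A).comul x) := by
  classical
  let Δ : MvPolynomial (LTree A) K →ₐ[K] MvPolynomial (LTree A) K ⊗[K] MvPolynomial (LTree A) K :=
    MvPolynomial.aeval fun t : LTree A =>
      (MvPolynomial.X t ⊗ₜ[K] 1 + 1 ⊗ₜ[K] MvPolynomial.X t +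
      ∑ c : Finset (Fin t.1.size), if hc : c.Nonempty ∧ t.rep.IsAdmissible c then
        prunedPart K t c ⊗ₜ[K] remainingPart K t c hc.2 else 0)
  have e : (Bialgebra.comulAlgHom K (treeHopf K A).Carrier).comp (toForests K A) =
      (Algebra.TensorProduct.map (toForests K A) (toForests K A)).comp Δ := by
    refine MvPolynomial.algHom_ext fun t => ?_
    have h1 : (Bialgebra.comulAlgHom K (treeHopf K A).Carrier).comp (toForests K A)
        (MvPolynomial.X t) = Coalgebra.comul (R := K) (ofForest K t.1) :=
      congrArg (Coalgebra.comul (R := K)) (toForests_X (K := K) t)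
    rw [h1]
    have h2 : Δ (MvPolynomial.X t) = MvPolynomial.X t ⊗ₜ[K] 1 + 1 ⊗ₜ[K] MvPolynomial.X t +
      ∑ c : Finset (Fin t.1.size), if hc : c.Nonempty ∧ t.rep.IsAdmissible c then
        prunedPart K t c ⊗ₜ[K] remainingPart K t c hc.2 else 0 := MvPolynomial.aeval_X _ _
    rw [AlgHom.comp_apply, h2, map_add, map_add, map_sum, Algebra.TensorProduct.map_tmul,
      Algebra.TensorProduct.map_tmul, map_one, toForests_X]
    refine (comul_ofForest t).trans (congrArg₂ _ rfl (Finset.sum_congr rfl fun c _ => ?_))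
    split_ifs with hc
    · rw [Algebra.TensorProduct.map_tmul, toForests_prunedPart t c hc.2,
        toForests_remainingPart t c hc.2]
      rfl
    · rw [map_zero]
      rfl
  have hΔ : Δ.toLinearMap = (ckHopf K A).comul := by
    simp only [ckHopf, Δ]
  rw [← hΔ]
  exact DFunLike.congr_fun e x

theorem isHom : PreHopf.IsHom (ckHopf K A) (treeHopf K A) (equiv K A).toLinearMap where
  map_one := by
    have h : toForests K A 1 = 1 := map_one _
    exact (equiv_apply 1).trans h
  map_mul x y := by
    have h : toForests K A (x * y) = toForests K A x * toForests K A y := map_mul _ _ _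
    refine (equiv_apply (x * y)).trans (h.trans ?_)
    exact congrArg₂ (fun a b => (treeHopf K A).mul a b) (equiv_apply x).symm (equiv_apply y).symm
  map_comul x := by
    have e : (equiv K A).toLinearMap = (toForests K A).toLinearMap := LinearMap.ext equiv_apply
    have h := comul_toForests x
    rw [← e] at h
    exact (congrArg _ (equiv_apply x)).trans h
  map_counit x := by
    classical
    have e : (Bialgebra.counitAlgHom K (treeHopf K A).Carrier).comp (toForests K A) =
        MvPolynomial.aeval fun _ => (0 : K) := by
      refine MvPolynomial.algHom_ext fun t => ?_
      have h1 : (Bialgebra.counitAlgHom K (treeHopf K A).Carrier).comp (toForests K A)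
          (MvPolynomial.X t) = (treeHopf K A).counit (Finsupp.single t.1 1) :=
        congrArg (Coalgebra.counit (R := K)) (toForests_X (K := K) t)
      rw [h1, MvPolynomial.aeval_X, TreeHopf.counit_single, if_neg]
      intro h
      obtain ⟨a, v, hv⟩ := Forest.IsTree.exists_eq_B t.2
      exact Forest.B_ne_one a v (hv.symm.trans h)
    exact (congrArg (treeHopf K A).counit (equiv_apply x)).trans (DFunLike.congr_fun e x)

instance isHopf : (ckHopf K A).IsHopf := PreHopf.isHopf_of_equiv (equiv K A) isHom

end CKHopf

/-! ### Reconstruction of a labelled forest from its lower sets. -/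

namespace RForest

/-- The parent is the largest element strictly below a vertex. Being expressed by the order alone,
it is preserved by order isomorphisms. -/
theorem parent_eq_some_iff {V : Type} {X : RForest V} {v p : V} :
    X.parent v = some p ↔ p ≠ v ∧ X.le p v ∧ ∀ z, X.le z v → z ≠ v → X.le z p := by
  constructor
  · intro h
    refine ⟨?_, Relation.ReflTransGen.single h, fun z hz hne => le_parent hz (Ne.symm hne) h⟩
    rintro rfl
    exact X.wf.irrefl.irrefl p h
  · rintro ⟨h1, h2, h3⟩
    obtain ⟨q, hq⟩ : ∃ q, X.parent v = some q := by
      rw [← Option.ne_none_iff_exists']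
      exact fun h => h1 (eq_of_le_root h2 h)
    have hqv : q ≠ v := by
      rintro rfl
      exact X.wf.irrefl.irrefl q hq
    rw [hq, le_antisymm (le_parent h2 h1.symm hq) (h3 q (Relation.ReflTransGen.single hq) hqv)]

end RForest

namespace LForest

variable {A : Type*} {V W : Type}

/-- Labelled forests with the same order and the same labels are isomorphic. -/
theorem isIso_of_le_iff {X : LForest A V} {Y : LForest A W} {e : V ≃ W}
    (h : ∀ v w, Y.le (e v) (e w) ↔ X.le v w) (hl : ∀ v, Y.lab (e v) = X.lab v) : X.IsIso Y e := by
  refine isIso_iff.2 ⟨fun v p => ?_, hl⟩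
  rw [RForest.parent_eq_some_iff, RForest.parent_eq_some_iff, h, e.injective.ne_iff]
  refine and_congr_right fun _ => and_congr_right fun _ => ?_
  rw [e.surjective.forall]
  simp only [h, e.injective.ne_iff]

theorem cls_restrict_eq [Finite V] {X Y : LForest A V} {S : Set V}
    (h : ∀ v ∈ S, X.parent v = Y.parent v) (hl : X.lab = Y.lab) :
    (X.restrict S).cls = (Y.restrict S).cls := by
  refine IsIso.cls_eq (e := Equiv.refl _) (isIso_iff.2 ⟨fun v w => ?_, fun v => ?_⟩)
  · refine RForest.restrict_parent_eq_some.trans (Iff.trans ?_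
      RForest.restrict_parent_eq_some.symm)
    rw [h v v.2]
    rfl
  · exact (congrFun hl v).symm

/-- The set of vertices below a given one. -/
noncomputable def below [Finite V] (X : LForest A V) (x : V) : Finset V :=
  (Set.toFinite {y | X.le y x}).toFinset

theorem mem_below [Finite V] {X : LForest A V} {x y : V} : y ∈ X.below x ↔ X.le y x := by
  simp [below]

theorem isLower_below [Finite V] (X : LForest A V) (x : V) : X.IsLower (X.below x) := by
  intro y z hzy hy
  rw [mem_below] at hy ⊢
  exact hzy.trans hy

theorem below_subset_iff [Finite V] {X : LForest A V} {x : V} {S : Finset V} (hS : X.IsLower S) :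
    X.below x ⊆ S ↔ x ∈ S :=
  ⟨fun h => h (mem_below.2 .refl), fun h _ hy => hS _ _ (mem_below.1 hy) h⟩

/-- `S'` is obtained from `S` by removing a vertex with label `a`. -/
def Removes (X : LForest A V) (a : A) (S S' : Finset V) : Prop :=
  ∃ v ∈ S, X.lab v = a ∧ ∀ w, w ∈ S' ↔ w ∈ S ∧ w ≠ v

theorem IsIso.removes_iff {X : LForest A V} {Y : LForest A W} {e : V ≃ W} (h : X.IsIso Y e) {a : A}
    {S S' : Finset V} : Y.Removes a (S.map e.toEmbedding) (S'.map e.toEmbedding) ↔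
      X.Removes a S S' := by
  unfold Removes
  rw [e.surjective.exists]
  simp only [e.surjective.forall, Finset.mem_map_equiv, Equiv.symm_apply_apply, (h _).2,
    e.injective.ne_iff]

/-- The set below `x` is the smallest lower set containing `x`. Let `w` be the vertex by which its
image shrinks when `x` is removed, and let `S` correspond to the set below `w`. If `S` missed `x`,
it would lie in the set below `x` without `x`, whose image lacks `w`; so `S` contains `x` and is the
whole set below `x`. The label of `x` is carried by the removal relation. -/
theorem exists_below_eq [Finite V] [Finite W] {X : LForest A V} {Y : LForest A W}
    (e : {S // X.IsLower S} ≃ {S // Y.IsLower S})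
    (he : ∀ S S', (e S).1 ⊆ (e S').1 ↔ S.1 ⊆ S'.1)
    (hr : ∀ a S S', X.Removes a S.1 S'.1 → Y.Removes a (e S).1 (e S').1) (x : V) :
    ∃ w, Y.lab w = X.lab x ∧ (e ⟨_, X.isLower_below x⟩).1 = Y.below w := by
  classical
  have hlow : X.IsLower ((X.below x).erase x) := by
    intro y z hzy hy
    simp only [Finset.mem_erase, mem_below] at hy ⊢
    refine ⟨?_, hzy.trans hy.2⟩
    rintro rfl
    exact hy.1 (RForest.le_antisymm hy.2 hzy)
  obtain ⟨w, hw, hl, hT⟩ := hr (X.lab x) ⟨_, X.isLower_below x⟩ ⟨_, hlow⟩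
    ⟨x, mem_below.2 .refl, rfl, fun w => by simp [and_comm]⟩
  refine ⟨w, hl, ?_⟩
  set T := e ⟨_, X.isLower_below x⟩ with hTdef
  have hsub : Y.below w ⊆ T.1 := (below_subset_iff T.2).2 hw
  refine (subset_antisymm ?_ hsub)
  obtain ⟨S, hS⟩ := e.surjective ⟨_, Y.isLower_below w⟩
  have h1 : S.1 ⊆ X.below x := by
    refine (he S ⟨_, X.isLower_below x⟩).1 ?_
    rw [hS]
    exact hsub
  by_cases hx : x ∈ S.1
  · have h2 := (below_subset_iff S.2).2 hx
    have h3 := (he ⟨_, X.isLower_below x⟩ S).2 h2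
    rw [hS] at h3
    exact h3
  · have h2 : S.1 ⊆ (X.below x).erase x := fun y hy =>
      Finset.mem_erase.2 ⟨fun h => hx (h ▸ hy), h1 hy⟩
    have h3 := (he S ⟨_, hlow⟩).2 h2
    rw [hS] at h3
    have h4 := (hT w).1 (h3 (mem_below.2 .refl))
    exact absurd rfl h4.2

/-- A labelled forest is determined by its lattice of lower sets, in which the relations of removal
of a vertex carry labels. -/
theorem exists_isIso_of_lower [Finite V] [Finite W] {X : LForest A V} {Y : LForest A W}
    (e : {S // X.IsLower S} ≃ {S // Y.IsLower S})
    (he : ∀ S S', (e S).1 ⊆ (e S').1 ↔ S.1 ⊆ S'.1)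
    (hr : ∀ a S S', Y.Removes a (e S).1 (e S').1 ↔ X.Removes a S.1 S'.1) :
    ∃ σ : V ≃ W, X.IsIso Y σ := by
  choose f hf hf' using exists_below_eq e he fun a S S' => (hr a S S').2
  choose g hg hg' using exists_below_eq e.symm
    (fun S S' => by rw [← he, Equiv.apply_symm_apply, Equiv.apply_symm_apply])
    (fun a S S' h => by
      rw [← hr, Equiv.apply_symm_apply, Equiv.apply_symm_apply]
      exact h)
  have injX : ∀ x y, X.below x = X.below y → x = y := fun x y h =>
    RForest.le_antisymm (mem_below.1 (h ▸ mem_below.2 .refl))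
      (mem_below.1 (h.symm ▸ mem_below.2 .refl))
  have injY : ∀ x y, Y.below x = Y.below y → x = y := fun x y h =>
    RForest.le_antisymm (mem_below.1 (h ▸ mem_below.2 .refl))
      (mem_below.1 (h.symm ▸ mem_below.2 .refl))
  have hf'' : ∀ x, e ⟨_, X.isLower_below x⟩ = ⟨_, Y.isLower_below (f x)⟩ := fun x =>
    Subtype.ext (hf' x)
  have hg'' : ∀ x, e.symm ⟨_, Y.isLower_below x⟩ = ⟨_, X.isLower_below (g x)⟩ := fun x =>
    Subtype.ext (hg' x)
  let σ : V ≃ W :=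
    { toFun := f
      invFun := g
      left_inv := fun x => injX _ _ (by
        have h := hg'' (f x)
        rw [← hf'', Equiv.symm_apply_apply] at h
        exact (congrArg Subtype.val h).symm)
      right_inv := fun x => injY _ _ (by
        have h := hf'' (g x)
        rw [← hg'', Equiv.apply_symm_apply] at h
        exact (congrArg Subtype.val h).symm) }
  refine ⟨σ, isIso_of_le_iff (fun v w => ?_) hf⟩
  have h := he ⟨_, X.isLower_below v⟩ ⟨_, X.isLower_below w⟩
  rw [hf', hf', below_subset_iff (Y.isLower_below _), below_subset_iff (X.isLower_below _),
    mem_below, mem_below] at h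
  exact h

end LForest

/-! ### Intervals of the NAP partition posets as lattices of lower sets. -/

namespace NAPInterval

open LForest

variable {A : Type*} (i : NAPInterval A)

/-- The vertices which are grafted between the bottom and the top of the interval. -/
def grafted : Set (Fin i.n) := {v | i.bot.parent v = none ∧ i.top.parent v ≠ none}

/-- The forest of the grafted vertices. -/
noncomputable def forest : LForest A i.grafted := (⟨i.top, i.lab⟩ : LForest A (Fin i.n)).restrict _

variable {i}

theorem parent_of_isSome {Z : i.Elem} {v p : Fin i.n} (h : Z.1.parent v = some p) :
    i.top.parent v = some p :=
  (RForest.napLe_iff.1 Z.2.2).1 v p h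

theorem bot_eq_none {Z : i.Elem} {v : Fin i.n} (h : Z.1.parent v = none) :
    i.bot.parent v = none := by
  by_contra hne
  obtain ⟨p, hp⟩ := Option.ne_none_iff_exists'.1 hne
  rw [(RForest.napLe_iff.1 Z.2.1).1 v p hp] at h
  cases h

/-- The grafted vertices which are roots in the element `Z`. -/
noncomputable def roots (Z : i.Elem) : Finset i.grafted :=
  (Set.toFinite {v : i.grafted | Z.1.parent v = none}).toFinset

theorem mem_roots {Z : i.Elem} {v : i.grafted} : v ∈ roots Z ↔ Z.1.parent v = none := by
  simp [roots]

theorem isLower_roots (Z : i.Elem) : i.forest.IsLower (roots Z) := by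
  refine isLower_iff.2 fun v p hp hv => ?_
  rw [mem_roots] at hv ⊢
  exact (RForest.napLe_iff.1 Z.2.2).2 v p hv (RForest.restrict_parent_eq_some.1 hp)

theorem parent_eq_top {Z : i.Elem} {v : Fin i.n} (h : ∀ hv : v ∈ i.grafted, ⟨v, hv⟩ ∉ roots Z) :
    Z.1.parent v = i.top.parent v := by
  cases hp : Z.1.parent v with
  | some p => exact (parent_of_isSome hp).symm
  | none =>
    by_contra hne
    exact h ⟨bot_eq_none hp, Ne.symm hne⟩ (mem_roots.2 hp)

/-- Every edge of an element of the interval is an edge of the top, so an element only decides which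
grafted vertices are still roots. Going up in the poset grafts more of them. -/
theorem napLe_iff_roots {Z Z' : i.Elem} : Z.1.NAPLe Z'.1 ↔ roots Z' ⊆ roots Z := by
  rw [RForest.napLe_iff]
  constructor
  · rintro ⟨h1, h2⟩ v hv
    rw [mem_roots] at hv ⊢
    by_contra hne
    obtain ⟨p, hp⟩ := Option.ne_none_iff_exists'.1 hne
    rw [h1 _ p hp] at hv
    cases hv
  · intro h
    refine ⟨fun v p hp => ?_, fun v p hv hp => ?_⟩
    · rw [parent_eq_top, parent_of_isSome hp]
      intro hv hv'
      have := mem_roots.1 (h hv')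
      rw [hp] at this
      cases this
    · exact (RForest.napLe_iff.1 Z.2.2).2 v p hv (parent_of_isSome hp)

theorem napCover_iff_roots {Z Z' : i.Elem} {a : A} :
    Z.1.NAPCover i.lab a Z'.1 ↔ i.forest.Removes a (roots Z) (roots Z') := by
  constructor
  · rintro ⟨v, r, hvr, hv, hr, ha, hp, hw⟩
    have hvN : v ∈ i.grafted := ⟨bot_eq_none hv, by rw [parent_of_isSome hp]; simp⟩
    refine ⟨⟨v, hvN⟩, mem_roots.2 hv, ha, fun w => ?_⟩
    rw [mem_roots, mem_roots]
    by_cases hwv : w = ⟨v, hvN⟩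
    · subst hwv
      simp [hp]
    · rw [hw w fun h => hwv (Subtype.ext h)]
      simp [hwv]
  · rintro ⟨v, hv, ha, h⟩
    have hv' := mem_roots.1 hv
    obtain ⟨r, hr⟩ := Option.ne_none_iff_exists'.1 v.2.2
    refine ⟨v, r, ?_, hv', (RForest.napLe_iff.1 Z.2.2).2 v r hv' hr, ha, ?_, fun w hw => ?_⟩
    · intro hvr
      exact i.top.wf.irrefl.irrefl r (by rw [hvr] at hr; exact hr)
    · rw [parent_eq_top, hr]
      exact fun _ h' => ((h v).1 h').2 rfl
    · by_cases hw' : ∃ hwN : w ∈ i.grafted, ⟨w, hwN⟩ ∈ roots Z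
      · obtain ⟨hwN, hw'⟩ := hw'
        rw [mem_roots.1 hw', mem_roots.1 ((h ⟨w, hwN⟩).2 ⟨hw', fun h => hw (congrArg Subtype.val h)⟩)]
      · push Not at hw'
        rw [parent_eq_top hw', parent_eq_top fun hwN h' => hw' hwN ((h _).1 h').1]

/-- The elements of an interval correspond to the lower sets of the forest of grafted vertices. -/
noncomputable def elemEquiv (i : NAPInterval A) : i.Elem ≃ {S // i.forest.IsLower S} := by
  refine Equiv.ofBijective (fun Z => ⟨roots Z, isLower_roots Z⟩) ⟨?_, ?_⟩
  · intro Z Z' h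
    have h' : roots Z = roots Z' := congrArg Subtype.val h
    refine Subtype.ext (RForest.ext (funext fun v => ?_))
    by_cases hv : ∃ hvN : v ∈ i.grafted, ⟨v, hvN⟩ ∈ roots Z
    · obtain ⟨hvN, hv⟩ := hv
      exact (mem_roots.1 hv).trans (mem_roots.1 (h' ▸ hv)).symm
    · push Not at hv
      exact (parent_eq_top hv).trans (parent_eq_top (h' ▸ hv)).symm
  · rintro ⟨S, hS⟩
    classical
    -- The element with roots `S` is obtained from the top by deleting the edges from the vertices
    -- of `S` to their parents.
    let Z : RForest (Fin i.n) :=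
      { parent := fun v => if ∃ hv : v ∈ i.grafted, ⟨v, hv⟩ ∈ S then none else i.top.parent v
        wf := by
          refine Subrelation.wf (fun {u v} h => ?_) i.top.wf
          by_contra hne
          split_ifs at h
          exact hne h }
    have hZ : ∀ v p, Z.parent v = some p → i.top.parent v = some p := by
      intro v p h
      simp only [Z] at h
      split_ifs at h
      exact h
    have hle := RForest.napLe_iff.1 i.le
    have h1 : i.bot.NAPLe Z := by
      refine RForest.napLe_iff.2 ⟨fun v p hp => ?_, fun v p hv hp => hle.2 v p hv (hZ v p hp)⟩
      simp only [Z]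
      rw [if_neg, hle.1 v p hp]
      rintro ⟨hv, -⟩
      rw [hv.1] at hp
      cases hp
    have h2 : Z.NAPLe i.top := by
      refine RForest.napLe_iff.2 ⟨hZ, fun v p hv hp => ?_⟩
      have hvS : ∃ hv : v ∈ i.grafted, ⟨v, hv⟩ ∈ S := by
        by_contra hn
        simp only [Z, if_neg hn, hp] at hv
        cases hv
      obtain ⟨hvN, hvS⟩ := hvS
      simp only [Z]
      split_ifs with hpS
      · rfl
      · by_contra hne
        -- Grafting must take place onto roots. A parent that is itself grafted belongs to `S`
        -- because `S` is a lower set, and so it is a root of `Z`.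
        have hpN : p ∈ i.grafted := ⟨hle.2 v p hvN.1 hp, hne⟩
        refine hpS ⟨hpN, isLower_iff.1 hS ⟨v, hvN⟩ ⟨p, hpN⟩ ?_ hvS⟩
        exact RForest.restrict_parent_eq_some.2 hp
    refine ⟨⟨Z, h1, h2⟩, Subtype.ext (Finset.ext fun v => ?_)⟩
    refine mem_roots.trans ?_
    simp only [Z]
    constructor
    · intro h
      split_ifs at h with hv
      · exact hv.2
      · exact absurd h v.2.2
    · intro h
      rw [if_pos ⟨v.2, h⟩]

theorem elemEquiv_apply (Z : i.Elem) : (i.elemEquiv Z).1 = roots Z := rfl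

/-- Under `elemEquiv` an isomorphism of labelled intervals is an isomorphism of lattices of lower
sets respecting labelled removals, and such an isomorphism comes from an isomorphism of the forests
of grafted vertices. Conversely, an isomorphism of these forests transports lower sets. -/
theorem cls_eq_cls_iff {i j : NAPInterval A} : i.cls = j.cls ↔ i.forest.cls = j.forest.cls := by
  classical
  constructor
  · intro h
    obtain ⟨φ, h1, h2⟩ := Quotient.exact h
    refine LForest.cls_eq_cls_iff.2 (exists_isIso_of_lower
      ((i.elemEquiv.symm.trans φ).trans j.elemEquiv) (fun S S' => ?_) (fun a S S' => ?_))
    · obtain ⟨Z, rfl⟩ := i.elemEquiv.surjective S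
      obtain ⟨Z', rfl⟩ := i.elemEquiv.surjective S'
      simp only [Equiv.trans_apply, Equiv.symm_apply_apply, elemEquiv_apply]
      rw [← napLe_iff_roots, ← napLe_iff_roots, h1]
    · obtain ⟨Z, rfl⟩ := i.elemEquiv.surjective S
      obtain ⟨Z', rfl⟩ := i.elemEquiv.surjective S'
      simp only [Equiv.trans_apply, Equiv.symm_apply_apply, elemEquiv_apply]
      rw [← napCover_iff_roots, ← napCover_iff_roots, h2]
  · intro h
    obtain ⟨e, he⟩ := LForest.cls_eq_cls_iff.1 h
    have hlow : ∀ S : Finset i.grafted, i.forest.IsLower S ↔ j.forest.IsLower (S.map e.toEmbedding) := by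
      intro S
      constructor
      · intro hS x y hyx hx
        obtain ⟨x, rfl⟩ := e.surjective x
        obtain ⟨y, rfl⟩ := e.surjective y
        rw [he.le_iff] at hyx
        simp only [Finset.mem_map_equiv, Equiv.symm_apply_apply] at hx ⊢
        exact hS _ _ hyx hx
      · intro hS x y hyx hx
        have := hS (e x) (e y) ((he.le_iff _ _).2 hyx)
        simp only [Finset.mem_map_equiv, Equiv.symm_apply_apply] at this
        exact this hx
    let ψ : {S // i.forest.IsLower S} ≃ {S // j.forest.IsLower S} :=
      e.finsetCongr.subtypeEquiv hlow
    have hψ : ∀ Z, roots (j.elemEquiv.symm (ψ (i.elemEquiv Z))) =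
        (roots Z).map e.toEmbedding := by
      intro Z
      rw [← elemEquiv_apply, Equiv.apply_symm_apply]
      rfl
    refine Quotient.sound ⟨(i.elemEquiv.trans ψ).trans j.elemEquiv.symm,
      fun Z Z' => ?_, fun a Z Z' => ?_⟩
    · simp only [Equiv.trans_apply, napLe_iff_roots, hψ, Finset.map_subset_map]
    · simp only [Equiv.trans_apply, napCover_iff_roots, hψ, he.removes_iff]

end NAPInterval

/-! ### The correspondence between classes of intervals and forests. -/

namespace NAPInterval

open LForest

variable {A : Type*}

theorem cls_forest_sum (i j : NAPInterval A) :
    (i.sum j).forest.cls = i.forest.cls * j.forest.cls := by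
  let X : LForest A (Fin i.n) := ⟨i.top, i.lab⟩
  let Y : LForest A (Fin j.n) := ⟨j.top, j.lab⟩
  have h1 : ((X.sum Y).restrict (finSumFinEquiv ⁻¹' (i.sum j).grafted)).cls =
      (i.sum j).forest.cls :=
    (((X.sum Y).isIso_transport finSumFinEquiv).restrict fun _ => Iff.rfl).cls_eq
  rw [← h1, cls_restrict_sum]
  congr 1
  · refine cls_restrict_congr _ (Set.ext fun v => ?_)
    simp [NAPInterval.sum, grafted, RForest.transport, RForest.sum]
  · refine cls_restrict_congr _ (Set.ext fun v => ?_)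
    simp [NAPInterval.sum, grafted, RForest.transport, RForest.sum]

theorem cls_forest_point : (point (A := A)).forest.cls = 1 := by
  have : IsEmpty (point (A := A)).grafted := ⟨fun v => v.1.elim0⟩
  exact cls_eq_one _

/-- The grafted vertices that are no longer roots in `Z` are grafted between the bottom and `Z`, the
others between `Z` and the top. This is why the incidence coproduct becomes the sum over lower sets.
-/
theorem cls_forest_lower (i : NAPInterval A) (Z : i.Elem) :
    (i.lower Z).forest.cls = (i.forest.restrict {x | x ∉ roots Z}).cls := by
  have hg : (i.lower Z).grafted = Subtype.val '' {x : i.grafted | x ∉ roots Z} := by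
    ext v
    constructor
    · rintro ⟨hv, hv'⟩
      obtain ⟨p, hp⟩ := Option.ne_none_iff_exists'.1 hv'
      refine ⟨⟨v, hv, ?_⟩, ?_, rfl⟩
      · rw [parent_of_isSome (Z := Z) hp]
        simp
      · exact fun h => hv' (mem_roots.1 h)
    · rintro ⟨v, hv, rfl⟩
      exact ⟨v.2.1, fun h => hv (mem_roots.2 h)⟩
  refine Eq.trans (Eq.trans ?_ (cls_restrict_congr _ hg)) (cls_restrict_restrict _ _ _).symm
  refine cls_restrict_eq (fun v hv => ?_) rfl
  obtain ⟨p, hp⟩ := Option.ne_none_iff_exists'.1 hv.2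
  exact hp.trans (parent_of_isSome (Z := Z) hp).symm

theorem cls_forest_upper (i : NAPInterval A) (Z : i.Elem) :
    (i.upper Z).forest.cls = (i.forest.restrict {x | x ∈ roots Z}).cls := by
  refine Eq.trans ?_ (cls_restrict_restrict _ _ _).symm
  refine cls_restrict_congr _ (Set.ext fun v => ?_)
  constructor
  · rintro ⟨hv, hv'⟩
    exact ⟨⟨v, bot_eq_none (Z := Z) hv, hv'⟩, mem_roots.2 hv, rfl⟩
  · rintro ⟨v, hv, rfl⟩
    exact ⟨mem_roots.1 hv, v.2.2⟩

/-- The interval from the forest without edges to the given forest. -/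
def ofForest {n : ℕ} (X : LForest A (Fin n)) : NAPInterval A where
  n := n
  lab := X.lab
  bot := ⟨fun _ => none, ⟨fun v => ⟨_, fun _ h => (Option.some_ne_none _ h.symm).elim⟩⟩⟩
  top := X.toRForest
  le := RForest.napLe_iff.2 ⟨fun _ _ h => (Option.some_ne_none _ h.symm).elim, fun _ _ _ _ => rfl⟩

/-- In the interval from the edgeless forest to a tree every vertex but the root is grafted. So a
forest is realised by adding a root, whose label is irrelevant; the empty forest offers no label to
borrow and is realised by the point instead. -/
theorem exists_cls_forest_eq (u : Forest A) : ∃ i : NAPInterval A, i.forest.cls = u := by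
  obtain ⟨n, X, rfl⟩ := Forest.exists_cls u
  rcases n with _ | n
  · exact ⟨point, cls_forest_point.trans (cls_eq_one X).symm⟩
  · obtain ⟨e, he⟩ := Forest.exists_isIso_rep_cls (X.addRoot (X.lab 0))
    refine ⟨ofForest (X.addRoot (X.lab 0)).cls.rep, ?_⟩
    have h : ((X.addRoot (X.lab 0)).restrict {v | v ≠ none}).cls =
        (ofForest (X.addRoot (X.lab 0)).cls.rep).forest.cls := by
      refine (he.restrict fun v => ?_).cls_eq
      have : v ≠ none ↔ (X.addRoot (X.lab 0)).parent v ≠ none := by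
        cases v <;> simp [LForest.addRoot, RForest.addRoot]
      refine this.trans ?_
      have h : (X.addRoot (X.lab 0)).parent v ≠ none ↔
          (X.addRoot (X.lab 0)).cls.rep.parent (e v) ≠ none := by
        rw [(he v).1, Ne, Ne, Option.map_eq_none_iff]
      exact h.trans ⟨fun h => ⟨rfl, h⟩, fun h => h.2⟩
    rw [← h, cls_restrict_addRoot_of_notMem _ _ (by simp), cls_restrict_univ _ (by simp)]

/-- The forest attached to a class of intervals. -/
noncomputable def Cls.toForest : Cls A → Forest A :=
  Quotient.lift (fun i => i.forest.cls) fun _ _ h => cls_eq_cls_iff.1 (Quotient.sound h)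

theorem toForest_cls (i : NAPInterval A) : i.cls.toForest = i.forest.cls := rfl

theorem cls_out (c : Cls A) : c.out.cls = c := Quotient.out_eq c

theorem Cls.toForest_bijective : Function.Bijective (Cls.toForest (A := A)) := by
  constructor
  · intro c d h
    rw [← cls_out c, ← cls_out d] at h ⊢
    exact cls_eq_cls_iff.2 h
  · intro u
    obtain ⟨i, hi⟩ := exists_cls_forest_eq u
    exact ⟨i.cls, hi⟩

end NAPInterval

/-! ### The incidence Hopf algebra of NAP as the algebra of forests. -/

namespace NAPHopf

open LForest NAPInterval

variable {K A : Type*} [Field K]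

/-- The linear isomorphism of the incidence Hopf algebra of NAP with the algebra of forests. -/
noncomputable def equiv (K A : Type*) [Field K] : (Cls A →₀ K) ≃ₗ[K] (Forest A →₀ K) :=
  Finsupp.domLCongr (Equiv.ofBijective _ Cls.toForest_bijective)

theorem equiv_single (c : Cls A) (r : K) :
    equiv K A (Finsupp.single c r) = Finsupp.single c.toForest r := by
  simp [equiv]

theorem induction_cls {P : (Cls A →₀ K) → Prop} (zero : P 0)
    (add : ∀ x y, P x → P y → P (x + y)) (smul : ∀ (r : K) x, P x → P (r • x))
    (single : ∀ u, P (Finsupp.single u 1)) (x : Cls A →₀ K) : P x := by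
  induction x using Finsupp.induction_linear with
  | zero => exact zero
  | add x y hx hy => exact add _ _ hx hy
  | single u r =>
    have := smul r _ (single u)
    rwa [Finsupp.smul_single, smul_eq_mul, mul_one] at this

theorem equiv_mul_single (c d : Cls A) : equiv K A ((napHopf K A).mul (Finsupp.single c 1)
    (Finsupp.single d 1)) = Finsupp.single (c.toForest * d.toForest) 1 := by
  simp only [napHopf, Finsupp.linearCombination_single, one_smul]
  rw [equiv_single, toForest_cls, cls_forest_sum, ← toForest_cls, ← toForest_cls, cls_out, cls_out]

open Classical in
theorem map_comul_single (c : Cls A) : TensorProduct.map (equiv K A).toLinearMap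
    (equiv K A).toLinearMap ((napHopf K A).comul (Finsupp.single c 1)) =
      (treeHopf K A).comul (Finsupp.single c.toForest 1) := by
  have hc : c.toForest = c.out.forest.cls := by rw [← toForest_cls, cls_out]
  let _ : Fintype c.out.grafted := Fintype.ofFinite _
  rw [hc, TreeHopf.comul_cls]
  simp only [napHopf, Finsupp.linearCombination_single, one_smul, map_sum]
  rw [Finset.sum_subtype (p := fun W => c.out.forest.IsLower W) _ (by simp)]
  refine Fintype.sum_equiv c.out.elemEquiv _ _ fun Z => ?_
  rw [TensorProduct.map_tmul]
  simp only [LinearEquiv.coe_coe, equiv_single, toForest_cls, cls_forest_lower, cls_forest_upper]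
  rfl

theorem isHom : PreHopf.IsHom (napHopf K A) (treeHopf K A) (equiv K A).toLinearMap where
  map_one := by
    refine (equiv_single _ _).trans ?_
    rw [toForest_cls, cls_forest_point]
    rfl
  map_mul x y := by
    simp only [LinearEquiv.coe_coe]
    induction x using induction_cls with
    | zero => simp
    | add x x' h h' => simp only [map_add, LinearMap.add_apply, h, h']
    | smul r x h => simp only [map_smul, LinearMap.smul_apply, h]
    | single c =>
      induction y using induction_cls with
      | zero => simp
      | add x x' h h' => simp only [map_add, h, h']
      | smul r x h => simp only [map_smul, h]
      | single d => rw [equiv_mul_single, equiv_single, equiv_single, TreeHopf.mul_single]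
  map_comul x := by
    simp only [LinearEquiv.coe_coe]
    induction x using induction_cls with
    | zero => simp
    | add x x' h h' => simp only [map_add, h, h']
    | smul r x h => simp only [map_smul, h]
    | single c => rw [map_comul_single, equiv_single]
  map_counit x := by
    classical
    simp only [LinearEquiv.coe_coe]
    induction x using induction_cls with
    | zero => simp
    | add x x' h h' => simp only [map_add, h, h']
    | smul r x h => simp only [map_smul, h]
    | single c =>
      rw [equiv_single, TreeHopf.counit_single]
      simp only [napHopf, Finsupp.linearCombination_single, one_smul]
      congr 1
      rw [← cls_forest_point, ← toForest_cls, Cls.toForest_bijective.1.eq_iff]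

instance isHopf : (napHopf K A).IsHopf := PreHopf.isHopf_of_equiv (equiv K A) isHom

end NAPHopf

/-! ### Transport of structure maps. -/

namespace PreHopf

variable {K V W : Type*} [Field K] [AddCommGroup V] [Module K V] [AddCommGroup W] [Module K W]

/-- Transport of structure along a linear isomorphism. -/
noncomputable def transport (D : PreHopf K V) (e : V ≃ₗ[K] W) : PreHopf K W where
  one := e D.one
  mul := (D.mul.compl₁₂ e.symm.toLinearMap e.symm.toLinearMap).compr₂ e.toLinearMap
  comul := TensorProduct.map e.toLinearMap e.toLinearMap ∘ₗ D.comul ∘ₗ e.symm.toLinearMap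
  counit := D.counit ∘ₗ e.symm.toLinearMap

theorem isHom_transport (D : PreHopf K V) (e : V ≃ₗ[K] W) :
    IsHom D (D.transport e) e.toLinearMap where
  map_one := rfl
  map_mul x y := by simp [transport]
  map_comul x := by simp [transport]
  map_counit x := by simp [transport]

end PreHopf

/-! ### The derivations removing a first letter. -/

namespace QuasiShuffle

variable {K A : Type*} [Field K] {deg : A → ℕ} (p : HoffmanPairing A deg)

/-- Removal of the first letter. -/
noncomputable def tailL (K : Type*) [Field K] (a : A) : (List A →₀ K) →ₗ[K] (List A →₀ K) :=
  Finsupp.lcomapDomain (List.cons a) (List.cons_injective)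

theorem tailL_apply (a : A) (x : List A →₀ K) (w : List A) : tailL K a x w = x (a :: w) := rfl

open Classical in
theorem tailL_consL (a b : A) (x : List A →₀ K) :
    tailL K a (consL K b x) = if b = a then x else 0 := by
  ext w
  rw [tailL_apply, consL_apply_cons]
  split_ifs <;> rfl

theorem tailL_nil (a : A) : tailL K a (Finsupp.single [] 1) = 0 := by
  ext w
  rw [tailL_apply]
  simp

/-- Removal of the first letter is a derivation of the shuffle algebra. -/
theorem tailL_mul (hp : ∀ a b, p.pair (some a) (some b) = none) (a : A) (x y : List A →₀ K) :
    tailL K a ((quasiShuffleHopf K p).mul x y) =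
      (quasiShuffleHopf K p).mul (tailL K a x) y + (quasiShuffleHopf K p).mul x (tailL K a y) := by
  classical
  induction x using induction_consL with
  | zero => simp
  | add f g hf hg => simp only [map_add, LinearMap.add_apply, hf, hg]; abel
  | smul r f hf => simp only [map_smul, LinearMap.smul_apply, hf, smul_add]
  | nil => rw [nil_mul, nil_mul, tailL_nil]; simp
  | consL b x hx =>
    clear hx
    induction y using induction_consL with
    | zero => simp
    | add f g hf hg => simp only [map_add, hf, hg]; abel
    | smul r f hf => simp only [map_smul, hf, smul_add]
    | nil => rw [mul_nil, mul_nil, tailL_nil]; simp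
    | consL c y hy =>
      rw [mul_consL_consL, hp]
      simp only [map_add, tailL_consL, consO_none, LinearMap.zero_apply, add_zero]
      congr 1 <;> split_ifs <;> simp

end QuasiShuffle

/-! ### The universal Hopf algebra of renormalization as a shuffle algebra. -/

namespace UniversalHopf

open QuasiShuffle

variable {K : Type*} [Field K]

/-- The product of the generators of the enveloping algebra with the given indices. -/
noncomputable def word (K : Type*) [Field K] (l : List ℕ+ᵒᵈ) : EnvU K :=
  (l.map fun n => UniversalEnvelopingAlgebra.ι K (FreeLieAlgebra.of K (OrderDual.ofDual n))).prod

@[simp] theorem word_nil : word K [] = 1 := rfl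

theorem word_cons (n : ℕ+ᵒᵈ) (l : List ℕ+ᵒᵈ) : word K (n :: l) =
    UniversalEnvelopingAlgebra.ι K (FreeLieAlgebra.of K (OrderDual.ofDual n)) * word K l := by
  simp [word]

theorem word_append (l l' : List ℕ+ᵒᵈ) : word K (l ++ l') = word K l * word K l' := by
  simp [word]

theorem _root_.FreeAlgebra.basisFreeMonoid_apply {R X : Type*} [CommSemiring R] (l : List X) :
    FreeAlgebra.basisFreeMonoid R X (FreeMonoid.ofList l) = (l.map (FreeAlgebra.ι R)).prod := by
  rw [FreeAlgebra.basisFreeMonoid, Module.Basis.map_apply]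
  simp [FreeAlgebra.equivMonoidAlgebraFreeMonoid, MonoidAlgebra.lift_single, FreeMonoid.lift_apply]

/-- The words in the generators form a basis of the enveloping algebra. -/
theorem exists_basis (K : Type*) [Field K] :
    ∃ b : Module.Basis (List ℕ+ᵒᵈ) K (EnvU K), ∀ l, b l = word K l := by
  let σ : FreeMonoid ℕ+ ≃ List ℕ+ᵒᵈ :=
    { toFun := fun w => w.toList.map OrderDual.toDual
      invFun := fun w => FreeMonoid.ofList (w.map OrderDual.ofDual)
      left_inv := fun w => by simp
      right_inv := fun w => by simp }
  -- The enveloping algebra of a free Lie algebra is the free algebra on the same generators, whose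
  -- monomials form a basis.
  refine ⟨((FreeAlgebra.basisFreeMonoid K ℕ+).map
    (FreeLieAlgebra.universalEnvelopingEquivFreeAlgebra K ℕ+).symm.toLinearEquiv).reindex σ,
      fun l => ?_⟩
  rw [Module.Basis.reindex_apply, Module.Basis.map_apply]
  have h : FreeAlgebra.basisFreeMonoid K ℕ+ (σ.symm l) =
      ((l.map OrderDual.ofDual).map (FreeAlgebra.ι K)).prod :=
    FreeAlgebra.basisFreeMonoid_apply _
  rw [h]
  refine (map_list_prod (FreeLieAlgebra.universalEnvelopingEquivFreeAlgebra K ℕ+).symm _).trans ?_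
  rw [word, List.map_map, List.map_map]
  congr 1
  refine List.map_congr_left fun n _ => ?_
  simp

/-- The basis of words of the enveloping algebra. -/
noncomputable def wordBasis (K : Type*) [Field K] : Module.Basis (List ℕ+ᵒᵈ) K (EnvU K) :=
  (exists_basis K).choose

@[simp] theorem wordBasis_apply (l : List ℕ+ᵒᵈ) : wordBasis K l = word K l :=
  (exists_basis K).choose_spec l

/-- The linear form with given values on words. -/
noncomputable def form (K : Type*) [Field K] :
    (List ℕ+ᵒᵈ →₀ K) →ₗ[K] Module.Dual K (EnvU K) :=
  ((wordBasis K).constr K).toLinearMap ∘ₗ Finsupp.lcoeFun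

theorem form_word (x : List ℕ+ᵒᵈ →₀ K) (l : List ℕ+ᵒᵈ) : form K x (word K l) = x l := by
  rw [← wordBasis_apply]
  exact (wordBasis K).constr_basis K _ l

/-- The degree of a word. -/
def wordDegree (l : List ℕ+ᵒᵈ) : ℕ := (l.map fun n => ((OrderDual.ofDual n : ℕ+) : ℕ)).sum

/-- Generators have positive degree and there is one for each degree. Hence a linear form vanishing
in large degrees is nonzero on finitely many words only, which identifies the graded dual with the
span of words. -/
theorem finite_wordDegree_lt (N : ℕ) : {l | wordDegree l < N}.Finite := by
  induction N with
  | zero => simp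
  | succ N ih =>
    refine (((Set.finite_singleton []).union (Set.Finite.image2 (fun (n : ℕ+ᵒᵈ) l => n :: l)
      (Set.Finite.preimage (f := fun n : ℕ+ᵒᵈ => ((OrderDual.ofDual n : ℕ+) : ℕ))
        (PNat.coe_injective.injOn) (Set.finite_Iio (N + 1))) ih)).subset ?_)
    rintro (_ | ⟨n, l⟩) h
    · exact Or.inl rfl
    · simp only [wordDegree, List.map_cons, List.sum_cons, Set.mem_ofPred_eq] at h
      have hn := (OrderDual.ofDual n : ℕ+).pos
      refine Or.inr ⟨n, ?_, l, ?_, rfl⟩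
      · simp only [Set.mem_preimage, Set.mem_Iio]
        omega
      · simp only [wordDegree, Set.mem_ofPred_eq]
        omega

theorem word_mem_envGrade (l : List ℕ+ᵒᵈ) : word K l ∈ envGrade K (wordDegree l) :=
  Submodule.subset_span ⟨l, rfl, rfl⟩

theorem form_mem (x : List ℕ+ᵒᵈ →₀ K) : form K x ∈ HU K := by
  refine ⟨x.support.sup wordDegree + 1, fun m hm y hy => ?_⟩
  induction hy using Submodule.span_induction with
  | mem y hy =>
    obtain ⟨l, hl, rfl⟩ := hy
    refine (form_word x l).trans ?_
    by_contra h
    have h1 : wordDegree l ≤ x.support.sup wordDegree :=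
      Finset.le_sup (f := wordDegree) (Finsupp.mem_support_iff.2 h)
    have h2 : wordDegree l = m := hl
    omega
  | zero => exact map_zero _
  | add y z _ _ h h' => rw [map_add, h, h', add_zero]
  | smul r y _ h => rw [map_smul, h, smul_zero]

/-- The linear isomorphism of the space of words with the graded dual of the enveloping algebra. -/
noncomputable def equiv (K : Type*) [Field K] : (List ℕ+ᵒᵈ →₀ K) ≃ₗ[K] HU K := by
  refine LinearEquiv.ofBijective ((form K).codRestrict (HU K) form_mem) ⟨?_, ?_⟩
  · intro x y h
    ext l
    rw [← form_word, ← form_word]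
    exact DFunLike.congr_fun (congrArg Subtype.val h) _
  · rintro ⟨f, N, hf⟩
    have hfin : (Function.support fun l => f (word K l)).Finite := by
      refine (finite_wordDegree_lt N).subset fun l hl => ?_
      by_contra hN
      exact hl (hf _ (not_lt.1 hN) _ (word_mem_envGrade l))
    refine ⟨Finsupp.ofSupportFinite _ hfin, Subtype.ext ((wordBasis K).ext fun l => ?_)⟩
    rw [wordBasis_apply]
    exact form_word _ _

theorem equiv_word (x : List ℕ+ᵒᵈ →₀ K) (l : List ℕ+ᵒᵈ) :
    (equiv K x : Module.Dual K (EnvU K)) (word K l) = x l := form_word x l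

theorem ext_word {f g : Module.Dual K (EnvU K)} (h : ∀ l, f (word K l) = g (word K l)) (x : EnvU K) :
    f x = g x :=
  LinearMap.congr_fun ((wordBasis K).ext fun l => by simpa using h l) x

theorem pairU_word (z : (List ℕ+ᵒᵈ →₀ K) ⊗[K] (List ℕ+ᵒᵈ →₀ K)) (l l' : List ℕ+ᵒᵈ) :
    pairU K (TensorProduct.map (equiv K).toLinearMap (equiv K).toLinearMap z)
      (word K l ⊗ₜ word K l') = LinearMap.mul' K K
        (TensorProduct.map (Finsupp.lapply l) (Finsupp.lapply l') z) := by
  induction z with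
  | zero => simp
  | add z z' h h' => simp only [map_add, LinearMap.add_apply, h, h']
  | tmul x y =>
    simp only [pairU, LinearMap.comp_apply, TensorProduct.map_tmul,
      TensorProduct.dualDistrib_apply, LinearMap.mul'_apply]
    exact congrArg₂ _ (equiv_word x l) (equiv_word y l')

/-- Left multiplication by a generator prepends a letter to a basis word, so its transpose removes a
first letter. -/
theorem equiv_gen_mul (x : List ℕ+ᵒᵈ →₀ K) (n : ℕ+ᵒᵈ) (y : EnvU K) :
    (equiv K x : Module.Dual K (EnvU K)) (UniversalEnvelopingAlgebra.ι K
      (FreeLieAlgebra.of K (OrderDual.ofDual n)) * y) =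
      (equiv K (tailL K n x) : Module.Dual K (EnvU K)) y := by
  have h := ext_word (f := (equiv K x : Module.Dual K (EnvU K)) ∘ₗ LinearMap.mulLeft K
    (UniversalEnvelopingAlgebra.ι K (FreeLieAlgebra.of K (OrderDual.ofDual n))))
    (g := (equiv K (tailL K n x) : Module.Dual K (EnvU K))) (fun l => by
      rw [LinearMap.comp_apply, LinearMap.mulLeft_apply, ← word_cons, equiv_word, equiv_word]
      rfl) y
  exact h

theorem pairU_gen_mul (x y : List ℕ+ᵒᵈ →₀ K) (n : ℕ+ᵒᵈ) (z : EnvU K ⊗[K] EnvU K) :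
    pairU K (equiv K x ⊗ₜ equiv K y) (envComul K (UniversalEnvelopingAlgebra.ι K
      (FreeLieAlgebra.of K (OrderDual.ofDual n))) * z) =
      pairU K (equiv K (tailL K n x) ⊗ₜ equiv K y) z +
        pairU K (equiv K x ⊗ₜ equiv K (tailL K n y)) z := by
  have h : envComul K (UniversalEnvelopingAlgebra.ι K
      (FreeLieAlgebra.of K (OrderDual.ofDual n))) =
      UniversalEnvelopingAlgebra.ι K (FreeLieAlgebra.of K (OrderDual.ofDual n)) ⊗ₜ 1 +
      1 ⊗ₜ UniversalEnvelopingAlgebra.ι K (FreeLieAlgebra.of K (OrderDual.ofDual n)) := by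
    rw [envComul, UniversalEnvelopingAlgebra.lift_ι_apply]
    rfl
  rw [h]
  induction z with
  | zero => simp
  | add z z' h h' => rw [mul_add, map_add, h, h', map_add, map_add]; abel
  | tmul a b =>
    rw [add_mul, map_add, Algebra.TensorProduct.tmul_mul_tmul, Algebra.TensorProduct.tmul_mul_tmul,
      one_mul, one_mul]
    have e : ∀ (f g : HU K) (a b : EnvU K), pairU K (f ⊗ₜ g) (a ⊗ₜ b) = f.1 a * g.1 b :=
      fun f g a b => TensorProduct.dualDistrib_apply ..
    rw [e, e, e, e, equiv_gen_mul, equiv_gen_mul]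

variable {deg : ℕ+ᵒᵈ → ℕ} (p : HoffmanPairing ℕ+ᵒᵈ deg)

/-- Generators are primitive, so splitting one off on the left produces the two terms of a Leibniz
rule. Removing a first letter is a derivation of the shuffle algebra, and so both sides satisfy the
same recursion in `l`. -/
theorem pairU_envComul (hp : ∀ a b, p.pair (some a) (some b) = none) (l : List ℕ+ᵒᵈ)
    (x y : List ℕ+ᵒᵈ →₀ K) : pairU K (equiv K x ⊗ₜ equiv K y) (envComul K (word K l)) =
      (quasiShuffleHopf K p).mul x y l := by
  induction l generalizing x y with
  | nil =>
    rw [word_nil, map_one, Algebra.TensorProduct.one_def, mul_apply_nil, ← word_nil]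
    refine (pairU_word (x ⊗ₜ y) [] []).trans ?_
    simp
  | cons n l ih =>
    rw [word_cons, map_mul, pairU_gen_mul, ih, ih, ← tailL_apply, tailL_mul p hp]
    rfl

/-- The structure maps of the universal Hopf algebra of renormalization. -/
noncomputable def hopf : PreHopf K (HU K) := (quasiShuffleHopf K p).transport (equiv K)

theorem isHom : PreHopf.IsHom (quasiShuffleHopf K p) (hopf p) (equiv K).toLinearMap :=
  PreHopf.isHom_transport (W := HU K) _ _

instance isHopf : (hopf (K := K) p).IsHopf :=
  PreHopf.isHopf_of_equiv (equiv K).symm (PreHopf.IsHom.symm (isHom p))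

theorem isUniversalHopf (hp : ∀ a b, p.pair (some a) (some b) = none) :
    IsUniversalHopf K (hopf p) where
  one_apply x := by
    refine ext_word (g := (envCounit K).toLinearMap) (fun l => ?_) x
    refine (equiv_word _ l).trans ?_
    rw [one_def, AlgHom.toLinearMap_apply]
    cases l with
    | nil => rw [word_nil, map_one]; simp
    | cons n l =>
      rw [word_cons, map_mul, envCounit, UniversalEnvelopingAlgebra.lift_ι_apply]
      simp
  mul_apply f g x := by
    obtain ⟨f, rfl⟩ := (equiv K).surjective f
    obtain ⟨g, rfl⟩ := (equiv K).surjective g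
    have h := (isHom p).map_mul f g
    simp only [LinearEquiv.coe_coe] at h
    rw [← h]
    refine ext_word (g := pairU K (equiv K f ⊗ₜ equiv K g) ∘ₗ (envComul K).toLinearMap)
      (fun l => ?_) x
    exact (equiv_word _ l).trans (pairU_envComul p hp l f g).symm
  comul_apply f x y := by
    obtain ⟨f, rfl⟩ := (equiv K).surjective f
    have h' := (isHom p).map_comul f
    simp only [LinearEquiv.coe_coe] at h'
    rw [h']
    -- Both sides are bilinear, and words suffice in each variable: here the first variable is a
    -- word and the second is arbitrary, and afterwards the first becomes arbitrary too.
    have h : ∀ l, pairU K (TensorProduct.map (equiv K).toLinearMap (equiv K).toLinearMap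
        ((quasiShuffleHopf K p).comul f)) ∘ₗ TensorProduct.mk K _ _ (word K l) =
        (equiv K f : Module.Dual K (EnvU K)) ∘ₗ LinearMap.mulLeft K (word K l) := by
      intro l
      refine LinearMap.ext (ext_word fun l' => ?_)
      refine (pairU_word _ l l').trans ((coeff_comul p l l' f).trans ?_)
      rw [LinearMap.comp_apply, LinearMap.mulLeft_apply, ← word_append, equiv_word]
    refine ext_word (f := pairU K (TensorProduct.map (equiv K).toLinearMap (equiv K).toLinearMap
        ((quasiShuffleHopf K p).comul f)) ∘ₗ (TensorProduct.mk K _ _).flip y)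
      (g := (equiv K f : Module.Dual K (EnvU K)) ∘ₗ LinearMap.mulRight K y) (fun l => ?_) x
    exact LinearMap.congr_fun (h l) y
  counit_apply f := by
    obtain ⟨f, rfl⟩ := (equiv K).surjective f
    have h := (isHom p).map_counit f
    simp only [LinearEquiv.coe_coe] at h
    rw [h, counit_apply, ← word_nil, equiv_word]

end UniversalHopf

/-! ### Lyndon words and their factorizations. -/

namespace Lyndon

variable {A : Type*} [LinearOrder A]

/-- The words `u < v` differ in some letter, i.e. neither is a prefix of the other. -/
def Diff (u v : List A) : Prop :=
  ∃ (p : List A) (a b : A) (s t : List A), a < b ∧ u = p ++ a :: s ∧ v = p ++ b :: t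

theorem Diff.append {u v : List A} (h : Diff u v) (s t : List A) : Diff (u ++ s) (v ++ t) := by
  obtain ⟨p, a, b, s', t', hab, rfl, rfl⟩ := h
  exact ⟨p, a, b, s' ++ s, t' ++ t, hab, by simp, by simp⟩

theorem Diff.lt {u v : List A} (h : Diff u v) : u < v := by
  obtain ⟨p, a, b, s, t, hab, rfl, rfl⟩ := h
  exact List.append_left_lt (List.cons_lt_cons_iff.2 (Or.inl hab))

theorem Diff.cons {u v : List A} (h : Diff u v) (a : A) : Diff (a :: u) (a :: v) := by
  obtain ⟨p, b, c, s, t, hab, rfl, rfl⟩ := h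
  exact ⟨a :: p, b, c, s, t, hab, rfl, rfl⟩

theorem diff_or_prefix_of_lt : ∀ {u v : List A}, u < v → Diff u v ∨ ∃ t, t ≠ [] ∧ v = u ++ t
  | [], [], h => absurd h (lt_irrefl _)
  | [], b :: v, _ => Or.inr ⟨b :: v, by simp, rfl⟩
  | a :: u, [], h => absurd h (List.not_lt_nil _)
  | a :: u, b :: v, h => by
    rcases List.cons_lt_cons_iff.1 h with h' | ⟨hab, h'⟩
    · exact Or.inl ⟨[], a, b, u, v, h', rfl, rfl⟩
    · rcases diff_or_prefix_of_lt h' with h | ⟨t, ht, h⟩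
      · exact Or.inl (hab ▸ h.cons a)
      · exact Or.inr ⟨t, ht, by rw [h, hab]; rfl⟩

theorem diff_of_lt_of_length_le {u v : List A} (h : u < v) (hl : v.length ≤ u.length) :
    Diff u v := by
  rcases diff_or_prefix_of_lt h with h | ⟨t, ht, rfl⟩
  · exact h
  · have := List.length_pos_iff.2 ht
    rw [List.length_append] at hl
    omega

theorem le_append (u v : List A) : u ≤ u ++ v := not_lt.1 fun h => by
  rcases diff_or_prefix_of_lt h with ⟨p, a, b, s, t, hab, h1, h2⟩ | ⟨t, ht, h⟩
  · rw [h2] at h1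
    simp at h1
    exact hab.ne' h1.1
  · simp [ht] at h

theorem append_lt_append_iff (p : List A) {u v : List A} : p ++ u < p ++ v ↔ u < v := by
  refine ⟨fun h => ?_, fun h => List.append_left_lt h⟩
  by_contra h'
  rcases lt_or_eq_of_le (not_lt.1 h') with h' | rfl
  · exact lt_asymm h (List.append_left_lt h')
  · exact lt_irrefl _ h

theorem append_le_append_iff (p : List A) {u v : List A} : p ++ u ≤ p ++ v ↔ u ≤ v := by
  rw [← not_lt, ← not_lt, append_lt_append_iff]

theorem cons_le_cons (a : A) {u v : List A} (h : u ≤ v) : a :: u ≤ a :: v :=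
  (append_le_append_iff [a]).2 h

theorem isLyndon_singleton (a : A) : IsLyndon [a] := by
  refine ⟨by simp, fun u v hu hv h => ?_⟩
  have := congrArg List.length h
  have := List.length_pos_iff.2 hu
  have := List.length_pos_iff.2 hv
  simp at *
  omega

theorem lt_of_suffix {w u v : List A} (hw : IsLyndon w) (h : w = u ++ v) (hu : u ≠ [])
    (hv : v ≠ []) : w < v := hw.2 u v hu hv h

theorem IsLyndon.le_suffix {w u v : List A} (hw : IsLyndon w) (h : w = u ++ v) (hv : v ≠ []) :
    w ≤ v := by
  by_cases hu : u = []
  · subst hu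
    exact h.le
  · exact (lt_of_suffix hw h hu hv).le

theorem append_lt_right {u v : List A} (hu : IsLyndon u) (hv : IsLyndon v) (h : u < v) :
    u ++ v < v := by
  rcases diff_or_prefix_of_lt h with h' | ⟨t, ht, rfl⟩
  · have := (h'.append v []).lt
    simpa using this
  · have h1 : u ++ t < t := lt_of_suffix hv rfl hu.1 ht
    exact (append_lt_append_iff u).2 h1

/-- A proper suffix of `u ++ v` is a suffix of `v`, or is a proper suffix of `u` followed by `v`. In
the second case the suffix of `u` is larger and shorter than `u`, so the two differ at some letter
and what follows is immaterial. -/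
theorem IsLyndon.append {u v : List A} (hu : IsLyndon u) (hv : IsLyndon v) (h : u < v) :
    IsLyndon (u ++ v) := by
  refine ⟨by simp [hu.1], fun p s hp hs he => ?_⟩
  have h0 := append_lt_right hu hv h
  rcases List.append_eq_append_iff.1 he with ⟨c, rfl, rfl⟩ | ⟨c, rfl, rfl⟩
  · exact h0.trans_le (IsLyndon.le_suffix hv rfl hs)
  · by_cases hc : c = []
    · subst hc
      simpa using h0
    · have h1 := diff_of_lt_of_length_le (lt_of_suffix hu rfl hp hc) (by simp)
      exact (h1.append v v).lt

/-- A nonincreasing sequence of Lyndon words. -/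
def IsFactorization (L : List (List A)) : Prop :=
  L.Pairwise (fun x y => y ≤ x) ∧ ∀ x ∈ L, IsLyndon x

theorem IsFactorization.tail {x : List A} {L : List (List A)} (h : IsFactorization (x :: L)) :
    IsFactorization L :=
  ⟨(List.pairwise_cons.1 h.1).2, fun y hy => h.2 y (by simp [hy])⟩

/-- If `x` is smaller than the first factor, the two merge to a longer Lyndon word, which is
inserted in turn; otherwise `x` can stand in front. -/
theorem exists_insert (L : List (List A)) : ∀ x : List A, IsLyndon x → IsFactorization L →
    ∃ L', IsFactorization L' ∧ L'.flatten = x ++ L.flatten := by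
  induction L with
  | nil => exact fun x hx _ => ⟨[x], ⟨by simp, by simpa using hx⟩, by simp⟩
  | cons y L ih =>
    intro x hx h
    by_cases hxy : x < y
    · obtain ⟨L', h1, h2⟩ := ih (x ++ y) (IsLyndon.append hx (h.2 y (by simp)) hxy) h.tail
      exact ⟨L', h1, by simp [h2]⟩
    · have hxy := not_lt.1 hxy
      refine ⟨x :: y :: L, ⟨List.pairwise_cons.2 ⟨fun z hz => ?_, h.1⟩, fun z hz => ?_⟩, by simp⟩
      · rcases List.mem_cons.1 hz with rfl | hz
        · exact hxy
        · exact ((List.pairwise_cons.1 h.1).1 z hz).trans hxy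
      · rcases List.mem_cons.1 hz with rfl | hz
        · exact hx
        · exact h.2 z hz

theorem exists_factorization (w : List A) : ∃ L, IsFactorization L ∧ L.flatten = w := by
  induction w with
  | nil => exact ⟨[], ⟨by simp, by simp⟩, rfl⟩
  | cons a w ih =>
    obtain ⟨L, hL, rfl⟩ := ih
    exact exists_insert L [a] (isLyndon_singleton a) hL

/-- A nonempty suffix of the concatenation begins with a nonempty suffix of one of the factors, and
the latter is at least that factor because the factor is a Lyndon word. -/
theorem le_of_suffix_flatten {y : List A} (L : List (List A)) : ∀ {p z : List A},
    (∀ x ∈ L, IsLyndon x ∧ y ≤ x) → L.flatten = p ++ z → z ≠ [] → y ≤ z := by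
  induction L with
  | nil => intro p z _ h hz; simp_all
  | cons x L ih =>
    intro p z hL h hz
    have hx := hL x (by simp)
    have hL' : ∀ x ∈ L, IsLyndon x ∧ y ≤ x := fun x hx => hL x (by simp [hx])
    rw [List.flatten_cons] at h
    rcases List.append_eq_append_iff.1 h with ⟨c, rfl, h'⟩ | ⟨c, rfl, rfl⟩
    · exact ih hL' h' hz
    · by_cases hc : c = []
      · subst hc
        exact ih (p := []) hL' rfl hz
      · exact (hx.2.trans (IsLyndon.le_suffix hx.1 rfl hc)).trans (le_append _ _)

/-- The last factor is a proper suffix of the Lyndon word `x`, hence larger than `x`, and it is the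
smallest factor. -/
theorem lt_of_mem_factorization {x p : List A} {L : List (List A)} (hx : IsLyndon x)
    (hL : IsFactorization L) (h : x = p ++ L.flatten) (hp : p ≠ []) : ∀ y ∈ L, x < y := by
  intro y hy
  rcases List.eq_nil_or_concat L with rfl | ⟨L', l, rfl⟩
  · simp at hy
  · rw [List.concat_eq_append] at *
    have hl : x < l := by
      refine lt_of_suffix hx (u := p ++ L'.flatten) (by simpa using h) (by simp [hp]) ?_
      exact (hL.2 l (by simp)).1
    rcases List.mem_append.1 hy with hy | hy
    · exact hl.trans_le ((List.pairwise_append.1 hL.1).2.2 y hy l (by simp))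
    · simp at hy
      exact hy ▸ hl

theorem exists_suffix_le_of_prefix (L : List (List A)) : ∀ {c d : List A}, L.flatten = c ++ d →
    c ≠ [] → (∀ l ∈ L, l ≠ []) → ∃ s p, c = s ++ p ∧ p ≠ [] ∧ ∃ l ∈ L, p ≤ l := by
  induction L with
  | nil => intro c d h hc; simp_all
  | cons l L ih =>
    intro c d h hc hL
    rw [List.flatten_cons] at h
    rcases List.append_eq_append_iff.1 h with ⟨e, rfl, h'⟩ | ⟨e, rfl, rfl⟩
    · by_cases he : e = []
      · subst he
        exact ⟨[], l, by simp, hL l (by simp), l, by simp, le_rfl⟩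
      · obtain ⟨s, p, rfl, hp, l', hl', hpl⟩ := ih h' he fun l hl => hL l (by simp [hl])
        exact ⟨l ++ s, p, by simp, hp, l', by simp [hl'], hpl⟩
    · exact ⟨[], c, rfl, hc, c ++ e, by simp, le_append _ _⟩

/-- Some nonempty suffix `p` of `c` is a prefix of a later factor `l`. If `y ++ c` were a Lyndon
word, then `y ++ c < p ≤ l ≤ y`, which is absurd. So the first factor is the longest Lyndon prefix,
and this makes the factorization unique. -/
theorem not_isLyndon_append_of_prefix {x y c d : List A} {L : List (List A)}
    (hL : IsFactorization (y :: L)) (hx : x = y ++ c) (hc : c ≠ []) (h : L.flatten = c ++ d) :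
    ¬ IsLyndon x := by
  intro hxL
  obtain ⟨s, p, rfl, hp, l, hl, hpl⟩ :=
    exists_suffix_le_of_prefix L h hc fun l hl => (hL.2 l (by simp [hl])).1
  have hy := (hL.2 y (by simp)).1
  have h1 : x < p := lt_of_suffix hxL (u := y ++ s) (by simp [hx]) (by simp [hy]) hp
  have h2 : l ≤ y := (List.pairwise_cons.1 hL.1).1 l hl
  have h3 : y ≤ x := hx ▸ le_append _ _
  exact absurd (((h1.trans_le hpl).trans_le h2).trans_le h3) (lt_irrefl _)

theorem factorization_unique : ∀ {L M : List (List A)}, IsFactorization L → IsFactorization M →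
    L.flatten = M.flatten → L = M
  | [], [], _, _, _ => rfl
  | [], y :: M, _, hM, h => by
    have := (hM.2 y (by simp)).1
    simp [List.flatten_cons] at h
    exact absurd h.1 this
  | x :: L, [], hL, _, h => by
    have := (hL.2 x (by simp)).1
    simp [List.flatten_cons] at h
    exact absurd h.1 this
  | x :: L, y :: M, hL, hM, h => by
    have hx := hL.2 x (by simp)
    have hy := hM.2 y (by simp)
    rw [List.flatten_cons, List.flatten_cons] at h
    rcases List.append_eq_append_iff.1 h with ⟨c, h1, h2⟩ | ⟨c, h1, h2⟩
    · by_cases hc : c = []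
      · subst hc
        simp only [List.append_nil, List.nil_append] at h1 h2
        rw [h1, factorization_unique hL.tail hM.tail h2]
      · exact absurd hy (not_isLyndon_append_of_prefix hL h1 hc h2)
    · by_cases hc : c = []
      · subst hc
        simp only [List.append_nil, List.nil_append] at h1 h2
        rw [h1, factorization_unique hL.tail hM.tail h2.symm]
      · exact absurd hx (not_isLyndon_append_of_prefix hM h1 hc h2)

/-- Every nonempty suffix of `L.flatten` is at least the smallest factor `y`, while `y`, as a proper
suffix, exceeds the whole Lyndon word. This shows that the word stays Lyndon without `y`; the
converse is concatenation of Lyndon words. -/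
theorem isLyndon_peel {a : A} {L : List (List A)} {y : List A}
    (h : IsFactorization (L ++ [y])) :
    IsLyndon (a :: L.flatten ++ y) ↔ IsLyndon (a :: L.flatten) ∧ a :: L.flatten < y := by
  have hy : IsLyndon y := h.2 y (by simp)
  refine ⟨fun hz => ?_, fun hx => IsLyndon.append hx.1 hy hx.2⟩
  have h1 : a :: L.flatten < y :=
    (le_append _ _).trans_lt (lt_of_suffix hz rfl (by simp) hy.1)
  refine ⟨⟨by simp, fun p s hp hs he => h1.trans_le ?_⟩, h1⟩
  obtain ⟨b, p, rfl⟩ := List.exists_cons_of_ne_nil hp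
  simp only [List.cons_append, List.cons.injEq] at he
  exact le_of_suffix_flatten L (fun x hx => ⟨h.2 x (by simp [hx]),
    (List.pairwise_append.1 h.1).2.2 x hx y (by simp)⟩) he.2 hs

/-- Translates the membership condition of Hall sets to words. One copy of `s` after another can be
appended, because a Lyndon word ending in `s` is again smaller than `s`; so only the comparison
without any copy of `s` remains. -/
theorem isLyndon_append_replicate {a : A} {L : List (List A)} {s : List A} {r : ℕ} (hr : 1 ≤ r)
    (h : IsFactorization (L ++ List.replicate r s)) :
    IsLyndon (a :: (L ++ List.replicate r s).flatten) ↔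
      IsLyndon (a :: L.flatten) ∧ a :: L.flatten < s := by
  induction r, hr using Nat.le_induction with
  | base => simpa using isLyndon_peel (a := a) h
  | succ r hr ih =>
    have he : L ++ List.replicate (r + 1) s = (L ++ List.replicate r s) ++ [s] := by
      rw [List.replicate_succ', List.append_assoc]
    rw [he] at h ⊢
    have h' : IsFactorization (L ++ List.replicate r s) :=
      ⟨(List.pairwise_append.1 h.1).1, fun x hx => h.2 x (List.mem_append_left _ hx)⟩
    have hp := isLyndon_peel (a := a) h
    have hf : a :: (L ++ List.replicate r s ++ [s]).flatten =
      a :: (L ++ List.replicate r s).flatten ++ s := by simp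
    rw [hf, hp, ih h']
    refine ⟨fun h => h.1, fun hx => ⟨hx, ?_⟩⟩
    obtain ⟨q, rfl⟩ := Nat.exists_eq_add_of_le' hr
    refine lt_of_suffix ((ih h').2 hx) (u := a :: (L ++ List.replicate q s).flatten) ?_ (by simp)
      (h.2 s (by simp)).1
    rw [List.replicate_succ']
    simp

end Lyndon

/-! ### Shuffles of words and their alphabetical maximum. -/

namespace Lyndon

variable {A : Type*}

/-- The word `w` is a shuffle of the words `u` and `v`. -/
inductive IsShuffle : List A → List A → List A → Prop
  | nil : IsShuffle [] [] []
  | left (a : A) {u v w : List A} (h : IsShuffle u v w) : IsShuffle (a :: u) v (a :: w)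
  | right (a : A) {u v w : List A} (h : IsShuffle u v w) : IsShuffle u (a :: v) (a :: w)

namespace IsShuffle

theorem symm {u v w : List A} (h : IsShuffle u v w) : IsShuffle v u w := by
  induction h with
  | nil => exact nil
  | left a _ ih => exact ih.right a
  | right a _ ih => exact ih.left a

theorem refl_right (v : List A) : IsShuffle [] v v := by
  induction v with
  | nil => exact nil
  | cons a v ih => exact ih.right a

theorem refl_append (u v : List A) : IsShuffle u v (u ++ v) := by
  induction u with
  | nil => exact refl_right v
  | cons a u ih => exact ih.left a

theorem eq_of_nil {u v w : List A} (h : IsShuffle u v w) (hu : u = []) : w = v := by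
  induction h with
  | nil => rfl
  | left a _ _ => simp at hu
  | right a _ ih => rw [ih hu]

theorem perm {u v w : List A} (h : IsShuffle u v w) : w.Perm (u ++ v) := by
  induction h with
  | nil => exact List.Perm.refl _
  | left a _ ih => exact ih.cons a
  | right a _ ih => exact (ih.cons a).trans List.perm_middle.symm

theorem concat_left {u v w : List A} (h : IsShuffle u v w) (a : A) :
    IsShuffle (u ++ [a]) v (w ++ [a]) := by
  induction h with
  | nil => exact nil.left a
  | left b _ ih => exact ih.left b
  | right b _ ih => exact ih.right b

theorem reverse {u v w : List A} (h : IsShuffle u v w) :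
    IsShuffle u.reverse v.reverse w.reverse := by
  induction h with
  | nil => exact nil
  | left a _ ih => simpa using ih.concat_left a
  | right a _ ih => simpa using (ih.symm.concat_left a).symm

end IsShuffle

theorem isShuffle_cons_iff {a b c : A} {u v w : List A} :
    IsShuffle (a :: u) (b :: v) (c :: w) ↔
      (a = c ∧ IsShuffle u (b :: v) w) ∨ (b = c ∧ IsShuffle (a :: u) v w) := by
  constructor
  · intro h
    cases h with
    | left _ h => exact Or.inl ⟨rfl, h⟩
    | right _ h => exact Or.inr ⟨rfl, h⟩
  · rintro (⟨rfl, h⟩ | ⟨rfl, h⟩)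
    · exact h.left _
    · exact h.right _

section Order

variable [LinearOrder A]

/-- The given shuffle is copied letter by letter until the first strictly larger letter occurs; from
there on any continuation is larger. Equality of the lengths excludes that a word is exhausted
early. -/
theorem IsShuffle.exists_le {u' v' w' : List A} (h : IsShuffle u' v' w') : ∀ {u v : List A},
    u' ≤ u → v' ≤ v → u'.length = u.length → v'.length = v.length →
    ∃ w, IsShuffle u v w ∧ w' ≤ w := by
  have step : ∀ (a : A) {u' v' w' : List A}, (∀ {u v : List A}, u' ≤ u → v' ≤ v →
      u'.length = u.length → v'.length = v.length → ∃ w, IsShuffle u v w ∧ w' ≤ w) →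
      ∀ {u v : List A}, a :: u' ≤ u → v' ≤ v → (a :: u').length = u.length →
      v'.length = v.length → ∃ w, IsShuffle u v w ∧ a :: w' ≤ w := by
    intro a u' v' w' ih u v hu hv hul hvl
    obtain _ | ⟨b, u⟩ := u
    · simp at hul
    rcases lt_or_eq_of_le hu with hu | hu
    · rcases List.cons_lt_cons_iff.1 hu with hab | ⟨rfl, hu'⟩
      · exact ⟨b :: (u ++ v), (IsShuffle.refl_append u v).left b,
          (List.cons_lt_cons_iff.2 (Or.inl hab)).le⟩
      · obtain ⟨w, hw, hle⟩ := ih (u := u) hu'.le hv (by simpa using hul) hvl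
        exact ⟨a :: w, hw.left a, cons_le_cons a hle⟩
    · obtain ⟨rfl, rfl⟩ := List.cons.inj hu
      obtain ⟨w, hw, hle⟩ := ih le_rfl hv rfl hvl
      exact ⟨a :: w, hw.left a, cons_le_cons a hle⟩
  induction h with
  | nil =>
    intro u v _ _ hu hv
    rw [List.length_nil] at hu hv
    rw [List.eq_nil_of_length_eq_zero hu.symm, List.eq_nil_of_length_eq_zero hv.symm]
    exact ⟨[], IsShuffle.nil, le_rfl⟩
  | left a _ ih => exact fun hu hv hul hvl => step a ih hu hv hul hvl
  | right a _ ih =>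
    intro u v hu hv hul hvl
    obtain ⟨w, hw, hle⟩ := step a (fun hv hu hvl hul => by
      obtain ⟨w, hw, hle⟩ := ih hu hv hul hvl
      exact ⟨w, hw.symm, hle⟩) hv hu hvl hul
    exact ⟨w, hw.symm, hle⟩

/-- If `c` is not a prefix of `y` the comparison is decided at a letter. Otherwise `y = c ++ t`, and
the Lyndon word `y` differs at a letter from its larger and shorter suffix `t`. -/
theorem append_append_lt {c y : List A} (hc : c ≠ []) (hy : IsLyndon y) (h : c < y)
    (z z' : List A) : c ++ (y ++ z) < y ++ z' := by
  rcases diff_or_prefix_of_lt h with h | ⟨t, ht, rfl⟩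
  · exact (h.append _ _).lt
  · have h1 := diff_of_lt_of_length_le (lt_of_suffix hy rfl hc ht) (by simp)
    rw [List.append_assoc c t z']
    exact (append_lt_append_iff c).2 (h1.append _ _).lt

theorem pairwise_ge_iff_append {L M : List (List A)} :
    (L ++ M).Pairwise (fun x y => y ≤ x) ↔ L.Pairwise (fun x y => y ≤ x) ∧
      M.Pairwise (fun x y => y ≤ x) ∧ ∀ x ∈ L, ∀ y ∈ M, y ≤ x := List.pairwise_append

theorem exists_sort (L : List (List A)) :
    ∃ M : List (List A), M.Perm L ∧ M.Pairwise (fun x y => y ≤ x) :=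
  ⟨_, List.perm_insertionSort (· ≥ ·) L, List.pairwise_insertionSort (· ≥ ·) L⟩

theorem eq_filter_append {L : List (List A)} (h : L.Pairwise (fun x y => y ≤ x)) (y : List A) :
    L = L.filter (y < ·) ++ L.filter (fun x => ¬ y < x) := by
  refine List.Perm.eq_of_pairwise (le := fun x y => y ≤ x) (fun _ _ _ _ h h' => le_antisymm h' h)
    h ?_ (by simpa only [decide_not] using
      (List.filter_append_perm (fun x => decide (y < x)) L).symm)
  refine pairwise_ge_iff_append.2 ⟨h.filter _, h.filter _, fun x hx z hz => ?_⟩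
  simp only [List.mem_filter, decide_eq_true_eq] at hx hz
  exact (not_lt.1 hz.2).trans hx.2.le

/-- The inductive step for `IsShuffle.le_flatten`. Without its first letter the Lyndon factor `a x'`
breaks up into the factors `X` of `x'`, all larger than `a x'`. If `a x'` is the largest factor,
then `X` followed by the other factors is already sorted. Otherwise the largest factor `y` exceeds
`a x'`; the sorted rearrangement starts with the members of `X` above `y` and continues with `y`.
Those members, preceded by `a`, form a prefix of `a x'` and hence a word below `y`, so
`append_append_lt` applies. -/
theorem cons_le_flatten {a : A} {x' : List A} {T Z : List (List A)} {w' : List A}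
    (hx : IsLyndon (a :: x')) (hT : ∀ t ∈ T, IsLyndon t)
    (hZ : IsFactorization Z) (hp : Z.Perm ((a :: x') :: T))
    (ih : ∀ X Z', IsFactorization X → X.flatten = x' → IsFactorization Z' → Z'.Perm (X ++ T) →
      w' ≤ Z'.flatten) : a :: w' ≤ Z.flatten := by
  obtain ⟨X, hX, hXx⟩ := exists_factorization x'
  have hgt : ∀ l ∈ X, a :: x' < l :=
    lt_of_mem_factorization hx hX (p := [a]) (by simp [hXx]) (by simp)
  obtain ⟨Z1, Z2, rfl, hZ1⟩ := List.eq_append_cons_of_mem (hp.mem_iff.2 List.mem_cons_self)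
  have hpT : (Z1 ++ Z2).Perm T := (List.perm_middle.symm.trans hp).cons_inv
  have hpw := pairwise_ge_iff_append.1 hZ.1
  have hZ2 : ∀ z ∈ Z2, z ≤ a :: x' := (List.pairwise_cons.1 hpw.2.1).1
  have hZ2f : IsFactorization Z2 := ⟨(List.pairwise_cons.1 hpw.2.1).2,
    fun z hz => hZ.2 z (by simp [hz])⟩
  obtain _ | ⟨y, Z1⟩ := Z1
  · have h := ih X (X ++ Z2) hX hXx ⟨pairwise_ge_iff_append.2 ⟨hX.1, hZ2f.1,
      fun l hl z hz => (hZ2 z hz).trans (hgt l hl).le⟩, fun z hz => ?_⟩ (hpT.append_left X)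
    · have := cons_le_cons a h
      simpa [hXx] using this
    · exact (List.mem_append.1 hz).elim (hX.2 z) (hZ2f.2 z)
  · obtain ⟨M, hM, hMs⟩ := exists_sort (X ++ T)
    have hMf : IsFactorization M := ⟨hMs, fun z hz =>
      (List.mem_append.1 (hM.mem_iff.1 hz)).elim (hX.2 z) (hT z)⟩
    have hy : IsLyndon y := hZ.2 y (by simp)
    have hxy : a :: x' < y := lt_of_le_of_ne (hpw.2.2 y (by simp) _ (by simp))
      fun h => hZ1 (by simp [h])
    have hTy : ∀ t ∈ T, t ≤ y := by
      intro t ht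
      have hm : t ∈ y :: (Z1 ++ (a :: x') :: Z2) := hp.mem_iff.2 (List.mem_cons_of_mem _ ht)
      rcases List.mem_cons.1 hm with rfl | hm
      · exact le_rfl
      · exact (List.pairwise_cons.1 hZ.1).1 t hm
    have hyM : y ∈ M := by
      refine hM.mem_iff.2 (List.mem_append_right _ (hpT.mem_iff.1 (by simp)))
    -- All members of `T` are at most `y`, so those above `y` come from `X` alone.
    have hfil : M.filter (y < ·) = X.filter (y < ·) := by
      have hT0 : T.filter (y < ·) = [] := by
        simpa [List.filter_eq_nil_iff] using hTy
      have := hM.filter (fun x => decide (y < x))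
      rw [List.filter_append, hT0, List.append_nil] at this
      exact this.eq_of_pairwise (fun _ _ _ _ h h' => le_antisymm h' h) (hMs.filter _)
        (hX.1.filter _)
    have hMe := eq_filter_append hMs y
    obtain ⟨R, hR⟩ : ∃ R, M.filter (fun x => ¬ y < x) = y :: R := by
      have hym : y ∈ M.filter (fun x => ¬ y < x) := by simp [hyM]
      have hs : (M.filter (fun x => ¬ y < x)).Pairwise (fun x y => y ≤ x) := hMs.filter _
      rcases hq : M.filter (fun x => ¬ y < x) with _ | ⟨z, R⟩
      · rw [hq] at hym
        simp at hym
      · rw [hq] at hym hs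
        have hz : ¬ y < z := by
          have : z ∈ M.filter (fun x => ¬ y < x) := by rw [hq]; simp
          simpa using (List.mem_filter.1 this).2
        have hzy : y ≤ z := by
          rcases List.mem_cons.1 hym with rfl | h
          · exact le_rfl
          · exact (List.pairwise_cons.1 hs).1 y h
        rw [le_antisymm hzy (not_lt.1 hz)]
        exact ⟨R, rfl⟩
    have h := cons_le_cons a (ih X M hX hXx hMf hM)
    have hc : a :: (X.filter (y < ·)).flatten < y := by
      refine lt_of_le_of_lt ?_ hxy
      have := le_append (a :: (X.filter (y < ·)).flatten) (X.filter (fun x => ¬ y < x)).flatten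
      rw [List.cons_append, ← List.flatten_append, ← eq_filter_append hX.1 y, hXx] at this
      exact this
    refine h.trans ?_
    have h2 := (append_append_lt (by simp) hy hc R.flatten (Z1 ++ (a :: x') :: Z2).flatten).le
    rw [hMe, hR, hfil]
    simpa using h2

/-- Induction on the length of `w`. Its first letter opens the first factor of `U` or of `V`; after
removing this letter, the factors of the rest of that factor still stand in front of the others in
nonincreasing order. -/
theorem IsShuffle.le_flatten {n : ℕ} : ∀ {w : List A} {U V Z : List (List A)}, w.length = n →
    IsShuffle U.flatten V.flatten w → IsFactorization U → IsFactorization V →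
    IsFactorization Z → Z.Perm (U ++ V) → w ≤ Z.flatten := by
  induction n with
  | zero =>
    intro w U V Z hw _ _ _ _ _
    rw [List.eq_nil_of_length_eq_zero hw]
    exact le_append [] _
  | succ n ihn =>
    have step : ∀ {a : A} {u w : List A} {U V Z : List (List A)}, w.length = n →
        U.flatten = a :: u → IsShuffle u V.flatten w → IsFactorization U → IsFactorization V →
        IsFactorization Z → Z.Perm (U ++ V) → a :: w ≤ Z.flatten := by
      intro a u w U V Z hw hu h hU hV hZ hp
      obtain _ | ⟨x, U⟩ := U
      · simp at hu
      have hx := hU.2 x (by simp)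
      obtain ⟨b, x, rfl⟩ := List.exists_cons_of_ne_nil hx.1
      rw [List.flatten_cons, List.cons_append] at hu
      obtain ⟨rfl, rfl⟩ := List.cons.inj hu
      refine cons_le_flatten (T := U ++ V) hx (fun t ht => ?_) hZ hp
        fun X Z' hX hXx hZ' hp' => ?_
      · exact (List.mem_append.1 ht).elim (hU.tail.2 t) (hV.2 t)
      · refine ihn (U := X ++ U) (V := V) hw (by rwa [List.flatten_append, hXx])
          ⟨pairwise_ge_iff_append.2 ⟨hX.1, hU.tail.1, fun l hl z hz => ?_⟩, fun z hz => ?_⟩ hV hZ'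
          (by rwa [List.append_assoc])
        · exact ((List.pairwise_cons.1 hU.1).1 z hz).trans
            (lt_of_mem_factorization hx hX (p := [b]) (by simp [hXx]) (by simp) l hl).le
        · exact (List.mem_append.1 hz).elim (hX.2 z) (hU.tail.2 z)
    intro w U V Z hw h hU hV hZ hp
    generalize hu : U.flatten = u at h
    generalize hv : V.flatten = v at h
    cases h with
    | nil => simp at hw
    | left a h => exact step (by simpa using hw) hu (hv ▸ h) hU hV hZ hp
    | right a h =>
      exact step (by simpa using hw) hv (hu ▸ h.symm) hV hU hZ (hp.trans List.perm_append_comm)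

end Order

end Lyndon

/-! ### Leading words of shuffle products. -/

namespace Lyndon

variable {K A : Type*} [Field K] {deg : A → ℕ} (p : HoffmanPairing A deg)

/-- All coefficients are natural numbers. -/
def NatCoeff (x : List A →₀ K) : Prop := ∀ v, ∃ n : ℕ, x v = n

/-- Natural numbers cannot cancel in characteristic zero. The words occurring in a shuffle product
can therefore be determined combinatorially. -/
theorem exists_sum_eq_natCast [CharZero K] {ι : Type*} (s : Finset ι) (f : ι → K)
    (hf : ∀ i ∈ s, ∃ n : ℕ, f i = n) :
    (∃ n : ℕ, ∑ i ∈ s, f i = n) ∧ (∑ i ∈ s, f i ≠ 0 ↔ ∃ i ∈ s, f i ≠ 0) := by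
  choose! g hg using hf
  have h : ∑ i ∈ s, f i = ((∑ i ∈ s, g i : ℕ) : K) := by
    rw [Nat.cast_sum]
    exact Finset.sum_congr rfl hg
  refine ⟨⟨_, h⟩, ?_⟩
  rw [h, Nat.cast_ne_zero, ← not_iff_not]
  push Not
  rw [Finset.sum_eq_zero_iff]
  refine forall₂_congr fun i hi => ?_
  rw [hg i hi, Nat.cast_eq_zero]

open Classical in
theorem quasiShuffle_apply [CharZero K] (hp : ∀ a b, p.pair (some a) (some b) = none)
    (u v : List A) : ∀ w, (∃ n : ℕ, quasiShuffle K p.pair u v w = n) ∧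
      (quasiShuffle K p.pair u v w ≠ 0 ↔ IsShuffle u v w) := by
  have base : ∀ v w : List A, (∃ n : ℕ, (Finsupp.single v (1 : K)) w = n) ∧
      ((Finsupp.single v (1 : K)) w ≠ 0 ↔ IsShuffle [] v w) := by
    intro v w
    rw [Finsupp.single_apply]
    by_cases h : v = w
    · subst h
      simpa using ⟨⟨1, by simp⟩, IsShuffle.refl_right v⟩
    · simpa [h] using ⟨⟨0, by simp⟩, fun h' => h (h'.eq_of_nil rfl).symm⟩
  match u, v with
  | [], v => rw [quasiShuffle]; exact base v
  | a :: u, [] =>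
    rw [quasiShuffle]
    intro w
    refine ⟨(base _ w).1, (base _ w).2.trans ⟨IsShuffle.symm, IsShuffle.symm⟩⟩
  | a :: u, b :: v =>
    intro w
    have h1 := quasiShuffle_apply hp u (b :: v)
    have h2 := quasiShuffle_apply hp (a :: u) v
    have e : quasiShuffle K p.pair (a :: u) (b :: v) =
        QuasiShuffle.consL K a (quasiShuffle K p.pair u (b :: v)) +
          QuasiShuffle.consL K b (quasiShuffle K p.pair (a :: u) v) := by
      rw [quasiShuffle, hp]
      exact add_zero _
    rw [e, Finsupp.add_apply]
    obtain _ | ⟨c, w⟩ := w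
    · have h0 : ∀ (a : A) (x : List A →₀ K), QuasiShuffle.consL K a x [] = 0 := fun a x =>
        QuasiShuffle.consO_apply_nil (some a) x
      rw [h0, h0, add_zero]
      refine ⟨⟨0, by simp⟩, ⟨fun h => absurd rfl h, fun h => nomatch h⟩⟩
    · rw [QuasiShuffle.consL_apply_cons, QuasiShuffle.consL_apply_cons, isShuffle_cons_iff,
        ← (h1 w).2, ← (h2 w).2]
      obtain ⟨m, hm⟩ := (h1 w).1
      obtain ⟨n, hn⟩ := (h2 w).1
      rw [hm, hn]
      constructor
      · refine ⟨(if a = c then m else 0) + (if b = c then n else 0), ?_⟩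
        split_ifs <;> simp
      · rw [Nat.cast_ne_zero, Nat.cast_ne_zero]
        split_ifs <;> simp_all
        norm_cast
        omega
termination_by u.length + v.length

theorem mul_apply (x y : List A →₀ K) (w : List A) : (quasiShuffleHopf K p).mul x y w =
    ∑ i ∈ x.support ×ˢ y.support, x i.1 * (y i.2 * quasiShuffle K p.pair i.1 i.2 w) := by
  rw [Finset.sum_product]
  simp only [quasiShuffleHopf, Finsupp.linearCombination_apply, Finsupp.sum,
    LinearMap.sum_apply, LinearMap.smul_apply, Finsupp.finsetSum_apply, Finsupp.smul_apply,
    smul_eq_mul, Finset.mul_sum]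

theorem NatCoeff.mul_apply_ne_zero [CharZero K] (hp : ∀ a b, p.pair (some a) (some b) = none)
    {x y : List A →₀ K} (hx : NatCoeff x) (hy : NatCoeff y) :
    NatCoeff ((quasiShuffleHopf K p).mul x y) ∧ ∀ w, (quasiShuffleHopf K p).mul x y w ≠ 0 ↔
      ∃ u v, x u ≠ 0 ∧ y v ≠ 0 ∧ IsShuffle u v w := by
  have h : ∀ w, ∀ i ∈ x.support ×ˢ y.support,
      ∃ n : ℕ, x i.1 * (y i.2 * quasiShuffle K p.pair i.1 i.2 w) = n := by
    intro w i _
    obtain ⟨l, hl⟩ := hx i.1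
    obtain ⟨m, hm⟩ := hy i.2
    obtain ⟨n, hn⟩ := (quasiShuffle_apply (K := K) p hp i.1 i.2 w).1
    exact ⟨l * (m * n), by rw [hl, hm, hn]; push_cast; rfl⟩
  refine ⟨fun w => ?_, fun w => ?_⟩
  · rw [mul_apply]
    exact (exists_sum_eq_natCast _ _ (h w)).1
  · rw [mul_apply, (exists_sum_eq_natCast _ _ (h w)).2]
    simp only [Finset.mem_product, Finsupp.mem_support_iff, Prod.exists, mul_ne_zero_iff,
      (quasiShuffle_apply (K := K) p hp _ _ w).2]
    refine exists₂_congr fun u v => by tauto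

open Classical in
theorem snocL_apply_reverse_cons (a b : A) (w : List A) (x : List A →₀ K) :
    TreeHopf.snocL K a x (b :: w).reverse = if a = b then x w.reverse else 0 := by
  rw [TreeHopf.snocL, Finsupp.lmapDomain_apply, List.reverse_cons]
  by_cases hab : a = b
  · subst hab
    rw [if_pos rfl]
    exact Finsupp.mapDomain_apply (List.append_left_injective [a]) x w.reverse
  · rw [if_neg hab]
    refine Finsupp.mapDomain_of_notMem_range _ _ ?_
    rintro ⟨v, hv⟩
    exact hab (by simpa using (List.append_inj' hv rfl).2)

theorem snocL_apply_nil (a : A) (x : List A →₀ K) : TreeHopf.snocL K a x [] = 0 := by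
  refine Finsupp.mapDomain_of_notMem_range _ _ ?_
  rintro ⟨v, hv⟩
  simp at hv

section Order

variable [LinearOrder A]

/-- The words in `x` have natural coefficients, and when they are read backwards, `w` is the
alphabetically largest one, and all others are rearrangements of it. -/
def Lead (x : List A →₀ K) (w : List A) : Prop :=
  NatCoeff x ∧ x w.reverse ≠ 0 ∧ ∀ v, x v.reverse ≠ 0 → v.Perm w ∧ v ≤ w

theorem Lead.unique {x : List A →₀ K} {v w : List A} (hv : Lead x v) (hw : Lead x w) : v = w :=
  le_antisymm (hw.2.2 v hv.2.1).2 (hv.2.2 w hw.2.1).2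

theorem lead_one : Lead (Finsupp.single [] 1 : List A →₀ K) [] := by
  classical
  refine ⟨fun v => ?_, by simp, fun v hv => ?_⟩
  · rw [Finsupp.single_apply]
    split_ifs
    exacts [⟨1, by simp⟩, ⟨0, by simp⟩]
  · rw [Finsupp.single_apply] at hv
    have : v = [] := by
      by_contra h
      exact hv (if_neg fun h' => h (by simpa using h'.symm))
    subst this
    exact ⟨List.Perm.refl _, le_rfl⟩

theorem Lead.snocL {x : List A →₀ K} {w : List A} (h : Lead x w) (a : A) :
    Lead (TreeHopf.snocL K a x) (a :: w) := by
  classical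
  refine ⟨fun v => ?_, by rw [snocL_apply_reverse_cons, if_pos rfl]; exact h.2.1, fun v hv => ?_⟩
  · rw [← v.reverse_reverse]
    obtain _ | ⟨b, v⟩ := v.reverse
    · exact ⟨0, by simpa using snocL_apply_nil a x⟩
    · rw [snocL_apply_reverse_cons]
      split_ifs
      exacts [h.1 _, ⟨0, by simp⟩]
  · obtain _ | ⟨b, v⟩ := v
    · exact absurd (snocL_apply_nil a x) hv
    · rw [snocL_apply_reverse_cons] at hv
      split_ifs at hv with hab
      · subst hab
        exact ⟨(h.2.2 v hv).1.cons a, cons_le_cons a (h.2.2 v hv).2⟩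
      · exact absurd rfl hv

/-- A word of the product is a shuffle of words from `x` and `y`. By `IsShuffle.exists_le` it is at
most a shuffle of the two leading words, since rearrangements have equal length, and by
`IsShuffle.le_flatten` that is at most the sorted concatenation. -/
theorem Lead.mul [CharZero K] (hp : ∀ a b, p.pair (some a) (some b) = none)
    {x y : List A →₀ K} {U V : List (List A)} (hx : Lead x U.flatten) (hy : Lead y V.flatten)
    (h : IsFactorization (U ++ V)) :
    Lead ((quasiShuffleHopf K p).mul x y) (U ++ V).flatten := by
  obtain ⟨h1, h2⟩ := NatCoeff.mul_apply_ne_zero p hp hx.1 hy.1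
  have hUV := pairwise_ge_iff_append.1 h.1
  refine ⟨h1, (h2 _).2 ⟨_, _, hx.2.1, hy.2.1, ?_⟩, fun w hw => ?_⟩
  · rw [List.flatten_append]
    exact (IsShuffle.refl_append _ _).reverse
  · obtain ⟨u, v, hu, hv, hs⟩ := (h2 _).1 hw
    rw [← u.reverse_reverse] at hu
    rw [← v.reverse_reverse] at hv
    have hs := hs.reverse
    rw [List.reverse_reverse] at hs
    obtain ⟨hup, hul⟩ := hx.2.2 _ hu
    obtain ⟨hvp, hvl⟩ := hy.2.2 _ hv
    obtain ⟨w', hw', hle⟩ := hs.exists_le hul hvl hup.length_eq hvp.length_eq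
    refine ⟨?_, hle.trans ?_⟩
    · rw [List.flatten_append]
      exact hs.perm.trans (hup.append hvp)
    · exact IsShuffle.le_flatten rfl hw' ⟨hUV.1, fun x hx => h.2 x (by simp [hx])⟩
        ⟨hUV.2.1, fun x hx => h.2 x (by simp [hx])⟩ h (List.Perm.refl _)

end Order

end Lyndon

/-! ### Leading words of trees and of their powers. -/

namespace Lyndon

variable {K A : Type*} [Field K]

/-- The image under `π` of a forest. -/
noncomputable def wordSum (K : Type*) [Field K] (u : Forest A) : List A →₀ K :=
  forestToWords K A (Finsupp.single u 1)

theorem wordSum_one : wordSum K (1 : Forest A) = Finsupp.single [] 1 :=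
  TreeHopf.forestToWords_one

theorem wordSum_B (a : A) (u : Forest A) :
    wordSum K (Forest.B a u) = TreeHopf.snocL K a (wordSum K u) := by
  rw [wordSum, ← TreeHopf.BL_single, TreeHopf.forestToWords_BL, wordSum]

theorem wordSum_mul {deg : A → ℕ} (p : HoffmanPairing A deg)
    (hp : ∀ a b, p.pair (some a) (some b) = none) (u v : Forest A) :
    wordSum K (u * v) = (quasiShuffleHopf K p).mul (wordSum K u) (wordSum K v) := by
  rw [wordSum, ← TreeHopf.mul_single, TreeHopf.forestToWords_mul p hp, wordSum, wordSum]

/-- The words `F i` with their multiplicities. -/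
def powers {ι : Type*} (F : ι → List A) (l : List (ι × ℕ)) : List (List A) :=
  l.flatMap fun q => List.replicate q.2 (F q.1)

theorem mem_powers {ι : Type*} {F : ι → List A} {l : List (ι × ℕ)} {w : List A} :
    w ∈ powers F l ↔ ∃ q ∈ l, q.2 ≠ 0 ∧ F q.1 = w := by
  simp [powers, List.mem_replicate, eq_comm]

section Order

variable [LinearOrder A]

theorem Lead.of_snocL {x : List A →₀ K} {a b : A} {w : List A}
    (h : Lead (TreeHopf.snocL K a x) (b :: w)) : a = b ∧ Lead x w := by
  classical
  have hv : ∀ v : List A, TreeHopf.snocL K a x (a :: v).reverse = x v.reverse := fun v => by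
    rw [snocL_apply_reverse_cons, if_pos rfl]
  have hab : a = b := by
    have := h.2.1
    rw [snocL_apply_reverse_cons] at this
    by_contra hab
    exact this (if_neg hab)
  subst hab
  refine ⟨rfl, fun v => ?_, hv w ▸ h.2.1, fun v hx => ?_⟩
  · obtain ⟨n, hn⟩ := h.1 (a :: v.reverse).reverse
    rw [hv, List.reverse_reverse] at hn
    exact ⟨n, hn⟩
  · obtain ⟨h1, h2⟩ := h.2.2 (a :: v) ((hv v).symm ▸ hx)
    exact ⟨h1.cons_inv, (append_le_append_iff [a]).1 h2⟩

/-- The tree `t` has the Lyndon word `w` as leading word. -/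
def TreeLead (K : Type*) [Field K] (t : Forest A) (w : List A) : Prop :=
  t.IsTree ∧ IsLyndon w ∧ Lead (wordSum K t) w

theorem isFactorization_append_replicate {X : List (List A)} {a : A} {x : List A}
    (hx : IsLyndon (a :: x)) (hX : IsFactorization X) (hXx : X.flatten = x) (r : ℕ) :
    IsFactorization (X ++ List.replicate r (a :: x)) := by
  refine ⟨pairwise_ge_iff_append.2 ⟨hX.1, List.pairwise_replicate.2 (Or.inr le_rfl),
    fun l hl y hy => ?_⟩, fun z hz => ?_⟩
  · rw [List.eq_of_mem_replicate hy]
    exact (lt_of_mem_factorization hx hX (p := [a]) (by simp [hXx]) (by simp) l hl).le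
  · rcases List.mem_append.1 hz with hz | hz
    · exact hX.2 z hz
    · rw [List.eq_of_mem_replicate hz]
      exact hx

/-- The branches of `t^{∘ (r + 1)}` are those of `t` together with `t^{∘ r}`. The Lyndon factors of
the word `w` without its first letter are larger than `w`, so followed by copies of `w` they are
nonincreasing, and `Lead.mul` gives the leading word of the branches. -/
theorem TreeLead.cpow [CharZero K] {t : Forest A} {w : List A} (h : TreeLead K t w) (r : ℕ) :
    Lead (wordSum K (t.cpow r)) (List.replicate r w).flatten := by
  obtain ⟨ht, hw, hl⟩ := h
  obtain ⟨a, u, rfl⟩ := ht.exists_eq_B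
  obtain ⟨b, w, rfl⟩ := List.exists_cons_of_ne_nil hw.1
  rw [wordSum_B] at hl
  obtain ⟨rfl, hl'⟩ := hl.of_snocL
  obtain ⟨X, hX, rfl⟩ := exists_factorization w
  induction r with
  | zero => exact (wordSum_one (K := K)).symm ▸ lead_one
  | succ r ih =>
    rw [Forest.cpow, Forest.comp_B, wordSum_B,
      wordSum_mul (HoffmanPairing.trivial A fun _ => 0) fun _ _ => rfl]
    have := (Lead.mul (HoffmanPairing.trivial A fun _ => 0) (fun _ _ => rfl) hl' ih
      (isFactorization_append_replicate hw hX rfl r)).snocL a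
    simpa [List.replicate_succ] using this

theorem isFactorization_powers {ι : Type*} {F : ι → List A} {l : List (ι × ℕ)}
    (h : l.Pairwise fun q q' => F q'.1 < F q.1) (hF : ∀ q ∈ l, IsLyndon (F q.1)) :
    IsFactorization (powers F l) := by
  refine ⟨?_, fun w hw => ?_⟩
  · induction l with
    | nil => simp [powers]
    | cons q l ih =>
      rw [List.pairwise_cons] at h
      refine pairwise_ge_iff_append.2 ⟨List.pairwise_replicate.2 (Or.inr le_rfl),
        ih h.2 fun q hq => hF q (by simp [hq]), fun x hx y hy => ?_⟩
      obtain ⟨q', hq', -, rfl⟩ := mem_powers.1 hy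
      rw [List.eq_of_mem_replicate hx]
      exact (h.1 q' hq').le
  · obtain ⟨q, hq, -, rfl⟩ := mem_powers.1 hw
    exact hF q hq

theorem lead_prod_cpow [CharZero K] {ι : Type*} {T : ι → Forest A} {F : ι → List A}
    {l : List (ι × ℕ)} (h : l.Pairwise fun q q' => F q'.1 < F q.1)
    (hT : ∀ q ∈ l, TreeLead K (T q.1) (F q.1)) :
    Lead (wordSum K (l.map fun q => (T q.1).cpow q.2).prod) (powers F l).flatten := by
  induction l with
  | nil => exact (wordSum_one (K := K)).symm ▸ lead_one
  | cons q l ih =>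
    have hf := isFactorization_powers h fun q hq => (hT q hq).2.1
    rw [List.map_cons, List.prod_cons,
      wordSum_mul (HoffmanPairing.trivial A fun _ => 0) fun _ _ => rfl]
    exact Lead.mul (HoffmanPairing.trivial A fun _ => 0) (fun _ _ => rfl)
      ((hT q (by simp)).cpow q.2) (ih (List.pairwise_cons.1 h).2 fun q hq => hT q (by simp [hq])) hf

theorem lead_B_prod_cpow [CharZero K] {ι : Type*} {T : ι → Forest A} {F : ι → List A}
    {l : List (ι × ℕ)} (a : A) (h : l.Pairwise fun q q' => F q'.1 < F q.1)
    (hT : ∀ q ∈ l, TreeLead K (T q.1) (F q.1)) :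
    Lead (wordSum K (Forest.B a (l.map fun q => (T q.1).cpow q.2).prod))
      (a :: (powers F l).flatten) := by
  rw [wordSum_B]
  exact (lead_prod_cpow h hT).snocL a

end Order

end Lyndon

/-! ### Sizes of powers and products. -/

namespace Forest

variable {A : Type*}

theorem IsTree.size_cpow_succ {t : Forest A} (ht : t.IsTree) (r : ℕ) :
    (t.cpow (r + 1)).size = t.size + (t.cpow r).size := by
  obtain ⟨a, u, rfl⟩ := ht.exists_eq_B
  rw [cpow, comp_B]
  simp only [size_B, size_mul]
  omega

theorem IsTree.size_pos {t : Forest A} (ht : t.IsTree) : 0 < t.size := by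
  obtain ⟨a, u, rfl⟩ := ht.exists_eq_B
  simp

theorem size_le_size_prod {l : List (Forest A)} {u : Forest A} (h : u ∈ l) :
    u.size ≤ l.prod.size := by
  induction l with
  | nil => simp at h
  | cons v l ih =>
    rw [List.prod_cons, size_mul]
    rcases List.mem_cons.1 h with rfl | h
    · omega
    · have := ih h
      omega

end Forest

/-! ### The foliage as leading word. -/

namespace Lyndon

variable {A : Type*} {H : Set (Forest A)} {lt : H → H → Prop}

theorem hallForest_append (l l' : List (H × ℕ)) :
    hallForest (l ++ l') = hallForest l * hallForest l' := by
  simp [hallForest]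

theorem hallForest_singleton (s : H) (r : ℕ) : hallForest [(s, r)] = s.1.cpow r := by
  simp [hallForest]

theorem IsDecreasing.append_of_le {l : List (H × ℕ)} {s : H} {r q : ℕ}
    (h : IsDecreasing lt (l ++ [(s, r)])) (hq : 1 ≤ q) : IsDecreasing lt (l ++ [(s, q)]) := by
  obtain ⟨h1, h2⟩ := h
  rw [List.pairwise_append] at h1
  refine ⟨List.pairwise_append.2 ⟨h1.1, by simp, fun x hx y hy => ?_⟩, fun x hx => ?_⟩
  · obtain rfl := List.mem_singleton.1 hy
    exact h1.2.2 x hx (s, r) (by simp)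
  · rcases List.mem_append.1 hx with hx | hx
    · exact h2 x (by simp [hx])
    · obtain rfl := List.mem_singleton.1 hx
      exact hq

theorem mem_of_mem_succ (hH : IsHallSet H lt) {a : A} {l : List (H × ℕ)} {s : H} {r : ℕ}
    (hl : IsDecreasing lt (l ++ [(s, r + 1)]))
    (ht : Forest.B a (hallForest (l ++ [(s, r + 1)])) ∈ H) :
    Forest.B a (hallForest (l ++ [(s, r)])) ∈ H := by
  have h1 := (hH.mem_iff a l s _ hl).1 ht
  obtain _ | r := r
  · rw [hallForest_append, hallForest_singleton, Forest.cpow, mul_one]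
    exact h1.1
  · exact (hH.mem_iff a l s _ (IsDecreasing.append_of_le hl (by omega))).2 h1

/-- Induction on the number of vertices. The leading word of a Hall tree is its root label followed
by the foliages of its branches in decreasing order. Splitting off the last copy of the smallest
branch turns this into the recursion of the foliage, and uniqueness of leading words identifies the
two parts. -/
theorem lead_of_foliage [LinearOrder A] {K : Type*} [Field K] [CharZero K] (hH : IsHallSet H lt)
    {f : H → List A} (hf : ∀ t, Foliage lt t.1 (f t)) (hr : ∀ t, IsLyndon (f t))
    (hlt : ∀ s t, lt s t ↔ f s < f t) {n : ℕ} : ∀ {T : Forest A} {w : List A}, T.size = n →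
      Foliage lt T w → Lead (wordSum K T) w := by
  induction n using Nat.strong_induction_on with
  | _ n ih =>
  intro T w hn hT
  cases hT with
  | letter a =>
    rw [wordSum_B, wordSum_one]
    exact lead_one.snocL a
  | node a l s r u v hl ht hu hv =>
    have hsize : ∀ q ∈ l ++ [(s, r + 1)], q.1.1.size < n := by
      intro q hq
      obtain ⟨q2, hq2⟩ := Nat.exists_eq_add_of_le' (hl.2 q hq)
      have h1 := Forest.size_le_size_prod (l := (l ++ [(s, r + 1)]).map fun p => p.1.1.cpow p.2)
        (List.mem_map_of_mem hq)
      have h2 := (hH.isTree _ q.1.2).size_cpow_succ q2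
      rw [← hn, Forest.size_B, hallForest]
      rw [hq2, h2] at h1
      omega
    have hlead : ∀ q ∈ l ++ [(s, r + 1)], TreeLead K q.1.1 (f q.1) := fun q hq =>
      ⟨hH.isTree _ q.1.2, hr q.1, ih _ (hsize q hq) rfl (hf q.1)⟩
    have hpw : (l ++ [(s, r + 1)]).Pairwise fun q q' => f q'.1 < f q.1 :=
      hl.1.imp fun h => (hlt _ _).1 h
    -- The exponent `r` may be zero, and then the list is no longer decreasing in the strict sense
    -- of `IsDecreasing`; only the order of the words is kept, and `powers` omits a factor with
    -- exponent zero.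
    have hpw' : (l ++ [(s, r)]).Pairwise fun q q' => f q'.1 < f q.1 := by
      rw [List.pairwise_append] at hpw ⊢
      refine ⟨hpw.1, by simp, fun x hx y hy => ?_⟩
      obtain rfl := List.mem_singleton.1 hy
      exact hpw.2.2 x hx (s, r + 1) (by simp)
    have hlead' : ∀ q ∈ l ++ [(s, r)], TreeLead K q.1.1 (f q.1) := fun q hq => by
      rcases List.mem_append.1 hq with hq | hq
      · exact hlead q (by simp [hq])
      · obtain rfl := List.mem_singleton.1 hq
        exact hlead (s, r + 1) (by simp)
    have h1 : Lead (wordSum K (Forest.B a (hallForest (l ++ [(s, r + 1)]))))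
        (a :: (powers f (l ++ [(s, r + 1)])).flatten) := lead_B_prod_cpow a hpw hlead
    have h2 : Lead (wordSum K (Forest.B a (hallForest (l ++ [(s, r)]))))
        (a :: (powers f (l ++ [(s, r)])).flatten) := lead_B_prod_cpow a hpw' hlead'
    have hsu : (Forest.B a (hallForest (l ++ [(s, r)]))).size < n := by
      rw [← hn, Forest.size_B, Forest.size_B, hallForest_append, hallForest_append,
        Forest.size_mul, Forest.size_mul, hallForest_singleton, hallForest_singleton,
        (hH.isTree _ s.2).size_cpow_succ]
      have := (hH.isTree _ s.2).size_pos
      omega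
    have e1 : u = _ := (ih _ hsu rfl hu).unique h2
    have e2 : v = f s := (ih _ (hsize (s, r + 1) (by simp)) rfl hv).unique
      (hlead (s, r + 1) (by simp)).2.2
    rw [e1, e2]
    convert h1 using 1
    simp [powers, List.replicate_succ']

end Lyndon

/-! ### Monomials in Hall trees as a basis of the words. -/

namespace Lyndon

/-- The alphabetical order itself need not be well-founded, but a word has only finitely many
rearrangements. -/
theorem wellFounded_perm_lt (A : Type*) [LinearOrder A] :
    WellFounded fun v w : List A => v.Perm w ∧ v < w := by
  refine Subrelation.wf (r := InvImage (· < ·) fun w : List A =>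
    (w.permutations.toFinset.filter (· < w)).card) ?_ (InvImage.wf _ Nat.lt_wfRel.wf)
  rintro v w ⟨h1, h2⟩
  refine Finset.card_lt_card ⟨fun x hx => ?_, fun h => ?_⟩
  · simp only [Finset.mem_filter, List.mem_toFinset, List.mem_permutations] at hx ⊢
    exact ⟨hx.1.trans h1, hx.2.trans h2⟩
  · have : v ∈ w.permutations.toFinset.filter (· < w) := by
      simpa only [Finset.mem_filter, List.mem_toFinset, List.mem_permutations] using ⟨h1, h2⟩
    exact lt_irrefl _ (Finset.mem_filter.1 (h this)).2

/-- After reversing all words, the map is triangular for the alphabetical order among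
rearrangements, with nonzero diagonal entries. -/
theorem bijective_of_lead {K A : Type*} [Field K] [LinearOrder A]
    (φ : (List A →₀ K) →ₗ[K] (List A →₀ K)) (h : ∀ w, Lead (φ (Finsupp.single w 1)) w) :
    Function.Bijective φ := by
  let ρ : (List A →₀ K) ≃ₗ[K] (List A →₀ K) :=
    Finsupp.domLCongr (Equiv.ofBijective List.reverse List.reverse_involutive.bijective)
  have hρ : ∀ x w, ρ x w = x w.reverse := by
    intro x w
    have := Finsupp.mapDomain_apply List.reverse_injective x w.reverse
    rw [List.reverse_reverse] at this
    exact (DFunLike.congr_fun (Finsupp.equivMapDomain_eq_mapDomain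
      (Equiv.ofBijective List.reverse List.reverse_involutive.bijective) x) w).trans this
  have : Function.Bijective (ρ.toLinearMap ∘ₗ φ) := by
    refine Finsupp.bijective_of_triangular _ (fun v w : List A => v.Perm w ∧ v < w)
      (wellFounded_perm_lt A) (fun i j k h h' => ⟨h.1.trans h'.1, h.2.trans h'.2⟩)
      (fun w => ?_) fun w v hv => ?_
    · exact (hρ _ _).trans_ne (h w).2.1
    · obtain ⟨h1, h2⟩ := (h w).2.2 v ((hρ _ _).symm.trans_ne hv)
      exact h2.eq_or_lt.imp id fun h => ⟨h1, h⟩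
  exact (Function.Bijective.of_comp_iff' ρ.bijective φ).1 this

variable {K A : Type*} [Field K] [CharZero K] [LinearOrder A] {deg : A → ℕ}
  (p : HoffmanPairing A deg)

theorem lead_prod {H : Type*} {f : H → List A} (X : H → (quasiShuffleHopf K p).Carrier)
    (hp : ∀ a b, p.pair (some a) (some b) = none)
    (hX : ∀ t, Lead (X t : List A →₀ K) (f t)) {L : List H} (hL : IsFactorization (L.map f)) :
    Lead ((L.map X).prod : List A →₀ K) (L.map f).flatten := by
  induction L with
  | nil => exact lead_one
  | cons t L ih =>
    rw [List.map_cons, List.prod_cons]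
    exact Lead.mul (U := [f t]) p hp (by simpa using hX t) (ih hL.tail) hL

/-- A monomial is a multiset of Lyndon words, and sorting it in nonincreasing order makes it the
factorization of exactly one word, which is the leading word of the value of the monomial. -/
theorem bijective_aeval {H : Type*} {f : H → List A} (X : H → (quasiShuffleHopf K p).Carrier)
    (hp : ∀ a b, p.pair (some a) (some b) = none)
    (hX : ∀ t, Lead (X t : List A →₀ K) (f t)) (hf : Function.Injective f)
    (hr : Set.range f = {w | IsLyndon w}) :
    Function.Bijective (MvPolynomial.aeval (R := K) X) := by
  classical
  have hex : ∀ w : List A, ∃ L : List H, IsFactorization (L.map f) ∧ (L.map f).flatten = w := by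
    intro w
    obtain ⟨M, hM, rfl⟩ := exists_factorization w
    have : M ∈ Set.range (List.map f) := by
      rw [Set.range_list_map]
      exact fun x hx => hr.ge (hM.2 x hx)
    obtain ⟨L, rfl⟩ := this
    exact ⟨L, hM, rfl⟩
  choose L hL hLw using hex
  let g : List A → (H →₀ ℕ) := fun w => Multiset.toFinsupp (L w : Multiset H)
  -- Injectivity holds because sorting recovers the factorization from the multiset, surjectivity
  -- because the factorization of a sorted concatenation is unique.
  have hg : Function.Bijective g := by
    constructor
    · intro v w h
      have h : (L v).Perm (L w) := Multiset.coe_eq_coe.1 (Multiset.toFinsupp.injective h)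
      have h := (h.map f).eq_of_pairwise (fun _ _ _ _ h h' => le_antisymm h' h) (hL v).1 (hL w).1
      rw [← hLw v, h, hLw w]
    · intro m
      obtain ⟨s, rfl⟩ := Multiset.toFinsupp.surjective m
      obtain ⟨M, hM, hMs⟩ := exists_sort (s.toList.map f)
      have hMf : IsFactorization M := ⟨hMs, fun x hx => by
        obtain ⟨t, -, rfl⟩ := List.mem_map.1 (hM.mem_iff.1 hx)
        exact hr.le ⟨t, rfl⟩⟩
      refine ⟨M.flatten, congrArg Multiset.toFinsupp (?_ : (L M.flatten : Multiset H) = s)⟩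
      have := factorization_unique (hL M.flatten) hMf (hLw M.flatten)
      rw [← this] at hM
      rw [← s.coe_toList]
      exact Multiset.coe_eq_coe.2 ((List.map_perm_map_iff hf).1 hM)
  let b : Module.Basis (List A) K (MvPolynomial H K) :=
    (MvPolynomial.basisMonomials H K).reindex (Equiv.ofBijective g hg).symm
  have hb : ∀ w, b w = MvPolynomial.monomial (g w) 1 := by
    intro w
    simp [b]
  let α : MvPolynomial H K →ₗ[K] (List A →₀ K) := (MvPolynomial.aeval (R := K) X).toLinearMap
  have hα : Function.Bijective (α ∘ₗ b.repr.symm.toLinearMap) := by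
    refine bijective_of_lead _ fun w => ?_
    have e : (α ∘ₗ b.repr.symm.toLinearMap) (Finsupp.single w 1) = (((L w).map X).prod :
        (quasiShuffleHopf K p).Carrier) := by
      rw [LinearMap.comp_apply, LinearEquiv.coe_coe, Module.Basis.repr_symm_single_one, hb]
      refine (MvPolynomial.aeval_monomial X (g w) (1 : K)).trans ?_
      rw [map_one, one_mul, ← Multiset.prod_coe, ← Multiset.map_coe]
      rw [Finset.prod_multiset_map_count]
      simp [g, Finsupp.prod]
    rw [e]
    have := lead_prod p X hp hX (hL w)
    rwa [hLw] at this
  exact (Function.Bijective.of_comp_iff α b.repr.symm.bijective).1 hα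

theorem bijective_aeval_of_isLyndonHallSet (hp : ∀ a b, p.pair (some a) (some b) = none)
    {H : Set (Forest A)} {lt : H → H → Prop} (hH : IsLyndonHallSet H lt) :
    Function.Bijective (MvPolynomial.aeval (R := K) (S₁ := (quasiShuffleHopf K p).Carrier)
      fun t : H => wordSum K t.1) := by
  obtain ⟨hH, f, hf, hr, hlt⟩ := hH
  refine bijective_aeval p _ hp (fun t => lead_of_foliage hH hf (fun t => hr.le ⟨t, rfl⟩) hlt rfl
    (hf t)) (fun s t h => ?_) hr
  have := hH.total
  rcases trichotomous_of lt s t with h' | h' | h'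
  · exact absurd ((hlt _ _).1 h') (h ▸ lt_irrefl _)
  · exact h'
  · exact absurd ((hlt _ _).1 h') (h ▸ lt_irrefl _)

end Lyndon

/-! ### The Hall set of trees of the Lyndon words. -/

namespace Lyndon

variable {A : Type*}

theorem powers_cons (q : List A × ℕ) (l : List (List A × ℕ)) :
    powers id (q :: l) = List.replicate q.2 q.1 ++ powers id l := rfl

variable [LinearOrder A]

/-- Strictly decreasing Lyndon words with positive multiplicities. -/
def IsGrouping (l : List (List A × ℕ)) : Prop :=
  l.Pairwise (fun q q' => q'.1 < q.1) ∧ ∀ q ∈ l, IsLyndon q.1 ∧ 1 ≤ q.2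

theorem IsGrouping.tail {q : List A × ℕ} {l : List (List A × ℕ)} (h : IsGrouping (q :: l)) :
    IsGrouping l :=
  ⟨(List.pairwise_cons.1 h.1).2, fun q hq => h.2 q (by simp [hq])⟩

theorem IsGrouping.isFactorization {l : List (List A × ℕ)} (h : IsGrouping l) :
    IsFactorization (powers id l) :=
  isFactorization_powers h.1 fun q hq => (h.2 q hq).1

theorem exists_grouping_powers {L : List (List A)} (hL : IsFactorization L) :
    ∃ l, IsGrouping l ∧ powers id l = L := by
  induction L with
  | nil => exact ⟨[], ⟨by simp, by simp⟩, rfl⟩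
  | cons x L ih =>
    obtain ⟨l, hl, rfl⟩ := ih hL.tail
    have hx := hL.2 x (by simp)
    have hle : ∀ q ∈ l, q.1 ≤ x := fun q hq =>
      (List.pairwise_cons.1 hL.1).1 q.1
        (mem_powers.2 ⟨q, hq, by have := (hl.2 q hq).2; omega, rfl⟩)
    by_cases h : ∀ q ∈ l, q.1 < x
    · refine ⟨(x, 1) :: l, ⟨List.pairwise_cons.2 ⟨h, hl.1⟩, fun q hq => ?_⟩, rfl⟩
      rcases List.mem_cons.1 hq with rfl | hq
      · exact ⟨hx, le_rfl⟩
      · exact hl.2 q hq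
    · push Not at h
      obtain ⟨q', hq', hxq⟩ := h
      obtain _ | ⟨⟨y, r⟩, l⟩ := l
      · simp at hq'
      · have hy : y = x := by
          refine le_antisymm (hle (y, r) (by simp)) (hxq.trans ?_)
          rcases List.mem_cons.1 hq' with rfl | h
          · exact le_rfl
          · exact ((List.pairwise_cons.1 hl.1).1 q' h).le
        subst hy
        refine ⟨(y, r + 1) :: l, ⟨List.pairwise_cons.2 (List.pairwise_cons.1 hl.1),
          fun q hq => ?_⟩, by simp [powers_cons, List.replicate_succ]⟩
        rcases List.mem_cons.1 hq with rfl | hq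
        · exact ⟨hx, by simp⟩
        · exact hl.tail.2 q hq

theorem exists_grouping (w : List A) : ∃ l, IsGrouping l ∧ (powers id l).flatten = w := by
  obtain ⟨L, hL, rfl⟩ := exists_factorization w
  obtain ⟨l, hl, rfl⟩ := exists_grouping_powers hL
  exact ⟨l, hl, rfl⟩

theorem IsGrouping.count {q : List A × ℕ} {l : List (List A × ℕ)} (h : IsGrouping (q :: l)) :
    (powers id (q :: l)).count q.1 = q.2 := by
  have : q.1 ∉ powers id l := fun hm => by
    obtain ⟨q', hq', -, he⟩ := mem_powers.1 hm
    exact absurd he ((List.pairwise_cons.1 h.1).1 q' hq').ne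
  rw [powers_cons, List.count_append, List.count_replicate_self,
    List.count_eq_zero_of_not_mem this, add_zero]

theorem powers_injective : ∀ {l l' : List (List A × ℕ)}, IsGrouping l → IsGrouping l' →
    powers id l = powers id l' → l = l'
  | [], [], _, _, _ => rfl
  | [], q :: l', _, h', h => by
    have hm : q.1 ∈ powers id (q :: l') := mem_powers.2
      ⟨q, by simp, by have := (h'.2 q (by simp)).2; omega, rfl⟩
    rw [← h] at hm
    simp [powers] at hm
  | q :: l, [], h', _, h => by
    have hm : q.1 ∈ powers id (q :: l) := mem_powers.2
      ⟨q, by simp, by have := (h'.2 q (by simp)).2; omega, rfl⟩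
    rw [h] at hm
    simp [powers] at hm
  | (x, r) :: l, (y, s) :: l', h1, h2, h => by
    have hc := h1.count
    have hc' := h2.count
    obtain ⟨r, rfl⟩ := Nat.exists_eq_add_of_le' (h1.2 (x, r) (by simp)).2
    obtain ⟨s, rfl⟩ := Nat.exists_eq_add_of_le' (h2.2 (y, s) (by simp)).2
    have hxy : x = y := by
      simp only [powers_cons, List.replicate_succ, List.cons_append, List.cons.injEq] at h
      exact h.1
    subst hxy
    rw [h] at hc
    have hrs : r + 1 = s + 1 := hc.symm.trans hc'
    rw [hrs] at h ⊢
    rw [powers_injective h1.tail h2.tail (List.append_cancel_left h)]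

/-- The Lyndon factorization of a word, with multiplicities. -/
noncomputable def grouping (w : List A) : List (List A × ℕ) := (exists_grouping w).choose

theorem isGrouping_grouping (w : List A) : IsGrouping (grouping w) :=
  (exists_grouping w).choose_spec.1

theorem flatten_grouping (w : List A) : (powers id (grouping w)).flatten = w :=
  (exists_grouping w).choose_spec.2

theorem grouping_flatten {l : List (List A × ℕ)} (h : IsGrouping l) :
    grouping (powers id l).flatten = l :=
  powers_injective (isGrouping_grouping _) h (factorization_unique
    (isGrouping_grouping _).isFactorization h.isFactorization (flatten_grouping _))

theorem length_le_of_mem_grouping {w : List A} {q : List A × ℕ} (h : q ∈ grouping w) :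
    q.1.length ≤ w.length := by
  have hm : q.1 ∈ powers id (grouping w) := mem_powers.2
    ⟨q, h, by have := ((isGrouping_grouping w).2 q h).2; omega, rfl⟩
  have := (List.sublist_flatten_of_mem hm).length_le
  rwa [flatten_grouping] at this

/-- The tree of a word, defined through the Lyndon factorization of the tail of the word. -/
noncomputable def tree : List A → Forest A
  | [] => 1
  | a :: w => Forest.B a ((grouping w).attach.map fun q => (tree q.1.1).cpow q.1.2).prod
termination_by w => w.length
decreasing_by exact Nat.lt_succ_of_le (length_le_of_mem_grouping q.2)

theorem tree_cons (a : A) (w : List A) :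
    tree (a :: w) = Forest.B a ((grouping w).map fun q => (tree q.1).cpow q.2).prod := by
  rw [tree]
  congr 2
  exact List.attach_map_val (f := fun q : List A × ℕ => (tree q.1).cpow q.2)

theorem isTree_tree {w : List A} (hw : w ≠ []) : (tree w).IsTree := by
  obtain ⟨a, w, rfl⟩ := List.exists_cons_of_ne_nil hw
  rw [tree_cons]
  exact Forest.isTree_B _ _

/-- Leading words are unique, so this makes `tree` injective on nonempty words. The construction of
the tree involves no field, and the rational numbers serve as one of characteristic zero. -/
theorem lead_tree {w : List A} (hw : w ≠ []) : Lead (wordSum ℚ (tree w)) w := by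
  induction h : w.length using Nat.strong_induction_on generalizing w with
  | _ n ih =>
  obtain ⟨a, w, rfl⟩ := List.exists_cons_of_ne_nil hw
  rw [tree_cons]
  have := lead_B_prod_cpow (K := ℚ) (T := tree) (F := id) a (isGrouping_grouping w).1
    fun q hq => by
      have hq' := ((isGrouping_grouping w).2 q hq).1
      refine ⟨isTree_tree hq'.1, hq', ih _ ?_ hq'.1 rfl⟩
      rw [← h]
      exact Nat.lt_succ_of_le (length_le_of_mem_grouping hq)
  rwa [flatten_grouping] at this

theorem tree_injective {v w : List A} (hv : v ≠ []) (hw : w ≠ []) (h : tree v = tree w) :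
    v = w := (lead_tree hv).unique (h ▸ lead_tree hw)

/-- The trees of the Lyndon words. -/
def lyndonTrees (A : Type*) [LinearOrder A] : Set (Forest A) := {t | ∃ w, IsLyndon w ∧ tree w = t}

/-- The Lyndon word of a tree. -/
noncomputable def word (t : lyndonTrees A) : List A := t.2.choose

theorem isLyndon_word (t : lyndonTrees A) : IsLyndon (word t) := t.2.choose_spec.1

theorem tree_word (t : lyndonTrees A) : tree (word t) = t.1 := t.2.choose_spec.2

theorem word_eq {t : lyndonTrees A} {w : List A} (hw : w ≠ []) (h : tree w = t.1) : word t = w :=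
  tree_injective (isLyndon_word t).1 hw ((tree_word t).trans h.symm)

theorem word_injective : Function.Injective (word (A := A)) := fun s t h =>
  Subtype.ext (by rw [← tree_word, h, tree_word])

theorem tree_mem_iff {w : List A} (hw : w ≠ []) : tree w ∈ lyndonTrees A ↔ IsLyndon w :=
  ⟨fun ⟨_, hv, h⟩ => tree_injective hv.1 hw h ▸ hv, fun h => ⟨w, h, rfl⟩⟩

/-- The alphabetical order of the Lyndon words, carried over to their trees. -/
def wordLt (s t : lyndonTrees A) : Prop := word s < word t

theorem IsDecreasing.isGrouping {l : List (lyndonTrees A × ℕ)} (h : IsDecreasing wordLt l) :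
    IsGrouping (l.map fun q => (word q.1, q.2)) := by
  refine ⟨List.pairwise_map.2 h.1, fun q hq => ?_⟩
  obtain ⟨q', hq', rfl⟩ := List.mem_map.1 hq
  exact ⟨isLyndon_word q'.1, h.2 q' hq'⟩

theorem powers_map_word (l : List (lyndonTrees A × ℕ)) :
    powers id (l.map fun q => (word q.1, q.2)) = powers word l := by
  simp [powers, List.flatMap_map]

theorem tree_powers {l : List (lyndonTrees A × ℕ)} (h : IsDecreasing wordLt l) (a : A) :
    tree (a :: (powers word l).flatten) = Forest.B a (hallForest l) := by
  rw [← powers_map_word, tree_cons, grouping_flatten (IsDecreasing.isGrouping h), List.map_map,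
    hallForest]
  congr 3
  funext q
  exact congrArg (fun t => Forest.cpow t q.2) (tree_word q.1)

theorem exists_isDecreasing (w : List A) : ∃ l : List (lyndonTrees A × ℕ), IsDecreasing wordLt l ∧
    (powers word l).flatten = w := by
  obtain ⟨g, hg, rfl⟩ := exists_grouping w
  have : g ∈ Set.range (List.map fun q : lyndonTrees A × ℕ => (word q.1, q.2)) := by
    rw [Set.range_list_map]
    exact fun q hq => ⟨(⟨_, (tree_mem_iff (hg.2 q hq).1.1).2 (hg.2 q hq).1⟩, q.2),
      Prod.ext (word_eq (hg.2 q hq).1.1 rfl) rfl⟩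
  obtain ⟨l, rfl⟩ := this
  refine ⟨l, ⟨List.pairwise_map.1 hg.1, fun q hq => (hg.2 _ (List.mem_map_of_mem hq)).2⟩, ?_⟩
  rw [powers_map_word]

theorem isFactorization_powers_word {l : List (lyndonTrees A × ℕ)} (h : IsDecreasing wordLt l) :
    IsFactorization (powers word l) :=
  isFactorization_powers h.1 fun q _ => isLyndon_word q.1

theorem powers_append_singleton (l : List (lyndonTrees A × ℕ)) (s : lyndonTrees A) (r : ℕ) :
    powers word (l ++ [(s, r)]) = powers word l ++ List.replicate r (word s) := by
  simp [powers]

theorem IsDecreasing.init {l l' : List (lyndonTrees A × ℕ)}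
    (h : IsDecreasing wordLt (l ++ l')) : IsDecreasing wordLt l :=
  ⟨(List.pairwise_append.1 h.1).1, fun q hq => h.2 q (by simp [hq])⟩

theorem mem_lyndonTrees_iff {l : List (lyndonTrees A × ℕ)} (h : IsDecreasing wordLt l) (a : A) :
    Forest.B a (hallForest l) ∈ lyndonTrees A ↔ IsLyndon (a :: (powers word l).flatten) := by
  rw [← tree_powers h, tree_mem_iff (by simp)]

theorem word_B {l : List (lyndonTrees A × ℕ)} (h : IsDecreasing wordLt l) (a : A)
    (hm : Forest.B a (hallForest l) ∈ lyndonTrees A) :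
    word ⟨_, hm⟩ = a :: (powers word l).flatten := word_eq (by simp) (tree_powers h a)

theorem tree_singleton (a : A) : tree [a] = Forest.B a 1 := by
  have h : IsDecreasing wordLt ([] : List (lyndonTrees A × ℕ)) := ⟨by simp, by simp⟩
  exact tree_powers h a

/-- By `tree_powers` a tree with root `a` and decreasing branches belongs to the word `a` followed
by the powers of the words of its branches. The Hall conditions thereby become
`isLyndon_append_replicate` and `lt_of_mem_factorization`. -/
theorem isHallSet_lyndonTrees : IsHallSet (lyndonTrees A) wordLt where
  isTree := by
    rintro _ ⟨w, hw, rfl⟩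
    exact isTree_tree hw.1
  total :=
    { irrefl := fun s => lt_irrefl (word s)
      trans := fun _ _ _ h h' => lt_trans (α := List A) h h'
      trichotomous := fun s t h h' => word_injective
        (le_antisymm (not_lt.1 h') (not_lt.1 h)) }
  letter a := ⟨[a], isLyndon_singleton a, tree_singleton a⟩
  form := by
    rintro _ ⟨w, hw, rfl⟩
    obtain ⟨a, w, rfl⟩ := List.exists_cons_of_ne_nil hw.1
    obtain ⟨l, hl, rfl⟩ := exists_isDecreasing w
    exact ⟨a, l, hl, tree_powers hl a⟩
  mem_iff a l s r h := by
    have hl := IsDecreasing.init h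
    have hr : 1 ≤ r := h.2 (s, r) (by simp)
    have hf := isFactorization_powers_word h
    rw [mem_lyndonTrees_iff h]
    rw [powers_append_singleton] at hf ⊢
    rw [isLyndon_append_replicate hr hf]
    constructor
    · rintro ⟨h1, h2⟩
      have hm := (mem_lyndonTrees_iff hl a).2 h1
      exact ⟨hm, (word_B hl a hm).trans_lt h2⟩
    · rintro ⟨hm, h2⟩
      exact ⟨(mem_lyndonTrees_iff hl a).1 hm, (word_B hl a hm).symm.trans_lt h2⟩
  lt_of_mem a l h hm q hq := by
    refine (word_B h a hm).trans_lt ?_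
    refine lt_of_mem_factorization ((mem_lyndonTrees_iff h a).1 hm)
      (isFactorization_powers_word h) (p := [a]) rfl (by simp) _ (mem_powers.2 ⟨q, hq, ?_, rfl⟩)
    have := h.2 q hq
    omega

/-- Induction on the length. The smallest Lyndon factor of the word without its first letter is the
word of the smallest branch, and the word without its last copy is again a Lyndon word. So the
standard decomposition of the tree splits the word in two. -/
theorem foliage_tree {w : List A} (hw : IsLyndon w) : Foliage wordLt (tree w) w := by
  induction h : w.length using Nat.strong_induction_on generalizing w with
  | _ n ih =>
  obtain ⟨a, w, rfl⟩ := List.exists_cons_of_ne_nil hw.1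
  obtain ⟨l, hl, rfl⟩ := exists_isDecreasing w
  rcases List.eq_nil_or_concat l with rfl | ⟨l, ⟨s, r⟩, rfl⟩
  · exact (tree_singleton a).symm ▸ Foliage.letter a
  · rw [List.concat_eq_append] at *
    obtain ⟨r, rfl⟩ := Nat.exists_eq_add_of_le' (hl.2 (s, r) (by simp))
    have hm := (mem_lyndonTrees_iff hl a).2 hw
    have hu := mem_of_mem_succ isHallSet_lyndonTrees hl hm
    have hwd : powers word (l ++ [(s, r + 1)]) = powers word (l ++ [(s, r)]) ++ [word s] := by
      rw [powers_append_singleton, powers_append_singleton, List.replicate_succ',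
        List.append_assoc]
    have htu : tree (a :: (powers word (l ++ [(s, r)])).flatten) =
        Forest.B a (hallForest (l ++ [(s, r)])) := by
      -- With exponent zero the branch `s` disappears, and the shorter list `l` has to be used,
      -- since exponents in a decreasing list are positive.
      obtain _ | r := r
      · have hf : hallForest (l ++ [(s, 0)]) = hallForest l := by
          rw [hallForest_append, hallForest_singleton, Forest.cpow, mul_one]
        rw [hf, ← tree_powers (IsDecreasing.init hl), powers_append_singleton]
        simp
      · exact tree_powers (IsDecreasing.append_of_le hl (by omega)) a
    have hs := isLyndon_word s
    have hpos := List.length_pos_iff.2 hs.1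
    rw [hwd, List.flatten_append, List.flatten_singleton] at h
    simp only [List.length_cons, List.length_append] at h
    have hn := Foliage.node a l s r _ _ hl hm
      (htu ▸ ih _ (by simp only [List.length_cons]; omega)
        ((tree_mem_iff (by simp)).1 (htu ▸ hu)) rfl)
      (tree_word s ▸ ih _ (by omega) hs rfl)
    rw [← tree_powers hl] at hn
    convert hn using 1
    rw [hwd, List.flatten_append, List.flatten_singleton]
    rfl

theorem isLyndonHallSet_lyndonTrees : IsLyndonHallSet (lyndonTrees A) wordLt := by
  refine ⟨isHallSet_lyndonTrees, word, fun t => tree_word t ▸ foliage_tree (isLyndon_word t), ?_,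
    fun _ _ => Iff.rfl⟩
  ext w
  refine ⟨fun ⟨t, h⟩ => h ▸ isLyndon_word t, fun hw => ?_⟩
  exact ⟨⟨tree w, (tree_mem_iff hw.1).2 hw⟩, word_eq hw.1 rfl⟩

end Lyndon

/-! ### Assembly of the isomorphisms. -/

namespace PreHopf

variable {K V W : Type*} [Field K] [AddCommGroup V] [Module K V] [AddCommGroup W] [Module K W]
  {D : PreHopf K V} {E : PreHopf K W}

theorem IsHom.bijective_aeval [D.IsHopf] [E.IsHopf] {f : V →ₗ[K] W} (hf : IsHom D E f)
    (hb : Function.Bijective f) {σ : Type*} (X : σ → V)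
    (hX : Function.Bijective (MvPolynomial.aeval (R := K) (S₁ := D.Carrier) X)) :
    Function.Bijective (MvPolynomial.aeval (R := K) (S₁ := E.Carrier) fun i => f (X i)) := by
  let φ : D.Carrier →ₐ[K] E.Carrier := hf.toBialgHom
  have h : φ.comp (MvPolynomial.aeval (R := K) (S₁ := D.Carrier) X) =
      MvPolynomial.aeval (R := K) (S₁ := E.Carrier) fun i => f (X i) := MvPolynomial.comp_aeval _ _
  rw [← h]
  exact Function.Bijective.comp (g := φ) hb hX

end PreHopf

/-- Precomposing one surjection from the forests with the isomorphisms `CKHopf.isHom` and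
`NAPHopf.isHom` yields all three quotients at once. It serves both the quasi-shuffle algebra and the
graded dual. -/
theorem exists_quotients (K A V : Type*) [Field K] [AddCommGroup V] [Module K V]
    (D : PreHopf K V) [D.IsHopf] (f : (Forest A →₀ K) →ₗ[K] V)
    (hf : PreHopf.IsHom (treeHopf K A) D f) (hs : Function.Surjective f) :
    ∃ (I : Ideal (treeHopf K A).Carrier) (J₁ : Ideal (ckHopf K A).Carrier)
      (J₂ : Ideal (napHopf K A).Carrier)
      (_ : I.IsHopfIdeal K) (_ : J₁.IsHopfIdeal K) (_ : J₂.IsHopfIdeal K)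
      (Φ : ((treeHopf K A).Carrier ⧸ I) ≃ₐc[K] D.Carrier),
      (∀ x : Forest A →₀ K, x ∈ I ↔ f x = 0) ∧
      (∀ x : Forest A →₀ K, Φ (Ideal.Quotient.mk I x) = f x) ∧
      Nonempty (D.Carrier ≃ₐc[K] ((ckHopf K A).Carrier ⧸ J₁)) ∧
      Nonempty (D.Carrier ≃ₐc[K] ((napHopf K A).Carrier ⧸ J₂)) := by
  obtain ⟨I, hI, hmem, Φ, hΦ⟩ := hf.exists_quotient hs
  obtain ⟨J₁, hJ₁, -, e₁, -⟩ := (hf.comp CKHopf.isHom).exists_quotient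
    (hs.comp (CKHopf.equiv K A).surjective)
  obtain ⟨J₂, hJ₂, -, e₂, -⟩ := (hf.comp NAPHopf.isHom).exists_quotient
    (hs.comp (NAPHopf.equiv K A).surjective)
  exact ⟨I, J₁, J₂, hI, hJ₁, hJ₂, Φ, hmem, hΦ, ⟨e₁.symm⟩, ⟨e₂.symm⟩⟩

theorem mainTheorem1 (K : Type*) [Field K] [CharZero K] :
    (∀ (A : Type*) [LinearOrder A] (deg : A → ℕ) (_ : ∀ a, 0 < deg a)
      (_ : ∀ n, {a | deg a = n}.Finite) (p : HoffmanPairing A deg),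
      ∃ (_ : (quasiShuffleHopf K p).IsHopf) (_ : (treeHopf K A).IsHopf)
        (_ : (ckHopf K A).IsHopf) (_ : (napHopf K A).IsHopf)
        (I : Ideal (treeHopf K A).Carrier) (J₁ : Ideal (ckHopf K A).Carrier)
        (J₂ : Ideal (napHopf K A).Carrier)
        (_ : I.IsHopfIdeal K) (_ : J₁.IsHopfIdeal K) (_ : J₂.IsHopfIdeal K),
        (∀ x, x ∈ I ↔ forestToWords K A x = 0) ∧
        Nonempty ((quasiShuffleHopf K p).Carrier ≃ₐc[K] ((treeHopf K A).Carrier ⧸ I)) ∧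
        Nonempty (((treeHopf K A).Carrier ⧸ I) ≃ₐc[K] ((ckHopf K A).Carrier ⧸ J₁)) ∧
        Nonempty (((ckHopf K A).Carrier ⧸ J₁) ≃ₐc[K] ((napHopf K A).Carrier ⧸ J₂))) ∧
    ∃ (D : PreHopf K (HU K)) (_ : IsUniversalHopf K D) (_ : D.IsHopf)
      (_ : (treeHopf K ℕ+ᵒᵈ).IsHopf) (_ : (ckHopf K ℕ+ᵒᵈ).IsHopf) (_ : (napHopf K ℕ+ᵒᵈ).IsHopf)
      (I : Ideal (treeHopf K ℕ+ᵒᵈ).Carrier) (J₁ : Ideal (ckHopf K ℕ+ᵒᵈ).Carrier)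
      (J₂ : Ideal (napHopf K ℕ+ᵒᵈ).Carrier)
      (_ : I.IsHopfIdeal K) (_ : J₁.IsHopfIdeal K) (_ : J₂.IsHopfIdeal K)
      (Φ : ((treeHopf K ℕ+ᵒᵈ).Carrier ⧸ I) ≃ₐc[K] D.Carrier),
      (∀ x, x ∈ I ↔ forestToWords K ℕ+ᵒᵈ x = 0) ∧
      Nonempty (D.Carrier ≃ₐc[K] ((ckHopf K ℕ+ᵒᵈ).Carrier ⧸ J₁)) ∧
      Nonempty (D.Carrier ≃ₐc[K] ((napHopf K ℕ+ᵒᵈ).Carrier ⧸ J₂)) ∧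
      (∃ (H : Set (Forest ℕ+ᵒᵈ)) (lt : H → H → Prop), IsLyndonHallSet H lt) ∧
      ∀ (H : Set (Forest ℕ+ᵒᵈ)) (lt : H → H → Prop), IsLyndonHallSet H lt →
        Function.Bijective (MvPolynomial.aeval (R := K) fun t : H =>
          Φ (Ideal.Quotient.mk I (Finsupp.single t.1 1 : Forest ℕ+ᵒᵈ →₀ K))) := by
  constructor
  · intro A _ deg _ _ p
    have hq : ∀ a b, (HoffmanPairing.trivial A deg).pair (some a) (some b) = none := fun _ _ => rfl
    -- Since the exponential is injective, composing `π` with it leaves the kernel unchanged,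
    -- whatever the pairing.
    have hb := QuasiShuffle.expL_bijective (K := K) p
    obtain ⟨I, J₁, J₂, hI, hJ₁, hJ₂, Φ, hmem, -, ⟨e₁⟩, ⟨e₂⟩⟩ :=
      exists_quotients K A _ (quasiShuffleHopf K p) (QuasiShuffle.expL p K ∘ₗ forestToWords K A)
        ((QuasiShuffle.isHom_expL p _ hq).comp (TreeHopf.isHom_forestToWords _ hq))
        (hb.surjective.comp TreeHopf.forestToWords_surjective)
    refine ⟨QuasiShuffle.isHopf p, TreeHopf.isHopf, CKHopf.isHopf, NAPHopf.isHopf, I, J₁, J₂, hI,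
      hJ₁, hJ₂, fun x => (hmem x).trans (map_eq_zero_iff _ hb.injective), ⟨Φ.symm⟩, ⟨Φ.trans e₁⟩,
      ⟨e₁.symm.trans e₂⟩⟩
  -- With the zero pairing the degrees of letters play no role, so they are set to zero here.
  · let p := HoffmanPairing.trivial ℕ+ᵒᵈ fun _ => 0
    have hp : ∀ a b, p.pair (some a) (some b) = none := fun _ _ => rfl
    have he := UniversalHopf.isHom (K := K) p
    obtain ⟨I, J₁, J₂, hI, hJ₁, hJ₂, Φ, hmem, hΦ, h₁, h₂⟩ :=
      exists_quotients K ℕ+ᵒᵈ _ (UniversalHopf.hopf p)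
        ((UniversalHopf.equiv K).toLinearMap ∘ₗ forestToWords K ℕ+ᵒᵈ)
        (he.comp (TreeHopf.isHom_forestToWords p hp))
        ((UniversalHopf.equiv K).surjective.comp TreeHopf.forestToWords_surjective)
    refine ⟨UniversalHopf.hopf p, UniversalHopf.isUniversalHopf p hp, UniversalHopf.isHopf p,
      TreeHopf.isHopf, CKHopf.isHopf, NAPHopf.isHopf, I, J₁, J₂, hI, hJ₁, hJ₂, Φ,
      fun x => (hmem x).trans (map_eq_zero_iff _ (UniversalHopf.equiv K).injective), h₁, h₂,
      ⟨_, _, Lyndon.isLyndonHallSet_lyndonTrees⟩, fun H lt hH => ?_⟩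
    have h := he.bijective_aeval (UniversalHopf.equiv K).bijective _
      (Lyndon.bijective_aeval_of_isLyndonHallSet (K := K) p hp hH)
    exact (congrArg (fun X : H → (UniversalHopf.hopf (K := K) p).Carrier =>
      Function.Bijective (MvPolynomial.aeval (R := K) X))
      (funext fun t : H => hΦ (Finsupp.single t.1 1))).mpr h
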